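/- **Setting.** Let $\Omega$ be either a bounded domain in $\mathbb R^3$ with smooth boundary (Dirichlet boundary conditions) or the torus $\mathbb T^3=[0,2\pi]^3$ (periodic boundary conditions). Let $\alpha,\gamma>0$, $g\in L^2(\Omega)$, and let $f\in C^1(\mathbb R)$ satisfy, for some positive constants $C,\kappa,K$ and all $u\in\mathbb R$, $$f(u)u\ge -C+\kappa|u|^2,\qquad f'(u)\ge -K,\qquad |f'(u)|\le C(1+|u|^4).$$ Consider the problem $$\partial_t^2u+\gamma(-\Delta)^{1/2}\partial_tu+\alpha\,\partial_tu-\Delta u+f(u)=g,\qquad u|_{t=0}=u_0,\quad \partial_tu|_{t=0}=u_1, \tag{1}$$ where $(-\Delta)^{\theta}u=\sum_i\lambda_i^{\theta}(u,e_i)e_i$ and $\|u\|^2_{H^s_\Delta}=\sum_i(1+\lambda_i)^s(u,e_i)^2$ for an orthonormal basis of eigenfunctions $e_i$ of $-\Delta$ (with the given boundary conditions) with eigenvalues $\lambda_i$. Let $\mathcal E=H^1_0(\Omega)\times L^2(\Omega)$ (with $H^1(\mathbb T^3)$ in place of $H^1_0(\Omega)$ in the periodic case), $\|(u,p)\|^2_{\mathcal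 E}=\|u\|^2_{H^1}+\|p\|^2_{L^2}$, and $\xi_u=(u,\partial_tu)$. On a domain, $\|u\|^2_{H^{3/2}}=\|u\|^2_{H^1}+\int_\Omega\int_\Omega\frac{|\nabla u(x)-\nabla u(y)|^2}{|x-y|^{4}}\,dx\,dy$; on the torus, $H^{3/2}=H^{3/2}_\Delta$. An *energy solution* of (1) with $\xi_u(0)=(u_0,u_1)\in\mathcal E$ is a function $u$ on $[0,\infty)\times\Omega$ such that, for all $T>0$, $\xi_u\in L^\infty(0,T;\mathcal E)$, $\partial_tu\in L^2(0,T;H^{1/2}_\Delta)$, the initial condition holds, and $$-\int_0^T(\partial_tu,\partial_t\phi)\,dt+\int_0^T(\nabla u,\nabla\phi)\,dt+\alpha\int_0^T(\partial_tu,\phi)\,dt+\gamma\int_0^T(\partial_tu,(-\Delta)^{1/2}\phi)\,dt+\int_0^T(f(u),\phi)\,dt=\int_0^T(g,\phi)\,dt$$ for all $\phi\in C_0^\infty((0,T)\times\Omega)$. Here $\xi_u$ denotes the representative that is continuous with values in $L^2(\Omega)\times H^{-1}(\Omega)$, so that $\xi_u(t)\in\mathcal E$ is defined for every $t\ge0$.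 **Theorem.** Suppose that, for some monotone increasing function $Q$, every energy solution $u$ of (1) (with the given $g$ and arbitrary initial data in $\mathcal E$) satisfies, for all $\tau\ge0$, $$\|u\|_{L^2([\tau,\tau+1];H^{3/2}(\Omega))}\le Q\big(\|\xi_u\|_{L^\infty([\tau,\tau+1];\mathcal E)}+\|\partial_tu\|_{L^2([\tau,\tau+1];H^{1/2}_\Delta)}+\|g\|_{L^2(\Omega)}\big).$$ Then the energy solution of (1) with given initial data is unique. Moreover, for any two energy solutions $u_1,u_2$ of (1), the difference $v=u_1-u_2$ satisfies $$\|v(t)\|^2_{H^1(\Omega)}+\|\partial_tv(t)\|^2_{L^2(\Omega)}\le e^{\hat K(t+1)}\big(\|v(0)\|^2_{H^1(\Omega)}+\|\partial_tv(0)\|^2_{L^2(\Omega)}\big)\qquad\text{for all } t\ge0,$$ where, for fixed $\Omega,\alpha,\gamma,f$ and $Q$, the constant $\hat K>0$ depends only on $\|\xi_{u_1}(0)\|_{\mathcal E}$, $\|\xi_{u_2}(0)\|_{\mathcal E}$ and $\|g\|_{L^2(\Omega)}$. -/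

import Mathlib

open MeasureTheory Set
open scoped ContDiff ENNReal

noncomputable section

namespace DampedWave

/-- The ambient space `ℝ³` with its Euclidean norm. -/
abbrev E3 : Type := EuclideanSpace ℝ (Fin 3)

/-- A bounded domain with `C^∞` boundary: near each boundary point the set is the negativity
set of a smooth function without critical points. -/
structure IsSmoothBoundedDomain (Ω : Set E3) : Prop where
  isOpen : IsOpen Ω
  isConnected : IsConnected Ω
  isBounded : Bornology.IsBounded Ω
  smooth_boundary : ∀ x ∈ frontier Ω, ∃ U : Set E3, IsOpen U ∧ x ∈ U ∧
    ∃ ρ : E3 → ℝ, ContDiffOn ℝ ∞ ρ U ∧ (∀ y ∈ U, fderiv ℝ ρ y ≠ 0) ∧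
      Ω ∩ U = {y ∈ U | ρ y < 0}

/-- The two settings of the problem: a smooth bounded domain with Dirichlet boundary
conditions, or the torus `[0, 2π]³` with periodic boundary conditions. -/
inductive Setting : Type
  | dirichlet (Ω : Set E3) (hΩ : IsSmoothBoundedDomain Ω) : Setting
  | periodic : Setting

/-- `2π`-periodicity in each coordinate. -/
def IsPeriodic (φ : E3 → ℝ) : Prop :=
  ∀ (i : Fin 3) (x : E3), φ (x + EuclideanSpace.single i (2 * Real.pi)) = φ x

namespace Setting

/-- The set over which one integrates: `Ω`, or the (open) period cell of the torus. Functions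
on the torus are identified with functions on this cell. -/
def cell : Setting → Set E3
  | dirichlet Ω _ => Ω
  | periodic => {x | ∀ i, x i ∈ Ioo (0 : ℝ) (2 * Real.pi)}

/-- Smooth test functions in `x`: `C_0^∞(Ω)`, respectively `C^∞(𝕋³)`. -/
def IsTest : Setting → (E3 → ℝ) → Prop
  | dirichlet Ω _, φ => ContDiff ℝ ∞ φ ∧ HasCompactSupport φ ∧ tsupport φ ⊆ Ω
  | periodic, φ => ContDiff ℝ ∞ φ ∧ IsPeriodic φ

/-- Smooth test functions in `(t, x)`: `C_0^∞((0,T) × Ω)`, where for the torus the support is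
required to be compact in `t` and the function to be periodic in `x`. -/
def SpaceTimeSupport : Setting → ℝ → (ℝ × E3 → ℝ) → Prop
  | dirichlet Ω _, T, φ => HasCompactSupport φ ∧ tsupport φ ⊆ Ioo 0 T ×ˢ Ω
  | periodic, T, φ => (∀ t, IsPeriodic fun x => φ (t, x)) ∧
      ∃ a b : ℝ, 0 < a ∧ b < T ∧ ∀ t x, t ∉ Icc a b → φ (t, x) = 0

variable (X : Setting)

theorem isBounded_cell : Bornology.IsBounded X.cell := by
  cases X with
  | dirichlet Ω hΩ => exact hΩ.isBounded
  | periodic =>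
    refine (Metric.isBounded_closedBall (x := (0 : E3)) (r := √(3 * (2 * Real.pi) ^ 2))).subset ?_
    intro x hx
    rw [mem_closedBall_zero_iff, EuclideanSpace.norm_eq]
    apply Real.sqrt_le_sqrt
    have h : ∀ i, ‖x i‖ ^ 2 ≤ (2 * Real.pi) ^ 2 := by
      intro i
      have := hx i
      rw [Real.norm_eq_abs, sq_abs]
      exact pow_le_pow_left₀ this.1.le this.2.le 2
    rw [Fin.sum_univ_three]
    linarith [h 0, h 1, h 2]

/-- `L²(Ω)`. -/
abbrev L2 : Type := Lp ℝ 2 (volume.restrict X.cell)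

/-- `L²(Ω; ℝ³)`. -/
abbrev L2V : Type := Lp E3 2 (volume.restrict X.cell)

theorem memLp_of_continuous {h : E3 → ℝ} (hc : Continuous h) :
    MemLp h 2 (volume.restrict X.cell) := by
  have hb := X.isBounded_cell
  have hcpt : IsCompact (closure X.cell) := hb.isCompact_closure
  obtain ⟨M, hM⟩ := hcpt.exists_bound_of_continuousOn hc.continuousOn
  have h1 : MemLp h 2 (volume.restrict (closure X.cell)) := by
    have : IsFiniteMeasure (volume.restrict (closure X.cell)) :=
      ⟨by rw [Measure.restrict_apply_univ]; exact hcpt.measure_lt_top⟩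
    refine MemLp.of_bound hc.aestronglyMeasurable M ?_
    exact (ae_restrict_iff' isClosed_closure.measurableSet).2 (Filter.Eventually.of_forall hM)
  exact h1.mono_measure (Measure.restrict_mono subset_closure le_rfl)

/-- The class in `L²(Ω)` of a continuous function. -/
def ofContinuous (h : E3 → ℝ) (hc : Continuous h) : X.L2 := (X.memLp_of_continuous hc).toLp h

theorem IsTest.contDiff {X : Setting} {φ : E3 → ℝ} (h : X.IsTest φ) : ContDiff ℝ ∞ φ := by
  cases X <;> exact h.1

theorem IsTest.zero : X.IsTest fun _ => 0 := by
  cases X with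
  | dirichlet Ω hΩ =>
    refine ⟨contDiff_const, ?_, ?_⟩
    · exact HasCompactSupport.zero
    · have : tsupport (fun _ : E3 => (0 : ℝ)) = ∅ := tsupport_eq_empty_iff.2 rfl
      simp [this]
  | periodic => exact ⟨contDiff_const, fun _ _ => rfl⟩

theorem IsTest.add {X : Setting} {φ ψ : E3 → ℝ} (hφ : X.IsTest φ) (hψ : X.IsTest ψ) :
    X.IsTest fun x => φ x + ψ x := by
  cases X with
  | dirichlet Ω hΩ =>
    refine ⟨hφ.1.add hψ.1, hφ.2.1.add hψ.2.1, ?_⟩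
    exact (tsupport_add φ ψ).trans (union_subset hφ.2.2 hψ.2.2)
  | periodic =>
    refine ⟨hφ.1.add hψ.1, fun i x => ?_⟩
    simp only [hφ.2 i x, hψ.2 i x]

theorem IsTest.smul {X : Setting} {φ : E3 → ℝ} (c : ℝ) (hφ : X.IsTest φ) :
    X.IsTest fun x => c * φ x := by
  cases X with
  | dirichlet Ω hΩ =>
    exact ⟨contDiff_const.mul hφ.1, hφ.2.1.mul_left, (tsupport_mul_subset_right
      (f := fun _ => c) (g := φ)).trans hφ.2.2⟩
  | periodic =>
    refine ⟨contDiff_const.mul hφ.1, fun i x => ?_⟩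
    simp only [hφ.2 i x]

/-- The pairs `(φ, ∇φ)` with `φ` a test function, in `L²(Ω) × L²(Ω; ℝ³)`. -/
def testGraph : Submodule ℝ (WithLp 2 (X.L2 × X.L2V)) where
  carrier := {q | ∃ φ : E3 → ℝ, X.IsTest φ ∧
    q.fst =ᵐ[volume.restrict X.cell] φ ∧ q.snd =ᵐ[volume.restrict X.cell] gradient φ}
  zero_mem' := by
    refine ⟨fun _ => 0, IsTest.zero X, Lp.coeFn_zero _ _ _, ?_⟩
    filter_upwards [Lp.coeFn_zero E3 2 (volume.restrict X.cell)] with x hx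
    rw [gradient_fun_const]
    exact hx
  add_mem' := by
    rintro a b ⟨φ, hφ, ha, ha'⟩ ⟨ψ, hψ, hb, hb'⟩
    refine ⟨fun x => φ x + ψ x, hφ.add hψ, ?_, ?_⟩
    · filter_upwards [Lp.coeFn_add a.fst b.fst, ha, hb] with x h1 h2 h3
      rw [WithLp.add_fst, h1, Pi.add_apply, h2, h3]
    · filter_upwards [Lp.coeFn_add a.snd b.snd, ha', hb'] with x h1 h2 h3
      rw [WithLp.add_snd, h1, Pi.add_apply, h2, h3]
      have d1 : DifferentiableAt ℝ φ x := (hφ.contDiff.differentiable (by simp)) x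
      have d2 : DifferentiableAt ℝ ψ x := (hψ.contDiff.differentiable (by simp)) x
      simp only [gradient, fderiv_fun_add d1 d2, map_add]
  smul_mem' := by
    rintro c a ⟨φ, hφ, ha, ha'⟩
    refine ⟨fun x => c * φ x, hφ.smul c, ?_, ?_⟩
    · filter_upwards [Lp.coeFn_smul c a.fst, ha] with x h1 h2
      rw [WithLp.smul_fst, h1, Pi.smul_apply, h2, smul_eq_mul]
    · filter_upwards [Lp.coeFn_smul c a.snd, ha'] with x h1 h2
      rw [WithLp.smul_snd, h1, Pi.smul_apply, h2]
      have d1 : DifferentiableAt ℝ φ x := (hφ.contDiff.differentiable (by simp)) x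
      simp [gradient, fderiv_const_mul d1]

/-- The space `H^1_0(Ω)`, respectively `H^1(𝕋³)`: the closure of the test functions in the
`H^1` norm, a function being carried together with its gradient. The norm it inherits is
`‖u‖² = ‖u‖²_{L²} + ‖∇u‖²_{L²}`. -/
def H1 : Submodule ℝ (WithLp 2 (X.L2 × X.L2V)) := X.testGraph.topologicalClosure

/-- The embedding `H^1_0 → L²`. -/
def incl : X.H1 →L[ℝ] X.L2 := (WithLp.fstL 2 ℝ X.L2 X.L2V).comp X.H1.subtypeL

/-- The gradient `H^1_0 → L²(Ω; ℝ³)`. -/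
def grad : X.H1 →L[ℝ] X.L2V := (WithLp.sndL 2 ℝ X.L2 X.L2V).comp X.H1.subtypeL

/-- An element of `L²` as an element of `H^{-1} = (H^1_0)^*`. -/
def toHneg (p : X.L2) : StrongDual ℝ X.H1 := (innerSL ℝ p).comp X.incl

/-- The energy space `𝓔 = H^1_0 × L²`, with `‖(u,p)‖² = ‖u‖²_{H^1} + ‖p‖²_{L²}`. -/
abbrev Energy : Type := WithLp 2 (X.H1 × X.L2)

/-- The eigenspace of `-Δ` (with the boundary conditions of the setting) for the number `μ`,
as a subspace of `L²`; it is zero when `μ` is not an eigenvalue. -/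
def eigenspace (μ : ℝ) : Submodule ℝ X.L2 where
  carrier := {e | ∃ w : X.H1, X.incl w = e ∧
    ∀ z : X.H1, inner ℝ (X.grad w) (X.grad z) = μ * inner ℝ e (X.incl z)}
  zero_mem' := ⟨0, by simp, by simp⟩
  add_mem' := by
    rintro a b ⟨w, hw, hw'⟩ ⟨v, hv, hv'⟩
    refine ⟨w + v, by rw [map_add, hw, hv], fun z => ?_⟩
    rw [map_add, inner_add_left, hw', hv', inner_add_left, mul_add]
  smul_mem' := by
    rintro c a ⟨w, hw, hw'⟩
    refine ⟨c • w, by rw [map_smul, hw], fun z => ?_⟩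
    rw [map_smul, real_inner_smul_left, hw', real_inner_smul_left]
    ring

/-- The orthogonal projection of `L²` onto the eigenspace for `μ` (which is closed; the
closure is written only so that the projection is defined). -/
def eigenProj (μ : ℝ) : X.L2 →L[ℝ] X.L2 := (X.eigenspace μ).topologicalClosure.starProjection

/-- The fractional Laplacian `(-Δ)^θ u = ∑ λ^θ P_λ u`, the sum over the eigenvalues `λ`, with
`P_λ` the projection onto the eigenspace. -/
def fracLap (θ : ℝ) (u : X.L2) : X.L2 := ∑' μ : ℝ, μ ^ θ • X.eigenProj μ u

/-- The square of the norm of `H^s_Δ`: `∑ (1 + λ)^s ‖P_λ u‖²`, the sum over the eigenvalues. -/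
def hDeltaSq (s : ℝ) (u : X.L2) : ℝ≥0∞ :=
  ∑' μ : ℝ, ENNReal.ofReal ((1 + μ) ^ s) * ‖X.eigenProj μ u‖ₑ ^ 2

/-- The square of the norm of `H^{3/2}`, infinite if `u ∉ H^{3/2}`. On a domain it is the
Sobolev–Slobodetskii norm
`‖u‖²_{H^1} + ∫∫ |∇u(x) - ∇u(y)|² / |x - y|^{3 + 1} dx dy`; on the torus `H^{3/2} = H^{3/2}_Δ`. -/
def h32Sq : (X : Setting) → X.H1 → ℝ≥0∞
  | dirichlet Ω hΩ, u => ‖u‖ₑ ^ 2 + ∫⁻ x in Ω, ∫⁻ y in Ω,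
      ‖grad (dirichlet Ω hΩ) u x - grad (dirichlet Ω hΩ) u y‖ₑ ^ 2 / ‖x - y‖ₑ ^ 4
  | periodic, u => hDeltaSq periodic (3 / 2) (incl periodic u)

end Setting

/-- The assumptions on the nonlinearity. -/
structure IsNonlinearity (f : ℝ → ℝ) (C κ K : ℝ) : Prop where
  contDiff : ContDiff ℝ 1 f
  dissipative : ∀ u, -C + κ * |u| ^ 2 ≤ f u * u
  deriv_ge : ∀ u, -K ≤ deriv f u
  deriv_growth : ∀ u, |deriv f u| ≤ C * (1 + |u| ^ 4)

/-- `ξ = (u, p)`, `p = ∂_t u`, is a (global in time) weak energy solution of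
`∂_t² u + γ (-Δ)^{1/2} ∂_t u + α ∂_t u - Δ u + f(u) = g` with `ξ(0) = ξ₀`.
The function `t ↦ ξ t` is the representative that is continuous with values in
`L² × H^{-1}`, so that `ξ t` has a meaning for every `t ≥ 0`; only the values at `t ≥ 0`
matter. -/
structure IsEnergySolution (X : Setting) (f : ℝ → ℝ) (α γ : ℝ) (g : X.L2) (ξ₀ : X.Energy)
    (ξ : ℝ → X.Energy) : Prop where
  bounded : ∀ T : ℝ, 0 < T → MemLp ξ ⊤ (volume.restrict (Ioo 0 T))
  dissipation : ∀ T : ℝ, 0 < T →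
    (∫⁻ t in Ioo 0 T, X.hDeltaSq (1 / 2) (ξ t).snd) < ⊤
  continuous_fst : ContinuousOn (fun t => X.incl (ξ t).fst) (Ici 0)
  continuous_snd : ContinuousOn (fun t => X.toHneg (ξ t).snd) (Ici 0)
  initial : ξ 0 = ξ₀
  time_deriv : ∀ T : ℝ, 0 < T → ∀ φ : ℝ × E3 → ℝ, ContDiff ℝ ∞ φ → X.SpaceTimeSupport T φ →
    (∫ t in Ioo 0 T, ∫ x in X.cell, X.incl (ξ t).fst x * deriv (fun s => φ (s, x)) t) =
      -(∫ t in Ioo 0 T, ∫ x in X.cell, (ξ t).snd x * φ (t, x))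
  equation : ∀ T : ℝ, 0 < T → ∀ (φ : ℝ × E3 → ℝ) (hφ : ContDiff ℝ ∞ φ),
    X.SpaceTimeSupport T φ →
    -(∫ t in Ioo 0 T, ∫ x in X.cell, (ξ t).snd x * deriv (fun s => φ (s, x)) t)
      + (∫ t in Ioo 0 T, ∫ x in X.cell,
          inner ℝ (X.grad (ξ t).fst x) (gradient (fun y => φ (t, y)) x))
      + α * (∫ t in Ioo 0 T, ∫ x in X.cell, (ξ t).snd x * φ (t, x))
      + γ * (∫ t in Ioo 0 T, inner ℝ (ξ t).snd (X.fracLap (1 / 2)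
          (X.ofContinuous (fun x => φ (t, x))
            (hφ.continuous.comp (Continuous.prodMk_right t)))))
      + (∫ t in Ioo 0 T, ∫ x in X.cell, f (X.incl (ξ t).fst x) * φ (t, x))
      = ∫ t in Ioo 0 T, ∫ x in X.cell, g x * φ (t, x)

/-- The extra regularity estimate: for every `τ ≥ 0`,
`‖u‖_{L²([τ,τ+1]; H^{3/2})} ≤
  Q(‖ξ‖_{L^∞([τ,τ+1]; 𝓔)} + ‖∂_t u‖_{L²([τ,τ+1]; H^{1/2}_Δ)} + ‖g‖_{L²})`. -/
def ExtraRegularity (X : Setting) (Q : ℝ → ℝ) (g : X.L2) (ξ : ℝ → X.Energy) : Prop :=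
  ∀ τ : ℝ, 0 ≤ τ →
    (∫⁻ t in Icc τ (τ + 1), X.h32Sq (ξ t).fst) ^ (1 / 2 : ℝ) ≤
      ENNReal.ofReal (Q ((eLpNorm ξ ⊤ (volume.restrict (Icc τ (τ + 1)))).toReal
        + ((∫⁻ t in Icc τ (τ + 1), X.hDeltaSq (1 / 2) (ξ t).snd) ^ (1 / 2 : ℝ)).toReal
        + ‖g‖))

end DampedWave

end

/-! The difficulty is the quintic growth of `f`: at the level of the energy space `u ∈ L⁶` only, and
`f(u)` is then not in `L²`. The assumed bound of `u` in `L²(H^{3/2})` repairs this. Interpolating it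
with `u ∈ L^∞(H¹)` puts `∇u` in `L⁴(L^{12/5})`, and `W^{1,12/5} ⊂ L¹²` in dimension three, so `u ∈
L⁴(L¹²)`; this is `Setting.exists_lintegral_pow_twelve_le_h32Sq`. By Hölder with `v ∈ H¹ ⊂ L⁶`,
`‖f(u₁) - f(u₂)‖_{L²} ≤ D (1 + ‖u₁‖⁴_{L¹²} + ‖u₂‖⁴_{L¹²}) ‖v‖_{H¹}`, with a prefactor integrable in
time (`Setting.exists_enorm_nem_sub_le`). Hence the difference `v` solves a linear damped wave
equation with right-hand side in `L¹(L²)`. The energy inequality for that equation, together with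
`d/dt ‖v‖² = 2 (v, ∂_t v)` for the missing `L²` part of the norm, and Grönwall's lemma give the
estimate (`exists_sub_le`). Uniqueness is the case of equal data.

Multiplying a weak solution by `∂_t u` is not allowed as it stands. `energy_inequality` therefore
applies the resolvent `(1 + ε d*d)⁻¹` to the equation, obtains an exact identity for the regularized
solution, and lets `ε → 0`. Only an inequality survives, because the damping term passes to the
limit by Fatou; an inequality is all that is used. The argument lives in an abstract pair `i : V →
H`, `d : V → G`. On a domain it needs no completeness of the eigenfunctions: the damping operator is
a spectral series and Bessel's inequality suffices.

The constant must depend on the norms of the data only. For this the energy inequality is first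
applied to a single solution. The chain rule for the potential energy
(`Setting.integral_inner_nem_eq_sub`) turns the nonlinear term into `∫ F(u)`, which dissipativity
bounds below by a quadratic function. This controls the energy norm and the time integral of the
`H^{1/2}` dissipation uniformly in time (`exists_energy_bound`). These two quantities are the
arguments of `Q`, so monotonicity of `Q` bounds `∫ ‖u‖⁴_{L¹²}` over each unit interval by a fixed
constant (`exists_l12_bound`), and summing over unit intervals gives the linear exponent `t + 1`.

On a domain `H^{3/2}` is a Slobodetskii space, on the torus a spectral one. The embedding is proved
for the Slobodetskii seminorm in both settings, and on the torus that seminorm is bounded by the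
spectral norm through translations and the completeness of the trigonometric system. -/

open scoped NNReal

noncomputable section

namespace DampedWave

open Filter Topology

/-! ### Calculus along absolutely continuous curves: chain rule and Grönwall's inequality. -/

section AbsolutelyContinuous

/-- A map whose increments are dominated by those of an absolutely continuous map is absolutely
continuous. -/
theorem absolutelyContinuousOnInterval_of_dist_le {F₁ F₂ : Type*} [PseudoMetricSpace F₁]
    [PseudoMetricSpace F₂] {f : ℝ → F₁} {g : ℝ → F₂} {a b C : ℝ}
    (hg : AbsolutelyContinuousOnInterval g a b)
    (h : ∀ x ∈ uIcc a b, ∀ y ∈ uIcc a b, dist (f x) (f y) ≤ C * dist (g x) (g y)) :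
    AbsolutelyContinuousOnInterval f a b := by
  rw [absolutelyContinuousOnInterval_iff] at hg ⊢
  intro ε hε
  obtain ⟨δ, hδ, H⟩ := hg (ε / (|C| + 1)) (by positivity)
  refine ⟨δ, hδ, fun E hE hlt => ?_⟩
  have h1 := H E hE hlt
  have h2 : ∑ i ∈ Finset.range E.1, dist (f (E.2 i).1) (f (E.2 i).2) ≤
      (|C| + 1) * ∑ i ∈ Finset.range E.1, dist (g (E.2 i).1) (g (E.2 i).2) := by
    rw [Finset.mul_sum]
    refine Finset.sum_le_sum fun i hi => ?_
    refine (h _ (hE.1 i hi).1 _ (hE.1 i hi).2).trans ?_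
    refine mul_le_mul_of_nonneg_right ?_ dist_nonneg
    linarith [le_abs_self C]
  calc _ ≤ _ := h2
    _ < (|C| + 1) * (ε / (|C| + 1)) := by
        apply mul_lt_mul_of_pos_left h1; positivity
    _ = ε := by field_simp

/-- The chain rule `φ(P(t)) - φ(P(0)) = ∫₀ᵗ (Dφ)(P) ∂P` along a curve with integrable derivative. -/
theorem integral_chain_rule {F : Type*} [NormedAddCommGroup F] [NormedSpace ℝ F] [CompleteSpace F]
    {P a : ℝ → F} {t : ℝ} (ht : 0 ≤ t) (ha : IntervalIntegrable a volume 0 t)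
    (hP : ∀ s ∈ Icc 0 t, P s = P 0 + ∫ r in (0 : ℝ)..s, a r)
    {φ : F → ℝ} {φ' : F → F →L[ℝ] ℝ} (hφ : ∀ x, HasFDerivAt φ (φ' x) x)
    (hLip : ∀ R : ℝ, ∃ L : ℝ, 0 ≤ L ∧ ∀ x y, ‖x‖ ≤ R → ‖y‖ ≤ R → |φ x - φ y| ≤ L * ‖x - y‖) :
    ∫ s in (0 : ℝ)..t, φ' (P s) (a s) = φ (P t) - φ (P 0) := by
  set Q : ℝ → F := fun s => P 0 + ∫ r in (0 : ℝ)..s, a r with hQ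
  have hPQ : ∀ s ∈ Icc 0 t, P s = Q s := hP
  -- The curve is compared with the scalar function `A = ∫ ‖a‖`, because absolute continuity of an
  -- integral function is used for a real-valued control; `φ ∘ Q` then inherits it from `A`.
  have hI : uIcc 0 t = Icc 0 t := uIcc_of_le ht
  have hsub : ∀ x ∈ Icc 0 t, ∀ y ∈ Icc 0 t, IntervalIntegrable a volume x y := fun x hx y hy =>
    ha.mono_set (by rw [hI]; exact uIcc_subset_Icc hx hy)
  have h0 : (0 : ℝ) ∈ Icc 0 t := ⟨le_rfl, ht⟩
  set A : ℝ → ℝ := fun s => ∫ r in (0 : ℝ)..s, ‖a r‖ with hA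
  have hAac : AbsolutelyContinuousOnInterval A 0 t :=
    ha.norm.absolutelyContinuousOnInterval_intervalIntegral (by rw [hI]; exact h0)
  have hdist : ∀ x ∈ Icc 0 t, ∀ y ∈ Icc 0 t, ‖Q x - Q y‖ ≤ |A x - A y| := by
    intro x hx y hy
    simp only [hQ, hA, add_sub_add_left_eq_sub]
    rw [intervalIntegral.integral_interval_sub_left (hsub 0 h0 x hx) (hsub 0 h0 y hy),
      intervalIntegral.integral_interval_sub_left (hsub 0 h0 x hx).norm (hsub 0 h0 y hy).norm]
    exact intervalIntegral.norm_integral_le_abs_integral_norm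
  obtain ⟨R, hR⟩ : ∃ R, ∀ s ∈ Icc 0 t, ‖Q s‖ ≤ R := by
    obtain ⟨M, hM⟩ := hAac.exists_bound
    refine ⟨‖Q 0‖ + (M + M), fun s hs => ?_⟩
    have h1 := hdist s hs 0 h0
    have h2 := hM s (by rwa [hI])
    have h3 := hM 0 (by rwa [hI])
    rw [Real.norm_eq_abs] at h2 h3
    have h4 := abs_sub (A s) (A 0)
    have h5 := norm_le_norm_add_norm_sub' (Q s) (Q 0)
    linarith
  obtain ⟨L, hL, hLip⟩ := hLip R
  have hac : AbsolutelyContinuousOnInterval (fun s => φ (Q s)) 0 t := by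
    refine absolutelyContinuousOnInterval_of_dist_le (C := L) hAac fun x hx y hy => ?_
    rw [hI] at hx hy
    rw [Real.dist_eq, Real.dist_eq]
    exact (hLip _ _ (hR x hx) (hR y hy)).trans (mul_le_mul_of_nonneg_left (hdist x hx y hy) hL)
  have key := hac.integral_deriv_eq_sub
  rw [hPQ t ⟨ht, le_rfl⟩, hPQ 0 h0, ← key]
  apply intervalIntegral.integral_congr_ae
  filter_upwards [ha.ae_hasDerivAt_integral] with x hx hxm
  have hxI : x ∈ uIcc 0 t := uIoc_subset_uIcc hxm
  have h1 : HasDerivAt Q (a x) x := (hx hxI 0 (by rwa [hI])).const_add _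
  rw [hPQ x (by rwa [hI] at hxI)]
  exact ((hφ (Q x)).comp_hasDerivAt x h1).deriv.symm

/-- Symmetry of `M` makes `2 M x` the gradient of the quadratic form `(M x, x)`, and `(M x, x) - (M
y, y) = (M (x - y), x + y)` gives the Lipschitz bound on balls. The identity yields the kinetic
energy; a bounded approximation of `d*d` yields the elastic energy. -/
theorem integral_inner_apply_eq_sub {F : Type*} [NormedAddCommGroup F] [InnerProductSpace ℝ F]
    [CompleteSpace F] {P a : ℝ → F} {t : ℝ} (ht : 0 ≤ t) (ha : IntervalIntegrable a volume 0 t)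
    (hP : ∀ s ∈ Icc 0 t, P s = P 0 + ∫ r in (0 : ℝ)..s, a r) (M : F →L[ℝ] F)
    (hM : ∀ x y, inner ℝ (M x) y = inner ℝ x (M y)) :
    ∫ s in (0 : ℝ)..t, 2 * inner ℝ (M (P s)) (a s) =
      inner ℝ (M (P t)) (P t) - inner ℝ (M (P 0)) (P 0) := by
  have := integral_chain_rule ht ha hP (φ := fun x => inner ℝ (M x) x)
    (φ' := fun x => (2 : ℝ) • innerSL ℝ (M x)) ?_ ?_
  · simpa using this
  · intro x
    have h := (M.hasFDerivAt (x := x)).inner ℝ (hasFDerivAt_id x)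
    refine h.congr_fderiv ?_
    ext y
    simp [fderivInnerCLM_apply, hM y x, real_inner_comm (M x) y]
    ring
  · intro R
    refine ⟨‖M‖ * (|R| + |R|), by positivity, fun x y hx hy => ?_⟩
    have e : inner ℝ (M x) x - inner ℝ (M y) y = inner ℝ (M (x - y)) (x + y) := by
      simp only [map_sub, inner_sub_left, inner_add_right, hM x y, real_inner_comm (M y) x]
      ring
    rw [e]
    have h1 := abs_real_inner_le_norm (M (x - y)) (x + y)
    have h2 := M.le_opNorm (x - y)
    have h3 : ‖x + y‖ ≤ |R| + |R| := (norm_add_le _ _).trans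
      (add_le_add (hx.trans (le_abs_self R)) (hy.trans (le_abs_self R)))
    calc _ ≤ _ := h1
      _ ≤ (‖M‖ * ‖x - y‖) * (|R| + |R|) := by gcongr
      _ = _ := by ring

theorem integral_inner_eq_sub {F : Type*} [NormedAddCommGroup F] [InnerProductSpace ℝ F]
    [CompleteSpace F] {P a : ℝ → F} {t : ℝ} (ht : 0 ≤ t) (ha : IntervalIntegrable a volume 0 t)
    (hP : ∀ s ∈ Icc 0 t, P s = P 0 + ∫ r in (0 : ℝ)..s, a r) :
    ∫ s in (0 : ℝ)..t, 2 * inner ℝ (P s) (a s) = ‖P t‖ ^ 2 - ‖P 0‖ ^ 2 := by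
  have := integral_inner_apply_eq_sub ht ha hP (ContinuousLinearMap.id ℝ F) (fun _ _ => rfl)
  simpa [real_inner_self_eq_norm_sq] using this

/-- Grönwall's inequality in integral form, with an integrable kernel. -/
theorem le_mul_exp_of_le_add_integral {y k : ℝ → ℝ} {c t : ℝ} (ht : 0 ≤ t)
    (hk : IntervalIntegrable k volume 0 t) (hk0 : ∀ s ∈ Icc 0 t, 0 ≤ k s)
    (hky : IntervalIntegrable (fun s => k s * y s) volume 0 t)
    (hy : ∀ s ∈ Icc 0 t, y s ≤ c + ∫ r in (0 : ℝ)..s, k r * y r) :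
    y t ≤ c * Real.exp (∫ r in (0 : ℝ)..t, k r) := by
  set Y : ℝ → ℝ := fun s => c + ∫ r in (0 : ℝ)..s, k r * y r with hYdef
  set κ : ℝ → ℝ := fun s => ∫ r in (0 : ℝ)..s, k r with hκdef
  have hI : uIcc 0 t = Icc 0 t := uIcc_of_le ht
  have h0 : (0 : ℝ) ∈ uIcc 0 t := by rw [hI]; exact ⟨le_rfl, ht⟩
  have hYac : AbsolutelyContinuousOnInterval Y 0 t := by
    refine absolutelyContinuousOnInterval_of_dist_le (C := 1)
      (hky.absolutelyContinuousOnInterval_intervalIntegral h0) fun x _ y _ => ?_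
    simp [hYdef]
  have hκac : AbsolutelyContinuousOnInterval κ 0 t :=
    hk.absolutelyContinuousOnInterval_intervalIntegral h0
  have hκ0 : ∀ s ∈ Icc 0 t, 0 ≤ κ s := fun s hs =>
    intervalIntegral.integral_nonneg hs.1 fun r hr => hk0 r ⟨hr.1, hr.2.trans hs.2⟩
  -- `x ↦ e^{-x}` is 1-Lipschitz on `[0, ∞)`, and `κ ≥ 0` there since the kernel is nonnegative.
  have heac : AbsolutelyContinuousOnInterval (fun s => Real.exp (-κ s)) 0 t := by
    refine absolutelyContinuousOnInterval_of_dist_le (C := 1) hκac fun x hx y hy => ?_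
    rw [hI] at hx hy
    have hl : ∀ a b : ℝ, 0 ≤ a → 0 ≤ b → |Real.exp (-a) - Real.exp (-b)| ≤ |a - b| := by
      intro a b ha hb
      wlog hab : a ≤ b generalizing a b
      · rw [abs_sub_comm, abs_sub_comm a]; exact this b a hb ha (le_of_not_ge hab)
      have h1 : Real.exp (-b) ≤ Real.exp (-a) := Real.exp_le_exp.2 (by linarith)
      rw [abs_of_nonneg (by linarith), abs_of_nonpos (by linarith)]
      have h2 : Real.exp (-b) = Real.exp (-a) * Real.exp (-(b - a)) := by
        rw [← Real.exp_add]; ring_nf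
      have h3 := Real.add_one_le_exp (-(b - a))
      have h4 : Real.exp (-a) ≤ 1 := Real.exp_le_one_iff.2 (by linarith)
      have h5 := Real.exp_pos (-a)
      nlinarith
    rw [one_mul, Real.dist_eq, Real.dist_eq]
    exact hl _ _ (hκ0 x hx) (hκ0 y hy)
  have hprod := hYac.integral_deriv_mul_eq_sub heac
  -- `Y e^{-κ}` has almost everywhere the derivative `k (y - Y) e^{-κ} ≤ 0`.
  have hle : ∫ x in (0 : ℝ)..t, deriv Y x * Real.exp (-κ x) +
      Y x * deriv (fun s => Real.exp (-κ s)) x ≤ 0 := by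
    rw [intervalIntegral.integral_of_le ht]
    apply integral_nonpos_of_ae
    rw [EventuallyLE, ae_restrict_iff' measurableSet_Ioc]
    filter_upwards [hky.ae_hasDerivAt_integral, hk.ae_hasDerivAt_integral] with x hx1 hx2 hxm
    have hxI : x ∈ Icc 0 t := ⟨hxm.1.le, hxm.2⟩
    have d1 : HasDerivAt Y (k x * y x) x := (hx1 (by rwa [hI]) 0 h0).const_add _
    have d2 : HasDerivAt (fun s => Real.exp (-κ s)) (Real.exp (-κ x) * (-k x)) x :=
      ((hx2 (by rwa [hI]) 0 h0).neg).exp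
    rw [d1.deriv, d2.deriv]
    have := hy x hxI
    have h5 := Real.exp_pos (-κ x)
    have h6 : 0 ≤ k x * (Y x - y x) := mul_nonneg (hk0 x hxI) (by simpa [hYdef] using this)
    simp only [Pi.zero_apply]
    nlinarith
  have hκz : κ 0 = 0 := by simp [hκdef]
  have hYz : Y 0 = c := by simp [hYdef]
  rw [hprod, hκz, hYz] at hle
  simp only [neg_zero, Real.exp_zero, mul_one] at hle
  have h7 : Y t ≤ c * Real.exp (κ t) := by
    have h8 : Y t = (Y t * Real.exp (-κ t)) * Real.exp (κ t) := by
      rw [mul_assoc, ← Real.exp_add]; simp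
    rw [h8]
    exact mul_le_mul_of_nonneg_right (by linarith) (Real.exp_pos _).le
  exact (hy t ⟨ht, le_rfl⟩).trans h7

end AbsolutelyContinuous

/-! ### The resolvent `(1 + ε d*d)⁻¹` as a regularization of `H`. -/

section Resolvent

set_option linter.unusedSectionVars false

variable {V H G : Type*} [NormedAddCommGroup V] [InnerProductSpace ℝ V] [CompleteSpace V]
  [NormedAddCommGroup H] [InnerProductSpace ℝ H] [CompleteSpace H]
  [NormedAddCommGroup G] [InnerProductSpace ℝ G]

/-- The converse half of Banach–Steinhaus: equibounded operators converge everywhere once they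
converge on a dense set. -/
theorem tendsto_apply_of_dense {E F : Type*} [NormedAddCommGroup E] [NormedSpace ℝ E]
    [NormedAddCommGroup F] [NormedSpace ℝ F] {T : ℕ → E →L[ℝ] F} {T₀ : E →L[ℝ] F} {C : ℝ}
    (hC : ∀ n x, ‖T n x‖ ≤ C * ‖x‖) {s : Set E} (hs : Dense s)
    (h : ∀ x ∈ s, Tendsto (fun n => T n x) atTop (𝓝 (T₀ x))) (x : E) :
    Tendsto (fun n => T n x) atTop (𝓝 (T₀ x)) := by
  rw [Metric.tendsto_atTop]
  intro ε hε
  obtain ⟨y, hy, hxy⟩ := hs.exists_dist_lt x (ε := ε / (2 * (|C| + ‖T₀‖ + 1))) (by positivity)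
  obtain ⟨N, hN⟩ := Metric.tendsto_atTop.1 (h y hy) (ε / 2) (by positivity)
  refine ⟨N, fun n hn => ?_⟩
  have h1 := hN n hn
  rw [dist_eq_norm] at h1 hxy ⊢
  have e : T n x - T₀ x = T n (x - y) + (T n y - T₀ y) - T₀ (x - y) := by
    simp only [map_sub]; abel
  rw [e]
  have h2 : ‖T n (x - y)‖ ≤ |C| * ‖x - y‖ := (hC n _).trans (by gcongr; exact le_abs_self C)
  have h3 := T₀.le_opNorm (x - y)
  have h4 : (|C| + ‖T₀‖) * ‖x - y‖ ≤ (|C| + ‖T₀‖ + 1) * (ε / (2 * (|C| + ‖T₀‖ + 1))) := by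
    refine mul_le_mul (by linarith) hxy.le (norm_nonneg _) (by positivity)
  have h5 : (|C| + ‖T₀‖ + 1) * (ε / (2 * (|C| + ‖T₀‖ + 1))) = ε / 2 := by
    have : (|C| + ‖T₀‖ + 1) ≠ 0 := by positivity
    field_simp
  have h6 := norm_sub_le (T n (x - y) + (T n y - T₀ y)) (T₀ (x - y))
  have h7 := norm_add_le (T n (x - y)) (T n y - T₀ y)
  linarith

/-- The bilinear form `(i v, i w) + ε (d v, d w)`. -/
def resolventForm (i : V →L[ℝ] H) (d : V →L[ℝ] G) (ε : ℝ) : V →L[ℝ] V →L[ℝ] ℝ :=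
  (innerSL ℝ).bilinearComp i i + ε • (innerSL ℝ).bilinearComp d d

theorem isCoercive_resolventForm {i : V →L[ℝ] H} {d : V →L[ℝ] G}
    (hin : ∀ v w, inner ℝ v w = inner ℝ (i v) (i w) + inner ℝ (d v) (d w)) {ε : ℝ} (hε : 0 < ε) :
    IsCoercive (resolventForm i d ε) := by
  refine ⟨min 1 ε, by positivity, fun v => ?_⟩
  have h1 : ‖v‖ * ‖v‖ = ‖i v‖ ^ 2 + ‖d v‖ ^ 2 := by
    rw [← real_inner_self_eq_norm_mul_norm, hin, real_inner_self_eq_norm_sq,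
      real_inner_self_eq_norm_sq]
  have h2 : resolventForm i d ε v v = ‖i v‖ ^ 2 + ε * ‖d v‖ ^ 2 := by
    simp [resolventForm]
  rw [mul_assoc, h1, h2]
  have h3 := min_le_left 1 ε
  have h4 := min_le_right 1 ε
  nlinarith [sq_nonneg ‖i v‖, sq_nonneg ‖d v‖]

open Classical in
/-- The resolvent `(1 + ε d*d)⁻¹` as an operator from `H` to `V`. -/
def resolvent (i : V →L[ℝ] H) (d : V →L[ℝ] G) (ε : ℝ) : H →L[ℝ] V :=
  if h : IsCoercive (resolventForm i d ε) then
    (h.continuousLinearEquivOfBilin.symm : V →L[ℝ] V).comp (ContinuousLinearMap.adjoint i)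
  else 0

/-- The orthogonal complement of the range of `i*` is the kernel of `i`. The range consists of the
regular elements of `V`: for `u = i* q` one has `d*d u = q - i u` in `H`. -/
theorem dense_range_adjoint {i : V →L[ℝ] H} (hinj : Function.Injective i) :
    Dense (Set.range (ContinuousLinearMap.adjoint i)) := by
  have h : (LinearMap.range (ContinuousLinearMap.adjoint i).toLinearMap).topologicalClosure = ⊤ := by
    rw [Submodule.topologicalClosure_eq_top_iff, Submodule.eq_bot_iff]
    intro v hv
    have h1 : ∀ q : H, inner ℝ q (i v) = 0 := fun q => by
      rw [← ContinuousLinearMap.adjoint_inner_left]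
      exact (Submodule.mem_orthogonal _ _).1 hv _ ⟨q, rfl⟩
    exact hinj (by rw [map_zero]; exact inner_self_eq_zero.1 (h1 (i v)))
  have := Submodule.dense_iff_topologicalClosure_eq_top.2 h
  exact this

variable {i : V →L[ℝ] H} {d : V →L[ℝ] G}

/-- Lax–Milgram with right-hand side `i* q`. This variational identity and linearity are all that is
used about the resolvent later. -/
theorem resolvent_spec
    (hin : ∀ v w, inner ℝ v w = inner ℝ (i v) (i w) + inner ℝ (d v) (d w))
    {ε : ℝ} (hε : 0 < ε) (q : H) (z : V) :
    inner ℝ (i (resolvent i d ε q)) (i z) + ε * inner ℝ (d (resolvent i d ε q)) (d z) =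
      inner ℝ q (i z) := by
  have hc := isCoercive_resolventForm hin hε
  have h1 := hc.continuousLinearEquivOfBilin_apply
    (hc.continuousLinearEquivOfBilin.symm (ContinuousLinearMap.adjoint i q)) z
  rw [ContinuousLinearEquiv.apply_symm_apply, ContinuousLinearMap.adjoint_inner_left] at h1
  rw [resolvent, dif_pos hc, h1]
  simp [resolventForm]

/-- Each of the two equations is tested with the solution of the other; the form is symmetric. -/
theorem resolvent_symm
    (hin : ∀ v w, inner ℝ v w = inner ℝ (i v) (i w) + inner ℝ (d v) (d w))
    {ε : ℝ} (hε : 0 < ε) (p q : H) :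
    inner ℝ (i (resolvent i d ε p)) q = inner ℝ p (i (resolvent i d ε q)) := by
  rw [← resolvent_spec hin hε p (resolvent i d ε q), real_inner_comm q,
    ← resolvent_spec hin hε q (resolvent i d ε p), real_inner_comm (i _) (i _),
    real_inner_comm (d _) (d _)]

theorem norm_resolvent_le
    (hin : ∀ v w, inner ℝ v w = inner ℝ (i v) (i w) + inner ℝ (d v) (d w))
    {ε : ℝ} (hε : 0 < ε) (q : H) : ‖i (resolvent i d ε q)‖ ≤ ‖q‖ := by
  have h := resolvent_spec hin hε q (resolvent i d ε q)
  rw [real_inner_self_eq_norm_sq, real_inner_self_eq_norm_sq] at h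
  have h1 := real_inner_le_norm q (i (resolvent i d ε q))
  have h2 : 0 ≤ ε * ‖d (resolvent i d ε q)‖ ^ 2 := by positivity
  by_contra hcon
  push Not at hcon
  nlinarith [norm_nonneg q, norm_nonneg (i (resolvent i d ε q))]

/-- In other words `d*d (1 + ε d*d)⁻¹ = ε⁻¹ (1 - (1 + ε d*d)⁻¹)`: composed with the resolvent, the
unbounded operator becomes a bounded operator of `H`. -/
theorem eps_inner_grad_resolvent
    (hin : ∀ v w, inner ℝ v w = inner ℝ (i v) (i w) + inner ℝ (d v) (d w))
    {ε : ℝ} (hε : 0 < ε) (q : H) (z : V) :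
    ε * inner ℝ (d (resolvent i d ε q)) (d z) = inner ℝ (q - i (resolvent i d ε q)) (i z) := by
  rw [inner_sub_left, ← resolvent_spec hin hε q z]; ring

/-- The previous identity tested with `u - J(i u)`. Its left side is a square, so `‖dJ‖² ≤ (dJ,
du)`; this gives the contraction in the `d`-seminorm, and then the rate `√ε` in `H`. -/
theorem sq_norm_sub_resolvent
    (hin : ∀ v w, inner ℝ v w = inner ℝ (i v) (i w) + inner ℝ (d v) (d w))
    {ε : ℝ} (hε : 0 < ε) (u : V) :
    ‖i u - i (resolvent i d ε (i u))‖ ^ 2 =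
      ε * (inner ℝ (d (resolvent i d ε (i u))) (d u) - ‖d (resolvent i d ε (i u))‖ ^ 2) := by
  have h := eps_inner_grad_resolvent hin hε (i u) (u - resolvent i d ε (i u))
  rw [map_sub, map_sub, real_inner_self_eq_norm_sq, inner_sub_right,
    real_inner_self_eq_norm_sq] at h
  exact h.symm

theorem norm_grad_resolvent_le
    (hin : ∀ v w, inner ℝ v w = inner ℝ (i v) (i w) + inner ℝ (d v) (d w))
    {ε : ℝ} (hε : 0 < ε) (u : V) :
    ‖d (resolvent i d ε (i u))‖ ≤ ‖d u‖ := by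
  have h := sq_norm_sub_resolvent hin hε u
  have h1 := real_inner_le_norm (d (resolvent i d ε (i u))) (d u)
  have h2 : 0 ≤ inner ℝ (d (resolvent i d ε (i u))) (d u) - ‖d (resolvent i d ε (i u))‖ ^ 2 := by
    by_contra hcon
    push Not at hcon
    nlinarith [sq_nonneg ‖i u - i (resolvent i d ε (i u))‖]
  by_contra hcon
  push Not at hcon
  nlinarith [norm_nonneg (d u), norm_nonneg (d (resolvent i d ε (i u)))]

theorem sq_norm_sub_resolvent_le
    (hin : ∀ v w, inner ℝ v w = inner ℝ (i v) (i w) + inner ℝ (d v) (d w))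
    {ε : ℝ} (hε : 0 < ε) (u : V) :
    ‖i u - i (resolvent i d ε (i u))‖ ^ 2 ≤ ε * ‖d u‖ ^ 2 := by
  rw [sq_norm_sub_resolvent hin hε]
  have h1 := real_inner_le_norm (d (resolvent i d ε (i u))) (d u)
  have h2 := norm_grad_resolvent_le hin hε u
  have h3 := norm_nonneg (d u)
  gcongr
  nlinarith [sq_nonneg ‖d (resolvent i d ε (i u))‖]

theorem tendsto_sub_resolvent
    (hin : ∀ v w, inner ℝ v w = inner ℝ (i v) (i w) + inner ℝ (d v) (d w))
    (u : V) :
    Tendsto (fun n : ℕ => ‖i u - i (resolvent i d (1 / ((n : ℝ) + 1)) (i u))‖) atTop (𝓝 0) := by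
  have h1 : Tendsto (fun n : ℕ => √(1 / ((n : ℝ) + 1) * ‖d u‖ ^ 2)) atTop (𝓝 0) := by
    have h := (tendsto_one_div_add_atTop_nhds_zero_nat (𝕜 := ℝ)).mul_const (‖d u‖ ^ 2)
    rw [zero_mul] at h
    simpa using h.sqrt
  refine squeeze_zero (fun _ => norm_nonneg _) (fun n => ?_) h1
  exact Real.le_sqrt_of_sq_le (sq_norm_sub_resolvent_le hin (by positivity) u)

theorem tendsto_resolvent
    (hin : ∀ v w, inner ℝ v w = inner ℝ (i v) (i w) + inner ℝ (d v) (d w))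
    (hd : DenseRange i) (q : H) :
    Tendsto (fun n : ℕ => i (resolvent i d (1 / ((n : ℝ) + 1)) q)) atTop (𝓝 q) := by
  refine tendsto_apply_of_dense (T := fun n : ℕ => i.comp (resolvent i d (1 / ((n : ℝ) + 1))))
    (T₀ := ContinuousLinearMap.id ℝ H) (C := 1) (fun n x => ?_) hd ?_ q
  · rw [one_mul]; exact norm_resolvent_le hin (by positivity) x
  · rintro _ ⟨u, rfl⟩
    rw [tendsto_iff_norm_sub_tendsto_zero]
    simpa [norm_sub_rev] using tendsto_sub_resolvent hin u

/-- By density it is enough to treat `u = i* q`. There `‖d(u - J)‖² = (d(u - J), du) - ((dJ, du) -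
‖dJ‖²)`; the first term equals `(q - i u, i u - i J)` and tends to zero, and the second is
nonnegative. -/
theorem tendsto_grad_resolvent
    (hin : ∀ v w, inner ℝ v w = inner ℝ (i v) (i w) + inner ℝ (d v) (d w))
    (hinj : Function.Injective i) (u : V) :
    Tendsto (fun n : ℕ => d (resolvent i d (1 / ((n : ℝ) + 1)) (i u))) atTop (𝓝 (d u)) := by
  refine tendsto_apply_of_dense
    (T := fun n : ℕ => d.comp ((resolvent i d (1 / ((n : ℝ) + 1))).comp i))
    (T₀ := d) (C := ‖d‖) (fun n x => ?_) (dense_range_adjoint hinj) ?_ u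
  · exact (norm_grad_resolvent_le hin (by positivity) x).trans (d.le_opNorm x)
  · rintro _ ⟨q, rfl⟩
    set u := ContinuousLinearMap.adjoint i q
    have hu : ∀ z, inner ℝ (d u) (d z) = inner ℝ (q - i u) (i z) := fun z => by
      have h1 := hin u z
      rw [ContinuousLinearMap.adjoint_inner_left] at h1
      rw [inner_sub_left, h1]; ring
    rw [tendsto_iff_norm_sub_tendsto_zero]
    have h0 := (tendsto_sub_resolvent hin u).const_mul ‖q - i u‖
    rw [mul_zero] at h0
    have h1 : Tendsto (fun n : ℕ => √(‖q - i u‖ *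
        ‖i u - i (resolvent i d (1 / ((n : ℝ) + 1)) (i u))‖)) atTop (𝓝 0) := by
      simpa using h0.sqrt
    refine squeeze_zero (fun _ => norm_nonneg _) (fun n => Real.le_sqrt_of_sq_le ?_) h1
    set J := resolvent i d (1 / ((n : ℝ) + 1)) (i u) with hJ
    have hpos : (0 : ℝ) < 1 / ((n : ℝ) + 1) := by positivity
    have h2 := sq_norm_sub_resolvent hin hpos u
    rw [← hJ] at h2
    have h3 := hu (u - J)
    have h4 := real_inner_le_norm (q - i u) (i u - i J)
    have h5 : 0 ≤ inner ℝ (d J) (d u) - ‖d J‖ ^ 2 := by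
      by_contra hcon
      push Not at hcon
      nlinarith [sq_nonneg ‖i u - i J‖]
    rw [map_sub, map_sub, inner_sub_right, real_inner_self_eq_norm_sq] at h3
    simp only [ContinuousLinearMap.comp_apply]
    rw [norm_sub_rev, norm_sub_sq_real]
    rw [real_inner_comm] at h5
    linarith

end Resolvent

/-! ### The energy inequality for an abstract linear damped wave equation. -/

section EnergyInequality

set_option linter.unusedSectionVars false

variable {V H G : Type*} [NormedAddCommGroup V] [InnerProductSpace ℝ V] [CompleteSpace V]
  [NormedAddCommGroup H] [InnerProductSpace ℝ H] [CompleteSpace H]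
  [NormedAddCommGroup G] [InnerProductSpace ℝ G]
  {i : V →L[ℝ] H} {d : V →L[ℝ] G}

theorem intervalIntegrable_of_ae_bound {F : Type*} [NormedAddCommGroup F] {p : ℝ → F} {t M : ℝ}
    (ht : 0 ≤ t)
    (hp : AEStronglyMeasurable p (volume.restrict (Ioc 0 t)))
    (hpM : ∀ᵐ s ∂volume.restrict (Ioc 0 t), ‖p s‖ ≤ M) : IntervalIntegrable p volume 0 t := by
  rw [intervalIntegrable_iff_integrableOn_Ioc_of_le ht]
  exact Integrable.mono' (integrable_const M) hp hpM

/-- The energy identity for the regularized problem. -/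
theorem resolvent_energy_identity
    (hin : ∀ v w, inner ℝ v w = inner ℝ (i v) (i w) + inner ℝ (d v) (d w))
    {D : V →L[ℝ] H} {ε : ℝ} (hε : 0 < ε)
    (hDsym : ∀ p q, inner ℝ (D (resolvent i d ε p)) q = inner ℝ p (D (resolvent i d ε q)))
    {α γ t M : ℝ} (ht : 0 ≤ t) {u : ℝ → V} {p h : ℝ → H}
    (hp : AEStronglyMeasurable p (volume.restrict (Ioc 0 t)))
    (hpM : ∀ᵐ s ∂volume.restrict (Ioc 0 t), ‖p s‖ ≤ M)
    (hh : IntervalIntegrable h volume 0 t)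
    (hu : ∀ s ∈ Icc 0 t, i (u s) = i (u 0) + ∫ r in (0 : ℝ)..s, p r)
    (hw : ∀ ψ : V, ∀ s ∈ Icc 0 t, inner ℝ (p s) (i ψ) = inner ℝ (p 0) (i ψ) +
      ∫ r in (0 : ℝ)..s, (inner ℝ (h r) (i ψ) - inner ℝ (d (u r)) (d ψ)
        - α * inner ℝ (p r) (i ψ) - γ * inner ℝ (p r) (D ψ))) :
    ‖i (resolvent i d ε (p t))‖ ^ 2 + ‖d (resolvent i d ε (i (u t)))‖ ^ 2
      + 2 * α * (∫ s in (0 : ℝ)..t, ‖i (resolvent i d ε (p s))‖ ^ 2)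
      + 2 * γ * (∫ s in (0 : ℝ)..t,
          inner ℝ (i (resolvent i d ε (p s))) (D (resolvent i d ε (p s)))) =
    ‖i (resolvent i d ε (p 0))‖ ^ 2 + ‖d (resolvent i d ε (i (u 0)))‖ ^ 2
      + 2 * (∫ s in (0 : ℝ)..t,
          inner ℝ (i (resolvent i d ε (h s))) (i (resolvent i d ε (p s)))) := by
  have hpi := intervalIntegrable_of_ae_bound ht hp hpM
  set J := resolvent i d ε with hJ
  set K : H →L[ℝ] H := i.comp J with hK
  set S : H →L[ℝ] H := D.comp J with hS
  -- The Yosida approximation of `d*d`, bounded on `H` and commuting with `K`.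
  set A : H →L[ℝ] H := ε⁻¹ • (ContinuousLinearMap.id ℝ H - K) with hA
  have hKs : ∀ x y, inner ℝ (K x) y = inner ℝ x (K y) := fun x y => resolvent_symm hin hε x y
  have hSs : ∀ x y, inner ℝ (S x) y = inner ℝ x (S y) := hDsym
  have hAs : ∀ x y, inner ℝ (A x) y = inner ℝ x (A y) := fun x y => by
    simp only [hA, smul_apply, sub_apply,
      ContinuousLinearMap.id_apply, real_inner_smul_left, real_inner_smul_right, inner_sub_left,
      inner_sub_right, hKs]
  have hAK : ∀ x, A (K x) = K (A x) := fun x => by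
    simp [hA]
  have hAd : ∀ (q : H) (z : V), inner ℝ (d (J q)) (d z) = inner ℝ (A q) (i z) := fun q z => by
    have h1 := eps_inner_grad_resolvent hin hε q z
    simp only [hA, smul_apply, sub_apply,
      ContinuousLinearMap.id_apply, real_inner_smul_left]
    rw [eq_inv_mul_iff_mul_eq₀ hε.ne']
    exact h1
  have hui : IntervalIntegrable (fun s => i (u s)) volume 0 t := by
    have hc : ContinuousOn (fun s => i (u s)) (uIcc 0 t) := by
      refine ContinuousOn.congr (f := fun s => i (u 0) + ∫ r in (0 : ℝ)..s, p r) ?_ ?_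
      · exact continuousOn_const.add (intervalIntegral.continuousOn_primitive_interval'
          hpi left_mem_uIcc)
      · intro s hs; rw [uIcc_of_le ht] at hs; exact hu s hs
    exact hc.intervalIntegrable
  have hcomp : ∀ (T : H →L[ℝ] H) {q : ℝ → H}, IntervalIntegrable q volume 0 t →
      IntervalIntegrable (fun s => T (q s)) volume 0 t := fun T q hq =>
    ⟨T.integrable_comp hq.1, T.integrable_comp hq.2⟩
  set a : ℝ → H := fun r => K (h r) - A (i (u r)) - α • K (p r) - γ • S (p r) with ha
  have hai : IntervalIntegrable a volume 0 t :=
    ((((hcomp K hh).sub (hcomp A hui)).sub ((hcomp K hpi).smul α)).sub ((hcomp S hpi).smul γ))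
  -- Testing the weak equation with `J z ∈ V` for arbitrary `z ∈ H` and moving `J` to the other
  -- factor turns it into an equation in `H` for `K p`, whose derivative is integrable.
  have hR : ∀ s ∈ Icc 0 t, K (p s) = K (p 0) + ∫ r in (0 : ℝ)..s, a r := by
    intro s hs
    have hais : IntervalIntegrable a volume 0 s :=
      hai.mono_set (by rw [uIcc_of_le ht, uIcc_of_le hs.1]; exact Icc_subset_Icc_right hs.2)
    refine ext_inner_right ℝ fun z => ?_
    rw [inner_add_left, hKs, hKs]
    have h1 := hw (J z) s hs
    have h2 : inner ℝ (∫ r in (0 : ℝ)..s, a r) z = ∫ r in (0 : ℝ)..s, inner ℝ (a r) z := by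
      have h3 := (innerSL ℝ z).intervalIntegral_comp_comm hais
      simp only [innerSL_apply_apply] at h3
      rw [real_inner_comm, ← h3]
      simp only [real_inner_comm z]
    rw [h2]
    change inner ℝ (p s) (i (J z)) = inner ℝ (p 0) (i (J z)) + _
    rw [h1]
    congr 1
    apply intervalIntegral.integral_congr
    intro r _
    simp only [ha, inner_sub_left, real_inner_smul_left, hKs, hSs]
    have h4 : inner ℝ (d (u r)) (d (J z)) = inner ℝ (A (i (u r))) z := by
      rw [real_inner_comm, hAd, hAs, real_inner_comm]
    rw [h4]
    rfl
  -- `e1` is the balance of the kinetic energy `‖K p‖²`, and `e2` that of the elastic energy `(A K i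
  -- u, i u) = ‖d J i u‖²`.
  have e1 := integral_inner_eq_sub ht hai hR
  have e2 := integral_inner_apply_eq_sub (P := fun s => i (u s)) ht hpi hu (A.comp K) (fun x y => by
    simp only [ContinuousLinearMap.comp_apply]
    rw [hAs, hKs, hAK])
  simp only [ContinuousLinearMap.comp_apply] at e2
  have hq : ∀ s, inner ℝ (A (K (i (u s)))) (i (u s)) = ‖d (J (i (u s)))‖ ^ 2 := fun s => by
    rw [← real_inner_self_eq_norm_sq, hAd, hAK, hKs]
    rfl
  rw [hq, hq] at e2
  have hpM' : ∀ (T : H →L[ℝ] H), ∀ᵐ s ∂volume.restrict (Ioc 0 t), ‖T (p s)‖ ≤ ‖T‖ * M := fun T => by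
    filter_upwards [hpM] with s hs
    exact (T.le_opNorm _).trans (by gcongr)
  have hii : ∀ (T : H →L[ℝ] H) {q : ℝ → H}, IntervalIntegrable q volume 0 t →
      IntervalIntegrable (fun s => inner ℝ (q s) (T (p s))) volume 0 t := by
    intro T q hq
    rw [intervalIntegrable_iff_integrableOn_Ioc_of_le ht] at hq ⊢
    have hm : AEStronglyMeasurable (fun s => T (p s)) (volume.restrict (Ioc 0 t)) :=
      T.continuous.comp_aestronglyMeasurable hp
    refine Integrable.mono' (hq.norm.mul_const (‖T‖ * M)) (hq.1.inner hm) ?_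
    filter_upwards [hpM' T] with s hs
    exact (abs_real_inner_le_norm _ _).trans (by gcongr)
  have i1 : IntervalIntegrable (fun s => 2 * inner ℝ (K (p s)) (a s)) volume 0 t := by
    simpa only [real_inner_comm] using (hii K hai).const_mul 2
  have i2 : IntervalIntegrable (fun s => 2 * inner ℝ (A (K (i (u s)))) (p s)) volume 0 t := by
    simpa using (hii (ContinuousLinearMap.id ℝ H) (hcomp (A.comp K) hui)).const_mul 2
  have i3 := hii K (hcomp K hh)
  have i4 := hii K (hcomp K hpi)
  have i5 := hii S (hcomp K hpi)
  -- The exchange terms `(K p, A i u)` and `(A K i u, p)` are equal and enter with opposite signs;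
  -- the forcing and the two damping terms remain.
  have hsum : (∫ s in (0 : ℝ)..t, 2 * inner ℝ (K (p s)) (a s)) +
      (∫ s in (0 : ℝ)..t, 2 * inner ℝ (A (K (i (u s)))) (p s)) =
      2 * (∫ s in (0 : ℝ)..t, inner ℝ (K (h s)) (K (p s)))
      - 2 * α * (∫ s in (0 : ℝ)..t, inner ℝ (K (p s)) (K (p s)))
      - 2 * γ * (∫ s in (0 : ℝ)..t, inner ℝ (K (p s)) (S (p s))) := by
    rw [← intervalIntegral.integral_add i1 i2, ← intervalIntegral.integral_const_mul,
      ← intervalIntegral.integral_const_mul, ← intervalIntegral.integral_const_mul,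
      ← intervalIntegral.integral_sub (i3.const_mul 2) (i4.const_mul _),
      ← intervalIntegral.integral_sub ((i3.const_mul 2).sub (i4.const_mul _)) (i5.const_mul _)]
    apply intervalIntegral.integral_congr
    intro s _
    have h5 : inner ℝ (A (K (i (u s)))) (p s) = inner ℝ (K (p s)) (A (i (u s))) := by
      rw [hAK, hKs, real_inner_comm]
    simp only [ha, inner_sub_right, real_inner_smul_right, h5, real_inner_comm (K (p s)) (K (h s))]
    ring
  rw [e1, e2] at hsum
  simp only [real_inner_self_eq_norm_sq] at hsum
  change ‖K (p t)‖ ^ 2 + _ + 2 * α * (∫ s in (0 : ℝ)..t, ‖K (p s)‖ ^ 2)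
    + 2 * γ * (∫ s in (0 : ℝ)..t, inner ℝ (K (p s)) (S (p s))) = ‖K (p 0)‖ ^ 2 + _
      + 2 * (∫ s in (0 : ℝ)..t, inner ℝ (K (h s)) (K (p s)))
  linarith

/-- The energy inequality for weak solutions of a linear damped wave equation with right-hand
side in `L¹(0,t;H)`. -/
theorem energy_inequality
    (hin : ∀ v w, inner ℝ v w = inner ℝ (i v) (i w) + inner ℝ (d v) (d w))
    (hinj : Function.Injective i) (hdense : DenseRange i) {D : V →L[ℝ] H}
    (hDsym : ∀ ε > 0, ∀ p q,
      inner ℝ (D (resolvent i d ε p)) q = inner ℝ p (D (resolvent i d ε q)))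
    (hDpos : ∀ ε > 0, ∀ p, 0 ≤ inner ℝ (i (resolvent i d ε p)) (D (resolvent i d ε p)))
    {q : H → ℝ≥0∞} (hq : ∀ p, q p ≤ liminf (fun n : ℕ => ENNReal.ofReal
      (inner ℝ (i (resolvent i d (1 / ((n : ℝ) + 1)) p))
        (D (resolvent i d (1 / ((n : ℝ) + 1)) p)))) atTop)
    {α γ t M : ℝ} (ht : 0 ≤ t) (hγ : 0 < γ) {u : ℝ → V} {p h : ℝ → H}
    (hp : AEStronglyMeasurable p (volume.restrict (Ioc 0 t)))
    (hpM : ∀ᵐ s ∂volume.restrict (Ioc 0 t), ‖p s‖ ≤ M)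
    (hh : IntervalIntegrable h volume 0 t)
    (hu : ∀ s ∈ Icc 0 t, i (u s) = i (u 0) + ∫ r in (0 : ℝ)..s, p r)
    (hw : ∀ ψ : V, ∀ s ∈ Icc 0 t, inner ℝ (p s) (i ψ) = inner ℝ (p 0) (i ψ) +
      ∫ r in (0 : ℝ)..s, (inner ℝ (h r) (i ψ) - inner ℝ (d (u r)) (d ψ)
        - α * inner ℝ (p r) (i ψ) - γ * inner ℝ (p r) (D ψ))) :
    ‖p t‖ ^ 2 + ‖d (u t)‖ ^ 2 + 2 * α * (∫ s in (0 : ℝ)..t, ‖p s‖ ^ 2) ≤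
      ‖p 0‖ ^ 2 + ‖d (u 0)‖ ^ 2 + 2 * (∫ s in (0 : ℝ)..t, inner ℝ (h s) (p s)) ∧
    ∫⁻ s in Ioc 0 t, q (p s) ≤ ENNReal.ofReal ((2 * γ)⁻¹ *
      ((‖p 0‖ ^ 2 + ‖d (u 0)‖ ^ 2 + 2 * (∫ s in (0 : ℝ)..t, inner ℝ (h s) (p s))) -
      (‖p t‖ ^ 2 + ‖d (u t)‖ ^ 2 + 2 * α * (∫ s in (0 : ℝ)..t, ‖p s‖ ^ 2)))) := by
  set ε : ℕ → ℝ := fun n => 1 / ((n : ℝ) + 1) with hεdef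
  have hε : ∀ n, 0 < ε n := fun n => by simp only [hεdef]; positivity
  set J : ℕ → H →L[ℝ] V := fun n => resolvent i d (ε n) with hJ
  have hKp : ∀ x, Tendsto (fun n => i (J n x)) atTop (𝓝 x) := fun x =>
    tendsto_resolvent hin hdense x
  have hdn : ∀ v, Tendsto (fun n => d (J n (i v))) atTop (𝓝 (d v)) := fun v =>
    tendsto_grad_resolvent hin hinj v
  have hKle : ∀ n x, ‖i (J n x)‖ ≤ ‖x‖ := fun n x => norm_resolvent_le hin (hε n) x
  have hmeas : ∀ (T : H →L[ℝ] H), AEStronglyMeasurable (fun s => T (p s))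
      (volume.restrict (Ioc 0 t)) := fun T => T.continuous.comp_aestronglyMeasurable hp
  have hh' := hh
  rw [intervalIntegrable_iff_integrableOn_Ioc_of_le ht] at hh'
  have l1 : Tendsto (fun n => ∫ s in (0 : ℝ)..t, ‖i (J n (p s))‖ ^ 2) atTop
      (𝓝 (∫ s in (0 : ℝ)..t, ‖p s‖ ^ 2)) := by
    simp only [intervalIntegral.integral_of_le ht]
    refine tendsto_integral_of_dominated_convergence (fun _ => M ^ 2) ?_ (integrable_const _) ?_ ?_
    · intro n
      exact ((hmeas (i.comp (J n))).norm.pow 2)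
    · intro n
      filter_upwards [hpM] with s hs
      rw [Real.norm_eq_abs, abs_of_nonneg (by positivity)]
      gcongr
      exact (hKle n _).trans hs
    · filter_upwards with s
      exact (hKp (p s)).norm.pow 2
  have l2 : Tendsto (fun n => ∫ s in (0 : ℝ)..t, inner ℝ (i (J n (h s))) (i (J n (p s)))) atTop
      (𝓝 (∫ s in (0 : ℝ)..t, inner ℝ (h s) (p s))) := by
    simp only [intervalIntegral.integral_of_le ht]
    refine tendsto_integral_of_dominated_convergence (fun s => ‖h s‖ * M) ?_
      (hh'.norm.mul_const M) ?_ ?_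
    · intro n
      exact ((i.comp (J n)).continuous.comp_aestronglyMeasurable hh'.1).inner (hmeas (i.comp (J n)))
    · intro n
      filter_upwards [hpM] with s hs
      refine (abs_real_inner_le_norm _ _).trans ?_
      gcongr
      · exact hKle n _
      · exact (hKle n _).trans hs
    · filter_upwards with s
      exact (hKp (h s)).inner (hKp (p s))
  -- The energy defect: what the fractional damping must account for. Every term in it converges
  -- strongly.
  set X : ℕ → ℝ := fun n =>
    (‖i (J n (p 0))‖ ^ 2 + ‖d (J n (i (u 0)))‖ ^ 2
      + 2 * (∫ s in (0 : ℝ)..t, inner ℝ (i (J n (h s))) (i (J n (p s))))) -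
    (‖i (J n (p t))‖ ^ 2 + ‖d (J n (i (u t)))‖ ^ 2
      + 2 * α * (∫ s in (0 : ℝ)..t, ‖i (J n (p s))‖ ^ 2)) with hX
  set X₀ : ℝ := (‖p 0‖ ^ 2 + ‖d (u 0)‖ ^ 2 + 2 * (∫ s in (0 : ℝ)..t, inner ℝ (h s) (p s))) -
      (‖p t‖ ^ 2 + ‖d (u t)‖ ^ 2 + 2 * α * (∫ s in (0 : ℝ)..t, ‖p s‖ ^ 2)) with hX₀
  have lX : Tendsto X atTop (𝓝 X₀) :=
    (((((hKp _).norm.pow 2).add ((hdn _).norm.pow 2)).add (l2.const_mul 2))).sub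
      (((((hKp _).norm.pow 2).add ((hdn _).norm.pow 2)).add (l1.const_mul (2 * α))))
  have hid : ∀ n, 2 * γ * (∫ s in (0 : ℝ)..t, inner ℝ (i (J n (p s))) (D (J n (p s)))) = X n := by
    intro n
    have := resolvent_energy_identity hin (hε n) (hDsym _ (hε n)) ht hp hpM hh hu hw
    simp only [hX, hJ]
    linarith
  -- The damping integral itself is not passed to the limit for the first claim; its sign alone
  -- makes the limit of the defects nonnegative.
  have hXnn : ∀ n, 0 ≤ X n := fun n => by
    rw [← hid n]
    exact mul_nonneg (by positivity)
      (intervalIntegral.integral_nonneg ht fun s _ => hDpos _ (hε n) _)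
  have hX₀nn : 0 ≤ X₀ := ge_of_tendsto' lX hXnn
  refine ⟨by linarith, ?_⟩
  have hlint : ∀ n, ∫⁻ s in Ioc 0 t, ENNReal.ofReal (inner ℝ (i (J n (p s))) (D (J n (p s)))) =
      ENNReal.ofReal ((2 * γ)⁻¹ * X n) := by
    intro n
    rw [← hid n, inv_mul_cancel_left₀ (by positivity), intervalIntegral.integral_of_le ht,
      ofReal_integral_eq_lintegral_ofReal]
    · refine Integrable.mono' (integrable_const ((‖i.comp (J n)‖ * M) * (‖D.comp (J n)‖ * M)))
        ((hmeas (i.comp (J n))).inner (hmeas (D.comp (J n)))) ?_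
      filter_upwards [hpM] with s hs
      refine (abs_real_inner_le_norm _ _).trans ?_
      have h1 : ‖i (J n (p s))‖ ≤ ‖i.comp (J n)‖ * M :=
        ((i.comp (J n)).le_opNorm _).trans (by gcongr)
      have h2 : ‖D (J n (p s))‖ ≤ ‖D.comp (J n)‖ * M :=
        ((D.comp (J n)).le_opNorm _).trans (by gcongr)
      exact mul_le_mul h1 h2 (norm_nonneg _) ((norm_nonneg _).trans h1)
    · filter_upwards with s using hDpos _ (hε n) _
  -- Fatou, with `q` dominated by the lower limit of the regularized damping densities, recovers the
  -- dissipation integral from the same defect.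
  calc ∫⁻ s in Ioc 0 t, q (p s)
      ≤ ∫⁻ s in Ioc 0 t, liminf (fun n : ℕ => ENNReal.ofReal
          (inner ℝ (i (J n (p s))) (D (J n (p s))))) atTop := lintegral_mono fun s => hq (p s)
    _ ≤ liminf (fun n => ∫⁻ s in Ioc 0 t, ENNReal.ofReal
          (inner ℝ (i (J n (p s))) (D (J n (p s))))) atTop := by
        refine lintegral_liminf_le' fun n => ?_
        exact ((hmeas (i.comp (J n))).inner (hmeas (D.comp (J n)))).aemeasurable.ennreal_ofReal
    _ = ENNReal.ofReal ((2 * γ)⁻¹ * X₀) := by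
        simp only [hlint]
        exact (ENNReal.tendsto_ofReal (lX.const_mul _)).liminf_eq

end EnergyInequality

/-! ### Eigenspaces of `d*d` and its square root. -/

section Spectral

set_option linter.unusedSectionVars false

theorem norm_sq_sum_of_pairwise_orthogonal {ι E : Type*} [NormedAddCommGroup E]
    [InnerProductSpace ℝ E] {x : ι → E} (hx : Pairwise fun j k => inner ℝ (x j) (x k) = 0)
    (s : Finset ι) : ‖∑ j ∈ s, x j‖ ^ 2 = ∑ j ∈ s, ‖x j‖ ^ 2 := by
  classical
  rw [← real_inner_self_eq_norm_sq, sum_inner]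
  refine Finset.sum_congr rfl fun j hj => ?_
  rw [inner_sum, Finset.sum_eq_single j (fun k _ hk => hx hk.symm) (fun h => absurd hj h),
    real_inner_self_eq_norm_sq]

/-- The lines spanned by the vectors form an orthogonal family of subspaces, for which summability
is known to be equivalent to that of the squared norms. -/
theorem summable_of_pairwise_orthogonal {ι E : Type*} [NormedAddCommGroup E]
    [InnerProductSpace ℝ E] [CompleteSpace E] {x : ι → E}
    (hx : Pairwise fun j k => inner ℝ (x j) (x k) = 0) (hs : Summable fun j => ‖x j‖ ^ 2) :
    Summable x := by
  have hV : OrthogonalFamily ℝ (fun j => Submodule.span ℝ {x j})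
      fun j => (Submodule.span ℝ {x j}).subtypeₗᵢ := by
    intro j k hjk a b
    obtain ⟨c, hc⟩ := Submodule.mem_span_singleton.1 a.2
    obtain ⟨c', hc'⟩ := Submodule.mem_span_singleton.1 b.2
    change inner ℝ (a : E) (b : E) = 0
    rw [← hc, ← hc', real_inner_smul_left, real_inner_smul_right, hx hjk]
    simp
  exact (hV.summable_iff_norm_sq_summable
    (fun j => ⟨x j, Submodule.mem_span_singleton_self _⟩)).2 hs

theorem norm_sq_tsum_of_pairwise_orthogonal {ι E : Type*} [NormedAddCommGroup E]
    [InnerProductSpace ℝ E] {x : ι → E}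
    (hx : Pairwise fun j k => inner ℝ (x j) (x k) = 0) (hs : Summable x) :
    HasSum (fun j => ‖x j‖ ^ 2) (‖∑' j, x j‖ ^ 2) := by
  have h := (hs.hasSum.norm.pow 2)
  simp only [norm_sq_sum_of_pairwise_orthogonal hx] at h
  exact h

/-- Bessel's inequality, from expanding `‖q - ∑ x j‖² ≥ 0`. -/
theorem sum_norm_sq_le_of_pairwise_orthogonal {ι E : Type*} [NormedAddCommGroup E]
    [InnerProductSpace ℝ E] {x : ι → E} {q : E}
    (hx : Pairwise fun j k => inner ℝ (x j) (x k) = 0)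
    (hq : ∀ j, inner ℝ (x j) q = ‖x j‖ ^ 2) (s : Finset ι) : ∑ j ∈ s, ‖x j‖ ^ 2 ≤ ‖q‖ ^ 2 := by
  have h := norm_sub_sq_real q (∑ j ∈ s, x j)
  rw [norm_sq_sum_of_pairwise_orthogonal hx, real_inner_comm, sum_inner,
    Finset.sum_congr rfl fun j _ => hq j] at h
  nlinarith [sq_nonneg ‖q - ∑ j ∈ s, x j‖]

variable {V H G : Type*} [NormedAddCommGroup V] [InnerProductSpace ℝ V]
  [NormedAddCommGroup H] [InnerProductSpace ℝ H]
  [NormedAddCommGroup G] [InnerProductSpace ℝ G]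

/-- The eigenspace of `d*d` for `μ`. -/
def formEigenspace (i : V →L[ℝ] H) (d : V →L[ℝ] G) (μ : ℝ) : Submodule ℝ H where
  carrier := {e | ∃ w : V, i w = e ∧ ∀ z : V, inner ℝ (d w) (d z) = μ * inner ℝ e (i z)}
  zero_mem' := ⟨0, by simp, by simp⟩
  add_mem' := by
    rintro a b ⟨w, hw, hw'⟩ ⟨v, hv, hv'⟩
    refine ⟨w + v, by rw [map_add, hw, hv], fun z => ?_⟩
    rw [map_add, inner_add_left, hw', hv', inner_add_left, mul_add]
  smul_mem' := by
    rintro c a ⟨w, hw, hw'⟩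
    refine ⟨c • w, by rw [map_smul, hw], fun z => ?_⟩
    rw [map_smul, real_inner_smul_left, hw', real_inner_smul_left]
    ring

variable [CompleteSpace V] [CompleteSpace H]

/-- The orthogonal projection onto the closure of the eigenspace. -/
def formProj (i : V →L[ℝ] H) (d : V →L[ℝ] G) (μ : ℝ) : H →L[ℝ] H :=
  (formEigenspace i d μ).topologicalClosure.starProjection

variable {i : V →L[ℝ] H} {d : V →L[ℝ] G}

theorem formEigenspace_inner_eq_zero {μ ν : ℝ} (hμν : μ ≠ ν) {e f : H}
    (he : e ∈ formEigenspace i d μ) (hf : f ∈ formEigenspace i d ν) : inner ℝ e f = 0 := by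
  obtain ⟨w, rfl, hw⟩ := he
  obtain ⟨v, rfl, hv⟩ := hf
  have h1 := hw v
  have h2 := hv w
  rw [real_inner_comm, h1, real_inner_comm (i w)] at h2
  have h3 : (μ - ν) * inner ℝ (i w) (i v) = 0 := by linear_combination h2
  exact (mul_eq_zero.1 h3).resolve_left (sub_ne_zero.2 hμν)

theorem formEigenspace_eq_bot {μ : ℝ} (hμ : μ < 0) : formEigenspace i d μ = ⊥ := by
  rw [Submodule.eq_bot_iff]
  rintro _ ⟨w, rfl, hw⟩
  have h1 := hw w
  rw [real_inner_self_eq_norm_sq, real_inner_self_eq_norm_sq] at h1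
  have h2 : ‖i w‖ ^ 2 = 0 := by nlinarith [sq_nonneg ‖d w‖, sq_nonneg ‖i w‖]
  simpa using h2

/-- The form is nonnegative, so no eigenvalue is negative. Sums over all real `μ` are thereby
harmless: real powers of a negative number always multiply a vanishing projection. -/
theorem formProj_eq_zero {μ : ℝ} (hμ : μ < 0) : formProj i d μ = 0 := by
  ext q
  have h : formProj i d μ q ∈ (formEigenspace i d μ).topologicalClosure :=
    Submodule.starProjection_apply_mem _ q
  have h1 : (formEigenspace i d μ).topologicalClosure = ⊥ := by
    rw [formEigenspace_eq_bot hμ]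
    exact (isClosed_singleton (x := (0 : H))).submodule_topologicalClosure_eq
  rw [h1] at h
  exact (Submodule.mem_bot ℝ).1 h

theorem inner_formProj_left (μ : ℝ) (p q : H) :
    inner ℝ (formProj i d μ p) q = inner ℝ p (formProj i d μ q) :=
  Submodule.inner_starProjection_left_eq_right _ p q

theorem inner_formProj_self (μ : ℝ) (q : H) :
    inner ℝ (formProj i d μ q) q = ‖formProj i d μ q‖ ^ 2 := by
  have h := Submodule.starProjection_inner_eq_zero (K := (formEigenspace i d μ).topologicalClosure)
    q (formProj i d μ q) (Submodule.starProjection_apply_mem _ q)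
  rw [inner_sub_left] at h
  rw [← real_inner_self_eq_norm_sq, real_inner_comm]
  exact sub_eq_zero.1 h

/-- `i*` inverts `1 + d*d` weakly, so the eigenvalue equation reads `(1 + μ) i i* e = e`. This
involves bounded operators of `H` only and shows that eigenspaces are closed. -/
theorem mem_formEigenspace_iff
    (hin : ∀ v w, inner ℝ v w = inner ℝ (i v) (i w) + inner ℝ (d v) (d w))
    {μ : ℝ} {e : H} : e ∈ formEigenspace i d μ ↔
    (1 + μ) • i (ContinuousLinearMap.adjoint i e) = e := by
  constructor
  · rintro ⟨w, rfl, hw⟩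
    have : (1 + μ) • ContinuousLinearMap.adjoint i (i w) = w := by
      refine ext_inner_right ℝ fun z => ?_
      rw [real_inner_smul_left, ContinuousLinearMap.adjoint_inner_left, hin, hw]
      ring
    rw [← map_smul, this]
  · intro he
    refine ⟨(1 + μ) • ContinuousLinearMap.adjoint i e, by rw [map_smul, he], fun z => ?_⟩
    have h1 := hin ((1 + μ) • ContinuousLinearMap.adjoint i e) z
    rw [map_smul i, he, real_inner_smul_left, ContinuousLinearMap.adjoint_inner_left] at h1
    linarith

theorem formEigenspace_closure
    (hin : ∀ v w, inner ℝ v w = inner ℝ (i v) (i w) + inner ℝ (d v) (d w))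
    (μ : ℝ) :
    (formEigenspace i d μ).topologicalClosure = formEigenspace i d μ := by
  refine IsClosed.submodule_topologicalClosure_eq ?_
  have h : (formEigenspace i d μ : Set H) =
      {e | (1 + μ) • i (ContinuousLinearMap.adjoint i e) = e} := by
    ext e; exact mem_formEigenspace_iff hin
  rw [h]
  exact isClosed_eq (by fun_prop) continuous_id

theorem formProj_mem
    (hin : ∀ v w, inner ℝ v w = inner ℝ (i v) (i w) + inner ℝ (d v) (d w))
    (μ : ℝ) (q : H) : formProj i d μ q ∈ formEigenspace i d μ := by
  rw [← formEigenspace_closure hin μ]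
  exact Submodule.starProjection_apply_mem _ q

theorem eq_formProj
    (hin : ∀ v w, inner ℝ v w = inner ℝ (i v) (i w) + inner ℝ (d v) (d w))
    {μ : ℝ} {q e : H} (he : e ∈ formEigenspace i d μ)
    (h : ∀ f ∈ formEigenspace i d μ, inner ℝ (q - e) f = 0) : formProj i d μ q = e := by
  refine (Submodule.eq_starProjection_of_mem_of_inner_eq_zero ?_ ?_)
  · rwa [formEigenspace_closure hin]
  · rwa [formEigenspace_closure hin]

theorem inner_sub_formProj {μ : ℝ} (q : H) {f : H} (hf : f ∈ formEigenspace i d μ) :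
    inner ℝ (q - formProj i d μ q) f = 0 :=
  Submodule.starProjection_inner_eq_zero q f (Submodule.le_topologicalClosure _ hf)

theorem exists_lift_formProj
    (hin : ∀ v w, inner ℝ v w = inner ℝ (i v) (i w) + inner ℝ (d v) (d w))
    (μ : ℝ) (q : H) : ∃ w : V, i w = formProj i d μ q ∧
    ∀ z : V, inner ℝ (d w) (d z) = μ * inner ℝ (formProj i d μ q) (i z) :=
  formProj_mem hin μ q

theorem pairwise_formProj
    (hin : ∀ v w, inner ℝ v w = inner ℝ (i v) (i w) + inner ℝ (d v) (d w))
    (q : H) :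
    Pairwise fun μ ν => inner ℝ (formProj i d μ q) (formProj i d ν q) = 0 :=
  fun _ _ h => formEigenspace_inner_eq_zero h (formProj_mem hin _ q) (formProj_mem hin _ q)

theorem sum_norm_sq_formProj_le
    (hin : ∀ v w, inner ℝ v w = inner ℝ (i v) (i w) + inner ℝ (d v) (d w))
    (q : H) (s : Finset ℝ) :
    ∑ μ ∈ s, ‖formProj i d μ q‖ ^ 2 ≤ ‖q‖ ^ 2 :=
  sum_norm_sq_le_of_pairwise_orthogonal (pairwise_formProj hin q) (inner_formProj_self · q) s

/-- Bessel's inequality in the target of `d`: the lifts `w μ` of the projections satisfy `(d w μ, d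
z) = μ ‖P_μ z‖² = ‖d w μ‖²`, and their images under `d` are pairwise orthogonal. -/
theorem sum_mul_norm_sq_formProj_le
    (hin : ∀ v w, inner ℝ v w = inner ℝ (i v) (i w) + inner ℝ (d v) (d w))
    (z : V) (s : Finset ℝ) :
    ∑ μ ∈ s, μ * ‖formProj i d μ (i z)‖ ^ 2 ≤ ‖d z‖ ^ 2 := by
  choose w hw hw' using fun μ => exists_lift_formProj hin μ (i z)
  have h1 : ∀ μ, ‖d (w μ)‖ ^ 2 = μ * ‖formProj i d μ (i z)‖ ^ 2 := fun μ => by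
    rw [← real_inner_self_eq_norm_sq, hw', hw, real_inner_self_eq_norm_sq]
  have h2 := sum_norm_sq_le_of_pairwise_orthogonal (x := fun μ => d (w μ)) (q := d z) ?_ ?_ s
  · simpa only [h1] using h2
  · intro μ ν hμν
    rw [hw', hw, pairwise_formProj hin _ hμν, mul_zero]
  · intro μ
    rw [hw', h1, inner_formProj_self]

theorem summable_sqrt_smul_formProj
    (hin : ∀ v w, inner ℝ v w = inner ℝ (i v) (i w) + inner ℝ (d v) (d w))
    (z : V) :
    Summable fun μ : ℝ => μ ^ (1 / 2 : ℝ) • formProj i d μ (i z) := by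
  refine summable_of_pairwise_orthogonal ?_ ?_
  · intro μ ν h
    rw [real_inner_smul_left, real_inner_smul_right, pairwise_formProj hin _ h]
    simp
  · refine summable_of_sum_le (c := ‖d z‖ ^ 2) (fun _ => by positivity) fun s => ?_
    refine (Finset.sum_congr rfl fun μ _ => ?_).trans_le (sum_mul_norm_sq_formProj_le hin z s)
    rcases lt_or_ge μ 0 with hμ | hμ
    · simp [formProj_eq_zero hμ]
    · rw [norm_smul, mul_pow, Real.norm_eq_abs, sq_abs, ← Real.sqrt_eq_rpow, Real.sq_sqrt hμ]

theorem norm_sqrt_formProj_le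
    (hin : ∀ v w, inner ℝ v w = inner ℝ (i v) (i w) + inner ℝ (d v) (d w))
    (z : V) :
    ‖∑' μ : ℝ, μ ^ (1 / 2 : ℝ) • formProj i d μ (i z)‖ ≤ ‖d z‖ := by
  have hs := summable_sqrt_smul_formProj hin z
  have h1 := norm_sq_tsum_of_pairwise_orthogonal (x := fun μ : ℝ =>
    μ ^ (1 / 2 : ℝ) • formProj i d μ (i z)) (fun μ ν h => by
      dsimp only
      rw [real_inner_smul_left, real_inner_smul_right, pairwise_formProj hin _ h]
      simp) hs
  refine abs_le_of_sq_le_sq' ?_ (norm_nonneg _) |>.2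
  refine hasSum_le_of_sum_le h1 fun s => ?_
  refine (Finset.sum_congr rfl fun μ _ => ?_).trans_le (sum_mul_norm_sq_formProj_le hin z s)
  rcases lt_or_ge μ 0 with hμ | hμ
  · simp [formProj_eq_zero hμ]
  · rw [norm_smul, mul_pow, Real.norm_eq_abs, sq_abs, ← Real.sqrt_eq_rpow, Real.sq_sqrt hμ]

/-- The square root of the operator `d*d`, as a bounded operator from `V` to `H`. -/
theorem exists_sqrtOp
    (hin : ∀ v w, inner ℝ v w = inner ℝ (i v) (i w) + inner ℝ (d v) (d w)) :
    ∃ D : V →L[ℝ] H, ∀ z, D z = ∑' μ : ℝ, μ ^ (1 / 2 : ℝ) • formProj i d μ (i z) := by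
  refine ⟨LinearMap.mkContinuous
    { toFun := fun z => ∑' μ : ℝ, μ ^ (1 / 2 : ℝ) • formProj i d μ (i z)
      map_add' := fun x y => ?_
      map_smul' := fun c x => ?_ } ‖d‖ fun z => ?_, fun z => rfl⟩
  · rw [← (summable_sqrt_smul_formProj hin x).tsum_add (summable_sqrt_smul_formProj hin y)]
    simp only [map_add, smul_add]
  · rw [RingHom.id_apply, ← tsum_const_smul'']
    simp only [map_smul, smul_comm c]
  · exact (norm_sqrt_formProj_le hin z).trans (d.le_opNorm z)

/-- The resolvent equation tested with an eigenvector. -/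
theorem formProj_resolvent
    (hin : ∀ v w, inner ℝ v w = inner ℝ (i v) (i w) + inner ℝ (d v) (d w))
    {ε : ℝ} (hε : 0 < ε) (μ : ℝ) (q : H) :
    formProj i d μ (i (resolvent i d ε q)) = (1 + ε * μ)⁻¹ • formProj i d μ q := by
  rcases lt_or_ge μ 0 with hμ | hμ
  · simp [formProj_eq_zero hμ]
  have hpos : 0 < 1 + ε * μ := by positivity
  refine eq_formProj hin (Submodule.smul_mem _ _ (formProj_mem hin μ q)) fun f hf => ?_
  have h0 := inner_sub_formProj q hf
  obtain ⟨w, rfl, hw⟩ := hf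
  have h1 := resolvent_spec hin hε q w
  rw [real_inner_comm, real_inner_comm (d w), hw, real_inner_comm (i w) q] at h1
  rw [inner_sub_left, sub_eq_zero, real_inner_comm] at h0 ⊢
  rw [real_inner_smul_left, eq_inv_mul_iff_mul_eq₀ hpos.ne']
  linarith

theorem hasSum_inner_sqrtOp_resolvent
    (hin : ∀ v w, inner ℝ v w = inner ℝ (i v) (i w) + inner ℝ (d v) (d w))
    {D : V →L[ℝ] H}
    (hD : ∀ z, D z = ∑' μ : ℝ, μ ^ (1 / 2 : ℝ) • formProj i d μ (i z)) {ε : ℝ} (hε : 0 < ε)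
    (p q : H) :
    HasSum (fun μ : ℝ => μ ^ (1 / 2 : ℝ) * (1 + ε * μ)⁻¹ * inner ℝ (formProj i d μ p) q)
      (inner ℝ (D (resolvent i d ε p)) q) := by
  have h1 := ((summable_sqrt_smul_formProj hin (resolvent i d ε p)).hasSum).mapL (innerSL ℝ q)
  rw [← hD] at h1
  simp only [innerSL_apply_apply, formProj_resolvent hin hε] at h1
  rw [real_inner_comm]
  refine h1.congr_fun fun μ => ?_
  rw [real_inner_smul_right, real_inner_smul_right, real_inner_comm q]
  ring

/-- Both pairings are the same series `∑ √μ (1 + ε μ)⁻¹ (P_μ p, q)`, since projections are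
symmetric. -/
theorem sqrtOp_resolvent_symm
    (hin : ∀ v w, inner ℝ v w = inner ℝ (i v) (i w) + inner ℝ (d v) (d w))
    {D : V →L[ℝ] H}
    (hD : ∀ z, D z = ∑' μ : ℝ, μ ^ (1 / 2 : ℝ) • formProj i d μ (i z)) {ε : ℝ} (hε : 0 < ε)
    (p q : H) : inner ℝ (D (resolvent i d ε p)) q = inner ℝ p (D (resolvent i d ε q)) := by
  refine (hasSum_inner_sqrtOp_resolvent hin hD hε p q).unique ?_
  rw [real_inner_comm]
  convert hasSum_inner_sqrtOp_resolvent hin hD hε q p using 3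
  rw [inner_formProj_left, real_inner_comm]

theorem hasSum_inner_resolvent_sqrtOp
    (hin : ∀ v w, inner ℝ v w = inner ℝ (i v) (i w) + inner ℝ (d v) (d w))
    {D : V →L[ℝ] H}
    (hD : ∀ z, D z = ∑' μ : ℝ, μ ^ (1 / 2 : ℝ) • formProj i d μ (i z)) {ε : ℝ} (hε : 0 < ε)
    (p : H) :
    HasSum (fun μ : ℝ => μ ^ (1 / 2 : ℝ) * ((1 + ε * μ)⁻¹) ^ 2 * ‖formProj i d μ p‖ ^ 2)
      (inner ℝ (i (resolvent i d ε p)) (D (resolvent i d ε p))) := by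
  rw [real_inner_comm]
  convert hasSum_inner_sqrtOp_resolvent hin hD hε p (i (resolvent i d ε p)) using 2 with μ
  rw [inner_formProj_left, formProj_resolvent hin hε, real_inner_smul_right, real_inner_comm,
    inner_formProj_self]
  ring

theorem sqrt_mul_formProj_nonneg (ε μ : ℝ) (p : H) :
    0 ≤ μ ^ (1 / 2 : ℝ) * ((1 + ε * μ)⁻¹) ^ 2 * ‖formProj i d μ p‖ ^ 2 := by
  rcases lt_or_ge μ 0 with hμ | hμ
  · simp [formProj_eq_zero hμ]
  · positivity

theorem inner_resolvent_sqrtOp_nonneg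
    (hin : ∀ v w, inner ℝ v w = inner ℝ (i v) (i w) + inner ℝ (d v) (d w))
    {D : V →L[ℝ] H}
    (hD : ∀ z, D z = ∑' μ : ℝ, μ ^ (1 / 2 : ℝ) • formProj i d μ (i z)) {ε : ℝ} (hε : 0 < ε)
    (p : H) : 0 ≤ inner ℝ (i (resolvent i d ε p)) (D (resolvent i d ε p)) :=
  (hasSum_inner_resolvent_sqrtOp hin hD hε p).nonneg fun μ => sqrt_mul_formProj_nonneg ε μ p

/-- Over a finite set of eigenvalues the weights `(1 + ε μ)⁻²` tend to 1 and the discarded terms are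
nonnegative; the supremum over finite sets follows. Totality of the eigenspaces plays no role. -/
theorem tsum_sqrt_le_liminf
    (hin : ∀ v w, inner ℝ v w = inner ℝ (i v) (i w) + inner ℝ (d v) (d w))
    {D : V →L[ℝ] H}
    (hD : ∀ z, D z = ∑' μ : ℝ, μ ^ (1 / 2 : ℝ) • formProj i d μ (i z)) (p : H) :
    ∑' μ : ℝ, ENNReal.ofReal (μ ^ (1 / 2 : ℝ)) * ‖formProj i d μ p‖ₑ ^ 2 ≤
    liminf (fun n : ℕ => ENNReal.ofReal
      (inner ℝ (i (resolvent i d (1 / ((n : ℝ) + 1)) p))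
        (D (resolvent i d (1 / ((n : ℝ) + 1)) p)))) atTop := by
  rw [ENNReal.tsum_eq_iSup_sum]
  refine iSup_le fun s => ?_
  have h1 : ∀ n : ℕ, ENNReal.ofReal (∑ μ ∈ s,
      μ ^ (1 / 2 : ℝ) * ((1 + 1 / ((n : ℝ) + 1) * μ)⁻¹) ^ 2 * ‖formProj i d μ p‖ ^ 2) ≤
      ENNReal.ofReal (inner ℝ (i (resolvent i d (1 / ((n : ℝ) + 1)) p))
        (D (resolvent i d (1 / ((n : ℝ) + 1)) p))) := fun n => by
    have hε : (0 : ℝ) < 1 / ((n : ℝ) + 1) := by positivity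
    have h2 := hasSum_inner_resolvent_sqrtOp hin hD hε p
    rw [← h2.tsum_eq]
    exact ENNReal.ofReal_le_ofReal (h2.summable.sum_le_tsum _ fun μ _ =>
      sqrt_mul_formProj_nonneg _ μ p)
  have h2 : Tendsto (fun n : ℕ => ENNReal.ofReal (∑ μ ∈ s,
      μ ^ (1 / 2 : ℝ) * ((1 + 1 / ((n : ℝ) + 1) * μ)⁻¹) ^ 2 * ‖formProj i d μ p‖ ^ 2)) atTop
      (𝓝 (ENNReal.ofReal (∑ μ ∈ s,
      μ ^ (1 / 2 : ℝ) * ((1 + 0 * μ)⁻¹) ^ 2 * ‖formProj i d μ p‖ ^ 2))) := by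
    refine ENNReal.tendsto_ofReal (tendsto_finsetSum _ fun μ _ => ?_)
    refine Tendsto.mul_const _ (Tendsto.const_mul _ (Tendsto.pow ?_ 2))
    refine Tendsto.inv₀ ?_ (by simp)
    exact ((tendsto_one_div_add_atTop_nhds_zero_nat (𝕜 := ℝ)).mul_const μ).const_add 1
  have h3 : ∑ μ ∈ s, ENNReal.ofReal (μ ^ (1 / 2 : ℝ)) * ‖formProj i d μ p‖ₑ ^ 2 =
      ENNReal.ofReal (∑ μ ∈ s,
      μ ^ (1 / 2 : ℝ) * ((1 + 0 * μ)⁻¹) ^ 2 * ‖formProj i d μ p‖ ^ 2) := by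
    rw [ENNReal.ofReal_sum_of_nonneg fun μ _ => sqrt_mul_formProj_nonneg 0 μ p]
    refine Finset.sum_congr rfl fun μ _ => ?_
    rw [ENNReal.ofReal_mul' (by positivity), ENNReal.ofReal_pow (norm_nonneg _),
      ofReal_norm]
    simp
  rw [h3, ← h2.liminf_eq]
  exact liminf_le_liminf (Eventually.of_forall h1)

/-- If the eigenspaces are total in `H`, the norm of `d z` is computed by the spectral sum. -/
theorem norm_grad_sq_eq_tsum
    (hin : ∀ v w, inner ℝ v w = inner ℝ (i v) (i w) + inner ℝ (d v) (d w))
    (hinj : Function.Injective i)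
    (htot : ∀ q : H, (∀ μ, formProj i d μ q = 0) → q = 0) (z : V) :
    ENNReal.ofReal (‖d z‖ ^ 2) = ∑' μ : ℝ, ENNReal.ofReal (μ * ‖formProj i d μ (i z)‖ ^ 2) := by
  choose w hw hw' using fun μ => exists_lift_formProj hin μ (i z)
  have hnn : ∀ μ, 0 ≤ μ * ‖formProj i d μ (i z)‖ ^ 2 := fun μ => by
    rcases lt_or_ge μ 0 with hμ | hμ
    · simp [formProj_eq_zero hμ]
    · positivity
  have hdw : ∀ μ, ‖d (w μ)‖ ^ 2 = μ * ‖formProj i d μ (i z)‖ ^ 2 := fun μ => by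
    rw [← real_inner_self_eq_norm_sq, hw', hw, real_inner_self_eq_norm_sq]
  have horth : Pairwise fun μ ν => inner ℝ (d (w μ)) (d (w ν)) = 0 := fun μ ν h => by
    beta_reduce
    rw [hw', hw, pairwise_formProj hin _ h, mul_zero]
  have hVorth : Pairwise fun μ ν => inner ℝ (w μ) (w ν) = 0 := fun μ ν h => by
    beta_reduce
    rw [hin, horth h, hw, hw, pairwise_formProj hin _ h, add_zero]
  have hsum : Summable w := by
    refine summable_of_pairwise_orthogonal hVorth ?_
    refine summable_of_sum_le (c := ‖i z‖ ^ 2 + ‖d z‖ ^ 2) (fun _ => by positivity) fun s => ?_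
    have h1 : ∀ μ, ‖w μ‖ ^ 2 = ‖formProj i d μ (i z)‖ ^ 2 + μ * ‖formProj i d μ (i z)‖ ^ 2 :=
      fun μ => by
        rw [← real_inner_self_eq_norm_sq, hin, real_inner_self_eq_norm_sq,
          real_inner_self_eq_norm_sq, hdw, hw]
    simp only [h1, Finset.sum_add_distrib]
    exact add_le_add (sum_norm_sq_formProj_le hin _ s) (sum_mul_norm_sq_formProj_le hin z s)
  -- The difference has all projections zero, so totality and injectivity of `i` make it vanish. The
  -- series converges in `V`, hence `d` may be applied to it.
  have hz : ∑' μ, w μ = z := by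
    rw [← sub_eq_zero]
    refine hinj ?_
    rw [map_zero]
    refine htot _ fun ν => ?_
    rw [map_sub, map_sub, sub_eq_zero]
    have h1 := (hsum.hasSum.mapL i).mapL (formProj i d ν)
    refine h1.unique ?_
    have h2 : ∀ μ, formProj i d ν (i (w μ)) = if μ = ν then formProj i d ν (i z) else 0 := by
      intro μ
      split_ifs with h
      · subst h
        rw [hw]
        exact eq_formProj hin (formProj_mem hin _ _) (by simp)
      · rw [hw]
        refine eq_formProj hin (Submodule.zero_mem _) fun f hf => ?_
        rw [sub_zero]
        exact formEigenspace_inner_eq_zero h (formProj_mem hin _ _) hf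
    simp only [h2]
    exact hasSum_ite_eq ν _
  have h3 := norm_sq_tsum_of_pairwise_orthogonal horth (hsum.mapL d)
  rw [← d.map_tsum hsum, hz] at h3
  simp only [hdw] at h3
  rw [← h3.tsum_eq, ENNReal.ofReal_tsum_of_nonneg hnn h3.summable]

end Spectral

/-! ### Weak derivatives in time. -/

/-- The lemma of du Bois-Reymond: a continuous function with integrable weak derivative is the
primitive of that derivative. -/
theorem eq_integral_of_weak_deriv {a b : ℝ → ℝ} {T : ℝ} (hT : 0 < T)
    (ha : ContinuousOn a (Icc 0 T)) (hb : IntervalIntegrable b volume 0 T)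
    (h : ∀ θ : ℝ → ℝ, ContDiff ℝ ∞ θ → (∃ l r : ℝ, 0 < l ∧ r < T ∧ ∀ t, t ∉ Icc l r → θ t = 0) →
      ∫ t in Ioo 0 T, a t * deriv θ t = -∫ t in Ioo 0 T, b t * θ t) :
    ∀ s ∈ Icc 0 T, a s = a 0 + ∫ r in (0 : ℝ)..s, b r := by
  have hI : uIcc 0 T = Icc 0 T := uIcc_of_le hT.le
  set B : ℝ → ℝ := fun s => ∫ r in (0 : ℝ)..s, b r with hB
  have hBac : AbsolutelyContinuousOnInterval B 0 T :=
    hb.absolutelyContinuousOnInterval_intervalIntegral left_mem_uIcc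
  have hBc : ContinuousOn B (Icc 0 T) := hI ▸ hBac.continuousOn
  set c : ℝ → ℝ := fun s => a s - B s with hc
  have hcc : ContinuousOn c (Icc 0 T) := ha.sub hBc
  have hci : ∀ η : ℝ → ℝ, Continuous η → IntegrableOn (fun t => c t * η t) (Ioc 0 T) := by
    intro η hη
    exact ((hcc.mul hη.continuousOn).integrableOn_Icc).mono_set Ioc_subset_Icc_self
  have hzero : ∀ θ : ℝ → ℝ, ContDiff ℝ ∞ θ →
      (∃ l r : ℝ, 0 < l ∧ r < T ∧ ∀ t, t ∉ Icc l r → θ t = 0) →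
      ∫ t in (0 : ℝ)..T, c t * deriv θ t = 0 := by
    intro θ hθ hs
    have h1 := h θ hθ hs
    obtain ⟨l, r, hl, hr, hs⟩ := hs
    have hθ' : Continuous (deriv θ) := hθ.continuous_deriv (by simp)
    have hθac : AbsolutelyContinuousOnInterval θ 0 T :=
      ((hθ.of_le (by simp)).contDiffOn).absolutelyContinuousOnInterval
    have h2 := hBac.integral_mul_deriv_eq_deriv_mul hθac
    have e0 : θ 0 = 0 := hs 0 (fun hm => by linarith [hm.1])
    have eT : θ T = 0 := hs T (fun hm => by linarith [hm.2])
    rw [e0, eT] at h2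
    have h3 : ∫ x in (0 : ℝ)..T, deriv B x * θ x = ∫ x in (0 : ℝ)..T, b x * θ x := by
      apply intervalIntegral.integral_congr_ae
      filter_upwards [hb.ae_hasDerivAt_integral] with x hx hxm
      rw [(hx (uIoc_subset_uIcc hxm) 0 left_mem_uIcc).deriv]
    rw [← integral_Ioc_eq_integral_Ioo, ← integral_Ioc_eq_integral_Ioo,
      ← intervalIntegral.integral_of_le hT.le, ← intervalIntegral.integral_of_le hT.le] at h1
    simp only [hc, sub_mul]
    rw [intervalIntegral.integral_sub, h1, h2, h3]
    · ring
    · exact ((hI ▸ ha).mul hθ'.continuousOn).intervalIntegrable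
    · exact ((hI ▸ hBc).mul hθ'.continuousOn).intervalIntegrable
  -- A fixed bump of mass one; the constant value of `c = a - B` will be `m = ∫ c ρ`.
  obtain ⟨ρ, hρs, hρc, hρsm, hρ1⟩ : ∃ ρ : ℝ → ℝ, tsupport ρ ⊆ Ioo 0 T ∧ HasCompactSupport ρ ∧
      ContDiff ℝ ∞ ρ ∧ ∫ x, ρ x = 1 := by
    let f : ContDiffBump (T / 2 : ℝ) := ⟨T / 8, T / 4, by linarith, by linarith⟩
    refine ⟨f.normed volume, ?_, f.hasCompactSupport_normed, f.contDiff_normed, f.integral_normed⟩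
    rw [f.tsupport_normed_eq, Real.closedBall_eq_Icc]
    have hr : f.rOut = T / 4 := rfl
    rw [hr]
    exact fun x hx => ⟨by linarith [hx.1], by linarith [hx.2]⟩
  set m : ℝ := ∫ x in (0 : ℝ)..T, c x * ρ x with hm
  have hIcc : ∀ g : ℝ → ℝ, HasCompactSupport g → tsupport g ⊆ Ioo 0 T →
      ∃ l r : ℝ, 0 < l ∧ r < T ∧ l ≤ r ∧ ∀ t, t ∉ Icc l r → g t = 0 := by
    intro g hg hgs
    rcases (tsupport g).eq_empty_or_nonempty with he | hne
    · refine ⟨T / 3, T / 2, by linarith, by linarith, by linarith, fun t _ => ?_⟩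
      exact image_eq_zero_of_notMem_tsupport (by rw [he]; simp)
    · obtain ⟨l, hl, hl'⟩ := hg.isCompact.exists_isLeast hne
      obtain ⟨r, hr, hr'⟩ := hg.isCompact.exists_isGreatest hne
      refine ⟨l, r, (hgs hl).1, (hgs hr).2, hl' hr, fun t ht => ?_⟩
      exact image_eq_zero_of_notMem_tsupport fun h' => ht ⟨hl' h', hr' h'⟩
  have hInt : ∀ g : ℝ → ℝ, HasCompactSupport g → tsupport g ⊆ Ioo 0 T →
      ∫ x, g x = ∫ x in (0 : ℝ)..T, g x := by
    intro g _ hgs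
    rw [intervalIntegral.integral_of_le hT.le]
    refine (setIntegral_eq_integral_of_forall_compl_eq_zero fun x hx => ?_).symm
    exact image_eq_zero_of_notMem_tsupport fun h' => hx (Ioo_subset_Ioc_self (hgs h'))
  have hae : ∀ᵐ x, x ∈ Ioo 0 T → c x - m = 0 := by
    refine isOpen_Ioo.ae_eq_zero_of_integral_contDiff_smul_eq_zero ?_ ?_
    · exact ((hcc.sub continuousOn_const).mono Ioo_subset_Icc_self).locallyIntegrableOn
        measurableSet_Ioo
    · intro g hg hgc hgs
      set e : ℝ := ∫ x in (0 : ℝ)..T, g x with he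
      -- Removing the mass of `g` makes the integral of `k` zero, so its primitive vanishes near
      -- both ends and is an admissible test function.
      set k : ℝ → ℝ := fun x => g x - e * ρ x with hk
      have hkc : Continuous k := hg.continuous.sub (continuous_const.mul hρsm.continuous)
      set θ : ℝ → ℝ := fun x => ∫ y in (0 : ℝ)..x, k y with hθ
      have hd : ∀ x, HasDerivAt θ (k x) x := fun x =>
        intervalIntegral.integral_hasDerivAt_right (hkc.intervalIntegrable _ _)
          (hkc.stronglyMeasurableAtFilter _ _) hkc.continuousAt
      have hdθ : deriv θ = k := funext fun x => (hd x).deriv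
      have hθsm : ContDiff ℝ ∞ θ := by
        rw [contDiff_infty_iff_deriv, hdθ]
        exact ⟨fun x => (hd x).differentiableAt, hg.sub (contDiff_const.mul hρsm)⟩
      obtain ⟨l₁, r₁, hl₁, hr₁, hlr₁, hz₁⟩ := hIcc g hgc hgs
      obtain ⟨l₂, r₂, hl₂, hr₂, hlr₂, hz₂⟩ := hIcc ρ hρc hρs
      have hkz : ∀ t, t ∉ Icc (min l₁ l₂) (max r₁ r₂) → k t = 0 := by
        intro t ht
        have h1 : g t = 0 := hz₁ t fun h' => ht ⟨(min_le_left _ _).trans h'.1,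
          h'.2.trans (le_max_left _ _)⟩
        have h2 : ρ t = 0 := hz₂ t fun h' => ht ⟨(min_le_right _ _).trans h'.1,
          h'.2.trans (le_max_right _ _)⟩
        simp [hk, h1, h2]
      have hkT : ∫ y in (0 : ℝ)..T, k y = 0 := by
        simp only [hk]
        rw [intervalIntegral.integral_sub (hg.continuous.intervalIntegrable _ _)
          ((hρsm.continuous.intervalIntegrable _ _).const_mul e),
          intervalIntegral.integral_const_mul, ← hInt ρ hρc hρs, hρ1]
        ring
      have hθz : ∀ t, t ∉ Icc (min l₁ l₂) (max r₁ r₂) → θ t = 0 := by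
        intro t ht
        rw [mem_Icc, not_and_or, not_le, not_le] at ht
        rcases ht with ht | ht
        · refine (intervalIntegral.integral_congr (g := fun _ => 0) fun y hy => ?_).trans (by simp)
          refine hkz y fun hy' => ?_
          have h1 : 0 < min l₁ l₂ := lt_min hl₁ hl₂
          rcases mem_uIcc.1 hy with h2 | h2 <;> linarith [hy'.1, h2.1, h2.2]
        · have h1 : max r₁ r₂ < T := max_lt hr₁ hr₂
          have h2 : θ t = ∫ y in T..t, k y := by
            have h3 := intervalIntegral.integral_add_adjacent_intervals
              (hkc.intervalIntegrable (μ := volume) 0 T) (hkc.intervalIntegrable T t)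
            rw [hkT, zero_add] at h3
            exact h3.symm
          rw [h2]
          refine (intervalIntegral.integral_congr (g := fun _ => 0) fun y hy => ?_).trans (by simp)
          refine hkz y fun hy' => ?_
          rcases mem_uIcc.1 hy with h2 | h2 <;> linarith [hy'.2, h2.1, h2.2]
      have h0 := hzero θ hθsm ⟨_, _, lt_min hl₁ hl₂, max_lt hr₁ hr₂, hθz⟩
      rw [hdθ] at h0
      have h4 : ∫ x, g x • (c x - m) = ∫ x in (0 : ℝ)..T, (c x * g x - m * g x) := by
        rw [hInt]
        · apply intervalIntegral.integral_congr; intro x _; simp only [smul_eq_mul]; ring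
        · exact hgc.smul_right
        · exact (tsupport_smul_subset_left g _).trans hgs
      have i1 : ∀ η : ℝ → ℝ, Continuous η → IntervalIntegrable (fun t => c t * η t) volume 0 T :=
        fun η hη => (intervalIntegrable_iff_integrableOn_Ioc_of_le hT.le).2 (hci η hη)
      rw [h4, intervalIntegral.integral_sub (i1 g hg.continuous)
        ((hg.continuous.intervalIntegrable _ _).const_mul m),
        intervalIntegral.integral_const_mul]
      simp only [hk, mul_sub] at h0
      have h5 : ∀ x, c x * (e * ρ x) = e * (c x * ρ x) := fun x => by ring
      simp only [h5] at h0
      rw [intervalIntegral.integral_sub (i1 g hg.continuous) ((i1 ρ hρsm.continuous).const_mul e),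
        intervalIntegral.integral_const_mul] at h0
      linarith
  -- Continuity upgrades equality almost everywhere to equality at every time, endpoints included;
  -- the estimate of the theorem is pointwise in time.
  have heq : EqOn c (fun _ => m) (Icc 0 T) := by
    refine Measure.eqOn_Icc_of_ae_eq volume hT.ne ?_ hcc continuousOn_const
    rw [← restrict_Ioo_eq_restrict_Icc]
    rw [EventuallyEq, ae_restrict_iff' measurableSet_Ioo]
    filter_upwards [hae] with x hx hxm
    linarith [hx hxm]
  intro s hs
  have h1 := heq hs
  have h2 := heq (left_mem_Icc.2 hT.le)
  simp only [hc, hB, intervalIntegral.integral_same] at h1 h2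
  linarith

/-! ### The space `H¹` as a closure of graphs: density, integration by parts, injectivity. -/

namespace Setting

variable (X : Setting)

instance : CompleteSpace X.H1 := by
  unfold H1; infer_instance

instance : IsFiniteMeasure (volume.restrict X.cell) :=
  ⟨by rw [Measure.restrict_apply_univ]; exact X.isBounded_cell.measure_lt_top⟩

theorem isOpen_cell : IsOpen X.cell := by
  cases X with
  | dirichlet Ω hΩ => exact hΩ.isOpen
  | periodic =>
    have : (periodic.cell) = ⋂ i : Fin 3, (fun x : E3 => x i) ⁻¹' Ioo (0 : ℝ) (2 * Real.pi) := by
      ext x; simp [cell]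
    rw [this]
    exact isOpen_iInter_of_finite fun i => isOpen_Ioo.preimage (by fun_prop)

theorem measurableSet_cell : MeasurableSet X.cell := X.isOpen_cell.measurableSet

theorem inner_H1 (v w : X.H1) :
    inner ℝ v w = inner ℝ (X.incl v) (X.incl w) + inner ℝ (X.grad v) (X.grad w) := by
  rw [Submodule.coe_inner, WithLp.prod_inner_apply]
  rfl

theorem norm_sq_H1 (v : X.H1) : ‖v‖ ^ 2 = ‖X.incl v‖ ^ 2 + ‖X.grad v‖ ^ 2 := by
  rw [← real_inner_self_eq_norm_sq, X.inner_H1, real_inner_self_eq_norm_sq,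
    real_inner_self_eq_norm_sq]

theorem norm_incl_le (v : X.H1) : ‖X.incl v‖ ≤ ‖v‖ :=
  (sq_le_sq₀ (norm_nonneg _) (norm_nonneg _)).1
    (by rw [X.norm_sq_H1]; nlinarith [sq_nonneg ‖X.grad v‖])

theorem norm_grad_le (v : X.H1) : ‖X.grad v‖ ≤ ‖v‖ :=
  (sq_le_sq₀ (norm_nonneg _) (norm_nonneg _)).1
    (by rw [X.norm_sq_H1]; nlinarith [sq_nonneg ‖X.incl v‖])

theorem continuous_gradient {φ : E3 → ℝ} (hφ : ContDiff ℝ ∞ φ) : Continuous (gradient φ) :=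
  (LinearIsometryEquiv.continuous _).comp (hφ.continuous_fderiv (by simp))

theorem memLp_of_continuous' {F : Type*} [NormedAddCommGroup F] {h : E3 → F} (hc : Continuous h)
    (p : ℝ≥0∞) : MemLp h p (volume.restrict X.cell) := by
  have hcpt : IsCompact (closure X.cell) := X.isBounded_cell.isCompact_closure
  obtain ⟨M, hM⟩ := hcpt.exists_bound_of_continuousOn hc.continuousOn
  have h1 : MemLp h p (volume.restrict (closure X.cell)) := by
    have : IsFiniteMeasure (volume.restrict (closure X.cell)) :=
      ⟨by rw [Measure.restrict_apply_univ]; exact hcpt.measure_lt_top⟩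
    refine MemLp.of_bound ?_ M ?_
    · exact hc.continuousOn.aestronglyMeasurable_of_isCompact hcpt isClosed_closure.measurableSet
    · exact (ae_restrict_iff' isClosed_closure.measurableSet).2 (Eventually.of_forall hM)
  exact h1.mono_measure (Measure.restrict_mono subset_closure le_rfl)

/-- `w` is the class of the test function `φ`, together with its gradient. -/
def IsLift (φ : E3 → ℝ) (w : X.H1) : Prop :=
  X.incl w =ᵐ[volume.restrict X.cell] φ ∧ X.grad w =ᵐ[volume.restrict X.cell] gradient φ

variable {X}

theorem IsTest.exists_lift {φ : E3 → ℝ} (hφ : X.IsTest φ) : ∃ w : X.H1, X.IsLift φ w := by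
  have h1 := X.memLp_of_continuous' hφ.contDiff.continuous 2
  have h2 := X.memLp_of_continuous' (continuous_gradient hφ.contDiff) 2
  refine ⟨⟨WithLp.toLp 2 (h1.toLp φ, h2.toLp _), Submodule.le_topologicalClosure _ ?_⟩, ?_, ?_⟩
  · exact ⟨φ, hφ, h1.coeFn_toLp, h2.coeFn_toLp⟩
  · exact h1.coeFn_toLp
  · exact h2.coeFn_toLp

variable (X)

theorem dense_lift : Dense {w : X.H1 | ∃ φ, X.IsTest φ ∧ X.IsLift φ w} := by
  intro z
  rw [Metric.mem_closure_iff]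
  intro ε hε
  have hz : (z : WithLp 2 (X.L2 × X.L2V)) ∈ closure (X.testGraph : Set _) := z.2
  obtain ⟨q, hq, hd⟩ := Metric.mem_closure_iff.1 hz ε hε
  obtain ⟨φ, hφ, h1, h2⟩ := hq
  refine ⟨⟨q, Submodule.le_topologicalClosure _ ⟨φ, hφ, h1, h2⟩⟩, ⟨φ, hφ, h1, h2⟩, hd⟩

/-- Integration by parts against a test function supported in the cell. -/
theorem IsLift.integral_grad {φ : E3 → ℝ} (hφ : ContDiff ℝ ∞ φ) {w : X.H1} (h : X.IsLift φ w)
    {ψ : E3 → ℝ} (hψ : ContDiff ℝ ∞ ψ) (hψc : HasCompactSupport ψ) (hψs : tsupport ψ ⊆ X.cell)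
    (e : E3) :
    ∫ x in X.cell, ψ x * inner ℝ (X.grad w x) e = -∫ x in X.cell, fderiv ℝ ψ x e * X.incl w x := by
  have h1 : ∫ x in X.cell, ψ x * inner ℝ (X.grad w x) e = ∫ x, ψ x * fderiv ℝ φ x e := by
    rw [← setIntegral_eq_integral_of_forall_compl_eq_zero (s := X.cell)
      (f := fun x => ψ x * fderiv ℝ φ x e)]
    · apply integral_congr_ae
      filter_upwards [h.2] with x hx
      rw [hx, gradient, InnerProductSpace.toDual_symm_apply]
    · intro x hx
      rw [image_eq_zero_of_notMem_tsupport fun h' => hx (hψs h'), zero_mul]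
  have h2 : ∫ x in X.cell, fderiv ℝ ψ x e * X.incl w x = ∫ x, fderiv ℝ ψ x e * φ x := by
    rw [← setIntegral_eq_integral_of_forall_compl_eq_zero (s := X.cell)
      (f := fun x => fderiv ℝ ψ x e * φ x)]
    · apply integral_congr_ae
      filter_upwards [h.1] with x hx
      rw [hx]
    · intro x hx
      have : fderiv ℝ ψ x = 0 := image_eq_zero_of_notMem_tsupport
        fun h' => hx (hψs (tsupport_fderiv_subset ℝ h'))
      rw [this]; simp
  rw [h1, h2]
  have cφ := hφ.continuous
  have cψ := hψ.continuous
  have cφ' : Continuous fun x => fderiv ℝ φ x e := by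
    exact (hφ.continuous_fderiv (by simp)).clm_apply continuous_const
  have cψ' : Continuous fun x => fderiv ℝ ψ x e := by
    exact (hψ.continuous_fderiv (by simp)).clm_apply continuous_const
  have sψ' : HasCompactSupport fun x => fderiv ℝ ψ x e := hψc.fderiv_apply ℝ e
  refine integral_mul_fderiv_eq_neg_fderiv_mul_of_integrable ?_ ?_ ?_ ?_ ?_
  · exact (cψ'.mul cφ).integrable_of_hasCompactSupport sψ'.mul_right
  · exact (cψ.mul cφ').integrable_of_hasCompactSupport hψc.mul_right
  · exact (cψ.mul cφ).integrable_of_hasCompactSupport hψc.mul_right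
  · exact fun x _ => hψ.differentiable (by simp) x
  · exact fun x _ => hφ.differentiable (by simp) x

/-- Both sides are continuous in `w`, so the formula extends from test functions. On the torus it is
enough to use `ψ` supported inside the cell, which avoids boundary terms. -/
theorem integral_grad (w : X.H1) {ψ : E3 → ℝ} (hψ : ContDiff ℝ ∞ ψ)
    (hψc : HasCompactSupport ψ) (hψs : tsupport ψ ⊆ X.cell) (e : E3) :
    ∫ x in X.cell, ψ x * inner ℝ (X.grad w x) e = -∫ x in X.cell, fderiv ℝ ψ x e * X.incl w x := by
  have cψ' : Continuous fun x => fderiv ℝ ψ x e := by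
    exact (hψ.continuous_fderiv (by simp)).clm_apply continuous_const
  have m1 := X.memLp_of_continuous' (F := E3) (h := fun x => ψ x • e)
    (hψ.continuous.smul continuous_const) 2
  have m2 := X.memLp_of_continuous' cψ' 2
  have e1 : ∀ v : X.H1, ∫ x in X.cell, ψ x * inner ℝ (X.grad v x) e =
      inner ℝ (X.grad v) (m1.toLp _) := fun v => by
    rw [L2.inner_def]
    apply integral_congr_ae
    filter_upwards [m1.coeFn_toLp] with x hx
    rw [hx, real_inner_smul_right]
  have e2 : ∀ v : X.H1, ∫ x in X.cell, fderiv ℝ ψ x e * X.incl v x =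
      inner ℝ (X.incl v) (m2.toLp _) := fun v => by
    rw [L2.inner_def]
    apply integral_congr_ae
    filter_upwards [m2.coeFn_toLp] with x hx
    rw [hx]; rfl
  rw [e1, e2]
  have hcl : IsClosed {v : X.H1 | inner ℝ (X.grad v) (m1.toLp _) =
      -inner ℝ (X.incl v) (m2.toLp _)} := by
    refine isClosed_eq ?_ ?_
    · exact X.grad.continuous.inner continuous_const
    · exact (X.incl.continuous.inner continuous_const).neg
  refine hcl.closure_subset_iff.2 ?_ (X.dense_lift w)
  rintro v ⟨φ, hφ, hv⟩
  rw [mem_ofPred_eq, ← e1, ← e2]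
  exact IsLift.integral_grad X hφ.contDiff hv hψ hψc hψs e

theorem ae_eq_zero_of_integral_eq_zero {F : Type*} [NormedAddCommGroup F] [NormedSpace ℝ F]
    [CompleteSpace F] {z : E3 → F} (hz : MemLp z 2 (volume.restrict X.cell))
    (h : ∀ ψ : E3 → ℝ, ContDiff ℝ ∞ ψ → HasCompactSupport ψ → tsupport ψ ⊆ X.cell →
      ∫ x in X.cell, ψ x • z x = 0) : z =ᵐ[volume.restrict X.cell] 0 := by
  rw [EventuallyEq, ae_restrict_iff' X.measurableSet_cell]
  refine X.isOpen_cell.ae_eq_zero_of_integral_contDiff_smul_eq_zero ?_ fun ψ hψ hc hs => ?_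
  · have : IntegrableOn z X.cell := hz.integrable (by norm_num)
    exact this.locallyIntegrableOn
  · rw [← h ψ hψ hc hs]
    refine (setIntegral_eq_integral_of_forall_compl_eq_zero fun x hx => ?_).symm
    rw [image_eq_zero_of_notMem_tsupport fun h' => hx (hs h'), zero_smul]

/-- The graph closure is again a graph: if the function component vanishes, integration by parts
makes the gradient component orthogonal to every `ψ` supported in the cell. -/
theorem incl_injective : Function.Injective X.incl := by
  rw [injective_iff_map_eq_zero]
  intro w hw
  have hg : X.grad w = 0 := by
    refine (Lp.eq_zero_iff_ae_eq_zero).2 ?_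
    refine X.ae_eq_zero_of_integral_eq_zero (Lp.memLp _) fun ψ hψ hc hs => ?_
    refine ext_inner_right ℝ fun e => ?_
    have hi : Integrable (fun x => ψ x • X.grad w x) (volume.restrict X.cell) := by
      have h1 := X.memLp_of_continuous' hψ.continuous 2
      exact memLp_one_iff_integrable.1 ((Lp.memLp (X.grad w)).smul (r := 1) h1)
    rw [real_inner_comm, ← integral_inner hi, inner_zero_left]
    have h2 := X.integral_grad w hψ hc hs e
    have h3 : ∫ x in X.cell, fderiv ℝ ψ x e * X.incl w x = 0 := by
      rw [hw]
      refine (integral_congr_ae (g := fun _ => 0) ?_).trans (by simp)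
      filter_upwards [Lp.coeFn_zero ℝ 2 (volume.restrict X.cell)] with x hx
      rw [hx]; simp
    rw [h3, neg_zero] at h2
    rw [← h2]
    congr 1
    ext x
    rw [real_inner_smul_right, real_inner_comm]
  have h4 := X.norm_sq_H1 w
  rw [hw, hg] at h4
  simpa using h4

theorem eigenProj_eq (μ : ℝ) : X.eigenProj μ = formProj X.incl X.grad μ := rfl

end Setting

/-! ### Periodic functions and the period lattice. -/

section Lattice

open scoped Pointwise

/-- The basis of the period lattice of the torus. -/
def periodBasis : Module.Basis (Fin 3) ℝ E3 :=
  (EuclideanSpace.basisFun (Fin 3) ℝ).toBasis.unitsSMul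
    fun _ => Units.mk0 (2 * Real.pi) (by positivity)

theorem periodBasis_apply (i : Fin 3) :
    periodBasis i = EuclideanSpace.single i (2 * Real.pi) := by
  rw [periodBasis, Module.Basis.unitsSMul_apply]
  ext j
  simp [Units.smul_def]

theorem periodBasis_repr (x : E3) (i : Fin 3) : periodBasis.repr x i = (2 * Real.pi)⁻¹ * x i := by
  rw [periodBasis, Module.Basis.repr_unitsSMul]
  simp [Units.smul_def]

/-- The lattice of periods. -/
abbrev periodLattice : Submodule ℤ E3 := Submodule.span ℤ (Set.range periodBasis)

/-- Invariance of a function under the period lattice. -/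
def LatticeInvariant {β : Type*} (p : E3 → β) : Prop := ∀ g ∈ periodLattice, ∀ x, p (g + x) = p x

theorem latticeInvariant_of_single {β : Type*} {p : E3 → β}
    (h : ∀ (i : Fin 3) (x : E3), p (x + EuclideanSpace.single i (2 * Real.pi)) = p x) :
    LatticeInvariant p := by
  intro g hg
  induction hg using Submodule.span_induction with
  | mem y hy =>
    obtain ⟨i, rfl⟩ := hy
    intro x
    rw [periodBasis_apply, add_comm, h]
  | zero => simp
  | add a b _ _ ha hb => intro x; rw [add_assoc, ha, hb]
  | smul n a _ ha =>
    have hneg : ∀ x, p (-a + x) = p x := fun x => by rw [← ha (-a + x), add_neg_cancel_left]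
    intro x
    induction n using Int.induction_on generalizing x with
    | zero => simp
    | succ k ih => rw [add_smul, one_smul, add_assoc, ih, ha]
    | pred k ih => rw [sub_smul, one_smul, sub_eq_add_neg, add_assoc, ih, hneg]

theorem IsPeriodic.latticeInvariant {φ : E3 → ℝ} (h : IsPeriodic φ) : LatticeInvariant φ :=
  latticeInvariant_of_single h

theorem cell_subset_fundamentalDomain :
    Setting.periodic.cell ⊆ ZSpan.fundamentalDomain periodBasis := by
  intro x hx i
  rw [periodBasis_repr]
  have hp : (0 : ℝ) < 2 * Real.pi := by positivity
  have := hx i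
  refine ⟨mul_nonneg (by positivity) this.1.le, ?_⟩
  rw [inv_mul_lt_one₀ hp]
  exact this.2

theorem volume_coord_eq_zero (i : Fin 3) : volume {x : E3 | x i = 0} = 0 := by
  have h : {x : E3 | x i = 0} = ((LinearMap.ker (EuclideanSpace.proj (𝕜 := ℝ) i).toLinearMap :
      Submodule ℝ E3) : Set E3) := by
    ext x; simp
  rw [h]
  refine Measure.addHaar_submodule _ _ fun htop => ?_
  have h1 : (EuclideanSpace.single i (1 : ℝ) : E3) ∈ {x : E3 | x i = 0} := by
    rw [h, htop]; trivial
  simp at h1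

/-- The half-open and the open cell differ by pieces of coordinate planes, which are null. -/
theorem fundamentalDomain_ae_eq_cell :
    ZSpan.fundamentalDomain periodBasis =ᵐ[volume] Setting.periodic.cell := by
  refine EventuallyLE.antisymm ?_ cell_subset_fundamentalDomain.eventuallyLE
  have h : ∀ᵐ x : E3, ∀ i, x i ≠ 0 := by
    rw [ae_all_iff]
    intro i
    rw [ae_iff]
    simpa using volume_coord_eq_zero i
  filter_upwards [h] with x hx hxm i
  have := hxm i
  rw [periodBasis_repr] at this
  have hp : (0 : ℝ) < 2 * Real.pi := by positivity
  refine ⟨lt_of_le_of_ne ?_ (hx i).symm, ?_⟩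
  · exact nonneg_of_mul_nonneg_right this.1 (by positivity)
  · exact (inv_mul_lt_one₀ hp).1 this.2

theorem setLIntegral_fundamentalDomain (p : E3 → ℝ≥0∞) :
    ∫⁻ x in ZSpan.fundamentalDomain periodBasis, p x = ∫⁻ x in Setting.periodic.cell, p x :=
  setLIntegral_congr fundamentalDomain_ae_eq_cell

/-- A translate of a fundamental domain is a fundamental domain, and an invariant function has the
same integral over both. -/
theorem lintegral_cell_add {p : E3 → ℝ≥0∞} (hp : LatticeInvariant p) (h : E3) :
    ∫⁻ x in Setting.periodic.cell, p (x + h) = ∫⁻ x in Setting.periodic.cell, p x := by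
  have hfd := ZSpan.isAddFundamentalDomain' periodBasis (volume : Measure E3)
  have : Countable (Submodule.span ℤ (Set.range periodBasis)).toAddSubgroup :=
    inferInstanceAs (Countable (Submodule.span ℤ (Set.range periodBasis)))
  have hfd' := hfd.vadd_of_comm h
  rw [← setLIntegral_fundamentalDomain, ← setLIntegral_fundamentalDomain]
  rw [hfd.setLIntegral_eq hfd' p (fun g x => hp g.1 g.2 x)]
  have h1 := (measurePreserving_add_right (volume : Measure E3) h).setLIntegral_comp_preimage_emb
    (measurableEmbedding_addRight h) p (h +ᵥ ZSpan.fundamentalDomain periodBasis)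
  rw [← h1]
  congr 2
  ext x
  simp only [mem_preimage, mem_vadd_set_iff_neg_vadd_mem, vadd_eq_add]
  rw [add_comm x h, neg_add_cancel_left]

/-- A bounded set meets only finitely many lattice translates of the cell. The bound serves to
compare a cut-off periodic function on the whole space with the function on the cell. -/
theorem lintegral_bounded_le {B : Set E3} (hB : Bornology.IsBounded B) :
    ∃ N : ℕ, ∀ p : E3 → ℝ≥0∞, LatticeInvariant p →
      ∫⁻ x in B, p x ≤ N * ∫⁻ x in Setting.periodic.cell, p x := by
  obtain ⟨R, hR⟩ := hB.exists_norm_le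
  have hfin := ZSpan.setFinite_inter (b := periodBasis)
    (Metric.isBounded_closedBall (x := (0 : E3)) (r := R + ∑ i, ‖periodBasis i‖))
  refine ⟨hfin.toFinset.card, fun p hp => ?_⟩
  have hsub : B ⊆ ⋃ g ∈ hfin.toFinset, (fun x => g + x) '' ZSpan.fundamentalDomain periodBasis := by
    intro x hx
    simp only [mem_iUnion]
    refine ⟨ZSpan.floor periodBasis x, ?_, ZSpan.fract periodBasis x,
      ZSpan.fract_mem_fundamentalDomain _ _, ?_⟩
    · rw [Set.Finite.mem_toFinset]
      refine ⟨?_, (ZSpan.floor periodBasis x).2⟩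
      rw [mem_closedBall_zero_iff]
      have h1 : (ZSpan.floor periodBasis x : E3) = x - ZSpan.fract periodBasis x := by
        rw [ZSpan.fract_apply]; abel
      rw [h1]
      exact (norm_sub_le _ _).trans (add_le_add (hR x hx) (ZSpan.norm_fract_le _ _))
    · simp only [ZSpan.fract_apply]; abel
  calc ∫⁻ x in B, p x
      ≤ ∫⁻ x in ⋃ g ∈ hfin.toFinset, (fun x => g + x) '' ZSpan.fundamentalDomain periodBasis,
          p x := lintegral_mono_set hsub
    _ ≤ ∑ g ∈ hfin.toFinset, ∫⁻ x in (fun x => g + x) '' ZSpan.fundamentalDomain periodBasis,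
          p x := by
        have := lintegral_iUnion_le (μ := volume) (fun g : hfin.toFinset =>
          (fun x => (g : E3) + x) '' ZSpan.fundamentalDomain periodBasis) p
        rw [Finset.tsum_subtype hfin.toFinset fun g =>
          ∫⁻ x in (fun x => g + x) '' ZSpan.fundamentalDomain periodBasis, p x] at this
        refine le_trans (lintegral_mono_set ?_) this
        intro x hx
        simp only [mem_iUnion] at hx ⊢
        obtain ⟨g, hg, hx⟩ := hx
        exact ⟨⟨g, hg⟩, hx⟩
    _ = ∑ g ∈ hfin.toFinset, ∫⁻ x in Setting.periodic.cell, p x := by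
        refine Finset.sum_congr rfl fun g hg => ?_
        rw [← setLIntegral_fundamentalDomain]
        have hgl : g ∈ periodLattice := ((Set.Finite.mem_toFinset _).1 hg).2
        have h1 := (measurePreserving_add_left (volume : Measure E3) g).setLIntegral_comp_emb
          (measurableEmbedding_addLeft g) p (ZSpan.fundamentalDomain periodBasis)
        rw [← h1]
        simp only [hp g hgl]
    _ = _ := by simp

end Lattice

/-! ### Sobolev inequalities for powers of a truncated function. -/

section Sobolev

/-- A bounded increasing truncation of the absolute value. -/
def softAbs (δ t : ℝ) : ℝ := |t| / √(1 + δ * t ^ 2)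

variable {δ : ℝ}

theorem one_le_one_add_mul_sq (hδ : 0 < δ) (t : ℝ) : 1 ≤ 1 + δ * t ^ 2 := by
  have : 0 ≤ δ * t ^ 2 := by positivity
  linarith

theorem softAbs_nonneg (δ t : ℝ) : 0 ≤ softAbs δ t := by unfold softAbs; positivity

theorem softAbs_sq (hδ : 0 < δ) (t : ℝ) : softAbs δ t ^ 2 = t ^ 2 / (1 + δ * t ^ 2) := by
  rw [softAbs, div_pow, sq_abs, Real.sq_sqrt (by linarith [one_le_one_add_mul_sq hδ t])]

theorem softAbs_le (hδ : 0 < δ) (t : ℝ) : softAbs δ t ≤ √(δ⁻¹) := by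
  refine Real.le_sqrt_of_sq_le ?_
  have h := one_le_one_add_mul_sq hδ t
  rw [softAbs_sq hδ, div_le_iff₀ (by linarith)]
  have : δ⁻¹ * (1 + δ * t ^ 2) = δ⁻¹ + t ^ 2 := by field_simp
  rw [this]
  have := inv_pos.2 hδ
  linarith

theorem continuous_softAbs (hδ : 0 < δ) : Continuous (softAbs δ) := by
  refine continuous_abs.div (by fun_prop) fun t => ?_
  have := one_le_one_add_mul_sq hδ t
  positivity

theorem softAbs_mono (hδ : 0 < δ) {s t : ℝ} (h : |s| ≤ |t|) : softAbs δ s ≤ softAbs δ t := by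
  have hs := one_le_one_add_mul_sq hδ s
  have ht := one_le_one_add_mul_sq hδ t
  refine (sq_le_sq₀ (softAbs_nonneg _ _) (softAbs_nonneg _ _)).1 ?_
  rw [softAbs_sq hδ, softAbs_sq hδ, div_le_div_iff₀ (by linarith) (by linarith)]
  have := sq_le_sq.2 h
  nlinarith

/-- The even power `2k` of the truncation is a rational function without poles; this is why the
truncation has this form and only such powers are differentiated. -/
theorem hasDerivAt_softAbs_pow (hδ : 0 < δ) (k : ℕ) (t : ℝ) :
    HasDerivAt (fun s => (s ^ 2 / (1 + δ * s ^ 2)) ^ k)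
      (k * (t ^ 2 / (1 + δ * t ^ 2)) ^ (k - 1) * (2 * t / (1 + δ * t ^ 2) ^ 2)) t := by
  have h := one_le_one_add_mul_sq hδ t
  have h1 : HasDerivAt (fun s : ℝ => s ^ 2) (2 * t) t := by simpa using hasDerivAt_pow 2 t
  have h2 : HasDerivAt (fun s : ℝ => 1 + δ * s ^ 2) (δ * (2 * t)) t := (h1.const_mul δ).const_add 1
  have h3 := (h1.div h2 (by linarith)).pow k
  refine h3.congr_deriv ?_
  simp only [Pi.div_apply]
  congr 2
  ring

theorem contDiff_softAbs_pow (hδ : 0 < δ) (k : ℕ) :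
    ContDiff ℝ 1 (fun s : ℝ => (s ^ 2 / (1 + δ * s ^ 2)) ^ k) := by
  refine ContDiff.pow (ContDiff.div (by fun_prop) (by fun_prop) fun t => ?_) k
  linarith [one_le_one_add_mul_sq hδ t]

/-- The truncation obeys the same differential inequality as `|t|^{2k}`, with a constant independent
of `δ`. The point is `√(1 + δt²) ≤ (1 + δt²)²`. -/
theorem abs_deriv_softAbs_le (hδ : 0 < δ) {k : ℕ} (hk : 1 ≤ k) (t : ℝ) :
    |k * (t ^ 2 / (1 + δ * t ^ 2)) ^ (k - 1) * (2 * t / (1 + δ * t ^ 2) ^ 2)| ≤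
      2 * k * softAbs δ t ^ (2 * k - 1) := by
  have h := one_le_one_add_mul_sq hδ t
  have h1 : |2 * t / (1 + δ * t ^ 2) ^ 2| ≤ 2 * softAbs δ t := by
    rw [abs_div, abs_mul, abs_of_pos (show (0 : ℝ) < 2 by norm_num),
      abs_of_nonneg (show (0 : ℝ) ≤ (1 + δ * t ^ 2) ^ 2 by positivity), softAbs, mul_div_assoc]
    have h2 : √(1 + δ * t ^ 2) ≤ (1 + δ * t ^ 2) ^ 2 := by
      rw [Real.sqrt_le_left (by positivity)]
      nlinarith [one_le_pow₀ h (n := 3), one_le_pow₀ h (n := 4), sq_nonneg (1 + δ * t ^ 2)]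
    gcongr
  rw [← softAbs_sq hδ, abs_mul, abs_of_nonneg (by have := softAbs_nonneg δ t; positivity)]
  have h3 : softAbs δ t ^ (2 * k - 1) = (softAbs δ t ^ 2) ^ (k - 1) * softAbs δ t := by
    rw [← pow_mul, ← pow_succ]; congr 1; omega
  rw [h3]
  have h4 : 0 ≤ k * (softAbs δ t ^ 2) ^ (k - 1) := by positivity
  calc _ ≤ k * (softAbs δ t ^ 2) ^ (k - 1) * (2 * softAbs δ t) :=
        mul_le_mul_of_nonneg_left h1 h4
    _ = _ := by ring

theorem ofReal_softAbs_pow (hδ : 0 < δ) (k : ℕ) (t : ℝ) :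
    ‖(t ^ 2 / (1 + δ * t ^ 2)) ^ k‖ₑ ^ (3 / 2 : ℝ) = ENNReal.ofReal (softAbs δ t) ^ (3 * k) := by
  have h0 := softAbs_nonneg δ t
  rw [← softAbs_sq hδ, Real.enorm_of_nonneg (by positivity), ENNReal.ofReal_pow (by positivity),
    ENNReal.ofReal_pow h0, ← pow_mul, ← ENNReal.rpow_natCast, ← ENNReal.rpow_natCast,
    ← ENNReal.rpow_mul]
  congr 1
  push_cast
  ring

/-- The `W^{1,1}` Sobolev inequality applied to a power of the truncation of `φ`. -/
theorem exists_sobolev_space : ∃ C : ℝ≥0, ∀ (k : ℕ), 1 ≤ k → ∀ δ : ℝ, 0 < δ → ∀ φ : E3 → ℝ,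
    ContDiff ℝ 1 φ → HasCompactSupport φ →
    ∫⁻ x, ENNReal.ofReal (softAbs δ (φ x)) ^ (3 * k) ≤
      C * (2 * k * ∫⁻ x, ENNReal.ofReal (softAbs δ (φ x)) ^ (2 * k - 1) * ‖fderiv ℝ φ x‖ₑ) ^
        (3 / 2 : ℝ) := by
  refine ⟨lintegralPowLePowLIntegralFDerivConst (volume : Measure E3) (3 / 2),
    fun k hk δ hδ φ hφ hc => ?_⟩
  have hconj : Real.HolderConjugate (Module.finrank ℝ E3 : ℝ) (3 / 2) := by
    rw [finrank_euclideanSpace_fin]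
    exact ⟨by norm_num, by norm_num, by norm_num⟩
  have h1 := lintegral_pow_le_pow_lintegral_fderiv (volume : Measure E3)
    (u := fun x => (φ x ^ 2 / (1 + δ * φ x ^ 2)) ^ k)
    ((contDiff_softAbs_pow hδ k).comp hφ)
    (hc.comp_left (g := fun s => (s ^ 2 / (1 + δ * s ^ 2)) ^ k) (by simp; omega)) hconj
  simp only [ofReal_softAbs_pow hδ] at h1
  refine h1.trans ?_
  gcongr
  rw [← lintegral_const_mul' _ _ (by finiteness)]
  refine lintegral_mono fun x => ?_
  have h2 := (hasDerivAt_softAbs_pow hδ k (φ x)).comp_hasFDerivAt x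
    (hφ.differentiable (by simp) x).hasFDerivAt
  have h3 : fderiv ℝ (fun x => (φ x ^ 2 / (1 + δ * φ x ^ 2)) ^ k) x = _ := h2.fderiv
  simp only at h3 ⊢
  rw [h3, enorm_smul, ← mul_assoc]
  gcongr
  rw [Real.enorm_eq_ofReal_abs]
  refine (ENNReal.ofReal_le_ofReal (abs_deriv_softAbs_le hδ hk (φ x))).trans_eq ?_
  rw [ENNReal.ofReal_mul (by positivity), ENNReal.ofReal_pow (softAbs_nonneg _ _),
    ENNReal.ofReal_mul (by norm_num)]
  simp

end Sobolev

theorem LatticeInvariant.gradient {φ : E3 → ℝ} (h : LatticeInvariant φ) :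
    LatticeInvariant (gradient φ) := by
  intro g hg x
  have : (fun y => φ (y + g)) = φ := by
    ext y; rw [add_comm, h g hg]
  rw [_root_.gradient, _root_.gradient, add_comm g x, ← fderiv_comp_add_right, this]

theorem enorm_gradient (φ : E3 → ℝ) (x : E3) : ‖gradient φ x‖ₑ = ‖fderiv ℝ φ x‖ₑ := by
  rw [← ofReal_norm, ← ofReal_norm, gradient, LinearIsometryEquiv.norm_map]

namespace Setting

/-- The truncated Sobolev inequality for test functions. -/
theorem exists_sobolev_test (X : Setting) : ∃ C : ℝ≥0, ∀ (k : ℕ), 1 ≤ k → ∀ δ : ℝ, 0 < δ →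
    ∀ φ : E3 → ℝ, X.IsTest φ →
    ∫⁻ x in X.cell, ENNReal.ofReal (softAbs δ (φ x)) ^ (3 * k) ≤
      C * (2 * k * ∫⁻ x in X.cell, ENNReal.ofReal (softAbs δ (φ x)) ^ (2 * k - 1) *
        (‖gradient φ x‖ₑ + ‖φ x‖ₑ)) ^ (3 / 2 : ℝ) := by
  obtain ⟨C, hC⟩ := exists_sobolev_space
  cases X with
  | dirichlet Ω hΩ =>
    refine ⟨C, fun k hk δ hδ φ hφ => ?_⟩
    have h1 := hC k hk δ hδ φ (hφ.1.of_le (by simp)) hφ.2.1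
    refine (lintegral_mono' Measure.restrict_le_self le_rfl).trans (h1.trans ?_)
    refine mul_le_mul_right (ENNReal.rpow_le_rpow (mul_le_mul_right ?_ _) (by norm_num)) _
    have h2 : ∫⁻ x, ENNReal.ofReal (softAbs δ (φ x)) ^ (2 * k - 1) * ‖fderiv ℝ φ x‖ₑ =
        ∫⁻ x in (dirichlet Ω hΩ).cell,
          ENNReal.ofReal (softAbs δ (φ x)) ^ (2 * k - 1) * ‖fderiv ℝ φ x‖ₑ := by
      refine (setLIntegral_eq_of_support_subset ?_).symm
      intro x hx
      by_contra hn
      refine hx ?_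
      have : fderiv ℝ φ x = 0 := image_eq_zero_of_notMem_tsupport
        fun h' => hn (hφ.2.2 (tsupport_fderiv_subset ℝ h'))
      simp [this, ← ofReal_norm]
    rw [h2]
    refine lintegral_mono fun x => ?_
    simp only [enorm_gradient]
    gcongr
    exact le_self_add
  | periodic =>
    obtain ⟨R₀, hR₀⟩ := periodic.isBounded_cell.exists_norm_le
    set R : ℝ := |R₀| + 1 with hR
    have hRpos : 0 < R := by positivity
    -- Periodic functions have no compact support: `φ` is multiplied by a cutoff equal to 1 on the
    -- cell. Its derivative costs the extra term `‖φ x‖ₑ`, and the ball of radius `2R` costs the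
    -- multiplicity `N`.
    let χ : ContDiffBump (0 : E3) := ⟨R, 2 * R, hRpos, by linarith⟩
    obtain ⟨M, hM⟩ := (χ.contDiff (n := 1)).continuous_fderiv (by simp)
      |>.bounded_above_of_compact_support (χ.hasCompactSupport.fderiv ℝ)
    have hM0 : 0 ≤ M := (norm_nonneg _).trans (hM 0)
    obtain ⟨N, hN⟩ := lintegral_bounded_le (Metric.isBounded_closedBall (x := (0 : E3)) (r := 2 * R))
    set L : ℝ≥0 := (1 + M).toNNReal with hL
    refine ⟨C * (L * N) ^ (3 / 2 : ℝ), fun k hk δ hδ φ hφ => ?_⟩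
    have hφd : ContDiff ℝ 1 φ := hφ.1.of_le (by simp)
    have h1 := hC k hk δ hδ (fun x => χ x * φ x) (χ.contDiff.mul hφd) χ.hasCompactSupport.mul_right
    have h2 : ∫⁻ x in periodic.cell, ENNReal.ofReal (softAbs δ (φ x)) ^ (3 * k) ≤
        ∫⁻ x, ENNReal.ofReal (softAbs δ (χ x * φ x)) ^ (3 * k) := by
      refine le_trans (le_of_eq ?_) (lintegral_mono'
        (Measure.restrict_le_self (s := periodic.cell)) le_rfl)
      refine setLIntegral_congr_fun periodic.measurableSet_cell fun x hx => ?_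
      have : χ x = 1 := χ.one_of_mem_closedBall (by
        rw [mem_closedBall_zero_iff]
        exact (hR₀ x hx).trans (by simp only [χ, hR]; linarith [le_abs_self R₀]))
      simp [this]
    have hpt : ∀ x, ENNReal.ofReal (softAbs δ (χ x * φ x)) ^ (2 * k - 1) *
        ‖fderiv ℝ (fun x => χ x * φ x) x‖ₑ ≤
        (Metric.closedBall (0 : E3) (2 * R)).indicator (fun x => L *
          (ENNReal.ofReal (softAbs δ (φ x)) ^ (2 * k - 1) * (‖gradient φ x‖ₑ + ‖φ x‖ₑ))) x := by
      intro x
      by_cases hx : x ∈ Metric.closedBall (0 : E3) (2 * R)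
      · rw [indicator_of_mem hx, mul_left_comm]
        have hχ1 : |χ x| ≤ 1 := by rw [abs_of_nonneg χ.nonneg]; exact χ.le_one
        gcongr
        · refine softAbs_mono hδ ?_
          rw [abs_mul]
          exact mul_le_of_le_one_left (abs_nonneg _) hχ1
        · rw [fderiv_fun_mul (χ.contDiff (n := 1).differentiable (by simp) x)
            (hφd.differentiable (by simp) x)]
          rw [enorm_gradient, mul_add]
          rw [← ofReal_norm]
          refine (ENNReal.ofReal_le_ofReal (norm_add_le _ _)).trans ?_
          rw [ENNReal.ofReal_add (norm_nonneg _) (norm_nonneg _), ofReal_norm, ofReal_norm]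
          refine add_le_add ?_ ?_
          · rw [enorm_smul]
            gcongr
            rw [Real.enorm_eq_ofReal_abs]
            refine (ENNReal.ofReal_le_ofReal (hχ1.trans (c := 1 + M) (by linarith))).trans_eq rfl
          · rw [enorm_smul, mul_comm]
            gcongr
            rw [← ofReal_norm]
            refine (ENNReal.ofReal_le_ofReal ((hM x).trans (c := 1 + M) (by linarith))).trans_eq rfl
      · rw [indicator_of_notMem hx]
        have hts : x ∉ tsupport fun x => χ x * φ x := fun h' => hx (by
          have := tsupport_mul_subset_left (f := χ) (g := φ) h'
          rwa [χ.tsupport_eq] at this)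
        have : fderiv ℝ (fun x => χ x * φ x) x = 0 := image_eq_zero_of_notMem_tsupport
          fun h' => hts (tsupport_fderiv_subset ℝ h')
        simp [this, ← ofReal_norm]
    have h3 : ∫⁻ x, ENNReal.ofReal (softAbs δ (χ x * φ x)) ^ (2 * k - 1) *
        ‖fderiv ℝ (fun x => χ x * φ x) x‖ₑ ≤ (L * N) * ∫⁻ x in periodic.cell,
          ENNReal.ofReal (softAbs δ (φ x)) ^ (2 * k - 1) * (‖gradient φ x‖ₑ + ‖φ x‖ₑ) := by
      refine (lintegral_mono hpt).trans ?_
      rw [lintegral_indicator Metric.isClosed_closedBall.measurableSet,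
        lintegral_const_mul' _ _ ENNReal.coe_ne_top, mul_assoc]
      gcongr
      refine hN _ fun g hg x => ?_
      have hinv := IsPeriodic.latticeInvariant hφ.2
      rw [hinv g hg, hinv.gradient g hg]
    refine h2.trans (h1.trans ?_)
    calc _ ≤ (C : ℝ≥0∞) * (2 * k * ((L * N) * ∫⁻ x in periodic.cell,
          ENNReal.ofReal (softAbs δ (φ x)) ^ (2 * k - 1) * (‖gradient φ x‖ₑ + ‖φ x‖ₑ))) ^
          (3 / 2 : ℝ) := by gcongr
      _ = _ := by
          rw [mul_left_comm, ENNReal.mul_rpow_of_nonneg _ _ (by norm_num), ← mul_assoc]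
          congr 2
          rw [ENNReal.coe_mul, ENNReal.coe_rpow_of_nonneg _ (by norm_num), ENNReal.coe_mul]
          simp

end Setting

/-! ### Sobolev embeddings `W^{1,q} ⊂ L^{3k}` for functions in `H¹`. -/

namespace Setting

variable (X : Setting)

theorem exists_test_approx (z : X.H1) : ∃ (φ : ℕ → E3 → ℝ) (w : ℕ → X.H1),
    (∀ n, X.IsTest (φ n) ∧ X.IsLift (φ n) (w n)) ∧ Tendsto w atTop (𝓝 z) ∧
    ∀ᵐ x ∂volume.restrict X.cell, Tendsto (fun n => φ n x) atTop (𝓝 (X.incl z x)) := by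
  obtain ⟨w, hw, hlim⟩ := mem_closure_iff_seq_limit.1 (X.dense_lift z)
  choose φ hφ using hw
  have h1 : Tendsto (fun n => X.incl (w n)) atTop (𝓝 (X.incl z)) :=
    (X.incl.continuous.tendsto z).comp hlim
  have h2 := tendstoInMeasure_of_tendsto_Lp h1
  obtain ⟨ns, hns, hae⟩ := h2.exists_seq_tendsto_ae
  refine ⟨fun n => φ (ns n), fun n => w (ns n), fun n => hφ (ns n),
    hlim.comp hns.tendsto_atTop, ?_⟩
  have h3 : ∀ᵐ x ∂volume.restrict X.cell, ∀ n, X.incl (w n) x = φ n x :=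
    ae_all_iff.2 fun n => (hφ n).2.1
  filter_upwards [hae, h3] with x hx hx3
  simpa only [hx3] using hx

theorem lintegral_enorm_le {F : Type*} [NormedAddCommGroup F]
    (u : Lp F 2 (volume.restrict X.cell)) :
    ∫⁻ x in X.cell, ‖u x‖ₑ ≤ ‖u‖ₑ * volume X.cell ^ (1 / 2 : ℝ) := by
  have h := eLpNorm_le_eLpNorm_mul_rpow_measure_univ (p := 1) (q := 2) (by norm_num)
    (Lp.aestronglyMeasurable u)
  rw [eLpNorm_one_eq_lintegral_enorm, ← Lp.enorm_def, Measure.restrict_apply_univ] at h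
  convert h using 2
  norm_num

/-- The pointwise size of a function and its gradient. -/
def jet (z : X.H1) (x : E3) : ℝ≥0∞ := ‖X.grad z x‖ₑ + ‖X.incl z x‖ₑ

theorem measurable_jet (z : X.H1) : Measurable (X.jet z) :=
  (Lp.stronglyMeasurable (X.grad z)).enorm.add (Lp.stronglyMeasurable (X.incl z)).enorm

theorem lintegral_jet_le (z : X.H1) :
    ∫⁻ x in X.cell, X.jet z x ≤ ‖z‖ₑ * (2 * volume X.cell ^ (1 / 2 : ℝ)) := by
  have h1 : ‖X.grad z‖ₑ ≤ ‖z‖ₑ := by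
    rw [← ofReal_norm, ← ofReal_norm]; exact ENNReal.ofReal_le_ofReal (X.norm_grad_le z)
  have h2 : ‖X.incl z‖ₑ ≤ ‖z‖ₑ := by
    rw [← ofReal_norm, ← ofReal_norm]; exact ENNReal.ofReal_le_ofReal (X.norm_incl_le z)
  unfold jet
  rw [lintegral_add_left (Lp.stronglyMeasurable (X.grad z)).enorm]
  calc _ ≤ ‖X.grad z‖ₑ * volume X.cell ^ (1 / 2 : ℝ) + ‖X.incl z‖ₑ * volume X.cell ^ (1 / 2 : ℝ) :=
        add_le_add (X.lintegral_enorm_le _) (X.lintegral_enorm_le _)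
    _ ≤ ‖z‖ₑ * volume X.cell ^ (1 / 2 : ℝ) + ‖z‖ₑ * volume X.cell ^ (1 / 2 : ℝ) := by gcongr
    _ = _ := by ring

theorem volume_cell_ne_top : volume X.cell ≠ ⊤ := X.isBounded_cell.measure_lt_top.ne

theorem jet_le_add (z w : X.H1) :
    ∀ᵐ x ∂volume.restrict X.cell, X.jet w x ≤ X.jet z x + X.jet (w - z) x := by
  filter_upwards [Lp.coeFn_sub (X.grad w) (X.grad z), Lp.coeFn_sub (X.incl w) (X.incl z)]
    with x h1 h2
  simp only [jet, map_sub, h1, h2, Pi.sub_apply]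
  have e1 := enorm_add_le (X.grad z x) (X.grad w x - X.grad z x)
  have e2 := enorm_add_le (X.incl z x) (X.incl w x - X.incl z x)
  rw [add_sub_cancel] at e1 e2
  calc _ ≤ _ := add_le_add e1 e2
    _ = _ := by ring

/-- The truncated Sobolev inequality in `H¹`. -/
theorem exists_sobolev_softAbs : ∃ C : ℝ≥0, ∀ (k : ℕ), 1 ≤ k → ∀ δ : ℝ, 0 < δ → ∀ z : X.H1,
    ∫⁻ x in X.cell, ENNReal.ofReal (softAbs δ (X.incl z x)) ^ (3 * k) ≤
      C * (2 * k * ∫⁻ x in X.cell, ENNReal.ofReal (softAbs δ (X.incl z x)) ^ (2 * k - 1) *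
        X.jet z x) ^ (3 / 2 : ℝ) := by
  obtain ⟨C, hC⟩ := X.exists_sobolev_test
  refine ⟨C, fun k hk δ hδ z => ?_⟩
  obtain ⟨φ, w, hφ, hlim, hae⟩ := X.exists_test_approx z
  set W : ℝ → ℝ≥0∞ := fun t => ENNReal.ofReal (softAbs δ t) with hW
  have hWc : Continuous W := ENNReal.continuous_ofReal.comp (continuous_softAbs hδ)
  -- For fixed `δ` the truncation is bounded, so integrability of the jet suffices for dominated
  -- convergence on the right; on the left Fatou is used.
  set B : ℝ≥0∞ := ENNReal.ofReal √(δ⁻¹) with hB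
  have hWB : ∀ t, W t ≤ B := fun t => ENNReal.ofReal_le_ofReal (softAbs_le hδ t)
  have hBt : B ^ (2 * k - 1) ≠ ⊤ := by finiteness
  have hφm : ∀ n, Measurable (φ n) := fun n => (hφ n).1.contDiff.continuous.measurable
  have hj : ∫⁻ x in X.cell, X.jet z x ≠ ⊤ := by
    refine ne_top_of_le_ne_top ?_ (X.lintegral_jet_le z)
    have := X.volume_cell_ne_top
    finiteness
  have herr : Tendsto (fun n => B ^ (2 * k - 1) * (‖w n - z‖ₑ * (2 * volume X.cell ^ (1 / 2 : ℝ))))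
      atTop (𝓝 0) := by
    have h0 : Tendsto (fun n => ‖w n - z‖ₑ) atTop (𝓝 0) := by
      have h := ENNReal.tendsto_ofReal (hlim.sub_const z).norm
      rw [sub_self, norm_zero, ENNReal.ofReal_zero] at h
      simpa only [ofReal_norm] using h
    have h1 : (2 * volume X.cell ^ (1 / 2 : ℝ)) ≠ ⊤ := by
      have := X.volume_cell_ne_top
      finiteness
    have h2 := ENNReal.Tendsto.mul_const h0 (Or.inr h1)
    have h3 := ENNReal.Tendsto.const_mul (a := B ^ (2 * k - 1)) h2 (Or.inr hBt)
    simpa using h3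
  have hdom : Tendsto (fun n => ∫⁻ x in X.cell, W (φ n x) ^ (2 * k - 1) * X.jet z x) atTop
      (𝓝 (∫⁻ x in X.cell, W (X.incl z x) ^ (2 * k - 1) * X.jet z x)) := by
    refine tendsto_lintegral_of_dominated_convergence' (fun x => B ^ (2 * k - 1) * X.jet z x)
      ?_ ?_ ?_ ?_
    · intro n
      exact (((hWc.measurable.comp (hφm n)).pow_const _).mul (X.measurable_jet z)).aemeasurable
    · intro n
      filter_upwards with x
      gcongr
      exact hWB _
    · rw [lintegral_const_mul' _ _ hBt]
      exact ENNReal.mul_ne_top hBt hj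
    · have hjf : ∀ᵐ x ∂volume.restrict X.cell, X.jet z x < ⊤ :=
        ae_lt_top (X.measurable_jet z) hj
      filter_upwards [hae, hjf] with x hx hxj
      refine ENNReal.Tendsto.mul_const ?_ (Or.inr hxj.ne)
      exact ENNReal.Tendsto.pow ((hWc.tendsto _).comp hx)
  have hle : ∀ n, ∫⁻ x in X.cell, W (φ n x) ^ (2 * k - 1) * (‖gradient (φ n) x‖ₑ + ‖φ n x‖ₑ) ≤
      (∫⁻ x in X.cell, W (φ n x) ^ (2 * k - 1) * X.jet z x) +
        B ^ (2 * k - 1) * (‖w n - z‖ₑ * (2 * volume X.cell ^ (1 / 2 : ℝ))) := by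
    intro n
    calc _ ≤ ∫⁻ x in X.cell, (W (φ n x) ^ (2 * k - 1) * X.jet z x +
          B ^ (2 * k - 1) * X.jet (w n - z) x) := by
          refine lintegral_mono_ae ?_
          filter_upwards [X.jet_le_add z (w n), (hφ n).2.1, (hφ n).2.2] with x hx h1 h2
          have e : ‖gradient (φ n) x‖ₑ + ‖φ n x‖ₑ = X.jet (w n) x := by rw [jet, h1, h2]
          rw [e]
          calc _ ≤ W (φ n x) ^ (2 * k - 1) * (X.jet z x + X.jet (w n - z) x) := by gcongr
            _ ≤ _ := by
              rw [mul_add]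
              gcongr
              exact hWB _
      _ = (∫⁻ x in X.cell, W (φ n x) ^ (2 * k - 1) * X.jet z x) +
          B ^ (2 * k - 1) * ∫⁻ x in X.cell, X.jet (w n - z) x := by
          have hmeas : Measurable fun x => W (φ n x) ^ (2 * k - 1) * X.jet z x :=
            ((hWc.measurable.comp (hφm n)).pow_const _).mul (X.measurable_jet z)
          rw [lintegral_add_left hmeas, lintegral_const_mul' _ _ hBt]
      _ ≤ _ := by gcongr; exact X.lintegral_jet_le _
  have hlimR : Tendsto (fun n => (C : ℝ≥0∞) * (2 * k *
      ((∫⁻ x in X.cell, W (φ n x) ^ (2 * k - 1) * X.jet z x) +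
        B ^ (2 * k - 1) * (‖w n - z‖ₑ * (2 * volume X.cell ^ (1 / 2 : ℝ))))) ^ (3 / 2 : ℝ)) atTop
      (𝓝 (C * (2 * k * ((∫⁻ x in X.cell, W (X.incl z x) ^ (2 * k - 1) * X.jet z x) + 0)) ^
        (3 / 2 : ℝ))) := by
    refine ENNReal.Tendsto.const_mul ?_ (Or.inr ENNReal.coe_ne_top)
    refine (ENNReal.continuous_rpow_const.tendsto _).comp ?_
    exact ENNReal.Tendsto.const_mul (hdom.add herr) (Or.inr (by finiteness))
  rw [add_zero] at hlimR
  calc ∫⁻ x in X.cell, W (X.incl z x) ^ (3 * k)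
      = ∫⁻ x in X.cell, liminf (fun n => W (φ n x) ^ (3 * k)) atTop := by
        refine lintegral_congr_ae ?_
        filter_upwards [hae] with x hx
        exact (ENNReal.Tendsto.pow ((hWc.tendsto _).comp hx)).liminf_eq.symm
    _ ≤ liminf (fun n => ∫⁻ x in X.cell, W (φ n x) ^ (3 * k)) atTop :=
        lintegral_liminf_le fun n => (hWc.measurable.comp (hφm n)).pow_const _
    _ ≤ liminf (fun n => (C : ℝ≥0∞) * (2 * k *
      ((∫⁻ x in X.cell, W (φ n x) ^ (2 * k - 1) * X.jet z x) +
        B ^ (2 * k - 1) * (‖w n - z‖ₑ * (2 * volume X.cell ^ (1 / 2 : ℝ))))) ^ (3 / 2 : ℝ))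
        atTop := by
        refine liminf_le_liminf (Eventually.of_forall fun n => ?_)
        refine (hC k hk δ hδ (φ n) (hφ n).1).trans ?_
        have := hle n
        gcongr
    _ = _ := hlimR.liminf_eq

/-- The power of `A` on the right is `(2k - 1)/(2k) < 1` and can be divided out. This needs `A`
finite, which is the purpose of the truncation. -/
theorem le_of_le_mul_rpow {A S : ℝ≥0∞} {C : ℝ≥0} {k : ℕ} (hk : 1 ≤ k) (hA : A ≠ ⊤)
    (h : A ≤ C * (2 * k * (A ^ ((2 * k - 1) / (3 * k) : ℝ) * S)) ^ (3 / 2 : ℝ)) :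
    A ≤ ((C : ℝ≥0∞) ^ (2 / 3 : ℝ) * (2 * k) * S) ^ (3 * k : ℝ) := by
  have hk' : (1 : ℝ) ≤ k := by exact_mod_cast hk
  rcases eq_or_ne A 0 with rfl | hA0
  · exact zero_le
  have hpos : (0 : ℝ) ≤ 3 / 2 := by norm_num
  have e1 : (2 * k * (A ^ ((2 * k - 1) / (3 * k) : ℝ) * S)) ^ (3 / 2 : ℝ) =
      (2 * k * S) ^ (3 / 2 : ℝ) * A ^ ((2 * k - 1) / (2 * k) : ℝ) := by
    rw [mul_left_comm, mul_comm (A ^ _), ENNReal.mul_rpow_of_nonneg _ _ hpos, ← ENNReal.rpow_mul]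
    congr 2
    field_simp
  have e2 : A = A ^ (1 / (2 * k) : ℝ) * A ^ ((2 * k - 1) / (2 * k) : ℝ) := by
    rw [← ENNReal.rpow_add _ _ hA0 hA]
    nth_rewrite 1 [← ENNReal.rpow_one A]
    congr 1
    field_simp
    ring
  have hne : A ^ ((2 * k - 1) / (2 * k) : ℝ) ≠ 0 := by
    rw [Ne, ENNReal.rpow_eq_zero_iff]; simp [hA0, hA]
  have hnt : A ^ ((2 * k - 1) / (2 * k) : ℝ) ≠ ⊤ :=
    ENNReal.rpow_ne_top_of_nonneg (div_nonneg (by linarith) (by linarith)) hA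
  have h1 : A ^ (1 / (2 * k) : ℝ) ≤ C * (2 * k * S) ^ (3 / 2 : ℝ) := by
    rw [e1, ← mul_assoc] at h
    rw [e2] at h
    rw [← e2] at h
    have h' : A ^ (1 / (2 * k) : ℝ) * A ^ ((2 * k - 1) / (2 * k) : ℝ) ≤
        C * (2 * k * S) ^ (3 / 2 : ℝ) * A ^ ((2 * k - 1) / (2 * k) : ℝ) := by rwa [← e2]
    exact (ENNReal.mul_le_mul_iff_left hne hnt).1 h'
  have h2 := ENNReal.rpow_le_rpow h1 (show (0 : ℝ) ≤ 2 * k by positivity)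
  rw [← ENNReal.rpow_mul, one_div_mul_cancel (by positivity), ENNReal.rpow_one] at h2
  refine h2.trans_eq ?_
  rw [mul_assoc ((C : ℝ≥0∞) ^ _)]
  generalize 2 * (k : ℝ≥0∞) * S = T
  rw [ENNReal.mul_rpow_of_nonneg _ _ (by positivity),
    ENNReal.mul_rpow_of_nonneg _ _ (by positivity), ← ENNReal.rpow_mul, ← ENNReal.rpow_mul]
  congr 2 <;> ring

/-- The Sobolev inequality `‖z‖_{L^{3 k}} ≤ C (‖∇z‖_{L^q} + ‖z‖_{L^q})`, `q = 3 k / (k + 1)`. -/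
theorem exists_sobolev (k : ℕ) (hk : 1 ≤ k) : ∃ C : ℝ≥0, ∀ z : X.H1,
    ∫⁻ x in X.cell, ‖X.incl z x‖ₑ ^ (3 * k : ℝ) ≤
      (C * (∫⁻ x in X.cell, X.jet z x ^ (3 * k / (k + 1) : ℝ)) ^ ((k + 1) / (3 * k) : ℝ)) ^
        (3 * k : ℝ) := by
  have hk' : (1 : ℝ) ≤ k := by exact_mod_cast hk
  obtain ⟨C, hC⟩ := X.exists_sobolev_softAbs
  refine ⟨C ^ (2 / 3 : ℝ) * (2 * k), fun z => ?_⟩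
  set S : ℝ≥0∞ := (∫⁻ x in X.cell, X.jet z x ^ (3 * k / (k + 1) : ℝ)) ^ ((k + 1) / (3 * k) : ℝ)
    with hS
  have hm : ∀ δ : ℝ, 0 < δ → Measurable fun x => ENNReal.ofReal (softAbs δ (X.incl z x)) :=
    fun δ hδ => ((continuous_softAbs hδ).measurable.comp
      (Lp.stronglyMeasurable (X.incl z)).measurable).ennreal_ofReal
  have main : ∀ δ : ℝ, 0 < δ →
      ∫⁻ x in X.cell, ENNReal.ofReal (softAbs δ (X.incl z x)) ^ (3 * k) ≤
        ((C : ℝ≥0∞) ^ (2 / 3 : ℝ) * (2 * k) * S) ^ (3 * k : ℝ) := by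
    intro δ hδ
    set A := ∫⁻ x in X.cell, ENNReal.ofReal (softAbs δ (X.incl z x)) ^ (3 * k) with hA
    have hAt : A ≠ ⊤ := by
      have h1 : A ≤ ∫⁻ _ in X.cell, ENNReal.ofReal √(δ⁻¹) ^ (3 * k) :=
        lintegral_mono fun x => by gcongr; exact softAbs_le hδ _
      refine ne_top_of_le_ne_top ?_ h1
      rw [setLIntegral_const]
      have := X.volume_cell_ne_top
      finiteness
    refine le_of_le_mul_rpow hk hAt ((hC k hk δ hδ z).trans ?_)
    gcongr
    -- With these exponents the power `2k - 1` of the truncation becomes `3k`, the power on the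
    -- left.
    have hpq : Real.HolderConjugate (3 * k / (2 * k - 1)) (3 * k / (k + 1)) := by
      have : (0 : ℝ) < 2 * k - 1 := by linarith
      refine ⟨?_, by positivity, by positivity⟩
      field_simp
      ring
    have h2 := ENNReal.lintegral_mul_le_Lp_mul_Lq (volume.restrict X.cell) hpq
      (f := fun x => ENNReal.ofReal (softAbs δ (X.incl z x)) ^ (2 * k - 1)) (g := X.jet z)
      ((hm δ hδ).pow_const _).aemeasurable (X.measurable_jet z).aemeasurable
    refine h2.trans_eq ?_
    rw [hS, hA, one_div_div, one_div_div]
    congr 3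
    ext x
    rw [← ENNReal.rpow_natCast, ← ENNReal.rpow_natCast, ← ENNReal.rpow_mul]
    congr 1
    rw [Nat.cast_sub (by omega)]
    push_cast
    have : (2 * k - 1 : ℝ) ≠ 0 := by linarith
    field_simp
  -- The bound does not depend on `δ`; along `δ = 1/(n + 1)` Fatou removes the truncation.
  calc ∫⁻ x in X.cell, ‖X.incl z x‖ₑ ^ (3 * k : ℝ)
      = ∫⁻ x in X.cell, liminf (fun n : ℕ =>
          ENNReal.ofReal (softAbs (1 / ((n : ℝ) + 1)) (X.incl z x)) ^ (3 * k)) atTop := by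
        refine lintegral_congr fun x => ?_
        have h1 : Tendsto (fun n : ℕ => softAbs (1 / ((n : ℝ) + 1)) (X.incl z x)) atTop
            (𝓝 |X.incl z x|) := by
          have h2 : Tendsto (fun n : ℕ => 1 + 1 / ((n : ℝ) + 1) * X.incl z x ^ 2) atTop
              (𝓝 (1 + 0 * X.incl z x ^ 2)) :=
            ((tendsto_one_div_add_atTop_nhds_zero_nat (𝕜 := ℝ)).mul_const _).const_add 1
          have h3 : Tendsto (fun n : ℕ => |X.incl z x| / √(1 + 1 / ((n : ℝ) + 1) * X.incl z x ^ 2))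
              atTop (𝓝 (|X.incl z x| / √(1 + 0 * X.incl z x ^ 2))) :=
            (tendsto_const_nhds (x := |X.incl z x|)).div h2.sqrt (by simp)
          simpa [softAbs] using h3
        have h4 := ENNReal.Tendsto.pow (n := 3 * k) (ENNReal.tendsto_ofReal h1)
        rw [h4.liminf_eq, Real.enorm_eq_ofReal_abs, ← ENNReal.rpow_natCast]
        congr 1
        push_cast
        ring
    _ ≤ liminf (fun n : ℕ => ∫⁻ x in X.cell,
          ENNReal.ofReal (softAbs (1 / ((n : ℝ) + 1)) (X.incl z x)) ^ (3 * k)) atTop :=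
        lintegral_liminf_le fun n => (hm _ (by positivity)).pow_const _
    _ ≤ _ := by
        refine (liminf_le_liminf (Eventually.of_forall fun n => main _ (by positivity))).trans_eq ?_
        rw [liminf_const]
        congr 2
        rw [ENNReal.coe_mul, ENNReal.coe_rpow_of_nonneg _ (by norm_num)]
        simp

end Setting

/-! ### Plumpness of the domain and of the period cell. -/

/-- Every ball of radius at most `r₀` centred in `s` contains a ball of comparable radius
contained in `t`. -/
def PlumpOn (s t : Set E3) : Prop :=
  ∃ c > 0, ∃ r₀ > 0, ∀ x ∈ s, ∀ r, 0 < r → r ≤ r₀ →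
    ∃ y : E3, Metric.ball y (c * r) ⊆ Metric.ball x r ∩ t

theorem PlumpOn.union {s₁ s₂ t : Set E3} (h₁ : PlumpOn s₁ t) (h₂ : PlumpOn s₂ t) :
    PlumpOn (s₁ ∪ s₂) t := by
  obtain ⟨c₁, hc₁, r₁, hr₁, H₁⟩ := h₁
  obtain ⟨c₂, hc₂, r₂, hr₂, H₂⟩ := h₂
  refine ⟨min c₁ c₂, lt_min hc₁ hc₂, min r₁ r₂, lt_min hr₁ hr₂, fun x hx r hr hr' => ?_⟩
  rcases hx with hx | hx
  · obtain ⟨y, hy⟩ := H₁ x hx r hr (hr'.trans (min_le_left _ _))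
    exact ⟨y, (Metric.ball_subset_ball (by gcongr; exact min_le_left _ _)).trans hy⟩
  · obtain ⟨y, hy⟩ := H₂ x hx r hr (hr'.trans (min_le_right _ _))
    exact ⟨y, (Metric.ball_subset_ball (by gcongr; exact min_le_right _ _)).trans hy⟩

theorem PlumpOn.mono {s₁ s₂ t : Set E3} (hs : s₁ ⊆ s₂) (h : PlumpOn s₂ t) : PlumpOn s₁ t := by
  obtain ⟨c, hc, r, hr, H⟩ := h
  exact ⟨c, hc, r, hr, fun x hx => H x (hs hx)⟩

/-- An interior cone condition. A direction `e` with `Dρ(x₀) e < 0` exists; by continuity `Dρ(y) d <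
0` for `y` near `x₀` and `d` near `e`. By the mean value theorem `ρ` decreases along these
directions, so starting from `ρ < 0` one stays inside. -/
theorem plumpOn_of_boundary {Ω U : Set E3} (hU : IsOpen U) {x₀ : E3} (hx₀ : x₀ ∈ U) {ρ : E3 → ℝ}
    (hρ : ContDiffOn ℝ ∞ ρ U) (hd : fderiv ℝ ρ x₀ ≠ 0) (hΩ : Ω ∩ U = {y ∈ U | ρ y < 0}) :
    ∃ δ > 0, PlumpOn (Ω ∩ Metric.ball x₀ δ) Ω := by
  obtain ⟨v, hv⟩ : ∃ v, fderiv ℝ ρ x₀ v ≠ 0 := by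
    by_contra! h
    exact hd (ContinuousLinearMap.ext h)
  set e : E3 := (-(fderiv ℝ ρ x₀ v)⁻¹) • v with he
  have hev : fderiv ℝ ρ x₀ e < 0 := by
    rw [he, map_smul, smul_eq_mul, neg_mul, inv_mul_cancel₀ hv]; norm_num
  have hcont : ContinuousAt (fun q : E3 × E3 => fderiv ℝ ρ q.1 q.2) (x₀, e) := by
    have h1 : ContinuousAt (fderiv ℝ ρ) x₀ :=
      (hρ.continuousOn_fderiv_of_isOpen hU (by simp)).continuousAt (hU.mem_nhds hx₀)
    have h2 : ContinuousAt (fun q : E3 × E3 => fderiv ℝ ρ q.1) (x₀, e) :=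
      h1.comp (f := Prod.fst) (x := (x₀, e)) continuousAt_fst
    exact h2.clm_apply continuousAt_snd
  have hev1 : ∀ᶠ q : E3 × E3 in 𝓝 (x₀, e), fderiv ℝ ρ q.1 q.2 < 0 ∧ q.1 ∈ U :=
    (hcont.eventually_lt continuousAt_const hev).and
      (continuousAt_fst.eventually (hU.mem_nhds hx₀))
  obtain ⟨δ, hδ, hball⟩ := Metric.eventually_nhds_iff_ball.1 hev1
  have hneg : ∀ y ∈ Metric.ball x₀ δ, ∀ d ∈ Metric.ball e δ, fderiv ℝ ρ y d < 0 := fun y hy d hd' =>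
    (hball (y, d) (by rw [← ball_prod_same]; exact ⟨hy, hd'⟩)).1
  have hUb : Metric.ball x₀ δ ⊆ U := fun y hy =>
    (hball (y, e) (by rw [← ball_prod_same]; exact ⟨hy, Metric.mem_ball_self hδ⟩)).2
  -- Scaled so that every `x + l r d` with `d` in the ball of radius `δ` about `e` stays at distance
  -- less than `r` from `x`.
  set l : ℝ := (‖e‖ + δ)⁻¹ with hl
  have hlpos : 0 < l := by positivity
  refine ⟨δ / 2, by positivity, l * δ, by positivity, δ / 2, by positivity, ?_⟩
  rintro x ⟨hxΩ, hx⟩ r hr hr'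
  refine ⟨x + (l * r) • e, fun y hy => ?_⟩
  have hlr : 0 < l * r := by positivity
  set d : E3 := (l * r)⁻¹ • (y - x) with hd'
  have hyd : y - x = (l * r) • d := by rw [hd', smul_smul, mul_inv_cancel₀ hlr.ne', one_smul]
  have hdist : d ∈ Metric.ball e δ := by
    rw [mem_ball_iff_norm] at hy ⊢
    have e1 : y - (x + (l * r) • e) = (l * r) • (d - e) := by
      rw [smul_sub, ← hyd]; abel
    rw [e1, norm_smul, Real.norm_of_nonneg hlr.le] at hy
    have : l * δ * r = (l * r) * δ := by ring
    rw [this] at hy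
    exact lt_of_mul_lt_mul_left hy hlr.le
  have hdn : ‖d‖ < ‖e‖ + δ := by
    have h1 := norm_add_le e (d - e)
    rw [add_sub_cancel] at h1
    have := mem_ball_iff_norm.1 hdist
    linarith
  have hyx : y ∈ Metric.ball x r := by
    rw [mem_ball_iff_norm, hyd, norm_smul, Real.norm_of_nonneg hlr.le]
    calc l * r * ‖d‖ < l * r * (‖e‖ + δ) := by gcongr
      _ = r := by rw [hl]; field_simp
  have hxb : x ∈ Metric.ball x₀ δ := Metric.ball_subset_ball (by linarith) hx
  have hyb : y ∈ Metric.ball x₀ δ := by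
    rw [Metric.mem_ball] at *
    linarith [dist_triangle y x x₀]
  refine ⟨hyx, ?_⟩
  obtain ⟨z, hz, hmv⟩ := domain_mvt (f := ρ) (f' := fderiv ℝ ρ) (s := Metric.ball x₀ δ)
    (fun w hw => ((hρ.differentiableOn (by simp)).differentiableAt
      (hU.mem_nhds (hUb hw))).hasFDerivAt.hasFDerivWithinAt) (convex_ball _ _) hxb hyb
  have hzb : z ∈ Metric.ball x₀ δ := (convex_ball x₀ δ).segment_subset hxb hyb hz
  have h1 : ρ x < 0 := by
    have : x ∈ Ω ∩ U := ⟨hxΩ, hUb hxb⟩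
    rw [hΩ] at this
    exact this.2
  have h2 : ρ y < 0 := by
    rw [hyd, map_smul, smul_eq_mul] at hmv
    have := mul_neg_of_pos_of_neg hlr (hneg z hzb d hdist)
    linarith
  have : y ∈ Ω ∩ U := by rw [hΩ]; exact ⟨hUb hyb, h2⟩
  exact this.1

/-- Plumpness is inherited by finite unions, so compactness of the closure reduces it to a
neighbourhood of each point, interior or boundary. -/
theorem IsSmoothBoundedDomain.plumpOn {Ω : Set E3} (hΩ : IsSmoothBoundedDomain Ω) :
    PlumpOn Ω Ω := by
  have key : PlumpOn (Ω ∩ closure Ω) Ω := by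
    refine hΩ.isBounded.isCompact_closure.induction_on (p := fun s => PlumpOn (Ω ∩ s) Ω)
      ?_ ?_ ?_ ?_
    · exact ⟨1, one_pos, 1, one_pos, by simp⟩
    · exact fun s t hst h => h.mono (inter_subset_inter_right _ hst)
    · intro s t hs ht
      rw [inter_union_distrib_left]
      exact hs.union ht
    · intro x₀ hx₀
      by_cases hin : x₀ ∈ Ω
      · obtain ⟨δ, hδ, hb⟩ := Metric.isOpen_iff.1 hΩ.isOpen x₀ hin
        refine ⟨Metric.ball x₀ (δ / 2),
          mem_nhdsWithin_of_mem_nhds (Metric.ball_mem_nhds _ (by positivity)), ?_⟩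
        refine ⟨1, one_pos, δ / 2, by positivity, fun x hx r _ hr' => ⟨x, ?_⟩⟩
        rw [one_mul]
        refine subset_inter subset_rfl ((Metric.ball_subset_ball' ?_).trans hb)
        linarith [Metric.mem_ball.1 hx.2]
      · have hfr : x₀ ∈ frontier Ω := by rw [frontier, hΩ.isOpen.interior_eq]; exact ⟨hx₀, hin⟩
        obtain ⟨U, hU, hxU, ρ, hρ, hd, hΩU⟩ := hΩ.smooth_boundary x₀ hfr
        obtain ⟨δ, hδ, h⟩ := plumpOn_of_boundary hU hxU hρ (hd x₀ hxU) hΩU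
        exact ⟨_, mem_nhdsWithin_of_mem_nhds (Metric.ball_mem_nhds _ hδ), h⟩
  rwa [inter_eq_self_of_subset_left subset_closure] at key

namespace Setting

variable (X : Setting)

/-- For the cube, the inscribed ball about the centre `(π, π, π)` is contracted towards `x` by the
factor `r / R`; convexity keeps it inside. -/
theorem plumpOn_cell : PlumpOn X.cell X.cell := by
  cases X with
  | dirichlet Ω hΩ => exact hΩ.plumpOn
  | periodic =>
    obtain ⟨R₀, hR₀⟩ := periodic.isBounded_cell.exists_norm_le
    have hπ := Real.pi_pos
    set a : E3 := WithLp.toLp 2 fun _ => Real.pi with ha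
    set R : ℝ := |R₀| + ‖a‖ + Real.pi with hR
    have hRpos : 0 < R := by positivity
    refine ⟨Real.pi / R, by positivity, R, hRpos, fun x hx r hr hr' => ?_⟩
    set l : ℝ := r / R with hl
    have hl0 : 0 < l := by positivity
    have hl1 : l ≤ 1 := (div_le_one hRpos).2 hr'
    refine ⟨x + l • (a - x), fun y hy => ?_⟩
    have hrad : Real.pi / R * r = l * Real.pi := by rw [hl]; ring
    rw [hrad, mem_ball_iff_norm] at hy
    have hxn : ‖x‖ ≤ |R₀| := (hR₀ x hx).trans (le_abs_self _)
    constructor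
    · rw [mem_ball_iff_norm]
      have h1 : y - x = (y - (x + l • (a - x))) + l • (a - x) := by abel
      have h2 := norm_add_le (y - (x + l • (a - x))) (l • (a - x))
      rw [← h1, norm_smul, Real.norm_of_nonneg hl0.le] at h2
      have h3 : ‖a - x‖ ≤ ‖a‖ + |R₀| := (norm_sub_le _ _).trans (by linarith)
      have h4 : l * ‖a - x‖ ≤ l * (‖a‖ + |R₀|) := by gcongr
      have h5 : l * R = r := by rw [hl]; field_simp
      have h6 : l * R = l * Real.pi + l * (‖a‖ + |R₀|) := by rw [hR]; ring
      linarith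
    · intro i
      have h1 := (PiLp.norm_apply_le (y - (x + l • (a - x))) i).trans_lt hy
      have hai : a i = Real.pi := rfl
      simp only [PiLp.sub_apply, PiLp.add_apply, PiLp.smul_apply, smul_eq_mul, hai,
        Real.norm_eq_abs, abs_lt] at h1
      obtain ⟨h2, h3⟩ := hx i
      have h4 : 0 ≤ (1 - l) * x i := mul_nonneg (by linarith) h2.le
      have h5 : 0 ≤ (1 - l) * (2 * Real.pi - x i) := mul_nonneg (by linarith) (by linarith)
      constructor <;> nlinarith

/-! ### From the Slobodetskii seminorm to `L^{12/5}` and to the bound in `L¹²`. -/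

/-- The kernel of the Slobodetskii seminorm of order `1/2`, integrated in one variable. -/
def slobKernel (F : E3 → E3) (x : E3) : ℝ≥0∞ :=
  ∫⁻ y in X.cell, ‖F x - F y‖ₑ ^ 2 / ‖x - y‖ₑ ^ 4

theorem measurable_slobKernel {F : E3 → E3} (hF : Measurable F) : Measurable (X.slobKernel F) := by
  unfold slobKernel
  refine Measurable.lintegral_prod_right' (f := fun q : E3 × E3 =>
    ‖F q.1 - F q.2‖ₑ ^ 2 / ‖q.1 - q.2‖ₑ ^ 4) ?_
  exact (((hF.comp measurable_fst).sub (hF.comp measurable_snd)).enorm.pow_const 2).div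
    ((measurable_fst.sub measurable_snd).enorm.pow_const 4)

/-- Integrate `|F x|² ≤ 2 |F x - F y|² + 2 |F y|²` over the small ball, where `|x - y| ≤ r` lets the
kernel absorb the first term. -/
theorem enorm_sq_mul_volume_le {F : E3 → E3} (hF : Measurable F) {x y₀ : E3} {r s : ℝ}
    (hb : Metric.ball y₀ s ⊆ Metric.ball x r ∩ X.cell) :
    ‖F x‖ₑ ^ 2 * volume (Metric.ball y₀ s) ≤
      2 * (ENNReal.ofReal r ^ 4 * X.slobKernel F x + ∫⁻ y in X.cell, ‖F y‖ₑ ^ 2) := by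
  have hpt : ∀ y ∈ Metric.ball y₀ s, ‖F x‖ₑ ^ 2 ≤
      2 * (ENNReal.ofReal r ^ 4 * (‖F x - F y‖ₑ ^ 2 / ‖x - y‖ₑ ^ 4) + ‖F y‖ₑ ^ 2) := by
    intro y hy
    have h1 : ‖F x‖ₑ ≤ ‖F x - F y‖ₑ + ‖F y‖ₑ := by
      have := enorm_add_le (F x - F y) (F y)
      rwa [sub_add_cancel] at this
    have h2 : ‖F x‖ₑ ^ 2 ≤ 2 * (‖F x - F y‖ₑ ^ 2 + ‖F y‖ₑ ^ 2) := by
      refine (pow_le_pow_left' h1 2).trans ?_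
      have := ENNReal.rpow_add_le_mul_rpow_add_rpow ‖F x - F y‖ₑ ‖F y‖ₑ (p := 2) (by norm_num)
      norm_num at this
      simpa using this
    refine h2.trans ?_
    gcongr
    rcases eq_or_ne x y with rfl | hxy
    · simp
    · have hne : ‖x - y‖ₑ ^ 4 ≠ 0 := by simpa [sub_eq_zero] using hxy
      have hnt : ‖x - y‖ₑ ^ 4 ≠ ⊤ := by finiteness
      have hle : ‖x - y‖ₑ ≤ ENNReal.ofReal r := by
        rw [← ofReal_norm]
        refine ENNReal.ofReal_le_ofReal ?_
        have := (hb hy).1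
        rw [Metric.mem_ball, dist_comm, dist_eq_norm] at this
        exact this.le
      calc ‖F x - F y‖ₑ ^ 2 = ‖x - y‖ₑ ^ 4 * (‖F x - F y‖ₑ ^ 2 / ‖x - y‖ₑ ^ 4) :=
            (ENNReal.mul_div_cancel hne hnt).symm
        _ ≤ _ := by gcongr
  have hmeas : Measurable fun y => ENNReal.ofReal r ^ 4 * (‖F x - F y‖ₑ ^ 2 / ‖x - y‖ₑ ^ 4) :=
    (((measurable_const.sub hF).enorm.pow_const 2).div
      ((measurable_const.sub measurable_id).enorm.pow_const 4)).const_mul _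
  calc ‖F x‖ₑ ^ 2 * volume (Metric.ball y₀ s) = ∫⁻ _ in Metric.ball y₀ s, ‖F x‖ₑ ^ 2 := by
        rw [setLIntegral_const]
    _ ≤ ∫⁻ y in Metric.ball y₀ s,
        2 * (ENNReal.ofReal r ^ 4 * (‖F x - F y‖ₑ ^ 2 / ‖x - y‖ₑ ^ 4) + ‖F y‖ₑ ^ 2) :=
        setLIntegral_mono' Metric.isOpen_ball.measurableSet hpt
    _ ≤ ∫⁻ y in X.cell,
        2 * (ENNReal.ofReal r ^ 4 * (‖F x - F y‖ₑ ^ 2 / ‖x - y‖ₑ ^ 4) + ‖F y‖ₑ ^ 2) :=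
        lintegral_mono_set (hb.trans inter_subset_right)
    _ = _ := by
        rw [lintegral_const_mul' _ _ (by finiteness), lintegral_add_left hmeas,
          lintegral_const_mul' _ _ (by finiteness), slobKernel]

/-- Division by the volume of the small ball, which is proportional to `r³` by plumpness. -/
theorem exists_enorm_sq_le : ∃ C : ℝ≥0, ∃ r₀ > 0, ∀ F : E3 → E3, Measurable F → ∀ x ∈ X.cell,
    ∀ r, 0 < r → r ≤ r₀ → ‖F x‖ₑ ^ 2 ≤ C * (ENNReal.ofReal r * X.slobKernel F x +
      ENNReal.ofReal (r⁻¹ ^ 3) * ∫⁻ y in X.cell, ‖F y‖ₑ ^ 2) := by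
  obtain ⟨c, hc, r₀, hr₀, h⟩ := X.plumpOn_cell
  set b : ℝ≥0∞ := volume (Metric.ball (0 : E3) 1) with hb
  have hb0 : b ≠ 0 := (Metric.measure_ball_pos _ _ one_pos).ne'
  have hbt : b ≠ ⊤ := measure_ball_lt_top.ne
  set D : ℝ≥0∞ := (ENNReal.ofReal (c ^ 3) * b)⁻¹ * 2 with hD
  have hcb0 : ENNReal.ofReal (c ^ 3) * b ≠ 0 :=
    mul_ne_zero (ENNReal.ofReal_pos.2 (by positivity)).ne' hb0
  have hcbt : ENNReal.ofReal (c ^ 3) * b ≠ ⊤ := by finiteness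
  have hDt : D ≠ ⊤ := by rw [hD]; finiteness
  refine ⟨D.toNNReal, r₀, hr₀, fun F hF x hx r hr hr' => ?_⟩
  rw [ENNReal.coe_toNNReal hDt]
  obtain ⟨y₀, hy₀⟩ := h x hx r hr hr'
  have h1 := X.enorm_sq_mul_volume_le hF hy₀
  rw [Measure.addHaar_ball _ _ (by positivity : 0 ≤ c * r), finrank_euclideanSpace_fin] at h1
  have e1 : ENNReal.ofReal ((c * r) ^ 3) * volume (Metric.ball (0 : E3) 1) =
      ENNReal.ofReal (c ^ 3) * b * ENNReal.ofReal (r ^ 3) := by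
    rw [mul_pow, ENNReal.ofReal_mul (by positivity)]; ring
  rw [e1] at h1
  have hr3 : ENNReal.ofReal (r ^ 3) * ENNReal.ofReal (r⁻¹ ^ 3) = 1 := by
    rw [← ENNReal.ofReal_mul (by positivity), ← mul_pow, mul_inv_cancel₀ hr.ne']; simp
  have hr4 : ENNReal.ofReal (r⁻¹ ^ 3) * ENNReal.ofReal r ^ 4 = ENNReal.ofReal r := by
    rw [← ENNReal.ofReal_pow hr.le, ← ENNReal.ofReal_mul (by positivity)]
    congr 1
    field_simp
  calc ‖F x‖ₑ ^ 2 = ‖F x‖ₑ ^ 2 * ((ENNReal.ofReal (c ^ 3) * b)⁻¹ *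
        (ENNReal.ofReal (c ^ 3) * b)) * (ENNReal.ofReal (r ^ 3) * ENNReal.ofReal (r⁻¹ ^ 3)) := by
        rw [ENNReal.inv_mul_cancel hcb0 hcbt, hr3]; simp
    _ = (ENNReal.ofReal (c ^ 3) * b)⁻¹ * ENNReal.ofReal (r⁻¹ ^ 3) *
        (‖F x‖ₑ ^ 2 * (ENNReal.ofReal (c ^ 3) * b * ENNReal.ofReal (r ^ 3))) := by ring
    _ ≤ (ENNReal.ofReal (c ^ 3) * b)⁻¹ * ENNReal.ofReal (r⁻¹ ^ 3) *
        (2 * (ENNReal.ofReal r ^ 4 * X.slobKernel F x + ∫⁻ y in X.cell, ‖F y‖ₑ ^ 2)) := by gcongr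
    _ = D * ((ENNReal.ofReal (r⁻¹ ^ 3) * ENNReal.ofReal r ^ 4) * X.slobKernel F x +
        ENNReal.ofReal (r⁻¹ ^ 3) * ∫⁻ y in X.cell, ‖F y‖ₑ ^ 2) := by rw [hD]; ring
    _ = _ := by rw [hr4]

/-- Optimization in the radius. The two terms balance at `r⁴ = M / H`; adding `r₀⁻⁴ M` to the kernel
ensures that this radius is at most `r₀`. -/
theorem exists_enorm_sq_le_rpow : ∃ C A : ℝ≥0, ∀ F : E3 → E3, Measurable F →
    (∫⁻ y in X.cell, ‖F y‖ₑ ^ 2) ≠ 0 → (∫⁻ y in X.cell, ‖F y‖ₑ ^ 2) ≠ ⊤ → ∀ x ∈ X.cell,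
    ‖F x‖ₑ ^ 2 ≤ C * ((∫⁻ y in X.cell, ‖F y‖ₑ ^ 2) ^ (1 / 4 : ℝ) *
      (X.slobKernel F x + A * ∫⁻ y in X.cell, ‖F y‖ₑ ^ 2) ^ (3 / 4 : ℝ)) := by
  obtain ⟨C, r₀, hr₀, h⟩ := X.exists_enorm_sq_le
  have hApos : (0 : ℝ) < (r₀ ^ 4)⁻¹ := by positivity
  refine ⟨C * 2 + 1, (r₀ ^ 4)⁻¹.toNNReal, fun F hF hM0 hMt x hx => ?_⟩
  set M := ∫⁻ y in X.cell, ‖F y‖ₑ ^ 2 with hM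
  have hA0 : (((r₀ ^ 4)⁻¹.toNNReal : ℝ≥0) : ℝ≥0∞) = ENNReal.ofReal ((r₀ ^ 4)⁻¹) := rfl
  rw [hA0]
  set H := X.slobKernel F x + ENNReal.ofReal ((r₀ ^ 4)⁻¹) * M with hH
  have hM4 : M ^ (1 / 4 : ℝ) ≠ 0 := by
    rw [Ne, ENNReal.rpow_eq_zero_iff]; simp [hM0, hMt]
  rcases eq_or_ne H ⊤ with hHt | hHt
  · rw [hHt, ENNReal.top_rpow_of_pos (by norm_num), ENNReal.mul_top hM4, ENNReal.mul_top (by simp)]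
    exact le_top
  have hH0 : H ≠ 0 := by
    rw [hH]
    have h2 : ENNReal.ofReal ((r₀ ^ 4)⁻¹) ≠ 0 := (ENNReal.ofReal_pos.2 hApos).ne'
    simp only [ne_eq, add_eq_zero, mul_eq_zero, h2, hM0, or_self, and_false, not_false_eq_true]
  have hm : 0 < M.toReal := ENNReal.toReal_pos hM0 hMt
  have hh : 0 < H.toReal := ENNReal.toReal_pos hH0 hHt
  have hmh : (r₀ ^ 4)⁻¹ * M.toReal ≤ H.toReal := by
    have h1 : ENNReal.ofReal ((r₀ ^ 4)⁻¹) * M ≤ H := le_add_self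
    have h2 := ENNReal.toReal_mono hHt h1
    rwa [ENNReal.toReal_mul, ENNReal.toReal_ofReal hApos.le] at h2
  set q : ℝ := M.toReal / H.toReal with hq
  have hqpos : 0 < q := by positivity
  set r : ℝ := q ^ (1 / 4 : ℝ) with hr
  have hrpos : 0 < r := by positivity
  have hr4 : r ^ 4 = q := by
    rw [hr, ← Real.rpow_natCast, ← Real.rpow_mul hqpos.le]; norm_num
  have hrr : r ≤ r₀ := by
    refine le_of_pow_le_pow_left₀ (n := 4) (by norm_num) hr₀.le ?_
    rw [hr4, hq, div_le_iff₀ hh]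
    have := mul_le_mul_of_nonneg_left hmh (show 0 ≤ r₀ ^ 4 by positivity)
    rwa [← mul_assoc, mul_inv_cancel₀ (by positivity), one_mul] at this
  have key : r * H.toReal = M.toReal ^ (1 / 4 : ℝ) * H.toReal ^ (3 / 4 : ℝ) := by
    rw [hr, hq, Real.div_rpow hm.le hh.le, div_mul_eq_mul_div, mul_div_assoc]
    congr 1
    rw [div_eq_iff (by positivity), ← Real.rpow_add hh]
    norm_num
  have key2 : r⁻¹ ^ 3 * M.toReal = r * H.toReal := by
    have : r⁻¹ ^ 3 * M.toReal = r * (M.toReal / r ^ 4) := by field_simp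
    rw [this, hr4, hq]
    field_simp
  have eM : M = ENNReal.ofReal M.toReal := (ENNReal.ofReal_toReal hMt).symm
  have eH : H = ENNReal.ofReal H.toReal := (ENNReal.ofReal_toReal hHt).symm
  have e1 : ENNReal.ofReal r * H = M ^ (1 / 4 : ℝ) * H ^ (3 / 4 : ℝ) := by
    rw [eM, eH, ENNReal.ofReal_rpow_of_pos (by simpa using hm),
      ENNReal.ofReal_rpow_of_pos (by simpa using hh), ← ENNReal.ofReal_mul hrpos.le,
      ← ENNReal.ofReal_mul (by positivity), ← key]
  have e2 : ENNReal.ofReal (r⁻¹ ^ 3) * M = M ^ (1 / 4 : ℝ) * H ^ (3 / 4 : ℝ) := by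
    rw [← e1]
    nth_rewrite 1 [eM]
    rw [eH, ← ENNReal.ofReal_mul (by positivity), key2, ENNReal.ofReal_mul hrpos.le]
  calc ‖F x‖ₑ ^ 2 ≤ C * (ENNReal.ofReal r * X.slobKernel F x + ENNReal.ofReal (r⁻¹ ^ 3) * M) :=
        h F hF x hx r hrpos hrr
    _ ≤ C * (ENNReal.ofReal r * H + ENNReal.ofReal (r⁻¹ ^ 3) * M) := by
        gcongr; exact le_self_add
    _ = (C * 2) * (M ^ (1 / 4 : ℝ) * H ^ (3 / 4 : ℝ)) := by rw [e1, e2]; ring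
    _ ≤ _ := by gcongr; simp

end Setting

namespace Setting

variable (X : Setting)

/-- The embedding `H^{1/2} ⊂ L^{12/5}` with interpolation between `L²` and `H^{1/2}`. -/
theorem exists_lintegral_rpow_le_slob : ∃ C : ℝ≥0, ∀ F : E3 → E3, Measurable F →
    (∫⁻ y in X.cell, ‖F y‖ₑ ^ 2) ≠ ⊤ →
    (∫⁻ x in X.cell, ‖F x‖ₑ ^ (12 / 5 : ℝ)) ^ (5 / 3 : ℝ) ≤
      C * ((∫⁻ y in X.cell, ‖F y‖ₑ ^ 2) *
        ((∫⁻ y in X.cell, ‖F y‖ₑ ^ 2) + ∫⁻ x in X.cell, X.slobKernel F x)) := by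
  obtain ⟨C, A, h⟩ := X.exists_enorm_sq_le_rpow
  set B : ℝ≥0∞ := (C : ℝ≥0∞) ^ (4 / 3 : ℝ) * (1 + A * volume X.cell) with hB
  have hBt : B ≠ ⊤ := by
    have := X.volume_cell_ne_top
    rw [hB]; finiteness
  refine ⟨B.toNNReal, fun F hF hMt => ?_⟩
  rw [ENNReal.coe_toNNReal hBt]
  set M := ∫⁻ y in X.cell, ‖F y‖ₑ ^ 2 with hM
  have hFm : Measurable fun x => ‖F x‖ₑ := hF.enorm
  rcases eq_or_ne M 0 with hM0 | hM0
  · have h1 : ∀ᵐ x ∂volume.restrict X.cell, ‖F x‖ₑ ^ (12 / 5 : ℝ) = 0 := by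
      have := (lintegral_eq_zero_iff (hFm.pow_const 2)).1 hM0
      filter_upwards [this] with x hx
      have : ‖F x‖ₑ = 0 := by simpa using hx
      rw [this, ENNReal.zero_rpow_of_pos (by norm_num)]
    rw [lintegral_congr_ae h1, lintegral_zero, ENNReal.zero_rpow_of_pos (by norm_num)]
    exact zero_le
  set S := ∫⁻ x in X.cell, X.slobKernel F x with hS
  set H : E3 → ℝ≥0∞ := fun x => X.slobKernel F x + A * M with hH
  have hHm : Measurable H := (X.measurable_slobKernel hF).add_const _
  -- Split `|F|^{12/5} = |F|^{4/5} (|F|²)^{4/5}` and use the pointwise bound on the second factor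
  -- only; Hölder with exponents `5/2` and `5/3` then leaves `∫ |F|²` and `∫ H`.
  have hpt : ∀ x ∈ X.cell, ‖F x‖ₑ ^ (12 / 5 : ℝ) ≤
      (C : ℝ≥0∞) ^ (4 / 5 : ℝ) * M ^ (1 / 5 : ℝ) *
        (‖F x‖ₑ ^ (4 / 5 : ℝ) * H x ^ (3 / 5 : ℝ)) := by
    intro x hx
    have h1 := ENNReal.rpow_le_rpow (h F hF hM0 hMt x hx) (show (0 : ℝ) ≤ 4 / 5 by norm_num)
    rw [ENNReal.mul_rpow_of_nonneg _ _ (by norm_num), ENNReal.mul_rpow_of_nonneg _ _ (by norm_num),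
      ← ENNReal.rpow_mul, ← ENNReal.rpow_mul, ← ENNReal.rpow_natCast, ← ENNReal.rpow_mul] at h1
    have e : ‖F x‖ₑ ^ (12 / 5 : ℝ) = ‖F x‖ₑ ^ (4 / 5 : ℝ) * ‖F x‖ₑ ^ ((2 : ℕ) * (4 / 5) : ℝ) := by
      rw [← ENNReal.rpow_add_of_nonneg _ _ (by norm_num) (by norm_num)]; norm_num
    rw [e]
    refine (mul_le_mul_right h1 _).trans_eq ?_
    norm_num [hH]
    ring
  have hpq : Real.HolderConjugate (5 / 2) (5 / 3) := ⟨by norm_num, by norm_num, by norm_num⟩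
  have hhol := ENNReal.lintegral_mul_le_Lp_mul_Lq (volume.restrict X.cell) hpq
    (f := fun x => ‖F x‖ₑ ^ (4 / 5 : ℝ)) (g := fun x => H x ^ (3 / 5 : ℝ))
    (hFm.pow_const _).aemeasurable (hHm.pow_const _).aemeasurable
  have e1 : ∀ x, (‖F x‖ₑ ^ (4 / 5 : ℝ)) ^ (5 / 2 : ℝ) = ‖F x‖ₑ ^ 2 := fun x => by
    rw [← ENNReal.rpow_mul, ← ENNReal.rpow_natCast]; norm_num
  have e2 : ∀ x, (H x ^ (3 / 5 : ℝ)) ^ (5 / 3 : ℝ) = H x := fun x => by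
    rw [← ENNReal.rpow_mul]; norm_num
  simp only [Pi.mul_apply, e1, e2, ← hM] at hhol
  have hHint : ∫⁻ x in X.cell, H x = S + A * M * volume X.cell := by
    rw [hH, lintegral_add_left (X.measurable_slobKernel hF), setLIntegral_const]
  have hI : ∫⁻ x in X.cell, ‖F x‖ₑ ^ (12 / 5 : ℝ) ≤
      (C : ℝ≥0∞) ^ (4 / 5 : ℝ) * M ^ (3 / 5 : ℝ) * (S + A * M * volume X.cell) ^ (3 / 5 : ℝ) := by
    calc _ ≤ ∫⁻ x in X.cell, (C : ℝ≥0∞) ^ (4 / 5 : ℝ) * M ^ (1 / 5 : ℝ) *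
        (‖F x‖ₑ ^ (4 / 5 : ℝ) * H x ^ (3 / 5 : ℝ)) := setLIntegral_mono' X.measurableSet_cell hpt
      _ = (C : ℝ≥0∞) ^ (4 / 5 : ℝ) * M ^ (1 / 5 : ℝ) *
        ∫⁻ x in X.cell, (‖F x‖ₑ ^ (4 / 5 : ℝ) * H x ^ (3 / 5 : ℝ)) :=
        lintegral_const_mul' _ _ (by finiteness)
      _ ≤ (C : ℝ≥0∞) ^ (4 / 5 : ℝ) * M ^ (1 / 5 : ℝ) *
        (M ^ (1 / (5 / 2) : ℝ) * (∫⁻ x in X.cell, H x) ^ (1 / (5 / 3) : ℝ)) := by gcongr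
      _ = (C : ℝ≥0∞) ^ (4 / 5 : ℝ) * (M ^ (1 / 5 : ℝ) * M ^ (2 / 5 : ℝ)) *
          (∫⁻ x in X.cell, H x) ^ (3 / 5 : ℝ) := by norm_num; ring
      _ = _ := by
        rw [← ENNReal.rpow_add_of_nonneg _ _ (by norm_num) (by norm_num), hHint]; norm_num
  have h2 := ENNReal.rpow_le_rpow hI (show (0 : ℝ) ≤ 5 / 3 by norm_num)
  rw [ENNReal.mul_rpow_of_nonneg _ _ (by norm_num), ENNReal.mul_rpow_of_nonneg _ _ (by norm_num),
    ← ENNReal.rpow_mul, ← ENNReal.rpow_mul, ← ENNReal.rpow_mul] at h2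
  norm_num at h2
  refine h2.trans ?_
  have e3 : B * (M * (M + S)) = (C : ℝ≥0∞) ^ (4 / 3 : ℝ) * M *
      ((1 + A * volume X.cell) * (M + S)) := by rw [hB]; ring
  rw [e3]
  gcongr
  calc S + A * M * volume X.cell ≤ (M + S) + (A * volume X.cell) * (M + S) := by
        rw [mul_right_comm]
        gcongr
        · exact le_add_self
        · exact le_self_add
    _ = _ := by ring

theorem lintegral_enorm_sq {F : Type*} [NormedAddCommGroup F]
    (u : Lp F 2 (volume.restrict X.cell)) : ∫⁻ x in X.cell, ‖u x‖ₑ ^ 2 = ‖u‖ₑ ^ 2 := by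
  rw [Lp.enorm_def, eLpNorm_eq_lintegral_rpow_enorm_toReal (by norm_num) (by norm_num)]
  simp only [ENNReal.toReal_ofNat, ENNReal.rpow_ofNat]
  rw [← ENNReal.rpow_natCast, ← ENNReal.rpow_mul]
  norm_num

theorem enorm_grad_le (z : X.H1) : ‖X.grad z‖ₑ ≤ ‖z‖ₑ := by
  rw [← ofReal_norm, ← ofReal_norm]; exact ENNReal.ofReal_le_ofReal (X.norm_grad_le z)

theorem enorm_incl_le (z : X.H1) : ‖X.incl z‖ₑ ≤ ‖z‖ₑ := by
  rw [← ofReal_norm, ← ofReal_norm]; exact ENNReal.ofReal_le_ofReal (X.norm_incl_le z)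

/-- The case `k = 2` of `exists_sobolev`, where `q = 2`. -/
theorem exists_lintegral_pow_six_le : ∃ C : ℝ≥0, ∀ z : X.H1,
    ∫⁻ x in X.cell, ‖X.incl z x‖ₑ ^ 6 ≤ C * ‖z‖ₑ ^ 6 := by
  obtain ⟨C, hC⟩ := X.exists_sobolev 2 (by norm_num)
  refine ⟨C ^ 6 * 4 ^ 3, fun z => ?_⟩
  have h := hC z
  have hj : ∫⁻ x in X.cell, X.jet z x ^ (2 : ℝ) ≤ 4 * ‖z‖ₑ ^ 2 := by
    calc _ ≤ ∫⁻ x in X.cell, (2 * ‖X.grad z x‖ₑ ^ 2 + 2 * ‖X.incl z x‖ₑ ^ 2) := by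
          refine lintegral_mono fun x => ?_
          have := ENNReal.rpow_add_le_mul_rpow_add_rpow ‖X.grad z x‖ₑ ‖X.incl z x‖ₑ (p := 2)
            (by norm_num)
          norm_num at this
          simpa [jet, mul_add] using this
      _ = 2 * ‖X.grad z‖ₑ ^ 2 + 2 * ‖X.incl z‖ₑ ^ 2 := by
          rw [lintegral_add_left (((Lp.stronglyMeasurable (X.grad z)).enorm.pow_const 2).const_mul 2),
            lintegral_const_mul' _ _ (by finiteness), lintegral_const_mul' _ _ (by finiteness),
            lintegral_enorm_sq, lintegral_enorm_sq]
      _ ≤ 2 * ‖z‖ₑ ^ 2 + 2 * ‖z‖ₑ ^ 2 := by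
          gcongr
          · exact X.enorm_grad_le z
          · exact X.enorm_incl_le z
      _ = _ := by ring
  have e0 : ∀ x, ‖X.incl z x‖ₑ ^ (3 * (2 : ℕ) : ℝ) = ‖X.incl z x‖ₑ ^ 6 := fun x => by
    rw [← ENNReal.rpow_natCast]; norm_num
  simp only [e0] at h
  norm_num at h
  refine h.trans ?_
  have h2 : (∫⁻ x in X.cell, X.jet z x ^ 2) ≤ 4 * ‖z‖ₑ ^ 2 := by simpa using hj
  calc _ ≤ ((C : ℝ≥0∞) * (4 * ‖z‖ₑ ^ 2) ^ (1 / 2 : ℝ)) ^ 6 := by gcongr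
    _ = (C : ℝ≥0∞) ^ 6 * (4 * ‖z‖ₑ ^ 2) ^ 3 := by
        rw [mul_pow, ← ENNReal.rpow_natCast (_ ^ (1 / 2 : ℝ)), ← ENNReal.rpow_mul,
          ← ENNReal.rpow_natCast _ 3]
        norm_num
    _ = _ := by push_cast; ring

/-- The Slobodetskii norm of `H^{3/2}` in either setting. -/
def slobSq (z : X.H1) : ℝ≥0∞ := ‖z‖ₑ ^ 2 + ∫⁻ x in X.cell, X.slobKernel (X.grad z) x

/-- The case `k = 4`, where `q = 12/5`. The gradient is in `L^{12/5}` by the Slobodetskii embedding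
and the function by `L⁶`; the exponents are such that `‖z‖⁴_{L¹²}` is linear in the square of the
`H^{3/2}` norm, hence integrable in time. -/
theorem exists_lintegral_pow_twelve_le : ∃ C : ℝ≥0, ∀ z : X.H1,
    (∫⁻ x in X.cell, ‖X.incl z x‖ₑ ^ 12) ^ (1 / 3 : ℝ) ≤ C * (‖z‖ₑ ^ 2 * X.slobSq z) := by
  obtain ⟨C₄, h₄⟩ := X.exists_sobolev 4 (by norm_num)
  obtain ⟨C₆, h₆⟩ := X.exists_lintegral_pow_six_le
  obtain ⟨C₁, h₁⟩ := X.exists_lintegral_rpow_le_slob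
  set B : ℝ≥0∞ := (C₄ : ℝ≥0∞) ^ 4 * ((2 : ℝ≥0∞) ^ (7 / 5 : ℝ)) ^ (5 / 3 : ℝ) *
    2 ^ (2 / 3 : ℝ) * (C₁ + (C₆ : ℝ≥0∞) ^ (2 / 3 : ℝ) * volume X.cell) with hB
  have hBt : B ≠ ⊤ := by
    have := X.volume_cell_ne_top
    rw [hB]; finiteness
  refine ⟨B.toNNReal, fun z => ?_⟩
  rw [ENNReal.coe_toNNReal hBt]
  have hgm : Measurable fun x => ‖X.grad z x‖ₑ := (Lp.stronglyMeasurable (X.grad z)).enorm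
  have him : Measurable fun x => ‖X.incl z x‖ₑ := (Lp.stronglyMeasurable (X.incl z)).enorm
  set a := ∫⁻ x in X.cell, ‖X.grad z x‖ₑ ^ (12 / 5 : ℝ) with ha
  set b := ∫⁻ x in X.cell, ‖X.incl z x‖ₑ ^ (12 / 5 : ℝ) with hb
  have hj : ∫⁻ x in X.cell, X.jet z x ^ (12 / 5 : ℝ) ≤ 2 ^ (7 / 5 : ℝ) * (a + b) := by
    calc _ ≤ ∫⁻ x in X.cell, 2 ^ (7 / 5 : ℝ) *
          (‖X.grad z x‖ₑ ^ (12 / 5 : ℝ) + ‖X.incl z x‖ₑ ^ (12 / 5 : ℝ)) := by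
          refine lintegral_mono fun x => ?_
          have := ENNReal.rpow_add_le_mul_rpow_add_rpow ‖X.grad z x‖ₑ ‖X.incl z x‖ₑ (p := 12 / 5)
            (by norm_num)
          norm_num at this
          simpa [jet] using this
      _ = _ := by
          rw [lintegral_const_mul' _ _ (by finiteness), lintegral_add_left (hgm.pow_const _)]
  have hab : (a + b) ^ (5 / 3 : ℝ) ≤ 2 ^ (2 / 3 : ℝ) * (a ^ (5 / 3 : ℝ) + b ^ (5 / 3 : ℝ)) := by
    have := ENNReal.rpow_add_le_mul_rpow_add_rpow a b (p := 5 / 3) (by norm_num)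
    norm_num at this
    simpa using this
  have hM : ∫⁻ y in X.cell, ‖X.grad z y‖ₑ ^ 2 ≤ ‖z‖ₑ ^ 2 := by
    rw [lintegral_enorm_sq]; gcongr; exact X.enorm_grad_le z
  have ha' : a ^ (5 / 3 : ℝ) ≤ C₁ * (‖z‖ₑ ^ 2 * X.slobSq z) := by
    refine (h₁ (X.grad z) (Lp.stronglyMeasurable _).measurable
      (ne_top_of_le_ne_top (by finiteness) hM)).trans ?_
    unfold slobSq
    gcongr
  have hb' : b ^ (5 / 3 : ℝ) ≤ (C₆ : ℝ≥0∞) ^ (2 / 3 : ℝ) * volume X.cell *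
      (‖z‖ₑ ^ 2 * X.slobSq z) := by
    have hpq : Real.HolderConjugate (5 / 2) (5 / 3) := ⟨by norm_num, by norm_num, by norm_num⟩
    have hhol := ENNReal.lintegral_mul_le_Lp_mul_Lq (volume.restrict X.cell) hpq
      (f := fun x => ‖X.incl z x‖ₑ ^ (12 / 5 : ℝ)) (g := fun _ => 1)
      (him.pow_const _).aemeasurable aemeasurable_const
    have e1 : ∀ x, (‖X.incl z x‖ₑ ^ (12 / 5 : ℝ)) ^ (5 / 2 : ℝ) = ‖X.incl z x‖ₑ ^ 6 := fun x => by
      rw [← ENNReal.rpow_mul, ← ENNReal.rpow_natCast]; norm_num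
    simp only [Pi.mul_apply, e1, ENNReal.one_rpow, mul_one, setLIntegral_const, one_mul] at hhol
    rw [← hb] at hhol
    have h2 := ENNReal.rpow_le_rpow (hhol.trans (mul_le_mul_left
      (ENNReal.rpow_le_rpow (h₆ z) (by norm_num)) _)) (show (0 : ℝ) ≤ 5 / 3 by norm_num)
    rw [ENNReal.mul_rpow_of_nonneg _ _ (by norm_num), ← ENNReal.rpow_mul, ← ENNReal.rpow_mul,
      ENNReal.mul_rpow_of_nonneg _ _ (by norm_num), ← ENNReal.rpow_natCast, ← ENNReal.rpow_mul] at h2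
    norm_num at h2
    refine h2.trans ?_
    rw [mul_right_comm]
    gcongr
    calc ‖z‖ₑ ^ 4 = ‖z‖ₑ ^ 2 * ‖z‖ₑ ^ 2 := by ring
      _ ≤ _ := by gcongr; exact le_self_add
  have h := h₄ z
  have e0 : ∀ x, ‖X.incl z x‖ₑ ^ (3 * (4 : ℕ) : ℝ) = ‖X.incl z x‖ₑ ^ 12 := fun x => by
    rw [← ENNReal.rpow_natCast]; norm_num
  simp only [e0] at h
  norm_num at h
  have h' := ENNReal.rpow_le_rpow h (show (0 : ℝ) ≤ 1 / 3 by norm_num)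
  refine h'.trans ?_
  calc _ = (C₄ : ℝ≥0∞) ^ 4 * (∫⁻ x in X.cell, X.jet z x ^ (12 / 5 : ℝ)) ^ (5 / 3 : ℝ) := by
        rw [← ENNReal.rpow_natCast, ← ENNReal.rpow_mul]
        norm_num
        rw [mul_pow, ← ENNReal.rpow_natCast (_ ^ (5 / 12 : ℝ)), ← ENNReal.rpow_mul]
        norm_num
    _ ≤ (C₄ : ℝ≥0∞) ^ 4 * (2 ^ (7 / 5 : ℝ) * (a + b)) ^ (5 / 3 : ℝ) := by gcongr
    _ = (C₄ : ℝ≥0∞) ^ 4 * ((2 ^ (7 / 5 : ℝ)) ^ (5 / 3 : ℝ) * (a + b) ^ (5 / 3 : ℝ)) := by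
        rw [ENNReal.mul_rpow_of_nonneg _ _ (by norm_num)]
    _ ≤ (C₄ : ℝ≥0∞) ^ 4 * ((2 ^ (7 / 5 : ℝ)) ^ (5 / 3 : ℝ) * (2 ^ (2 / 3 : ℝ) *
        (C₁ * (‖z‖ₑ ^ 2 * X.slobSq z) + (C₆ : ℝ≥0∞) ^ (2 / 3 : ℝ) * volume X.cell *
      (‖z‖ₑ ^ 2 * X.slobSq z)))) := by
        gcongr
        exact hab.trans (by gcongr)
    _ = _ := by rw [hB]; ring

end Setting

/-! ### Completeness of the trigonometric system; eigenfunctions on the torus. -/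

/-- The map from the period cell to the torus `(ℝ / ℤ)³`. -/
def torusMap (x : E3) : UnitAddTorus (Fin 3) :=
  fun i => (((2 * Real.pi)⁻¹ * x i : ℝ) : UnitAddCircle)

/-- The section of `torusMap` with values in the period cell. -/
def torusSection (t : UnitAddTorus (Fin 3)) : E3 :=
  WithLp.toLp 2 fun i => 2 * Real.pi * (AddCircle.equivIoc 1 (0 : ℝ) (t i) : ℝ)

theorem continuous_torusMap : Continuous torusMap := by
  refine continuous_pi fun i => (AddCircle.continuous_mk' 1).comp ?_
  fun_prop

theorem measurable_torusSection : Measurable torusSection := by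
  have h : Measurable fun t : UnitAddTorus (Fin 3) => fun i =>
      2 * Real.pi * (AddCircle.equivIoc 1 (0 : ℝ) (t i) : ℝ) := by
    refine measurable_pi_lambda _ fun i => Measurable.const_mul ?_ _
    exact measurable_subtype_coe.comp
      ((AddCircle.measurableEquivIoc 1 (0 : ℝ)).measurable.comp (measurable_pi_apply i))
  exact (WithLp.measurable_toLp 2 _).comp h

theorem torusSection_torusMap {x : E3} (hx : x ∈ Setting.periodic.cell) :
    torusSection (torusMap x) = x := by
  ext i
  have hp : (0 : ℝ) < 2 * Real.pi := by positivity
  have h1 : (2 * Real.pi)⁻¹ * x i ∈ Ioc (0 : ℝ) (0 + 1) := by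
    have := hx i
    refine ⟨mul_pos (by positivity) this.1, ?_⟩
    rw [zero_add]
    exact ((inv_mul_lt_one₀ hp).2 this.2).le
  have h2 : (AddCircle.equivIoc 1 (0 : ℝ) ((((2 * Real.pi)⁻¹ * x i : ℝ)) : UnitAddCircle) : ℝ) =
      (2 * Real.pi)⁻¹ * x i := by
    have := (AddCircle.equivIoc 1 (0 : ℝ)).apply_symm_apply ⟨_, h1⟩
    exact congrArg Subtype.val this
  change 2 * Real.pi * (AddCircle.equivIoc 1 (0 : ℝ) _ : ℝ) = x i
  rw [torusMap, h2]
  field_simp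

/-- An integer frequency vector. -/
def freq (k : Fin 3 → ℤ) : E3 := WithLp.toLp 2 fun i => (k i : ℝ)

theorem inner_freq (k : Fin 3 → ℤ) (x : E3) : inner ℝ (freq k) x = ∑ i, (k i : ℝ) * x i := by
  rw [PiLp.inner_apply]
  simp [freq, mul_comm]

theorem mFourier_torusMap (k : Fin 3 → ℤ) (x : E3) :
    UnitAddTorus.mFourier k (torusMap x) = Complex.exp ((inner ℝ (freq k) x : ℝ) * Complex.I) := by
  rw [inner_freq]
  simp only [UnitAddTorus.mFourier, ContinuousMap.coe_mk, torusMap, fourier_coe_apply]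
  rw [← Complex.exp_sum]
  congr 1
  push_cast
  rw [Finset.sum_mul]
  refine Finset.sum_congr rfl fun i _ => ?_
  have : (Real.pi : ℂ) ≠ 0 := by exact_mod_cast Real.pi_ne_zero
  field_simp

theorem integral_mul_cexp_eq {μ : Measure E3} {q θ : E3 → ℝ}
    (h1 : Integrable (fun x => q x * Real.cos (θ x)) μ)
    (h2 : Integrable (fun x => q x * Real.sin (θ x)) μ) :
    ∫ x, (q x : ℂ) * Complex.exp ((θ x : ℝ) * Complex.I) ∂μ =
      ((∫ x, q x * Real.cos (θ x) ∂μ : ℝ) : ℂ) +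
        ((∫ x, q x * Real.sin (θ x) ∂μ : ℝ) : ℂ) * Complex.I := by
  rw [← integral_complex_ofReal, ← integral_complex_ofReal, ← integral_mul_const, ← integral_add]
  · refine integral_congr_ae (Eventually.of_forall fun x => ?_)
    simp only [Complex.exp_mul_I]
    push_cast
    ring
  · exact h1.ofReal
  · exact h2.ofReal.mul_const _

/-- Completeness of the trigonometric system. -/
theorem eq_zero_of_trig_orthogonal (q : Setting.periodic.L2)
    (hc : ∀ k, ∫ x in Setting.periodic.cell, q x * Real.cos (inner ℝ (freq k) x) = 0)
    (hs : ∀ k, ∫ x in Setting.periodic.cell, q x * Real.sin (inner ℝ (freq k) x) = 0) : q = 0 := by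
  set μ := volume.restrict Setting.periodic.cell with hμ
  -- The function is transported to the standard torus with the image measure. Identifying `ν` with
  -- Haar measure is unnecessary: trigonometric polynomials are uniformly dense in the continuous
  -- functions, and these are dense in `L²(ν)`.
  set ν : Measure (UnitAddTorus (Fin 3)) := μ.map torusMap with hν
  have hmeas : Measurable torusMap := continuous_torusMap.measurable
  have hsec : ∀ᵐ x ∂μ, torusSection (torusMap x) = x :=
    (ae_restrict_iff' Setting.periodic.measurableSet_cell).2
      (Eventually.of_forall fun x hx => torusSection_torusMap hx)
  set Q : UnitAddTorus (Fin 3) → ℂ := fun t => ((q (torusSection t) : ℝ) : ℂ) with hQ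
  have hqm : Measurable q := (Lp.stronglyMeasurable q).measurable
  have hQm : Measurable Q :=
    Complex.measurable_ofReal.comp (hqm.comp measurable_torusSection)
  have hQmem : MemLp Q 2 ν := by
    rw [hν, memLp_map_measure_iff hQm.aestronglyMeasurable hmeas.aemeasurable]
    refine ((Lp.memLp q).ofReal (K := ℂ)).ae_eq ?_
    filter_upwards [hsec] with x hx
    simp only [hQ, Function.comp_apply, hx]
    rfl
  have hqi : Integrable q μ := (Lp.memLp q).integrable (by norm_num)
  have hInt : ∀ k, ∫ x, (q x : ℂ) * UnitAddTorus.mFourier k (torusMap x) ∂μ = 0 := by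
    intro k
    simp only [mFourier_torusMap]
    have hcont : Continuous fun x : E3 => inner ℝ (freq k) x := by fun_prop
    rw [integral_mul_cexp_eq, hc, hs]
    · simp
    · exact hqi.mul_of_top_left (memLp_top_of_bound
        (Real.continuous_cos.comp hcont).aestronglyMeasurable 1
        (Eventually.of_forall fun x => by simpa using Real.abs_cos_le_one _))
    · exact hqi.mul_of_top_left (memLp_top_of_bound
        (Real.continuous_sin.comp hcont).aestronglyMeasurable 1
        (Eventually.of_forall fun x => by simpa using Real.abs_sin_le_one _))
  have horth : ∀ F : C(UnitAddTorus (Fin 3), ℂ),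
      inner ℂ (hQmem.toLp Q) (ContinuousMap.toLp 2 ν ℂ F) = 0 := by
    set L : C(UnitAddTorus (Fin 3), ℂ) →L[ℂ] ℂ :=
      (innerSL ℂ (hQmem.toLp Q)).comp (ContinuousMap.toLp 2 ν ℂ) with hL
    have hcl : IsClosed (LinearMap.ker L.toLinearMap : Set C(UnitAddTorus (Fin 3), ℂ)) :=
      L.isClosed_ker
    have hle : Submodule.span ℂ (range (UnitAddTorus.mFourier (d := Fin 3))) ≤
        LinearMap.ker L.toLinearMap := by
      rw [Submodule.span_le]
      rintro _ ⟨k, rfl⟩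
      change inner ℂ (hQmem.toLp Q) (ContinuousMap.toLp 2 ν ℂ (UnitAddTorus.mFourier k)) = 0
      rw [L2.inner_def]
      have e1 : ∫ t, inner ℂ (hQmem.toLp Q t)
          (ContinuousMap.toLp 2 ν ℂ (UnitAddTorus.mFourier k) t) ∂ν =
          ∫ t, Q t * UnitAddTorus.mFourier k t ∂ν := by
        refine integral_congr_ae ?_
        filter_upwards [hQmem.coeFn_toLp,
          ContinuousMap.coeFn_toLp (p := 2) (𝕜 := ℂ) ν (UnitAddTorus.mFourier k)] with t h1 h2
        rw [h1, h2, RCLike.inner_apply]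
        simp [hQ, mul_comm]
      have hsm : AEStronglyMeasurable (fun t => Q t * UnitAddTorus.mFourier k t)
          (μ.map torusMap) :=
        hQm.aestronglyMeasurable.mul (ContinuousMap.continuous _).aestronglyMeasurable
      rw [e1, hν, integral_map hmeas.aemeasurable hsm, ← hInt k]
      refine integral_congr_ae ?_
      filter_upwards [hsec] with x hx
      simp only [hQ, hx]
    have htop := Submodule.topologicalClosure_minimal _ hle hcl
    rw [UnitAddTorus.span_mFourier_closure_eq_top] at htop
    intro F
    exact htop (Submodule.mem_top (x := F))
  have hzero : hQmem.toLp Q = 0 := by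
    have hd := ContinuousMap.toLp_denseRange ℂ ν ℂ (p := 2) (by norm_num)
    refine (inner_self_eq_zero (𝕜 := ℂ)).1 ?_
    have : ∀ g : Lp ℂ 2 ν, inner ℂ (hQmem.toLp Q) g = 0 := fun g => by
      refine hd.induction_on (p := fun g => inner ℂ (hQmem.toLp Q) g = 0) g ?_ horth
      exact isClosed_eq (by fun_prop) continuous_const
    exact this _
  have hQ0 : Q =ᵐ[ν] 0 := (MemLp.toLp_eq_toLp_iff hQmem MemLp.zero).1 (by rw [hzero]; rfl)
  have h3 := ae_of_ae_map hmeas.aemeasurable hQ0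
  refine (Lp.eq_zero_iff_ae_eq_zero).2 ?_
  filter_upwards [h3, hsec] with x hx hx'
  simpa [hQ, hx'] using hx

section Trig

theorem integral_cell_add {F : Type*} [NormedAddCommGroup F] [NormedSpace ℝ F] {p : E3 → F}
    (hp : LatticeInvariant p) (h : E3) :
    ∫ x in Setting.periodic.cell, p (x + h) = ∫ x in Setting.periodic.cell, p x := by
  open scoped Pointwise in
  have hfd := ZSpan.isAddFundamentalDomain' periodBasis (volume : Measure E3)
  have : Countable (Submodule.span ℤ (Set.range periodBasis)).toAddSubgroup :=
    inferInstanceAs (Countable (Submodule.span ℤ (Set.range periodBasis)))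
  have hfd' := hfd.vadd_of_comm h
  rw [← setIntegral_congr_set fundamentalDomain_ae_eq_cell,
    ← setIntegral_congr_set fundamentalDomain_ae_eq_cell]
  rw [hfd.setIntegral_eq hfd' (f := p) (fun g x => hp g.1 g.2 x)]
  have h1 := (measurePreserving_add_right (volume : Measure E3) h).setIntegral_preimage_emb
    (measurableEmbedding_addRight h) p (h +ᵥ ZSpan.fundamentalDomain periodBasis)
  rw [← h1]
  congr 2
  ext x
  simp only [mem_preimage, mem_vadd_set_iff_neg_vadd_mem, vadd_eq_add]
  rw [add_comm x h, neg_add_cancel_left]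

/-- The integral over the torus of a derivative vanishes. -/
theorem integral_cell_fderiv_eq_zero {G : E3 → ℝ} (hG : ContDiff ℝ 1 G) (hp : LatticeInvariant G)
    (v : E3) : ∫ x in Setting.periodic.cell, fderiv ℝ G x v = 0 := by
  have hcG := hG.continuous_fderiv one_ne_zero
  obtain ⟨R, hR⟩ := Setting.periodic.isBounded_cell.exists_norm_le
  obtain ⟨M, hM⟩ := (isCompact_closedBall (0 : E3) (R + ‖v‖)).exists_bound_of_continuousOn
    hcG.continuousOn
  have hmem : ∀ᵐ x ∂volume.restrict Setting.periodic.cell, x ∈ Setting.periodic.cell :=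
    ae_restrict_mem Setting.periodic.measurableSet_cell
  have key := hasDerivAt_integral_of_dominated_loc_of_deriv_le
    (μ := volume.restrict Setting.periodic.cell) (F := fun (s : ℝ) x => G (x + s • v))
    (F' := fun (s : ℝ) x => fderiv ℝ G (x + s • v) v) (x₀ := 0) (s := Metric.ball 0 1)
    (bound := fun _ => M * ‖v‖)
    (Metric.ball_mem_nhds _ one_pos) ?_ ?_ ?_ ?_ (integrable_const _) ?_
  · have h1 := key.2
    -- The integral of a translate is constant in the translation parameter, so differentiating
    -- under the integral gives zero.
    have h2 : (fun s : ℝ => ∫ x in Setting.periodic.cell, G (x + s • v)) =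
        fun _ => ∫ x in Setting.periodic.cell, G x := by
      ext s; exact integral_cell_add hp _
    rw [h2] at h1
    have := h1.unique (hasDerivAt_const (0 : ℝ) _)
    simpa using this
  · exact Eventually.of_forall fun s =>
      (hG.continuous.comp (by fun_prop)).aestronglyMeasurable
  · exact (Setting.periodic.memLp_of_continuous' (F := ℝ) (h := fun x => G (x + (0 : ℝ) • v))
      (hG.continuous.comp (by fun_prop)) 2).integrable (by norm_num)
  · refine Continuous.aestronglyMeasurable ?_
    exact (hcG.comp (by fun_prop)).clm_apply continuous_const
  · filter_upwards [hmem] with x hx s hs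
    refine (ContinuousLinearMap.le_opNorm _ _).trans ?_
    gcongr
    refine hM _ ?_
    rw [mem_closedBall_zero_iff]
    refine (norm_add_le _ _).trans (add_le_add (hR x hx) ?_)
    rw [norm_smul]
    have : ‖s‖ ≤ 1 := by simpa using (mem_ball_zero_iff.1 hs).le
    nlinarith [norm_nonneg v]
  · refine Eventually.of_forall fun x s _ => ?_
    have h1 : HasFDerivAt G (fderiv ℝ G (x + s • v)) (x + s • v) :=
      (hG.differentiable one_ne_zero _).hasFDerivAt
    have h2 : HasDerivAt (fun s : ℝ => x + s • v) v s := by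
      simpa using ((hasDerivAt_id s).smul_const v).const_add x
    exact h1.comp_hasDerivAt s h2

end Trig

theorem inner_toLp_eq_integral {X : Setting} {φ : E3 → ℝ} {e : X.L2} (q : X.L2)
    (he : e =ᵐ[volume.restrict X.cell] φ) : inner ℝ q e = ∫ x in X.cell, q x * φ x := by
  rw [L2.inner_def]
  refine integral_congr_ae ?_
  filter_upwards [he] with x hx
  rw [hx, RCLike.inner_apply]
  simp [mul_comm]

/-- A periodic function whose gradient points in a fixed direction `a` and has the form `χ a` with
`∂_a χ = -l φ` is an eigenfunction. -/
theorem incl_mem_eigenspace_of_plane_wave {φ χ : E3 → ℝ} {a : E3} {l : ℝ}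
    (hφ : Setting.periodic.IsTest φ) (hχ : ContDiff ℝ 1 χ) (hχp : IsPeriodic χ)
    (hgrad : ∀ x, gradient φ x = χ x • a) (hd : ∀ x, fderiv ℝ χ x a = -(l * φ x))
    {w : Setting.periodic.H1} (hw : Setting.periodic.IsLift φ w) :
    Setting.periodic.incl w ∈ Setting.periodic.eigenspace l := by
  refine ⟨w, rfl, fun z => ?_⟩
  have hcl : IsClosed {z : Setting.periodic.H1 |
      inner ℝ (Setting.periodic.grad w) (Setting.periodic.grad z) =
        l * inner ℝ (Setting.periodic.incl w) (Setting.periodic.incl z)} :=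
    isClosed_eq (by fun_prop) (by fun_prop)
  refine hcl.closure_subset_iff.2 ?_ (Setting.periodic.dense_lift z)
  rintro v ⟨ψ, hψ, hv⟩
  have hψ1 : ContDiff ℝ 1 ψ := hψ.contDiff.of_le (by simp)
  have hφ1 : ContDiff ℝ 1 φ := hφ.contDiff.of_le (by simp)
  have hinv : LatticeInvariant fun x => χ x * ψ x := by
    have h1 := hχp.latticeInvariant
    have h2 := IsPeriodic.latticeInvariant hψ.2
    intro g hg x
    simp only [h1 g hg x, h2 g hg x]
  -- Integration by parts on the torus: the integral of `∂_a (χ ψ)` vanishes, which is the weak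
  -- eigenvalue equation tested with `ψ`.
  have h0 := integral_cell_fderiv_eq_zero (hχ.mul hψ1) hinv a
  have e1 : ∀ x, fderiv ℝ (fun x => χ x * ψ x) x a =
      χ x * inner ℝ a (gradient ψ x) - l * (φ x * ψ x) := by
    intro x
    rw [fderiv_fun_mul (hχ.differentiable one_ne_zero x) (hψ1.differentiable one_ne_zero x)]
    have : inner ℝ a (gradient ψ x) = fderiv ℝ ψ x a := by
      rw [real_inner_comm, gradient, InnerProductSpace.toDual_symm_apply]
    rw [this]
    simp only [_root_.add_apply, _root_.smul_apply, smul_eq_mul, hd]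
    ring
  simp only [e1] at h0
  rw [integral_sub, integral_const_mul, sub_eq_zero] at h0
  · rw [mem_ofPred_eq, L2.inner_def, inner_toLp_eq_integral _ hv.1]
    have h1 : ∫ x in Setting.periodic.cell, Setting.periodic.incl w x * ψ x =
        ∫ x in Setting.periodic.cell, φ x * ψ x := by
      refine integral_congr_ae ?_
      filter_upwards [hw.1] with x hx
      rw [hx]
    rw [h1, ← h0]
    refine integral_congr_ae ?_
    filter_upwards [hw.2, hv.2] with x h2 h3
    rw [h2, h3, hgrad, real_inner_smul_left]
  · refine (Setting.periodic.memLp_of_continuous' (F := ℝ) (hχ.continuous.mul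
      (continuous_const.inner (Setting.continuous_gradient hψ.contDiff))) 2).integrable (by norm_num)
  · refine (Setting.periodic.memLp_of_continuous' (F := ℝ) (continuous_const.mul
      (hφ1.continuous.mul hψ1.continuous)) 2).integrable (by norm_num)

theorem inner_freq_add_single (k : Fin 3 → ℤ) (x : E3) (i : Fin 3) :
    inner ℝ (freq k) (x + EuclideanSpace.single i (2 * Real.pi)) =
      inner ℝ (freq k) x + k i * (2 * Real.pi) := by
  rw [inner_add_right, EuclideanSpace.inner_single_right]
  simp [freq, mul_comm]

theorem isPeriodic_comp_inner_freq {p : ℝ → ℝ} (hp : Function.Periodic p (2 * Real.pi))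
    (k : Fin 3 → ℤ) : IsPeriodic fun x => p (inner ℝ (freq k) x) := by
  intro i x
  simp only [inner_freq_add_single]
  exact hp.int_mul (k i) _

theorem hasFDerivAt_comp_inner {p : ℝ → ℝ} {p' : ℝ} (a x : E3)
    (hp : HasDerivAt p p' (inner ℝ a x)) :
    HasFDerivAt (fun y => p (inner ℝ a y)) (p' • innerSL ℝ a) x :=
  hp.comp_hasFDerivAt x (innerSL ℝ a).hasFDerivAt

theorem gradient_comp_inner {p : ℝ → ℝ} {p' : ℝ} (a x : E3)
    (hp : HasDerivAt p p' (inner ℝ a x)) : gradient (fun y => p (inner ℝ a y)) x = p' • a := by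
  rw [gradient, (hasFDerivAt_comp_inner a x hp).fderiv, map_smul]
  congr 1
  exact (InnerProductSpace.toDual ℝ E3).symm_apply_apply a

theorem incl_cos_mem_eigenspace (k : Fin 3 → ℤ) : ∃ w : Setting.periodic.H1,
    Setting.periodic.incl w ∈ Setting.periodic.eigenspace (‖freq k‖ ^ 2) ∧
    Setting.periodic.incl w =ᵐ[volume.restrict Setting.periodic.cell]
      fun x => Real.cos (inner ℝ (freq k) x) := by
  have ht : Setting.periodic.IsTest fun x => Real.cos (inner ℝ (freq k) x) :=
    ⟨Real.contDiff_cos.comp (innerSL ℝ (freq k)).contDiff, isPeriodic_comp_inner_freq Real.cos_periodic k⟩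
  obtain ⟨w, hw⟩ := ht.exists_lift
  refine ⟨w, ?_, hw.1⟩
  refine incl_mem_eigenspace_of_plane_wave ht (χ := fun x => -Real.sin (inner ℝ (freq k) x))
    (a := freq k) (Real.contDiff_sin.neg.comp (innerSL ℝ (freq k)).contDiff) ?_ ?_ ?_ hw
  · exact isPeriodic_comp_inner_freq (p := fun t => -Real.sin t)
      (fun t => by simp [Real.sin_add_two_pi]) k
  · exact fun x => gradient_comp_inner _ _ (Real.hasDerivAt_cos _)
  · intro x
    rw [(hasFDerivAt_comp_inner (p := fun t => -Real.sin t) _ x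
      (Real.hasDerivAt_sin _).neg).fderiv]
    simp [mul_comm]

theorem incl_sin_mem_eigenspace (k : Fin 3 → ℤ) : ∃ w : Setting.periodic.H1,
    Setting.periodic.incl w ∈ Setting.periodic.eigenspace (‖freq k‖ ^ 2) ∧
    Setting.periodic.incl w =ᵐ[volume.restrict Setting.periodic.cell]
      fun x => Real.sin (inner ℝ (freq k) x) := by
  have ht : Setting.periodic.IsTest fun x => Real.sin (inner ℝ (freq k) x) :=
    ⟨Real.contDiff_sin.comp (innerSL ℝ (freq k)).contDiff, isPeriodic_comp_inner_freq Real.sin_periodic k⟩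
  obtain ⟨w, hw⟩ := ht.exists_lift
  refine ⟨w, ?_, hw.1⟩
  refine incl_mem_eigenspace_of_plane_wave ht (χ := fun x => Real.cos (inner ℝ (freq k) x))
    (a := freq k) (Real.contDiff_cos.comp (innerSL ℝ (freq k)).contDiff) ?_ ?_ ?_ hw
  · exact isPeriodic_comp_inner_freq Real.cos_periodic k
  · exact fun x => gradient_comp_inner _ _ (Real.hasDerivAt_sin _)
  · intro x
    rw [(hasFDerivAt_comp_inner _ x (Real.hasDerivAt_cos _)).fderiv]
    simp [mul_comm]

/-- On the torus the eigenspaces span `L²`. -/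
theorem eq_zero_of_formProj_eq_zero (q : Setting.periodic.L2)
    (h : ∀ μ, formProj Setting.periodic.incl Setting.periodic.grad μ q = 0) : q = 0 := by
  have horth : ∀ (μ : ℝ) (e : Setting.periodic.L2), e ∈ Setting.periodic.eigenspace μ →
      inner ℝ q e = 0 := fun μ e he => by
    have := inner_sub_formProj q (μ := μ) (f := e) he
    rwa [h, sub_zero] at this
  refine eq_zero_of_trig_orthogonal q (fun k => ?_) fun k => ?_
  · obtain ⟨w, hw, hw'⟩ := incl_cos_mem_eigenspace k
    rw [← inner_toLp_eq_integral q hw', horth _ _ hw]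
  · obtain ⟨w, hw, hw'⟩ := incl_sin_mem_eigenspace k
    rw [← inner_toLp_eq_integral q hw', horth _ _ hw]

/-- A function orthogonal to the range is orthogonal to all compactly supported test functions on a
domain, and to all sines and cosines on the torus. -/
theorem Setting.denseRange_incl (X : Setting) : DenseRange X.incl := by
  have h : (LinearMap.range X.incl.toLinearMap).topologicalClosure = ⊤ := by
    rw [Submodule.topologicalClosure_eq_top_iff, Submodule.eq_bot_iff]
    intro q hq
    have hq' : ∀ w, inner ℝ q (X.incl w) = 0 := fun w =>
      (Submodule.mem_orthogonal' _ _).1 hq _ ⟨w, rfl⟩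
    cases X with
    | dirichlet Ω hΩ =>
      refine (Lp.eq_zero_iff_ae_eq_zero).2 ?_
      refine Setting.ae_eq_zero_of_integral_eq_zero _ (Lp.memLp _) fun ψ hψ hc hs => ?_
      have ht : (dirichlet Ω hΩ).IsTest ψ := ⟨hψ, hc, hs⟩
      obtain ⟨w, hw⟩ := ht.exists_lift
      have := hq' w
      rw [inner_toLp_eq_integral q hw.1] at this
      simpa [mul_comm] using this
    | periodic =>
      refine eq_zero_of_trig_orthogonal q (fun k => ?_) fun k => ?_
      · obtain ⟨w, -, hw'⟩ := incl_cos_mem_eigenspace k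
        rw [← inner_toLp_eq_integral q hw', hq']
      · obtain ⟨w, -, hw'⟩ := incl_sin_mem_eigenspace k
        rw [← inner_toLp_eq_integral q hw', hq']
  have h2 : Dense ((LinearMap.range X.incl.toLinearMap : Submodule ℝ X.L2) : Set X.L2) :=
    (Submodule.dense_iff_topologicalClosure_eq_top).2 h
  rwa [LinearMap.coe_range] at h2

/-! ### Translations on the torus and the comparison of the two `H^{3/2}` norms. -/

theorem measurable_fract_periodBasis : Measurable (ZSpan.fract periodBasis) := by
  have h : ZSpan.fract periodBasis = fun x : E3 =>
      ∑ i, Int.fract ((2 * Real.pi)⁻¹ * x i) • periodBasis i := by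
    ext1 x
    rw [← periodBasis.sum_repr (ZSpan.fract periodBasis x)]
    simp only [ZSpan.repr_fract_apply, periodBasis_repr]
  rw [h]
  refine Finset.measurable_sum _ fun i _ => Measurable.smul_const ?_ _
  refine measurable_fract.comp (Measurable.const_mul ?_ _)
  exact (EuclideanSpace.proj (𝕜 := ℝ) i).continuous.measurable

theorem LatticeInvariant.apply_fract {β : Type*} {p : E3 → β} (hp : LatticeInvariant p) (x : E3) :
    p (ZSpan.fract periodBasis x) = p x := by
  rw [← hp _ (ZSpan.floor periodBasis x).2 (ZSpan.fract periodBasis x), ZSpan.fract_apply]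
  congr 1
  abel

theorem latticeInvariant_comp_fract {β : Type*} (p : E3 → β) :
    LatticeInvariant fun x => p (ZSpan.fract periodBasis x) := fun g hg x => by
  simp only [ZSpan.fract_zSpan_add periodBasis x hg]

theorem fract_of_mem_cell {x : E3} (hx : x ∈ Setting.periodic.cell) :
    ZSpan.fract periodBasis x = x :=
  ZSpan.fract_eq_self.2 (cell_subset_fundamentalDomain hx)

/-- Translation by `h` on the torus, in terms of representatives. -/
def shift (h x : E3) : E3 := ZSpan.fract periodBasis (x + h)

theorem measurable_shift (h : E3) : Measurable (shift h) :=
  measurable_fract_periodBasis.comp (measurable_id.add_const h)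

theorem measurePreserving_shift (h : E3) : MeasurePreserving (shift h)
    (volume.restrict Setting.periodic.cell) (volume.restrict Setting.periodic.cell) := by
  refine ⟨measurable_shift h, Measure.ext fun A hA => ?_⟩
  rw [Measure.map_apply (measurable_shift h) hA, ← lintegral_indicator_one hA,
    ← lintegral_indicator_one (measurable_shift h hA)]
  have h1 := lintegral_cell_add
    (latticeInvariant_comp_fract (A.indicator (1 : E3 → ℝ≥0∞))) h
  refine Eq.trans ?_ (h1.trans ?_)
  · rfl
  · exact setLIntegral_congr_fun Setting.periodic.measurableSet_cell fun x hx => by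
      simp only [fract_of_mem_cell hx]

theorem shift_neg_shift {h x : E3} (hx : x ∈ Setting.periodic.cell) :
    shift (-h) (shift h x) = x := by
  have h1 : shift (-h) (shift h x) = ZSpan.fract periodBasis
      (-(ZSpan.floor periodBasis (x + h) : E3) + x) := by
    have h2 : ZSpan.fract periodBasis (x + h) + -h =
        -(ZSpan.floor periodBasis (x + h) : E3) + x := by
      rw [ZSpan.fract_apply]; abel
    rw [shift, shift, h2]
  rw [h1, ZSpan.fract_zSpan_add _ _ (neg_mem (ZSpan.floor periodBasis (x + h)).2),
    fract_of_mem_cell hx]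

/-- Translation as an isometry of `L²`. -/
def shiftL (F : Type*) [NormedAddCommGroup F] [NormedSpace ℝ F] (h : E3) :
    Lp F 2 (volume.restrict Setting.periodic.cell) →ₗᵢ[ℝ]
      Lp F 2 (volume.restrict Setting.periodic.cell) :=
  Lp.compMeasurePreservingₗᵢ ℝ (shift h) (measurePreserving_shift h)

section ShiftL

variable {F : Type*} [NormedAddCommGroup F] [NormedSpace ℝ F]

theorem coeFn_shiftL (h : E3) (q : Lp F 2 (volume.restrict Setting.periodic.cell)) :
    shiftL F h q =ᵐ[volume.restrict Setting.periodic.cell] fun x => q (shift h x) :=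
  Lp.coeFn_compMeasurePreserving q (measurePreserving_shift h)

theorem shiftL_neg (h : E3) (q : Lp F 2 (volume.restrict Setting.periodic.cell)) :
    shiftL F h (shiftL F (-h) q) = q := by
  refine Lp.ext ?_
  have h1 := (measurePreserving_shift h).quasiMeasurePreserving.ae_eq_comp (coeFn_shiftL (-h) q)
  filter_upwards [coeFn_shiftL h (shiftL F (-h) q), h1,
    ae_restrict_mem Setting.periodic.measurableSet_cell] with x e1 e2 hx
  rw [e1]
  simp only [Function.comp_apply] at e2
  rw [e2, shift_neg_shift hx]

theorem shiftL_of_invariant (h : E3) {q : Lp F 2 (volume.restrict Setting.periodic.cell)}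
    {p : E3 → F} (hp : LatticeInvariant p) (hq : q =ᵐ[volume.restrict Setting.periodic.cell] p) :
    shiftL F h q =ᵐ[volume.restrict Setting.periodic.cell] fun x => p (x + h) := by
  have h1 := (measurePreserving_shift h).quasiMeasurePreserving.ae_eq_comp hq
  filter_upwards [coeFn_shiftL h q, h1] with x e1 e2
  rw [e1]
  simp only [Function.comp_apply] at e2
  rw [e2, shift, hp.apply_fract]

end ShiftL

theorem isTest_comp_add {φ : E3 → ℝ} (hφ : Setting.periodic.IsTest φ) (h : E3) :
    Setting.periodic.IsTest fun x => φ (x + h) := by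
  refine ⟨hφ.1.comp (contDiff_id.add contDiff_const), fun i x => ?_⟩
  simp only
  rw [add_right_comm, hφ.2 i]

/-- Translation maps graphs of test functions to such graphs and is continuous, so it preserves the
closure. -/
theorem exists_shift_H1 (h : E3) (z : Setting.periodic.H1) : ∃ z' : Setting.periodic.H1,
    Setting.periodic.incl z' = shiftL ℝ h (Setting.periodic.incl z) ∧
    Setting.periodic.grad z' = shiftL E3 h (Setting.periodic.grad z) := by
  set Φ : WithLp 2 (Setting.periodic.L2 × Setting.periodic.L2V) →
      WithLp 2 (Setting.periodic.L2 × Setting.periodic.L2V) :=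
    fun q => WithLp.toLp 2 (shiftL ℝ h q.fst, shiftL E3 h q.snd) with hΦ
  have hΦc : Continuous Φ := by
    refine (WithLp.prod_continuous_toLp 2 _ _).comp (Continuous.prodMk ?_ ?_)
    · exact (shiftL ℝ h).continuous.comp (WithLp.fstL 2 ℝ _ _).continuous
    · exact (shiftL E3 h).continuous.comp (WithLp.sndL 2 ℝ _ _).continuous
  have hz : (z : WithLp 2 (Setting.periodic.L2 × Setting.periodic.L2V)) ∈
      closure (Setting.periodic.testGraph : Set _) := z.2
  have hmaps : MapsTo Φ (Setting.periodic.testGraph : Set _) Setting.periodic.testGraph := by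
    rintro q ⟨φ, hφ, h1, h2⟩
    have hinv := IsPeriodic.latticeInvariant hφ.2
    refine ⟨fun x => φ (x + h), isTest_comp_add hφ h, shiftL_of_invariant h hinv h1, ?_⟩
    refine (shiftL_of_invariant h hinv.gradient h2).trans (Eventually.of_forall fun x => ?_)
    simp only [gradient, fderiv_comp_add_right]
  exact ⟨⟨Φ z, map_mem_closure hΦc hz hmaps⟩, rfl, rfl⟩

theorem shiftL_mem_formEigenspace (h : E3) {μ : ℝ} {e : Setting.periodic.L2}
    (he : e ∈ formEigenspace Setting.periodic.incl Setting.periodic.grad μ) :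
    shiftL ℝ h e ∈ formEigenspace Setting.periodic.incl Setting.periodic.grad μ := by
  obtain ⟨w, rfl, hw⟩ := he
  obtain ⟨w', h1, h2⟩ := exists_shift_H1 h w
  refine ⟨w', h1, fun z => ?_⟩
  obtain ⟨z', h3, h4⟩ := exists_shift_H1 (-h) z
  rw [← shiftL_neg h (Setting.periodic.grad z), ← shiftL_neg h (Setting.periodic.incl z), h2,
    LinearIsometry.inner_map_map, LinearIsometry.inner_map_map, ← h3, ← h4, hw]

/-- Translations are isometries preserving each eigenspace in both directions, so they commute with
the orthogonal projections. -/
theorem formProj_shiftL (h : E3) (μ : ℝ) (q : Setting.periodic.L2) :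
    formProj Setting.periodic.incl Setting.periodic.grad μ (shiftL ℝ h q) =
      shiftL ℝ h (formProj Setting.periodic.incl Setting.periodic.grad μ q) := by
  refine eq_formProj Setting.periodic.inner_H1
    (shiftL_mem_formEigenspace h (formProj_mem Setting.periodic.inner_H1 μ q)) fun f hf => ?_
  rw [← shiftL_neg h f, ← map_sub, LinearIsometry.inner_map_map]
  exact inner_sub_formProj q (shiftL_mem_formEigenspace (-h) hf)

theorem lintegral_Ioc_sq_le {g : ℝ → ℝ≥0∞} (hg : Measurable g) :
    (∫⁻ s in Ioc (0 : ℝ) 1, g s) ^ 2 ≤ ∫⁻ s in Ioc (0 : ℝ) 1, g s ^ 2 := by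
  have hpq : Real.HolderConjugate 2 2 := ⟨by norm_num, by norm_num, by norm_num⟩
  have h := ENNReal.lintegral_mul_le_Lp_mul_Lq (volume.restrict (Ioc (0 : ℝ) 1)) hpq
    (f := g) (g := fun _ => 1) hg.aemeasurable aemeasurable_const
  simp only [Pi.mul_apply, mul_one, ENNReal.rpow_ofNat, one_pow, lintegral_const,
    Measure.restrict_apply_univ, Real.volume_Ioc, sub_zero, ENNReal.ofReal_one,
    ENNReal.one_rpow] at h
  have h2 := pow_le_pow_left' h 2
  rwa [← ENNReal.rpow_natCast (_ ^ (1 / 2 : ℝ)), ← ENNReal.rpow_mul, Nat.cast_ofNat,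
    one_div_mul_cancel (by norm_num), ENNReal.rpow_one] at h2

theorem enorm_sub_sq_le {φ : E3 → ℝ} (hφ : ContDiff ℝ 1 φ) (h x : E3) :
    ‖φ (x + h) - φ x‖ₑ ^ 2 ≤
      ‖h‖ₑ ^ 2 * ∫⁻ s in Ioc (0 : ℝ) 1, ‖gradient φ (x + s • h)‖ₑ ^ 2 := by
  have hc : Continuous fun s : ℝ => fderiv ℝ φ (x + s • h) :=
    (hφ.continuous_fderiv one_ne_zero).comp (by fun_prop)
  have hc' : Continuous fun s : ℝ => fderiv ℝ φ (x + s • h) h := hc.clm_apply continuous_const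
  have hftc : ∫ s in (0 : ℝ)..1, fderiv ℝ φ (x + s • h) h = φ (x + h) - φ x := by
    have := intervalIntegral.integral_eq_sub_of_hasDerivAt (a := 0) (b := 1)
      (f := fun s : ℝ => φ (x + s • h)) (f' := fun s => fderiv ℝ φ (x + s • h) h)
      (fun s _ => ?_) (hc'.intervalIntegrable 0 1)
    · simpa using this
    · have h1 : HasFDerivAt φ (fderiv ℝ φ (x + s • h)) (x + s • h) :=
        (hφ.differentiable one_ne_zero _).hasFDerivAt
      have h2 : HasDerivAt (fun s : ℝ => x + s • h) h s := by
        simpa using ((hasDerivAt_id s).smul_const h).const_add x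
      exact h1.comp_hasDerivAt s h2
  have hm : Measurable fun s : ℝ => ‖gradient φ (x + s • h)‖ₑ := by
    have e : ∀ s : ℝ, ‖gradient φ (x + s • h)‖ₑ =
        ENNReal.ofReal ‖fderiv ℝ φ (x + s • h)‖ := fun s => by
      rw [enorm_gradient, ofReal_norm]
    simp only [e]
    exact hc.norm.measurable.ennreal_ofReal
  have h1 : ‖φ (x + h) - φ x‖ₑ ≤ ‖h‖ₑ * ∫⁻ s in Ioc (0 : ℝ) 1, ‖gradient φ (x + s • h)‖ₑ := by
    rw [← hftc, intervalIntegral.integral_of_le zero_le_one]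
    refine (enorm_integral_le_lintegral_enorm _).trans ?_
    rw [← lintegral_const_mul' _ _ (by finiteness)]
    refine lintegral_mono fun s => ?_
    rw [enorm_gradient, ← ofReal_norm, ← ofReal_norm, ← ofReal_norm,
      ← ENNReal.ofReal_mul (norm_nonneg _), mul_comm]
    exact ENNReal.ofReal_le_ofReal (ContinuousLinearMap.le_opNorm _ _)
  calc _ ≤ (‖h‖ₑ * ∫⁻ s in Ioc (0 : ℝ) 1, ‖gradient φ (x + s • h)‖ₑ) ^ 2 := by gcongr
    _ = ‖h‖ₑ ^ 2 * (∫⁻ s in Ioc (0 : ℝ) 1, ‖gradient φ (x + s • h)‖ₑ) ^ 2 := by ring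
    _ ≤ _ := by gcongr; exact lintegral_Ioc_sq_le hm

theorem lintegral_enorm_sub_sq_le {φ : E3 → ℝ} (hφ : Setting.periodic.IsTest φ) (h : E3) :
    ∫⁻ x in Setting.periodic.cell, ‖φ (x + h) - φ x‖ₑ ^ 2 ≤
      ‖h‖ₑ ^ 2 * ∫⁻ x in Setting.periodic.cell, ‖gradient φ x‖ₑ ^ 2 := by
  have hφ1 : ContDiff ℝ 1 φ := hφ.contDiff.of_le (by simp)
  have hcg := Setting.continuous_gradient hφ.contDiff
  have hinv : LatticeInvariant fun x => ‖gradient φ x‖ₑ ^ 2 := fun g hg x => by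
    simp only [(IsPeriodic.latticeInvariant hφ.2).gradient g hg x]
  calc _ ≤ ∫⁻ x in Setting.periodic.cell,
        ‖h‖ₑ ^ 2 * ∫⁻ s in Ioc (0 : ℝ) 1, ‖gradient φ (x + s • h)‖ₑ ^ 2 :=
        lintegral_mono fun x => enorm_sub_sq_le hφ1 h x
    _ = ‖h‖ₑ ^ 2 * ∫⁻ x in Setting.periodic.cell,
        ∫⁻ s in Ioc (0 : ℝ) 1, ‖gradient φ (x + s • h)‖ₑ ^ 2 :=
        lintegral_const_mul' _ _ (by finiteness)
    _ = ‖h‖ₑ ^ 2 * ∫⁻ s in Ioc (0 : ℝ) 1, ∫⁻ x in Setting.periodic.cell,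
        ‖gradient φ (x + s • h)‖ₑ ^ 2 := by
        rw [lintegral_lintegral_swap]
        refine (Measurable.pow_const ?_ 2).aemeasurable
        exact (hcg.comp (by fun_prop : Continuous fun p : E3 × ℝ => p.1 + p.2 • h)).measurable.enorm
    _ = ‖h‖ₑ ^ 2 * ∫⁻ s in Ioc (0 : ℝ) 1, ∫⁻ x in Setting.periodic.cell,
        ‖gradient φ x‖ₑ ^ 2 := by
        congr 1
        exact lintegral_congr fun s => lintegral_cell_add hinv (s • h)
    _ = _ := by simp

/-- The difference-quotient bound: the fundamental theorem of calculus along the segment and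
translation invariance of the integral for test functions, then density. -/
theorem norm_shiftL_sub_le (h : E3) (z : Setting.periodic.H1) :
    ‖shiftL ℝ h (Setting.periodic.incl z) - Setting.periodic.incl z‖ ≤
      ‖h‖ * ‖Setting.periodic.grad z‖ := by
  have hcl : IsClosed {z : Setting.periodic.H1 |
      ‖shiftL ℝ h (Setting.periodic.incl z) - Setting.periodic.incl z‖ ≤
      ‖h‖ * ‖Setting.periodic.grad z‖} := by
    refine isClosed_le ?_ ?_
    · exact (((shiftL ℝ h).continuous.comp Setting.periodic.incl.continuous).sub
        Setting.periodic.incl.continuous).norm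
    · exact continuous_const.mul Setting.periodic.grad.continuous.norm
  refine hcl.closure_subset_iff.2 ?_ (Setting.periodic.dense_lift z)
  rintro v ⟨φ, hφ, hv⟩
  have h1 := lintegral_enorm_sub_sq_le hφ h
  have e1 : ∫⁻ x in Setting.periodic.cell, ‖φ (x + h) - φ x‖ₑ ^ 2 =
      ‖shiftL ℝ h (Setting.periodic.incl v) - Setting.periodic.incl v‖ₑ ^ 2 := by
    rw [← Setting.lintegral_enorm_sq]
    refine lintegral_congr_ae ?_
    filter_upwards [hv.1, shiftL_of_invariant h (IsPeriodic.latticeInvariant hφ.2) hv.1,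
      Lp.coeFn_sub (shiftL ℝ h (Setting.periodic.incl v)) (Setting.periodic.incl v)] with x a b c
    rw [c, Pi.sub_apply, a, b]
  have e2 : ∫⁻ x in Setting.periodic.cell, ‖gradient φ x‖ₑ ^ 2 =
      ‖Setting.periodic.grad v‖ₑ ^ 2 := by
    rw [← Setting.lintegral_enorm_sq]
    refine lintegral_congr_ae ?_
    filter_upwards [hv.2] with x a
    rw [a]
  rw [e1, e2, ← mul_pow, ← ofReal_norm, ← ofReal_norm, ← ofReal_norm,
    ← ENNReal.ofReal_mul (norm_nonneg _), ← ENNReal.ofReal_pow (norm_nonneg _),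
    ← ENNReal.ofReal_pow (by positivity), ENNReal.ofReal_le_ofReal_iff (by positivity)] at h1
  exact (sq_le_sq₀ (norm_nonneg _) (by positivity)).1 h1

/-- The triangle inequality gives the factor 4, and the difference-quotient bound on the
eigenfunction, whose gradient has squared norm `μ` times its own, gives `μ |h|²`. The second is used
at small `h` and the first at large `h`. -/
theorem norm_formProj_shiftL_sub_sq_le (h : E3) (μ : ℝ) (q : Setting.periodic.L2) :
    ‖formProj Setting.periodic.incl Setting.periodic.grad μ (shiftL ℝ h q - q)‖ ^ 2 ≤
      min 4 (μ * ‖h‖ ^ 2) * ‖formProj Setting.periodic.incl Setting.periodic.grad μ q‖ ^ 2 := by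
  obtain ⟨w, hw, hw'⟩ := exists_lift_formProj Setting.periodic.inner_H1 μ q
  rw [map_sub, formProj_shiftL, min_mul_of_nonneg _ _ (by positivity), le_min_iff]
  set e := formProj Setting.periodic.incl Setting.periodic.grad μ q
  constructor
  · have h1 := norm_sub_le (shiftL ℝ h e) e
    rw [LinearIsometry.norm_map] at h1
    calc _ ≤ (‖e‖ + ‖e‖) ^ 2 := by gcongr
      _ = _ := by ring
  · have h1 := norm_shiftL_sub_le h w
    rw [hw] at h1
    have h2 : ‖Setting.periodic.grad w‖ ^ 2 = μ * ‖e‖ ^ 2 := by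
      rw [← real_inner_self_eq_norm_sq, hw', hw, real_inner_self_eq_norm_sq]
    calc _ ≤ (‖h‖ * ‖Setting.periodic.grad w‖) ^ 2 := by gcongr
      _ = _ := by rw [mul_pow, h2]; ring

/-- Parseval for the gradient of the translate minus the original. Here the completeness of the
eigenfunctions on the torus is essential. -/
theorem enorm_shiftL_grad_sub_sq_le (h : E3) (z : Setting.periodic.H1) :
    ‖shiftL E3 h (Setting.periodic.grad z) - Setting.periodic.grad z‖ₑ ^ 2 ≤
      ∑' μ : ℝ, ENNReal.ofReal (μ * min 4 (μ * ‖h‖ ^ 2)) *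
        ‖Setting.periodic.eigenProj μ (Setting.periodic.incl z)‖ₑ ^ 2 := by
  obtain ⟨z', h1, h2⟩ := exists_shift_H1 h z
  rw [← h2, ← map_sub, ← ofReal_norm, ← ENNReal.ofReal_pow (norm_nonneg _),
    norm_grad_sq_eq_tsum Setting.periodic.inner_H1 Setting.periodic.incl_injective
      eq_zero_of_formProj_eq_zero]
  refine ENNReal.tsum_le_tsum fun μ => ?_
  rw [Setting.eigenProj_eq]
  rcases lt_or_ge μ 0 with hμ | hμ
  · simp [formProj_eq_zero hμ]
  · rw [← ofReal_norm, ← ENNReal.ofReal_pow (norm_nonneg _), ← ENNReal.ofReal_mul (by positivity),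
      map_sub, h1, mul_assoc]
    refine ENNReal.ofReal_le_ofReal ?_
    gcongr
    exact norm_formProj_shiftL_sub_sq_le h μ _

/-- In polar coordinates the integrand is at most 1 near the origin and `4 y⁻²` at infinity. -/
theorem integrable_min_div_norm_pow : Integrable fun h : E3 => min 4 (‖h‖ ^ 2) / ‖h‖ ^ 4 := by
  rw [integrable_fun_norm_addHaar volume (f := fun y => min 4 (y ^ 2) / y ^ 4),
    finrank_euclideanSpace_fin]
  have hm : Measurable fun y : ℝ => y ^ (3 - 1) • (min 4 (y ^ 2) / y ^ 4) := by fun_prop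
  rw [← Ioc_union_Ioi_eq_Ioi (zero_le_one' ℝ)]
  refine IntegrableOn.union ?_ ?_
  · refine Integrable.mono' (g := fun _ => (1 : ℝ)) (integrable_const _) hm.aestronglyMeasurable ?_
    filter_upwards [ae_restrict_mem measurableSet_Ioc] with y hy
    have hy0 : 0 < y := hy.1
    rw [Real.norm_of_nonneg (by positivity), smul_eq_mul, mul_div_assoc',
      div_le_one (by positivity)]
    calc y ^ (3 - 1) * min 4 (y ^ 2) ≤ y ^ 2 * y ^ 2 := by gcongr; exact min_le_right _ _
      _ = y ^ 4 := by ring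
  · have hi : IntegrableOn (fun y : ℝ => 4 * y ^ (-2 : ℝ)) (Ioi 1) :=
      (integrableOn_Ioi_rpow_of_lt (by norm_num) one_pos).const_mul 4
    refine Integrable.mono' hi hm.aestronglyMeasurable ?_
    filter_upwards [ae_restrict_mem measurableSet_Ioi] with y hy
    have hy0 : 0 < y := one_pos.trans hy
    rw [Real.norm_of_nonneg (by positivity), smul_eq_mul, Real.rpow_neg hy0.le,
      show (2 : ℝ) = ((2 : ℕ) : ℝ) by norm_num, Real.rpow_natCast, mul_div_assoc',
      div_le_iff₀ (by positivity)]
    calc y ^ (3 - 1) * min 4 (y ^ 2) ≤ y ^ 2 * 4 := by gcongr; exact min_le_left _ _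
      _ = 4 * (y ^ 2)⁻¹ * y ^ 4 := by field_simp

theorem lintegral_comp_smul_E3 {g : E3 → ℝ≥0∞} (hg : Measurable g) {r : ℝ} (hr : 0 < r) :
    ∫⁻ h, g (r • h) = ENNReal.ofReal ((r ^ 3)⁻¹) * ∫⁻ h, g h := by
  have h1 := Measure.map_addHaar_smul (volume : Measure E3) hr.ne'
  rw [← lintegral_map hg (measurable_const_smul r), h1, lintegral_smul_measure,
    finrank_euclideanSpace_fin, abs_of_pos (by positivity), smul_eq_mul]

/-- The scaling of the kernel `|h|⁻⁴ min(4, μ |h|²)`. -/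
theorem exists_lintegral_kernel_le : ∃ C : ℝ≥0, ∀ μ : ℝ, 0 ≤ μ →
    ∫⁻ h : E3, ENNReal.ofReal (μ * min 4 (μ * ‖h‖ ^ 2)) * (‖h‖ₑ ^ 4)⁻¹ ≤
      C * ENNReal.ofReal ((1 + μ) ^ (3 / 2 : ℝ)) := by
  set k : E3 → ℝ := fun h => min 4 (‖h‖ ^ 2) / ‖h‖ ^ 4 with hk
  have hkm : Measurable fun h => ENNReal.ofReal (k h) := by
    refine Measurable.ennreal_ofReal ?_
    fun_prop
  have hI : ∫⁻ h, ENNReal.ofReal (k h) ≠ ⊤ := by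
    have := integrable_min_div_norm_pow.lintegral_lt_top
    exact this.ne
  refine ⟨(∫⁻ h, ENNReal.ofReal (k h)).toNNReal, fun μ hμ => ?_⟩
  rw [ENNReal.coe_toNNReal hI]
  rcases hμ.eq_or_lt with rfl | hμ
  · simp
  have hs : 0 < √μ := Real.sqrt_pos.2 hμ
  have hs2 : √μ ^ 2 = μ := Real.sq_sqrt hμ.le
  have hne : ∀ᵐ h : E3, h ≠ 0 := by
    rw [ae_iff]; simp
  -- The substitution `h ↦ √μ h` removes `μ` from the integrand: `μ³` times the Jacobian `μ^{-3/2}`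
  -- is the weight of `H^{3/2}`.
  calc _ = ∫⁻ h : E3, ENNReal.ofReal (μ ^ 3) * ENNReal.ofReal (k (√μ • h)) := by
        refine lintegral_congr_ae ?_
        filter_upwards [hne] with h hh
        have hn : 0 < ‖h‖ := norm_pos_iff.2 hh
        rw [← ofReal_norm, ← ENNReal.ofReal_pow (norm_nonneg _),
          ← ENNReal.ofReal_inv_of_pos (by positivity), ← ENNReal.ofReal_mul (by positivity),
          ← ENNReal.ofReal_mul (by positivity)]
        congr 1
        simp only [hk]
        rw [norm_smul, Real.norm_of_nonneg hs.le, mul_pow, hs2]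
        have : (√μ * ‖h‖) ^ 4 = μ ^ 2 * ‖h‖ ^ 4 := by
          rw [mul_pow, show √μ ^ 4 = (√μ ^ 2) ^ 2 by ring, hs2]
        rw [this]
        field_simp
    _ = ENNReal.ofReal (μ ^ 3) * (ENNReal.ofReal ((√μ ^ 3)⁻¹) * ∫⁻ h, ENNReal.ofReal (k h)) := by
        rw [lintegral_const_mul' _ _ (by finiteness), lintegral_comp_smul_E3 hkm hs]
    _ = (∫⁻ h, ENNReal.ofReal (k h)) * ENNReal.ofReal (√μ ^ 3) := by
        rw [← mul_assoc, ← ENNReal.ofReal_mul (by positivity), mul_comm]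
        congr 2
        rw [← hs2]
        field_simp
        rw [hs2]
    _ ≤ _ := by
        gcongr
        rw [Real.sqrt_eq_rpow, ← Real.rpow_natCast, ← Real.rpow_mul hμ.le]
        norm_num
        gcongr
        linarith

/-- With `F` extended periodically, put `y = x + h` and exchange the integrals. Letting `y` run over
the whole space instead of the cell only enlarges the integral. -/
theorem lintegral_slobKernel_le_shift (z : Setting.periodic.H1) :
    ∫⁻ x in Setting.periodic.cell,
      Setting.periodic.slobKernel (Setting.periodic.grad z) x ≤
    ∫⁻ h, ‖shiftL E3 h (Setting.periodic.grad z) - Setting.periodic.grad z‖ₑ ^ 2 *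
      (‖h‖ₑ ^ 4)⁻¹ := by
  set F : E3 → E3 := ⇑(Setting.periodic.grad z) with hF
  have hFm : Measurable F := (Lp.stronglyMeasurable (Setting.periodic.grad z)).measurable
  set P : E3 → E3 := fun x => F (ZSpan.fract periodBasis x) with hP
  have hPm : Measurable P := hFm.comp measurable_fract_periodBasis
  have hPF : ∀ x ∈ Setting.periodic.cell, P x = F x := fun x hx => by
    simp only [hP, fract_of_mem_cell hx]
  have h1 : ∀ x ∈ Setting.periodic.cell, Setting.periodic.slobKernel F x ≤
      ∫⁻ h, ‖P (x + h) - P x‖ₑ ^ 2 * (‖h‖ₑ ^ 4)⁻¹ := by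
    intro x hx
    calc Setting.periodic.slobKernel F x
        = ∫⁻ y in Setting.periodic.cell, ‖P y - P x‖ₑ ^ 2 * (‖y - x‖ₑ ^ 4)⁻¹ := by
          refine setLIntegral_congr_fun Setting.periodic.measurableSet_cell fun y hy => ?_
          simp only [hPF x hx, hPF y hy, div_eq_mul_inv]
          rw [enorm_sub_rev, enorm_sub_rev x]
      _ ≤ ∫⁻ y, ‖P y - P x‖ₑ ^ 2 * (‖y - x‖ₑ ^ 4)⁻¹ :=
          lintegral_mono' Measure.restrict_le_self le_rfl
      _ = ∫⁻ h, ‖P (x + h) - P x‖ₑ ^ 2 * (‖x + h - x‖ₑ ^ 4)⁻¹ :=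
          (lintegral_add_left_eq_self (μ := volume)
            (fun y => ‖P y - P x‖ₑ ^ 2 * (‖y - x‖ₑ ^ 4)⁻¹) x).symm
      _ = _ := by simp only [add_sub_cancel_left]
  have hmeas : Measurable fun q : E3 × E3 => ‖P (q.1 + q.2) - P q.1‖ₑ ^ 2 * (‖q.2‖ₑ ^ 4)⁻¹ :=
    (((hPm.comp (measurable_fst.add measurable_snd)).sub
      (hPm.comp measurable_fst)).enorm.pow_const 2).mul (measurable_snd.enorm.pow_const 4).inv
  calc _ ≤ ∫⁻ x in Setting.periodic.cell, ∫⁻ h, ‖P (x + h) - P x‖ₑ ^ 2 * (‖h‖ₑ ^ 4)⁻¹ :=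
        setLIntegral_mono' Setting.periodic.measurableSet_cell h1
    _ = ∫⁻ h, ∫⁻ x in Setting.periodic.cell, ‖P (x + h) - P x‖ₑ ^ 2 * (‖h‖ₑ ^ 4)⁻¹ :=
        lintegral_lintegral_swap hmeas.aemeasurable
    _ = _ := by
        refine lintegral_congr fun h => ?_
        rw [lintegral_mul_const]
        · congr 1
          rw [← Setting.lintegral_enorm_sq]
          refine lintegral_congr_ae ?_
          filter_upwards [ae_restrict_mem Setting.periodic.measurableSet_cell,
            coeFn_shiftL h (Setting.periodic.grad z), Lp.coeFn_sub
            (shiftL E3 h (Setting.periodic.grad z)) (Setting.periodic.grad z)] with x hx a b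
          rw [b, Pi.sub_apply, a, hPF x hx]
          rfl
        · exact ((hPm.comp (measurable_id.add_const h)).sub hPm).enorm.pow_const 2

/-- Sum the translation estimate against `|h|⁻⁴` and integrate eigenvalue by eigenvalue. -/
theorem exists_lintegral_slobKernel_le_hDeltaSq : ∃ C : ℝ≥0, ∀ z : Setting.periodic.H1,
    ∫⁻ x in Setting.periodic.cell,
      Setting.periodic.slobKernel (Setting.periodic.grad z) x ≤
    C * Setting.periodic.hDeltaSq (3 / 2) (Setting.periodic.incl z) := by
  obtain ⟨C, hC⟩ := exists_lintegral_kernel_le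
  refine ⟨C, fun z => (lintegral_slobKernel_le_shift z).trans ?_⟩
  set b : ℝ → ℝ≥0∞ := fun μ =>
    ‖Setting.periodic.eigenProj μ (Setting.periodic.incl z)‖ₑ ^ 2 with hb
  have hsum : Summable fun μ : ℝ =>
      ‖Setting.periodic.eigenProj μ (Setting.periodic.incl z)‖ ^ 2 :=
    summable_of_sum_le (fun μ => by positivity)
      (sum_norm_sq_formProj_le Setting.periodic.inner_H1 (Setting.periodic.incl z))
  -- The sum runs over all real `μ`; exchanging it with the integral needs a countable index set,
  -- which Bessel's inequality provides.
  set s : Set ℝ := Function.support fun μ : ℝ =>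
      ‖Setting.periodic.eigenProj μ (Setting.periodic.incl z)‖ ^ 2 with hs
  have hsc : Countable s := hsum.countable_support.to_subtype
  have hb0 : ∀ μ, μ ∉ s → b μ = 0 := fun μ hμ => by
    have : ‖Setting.periodic.eigenProj μ (Setting.periodic.incl z)‖ ^ 2 = 0 := by
      simpa [hs] using hμ
    simp only [hb]
    rw [← ofReal_norm, ← ENNReal.ofReal_pow (norm_nonneg _), this, ENNReal.ofReal_zero]
  have hbt : ∀ μ, b μ ≠ ⊤ := fun μ => by simp only [hb]; finiteness
  have hb_neg : ∀ μ, μ < 0 → b μ = 0 := fun μ hμ => by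
    simp [hb, Setting.eigenProj_eq, formProj_eq_zero hμ]
  have hsub : ∀ a : ℝ → ℝ≥0∞, ∑' μ : ℝ, a μ * b μ = ∑' μ : s, a μ * b μ := fun a => by
    refine (tsum_subtype_eq_of_support_subset fun μ hμ => ?_).symm
    by_contra hn
    exact hμ (by simp [hb0 μ hn])
  have hmk : ∀ μ : ℝ, Measurable fun h : E3 =>
      ENNReal.ofReal (μ * min 4 (μ * ‖h‖ ^ 2)) * (‖h‖ₑ ^ 4)⁻¹ := fun μ => by
    refine Measurable.mul (Measurable.ennreal_ofReal (by fun_prop)) ?_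
    exact (measurable_enorm.pow_const 4).inv
  calc _ ≤ ∫⁻ h : E3, ∑' μ : s, (ENNReal.ofReal ((μ : ℝ) * min 4 ((μ : ℝ) * ‖h‖ ^ 2)) *
        (‖h‖ₑ ^ 4)⁻¹) * b μ := by
        refine lintegral_mono fun h => ?_
        refine (mul_le_mul_left (enorm_shiftL_grad_sub_sq_le h z) _).trans_eq ?_
        rw [hsub, ← ENNReal.tsum_mul_right]
        refine tsum_congr fun μ => ?_
        ring
    _ = ∑' μ : s, (∫⁻ h : E3, ENNReal.ofReal ((μ : ℝ) * min 4 ((μ : ℝ) * ‖h‖ ^ 2)) *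
        (‖h‖ₑ ^ 4)⁻¹) * b μ := by
        rw [lintegral_tsum fun μ : s => ((hmk μ).mul_const _).aemeasurable]
        refine tsum_congr fun μ => ?_
        rw [lintegral_mul_const _ (hmk μ)]
    _ ≤ ∑' μ : s, C * (ENNReal.ofReal ((1 + (μ : ℝ)) ^ (3 / 2 : ℝ)) * b μ) := by
        refine ENNReal.tsum_le_tsum fun μ => ?_
        rcases lt_or_ge (μ : ℝ) 0 with hμ | hμ
        · simp [hb_neg μ hμ]
        · rw [← mul_assoc]
          gcongr
          exact hC μ hμ
    _ = _ := by
        rw [ENNReal.tsum_mul_left, ← hsub fun μ => ENNReal.ofReal ((1 + μ) ^ (3 / 2 : ℝ))]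
        rfl

/-- The `L¹²` norm is controlled by the norms of `H¹` and `H^{3/2}`. -/
theorem Setting.exists_lintegral_pow_twelve_le_h32Sq (X : Setting) : ∃ C : ℝ≥0, ∀ z : X.H1,
    (∫⁻ x in X.cell, ‖X.incl z x‖ₑ ^ 12) ^ (1 / 3 : ℝ) ≤
      C * (‖z‖ₑ ^ 2 * (‖z‖ₑ ^ 2 + X.h32Sq z)) := by
  obtain ⟨C, hC⟩ := X.exists_lintegral_pow_twelve_le
  cases X with
  | dirichlet Ω hΩ =>
    refine ⟨C, fun z => (hC z).trans ?_⟩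
    gcongr
    exact le_add_self
  | periodic =>
    obtain ⟨C', hC'⟩ := exists_lintegral_slobKernel_le_hDeltaSq
    refine ⟨C * (1 + C'), fun z => (hC z).trans ?_⟩
    rw [ENNReal.coe_mul, mul_assoc, mul_left_comm ((1 + C' : ℝ≥0) : ℝ≥0∞)]
    gcongr
    rw [slobSq]
    calc _ ≤ ‖z‖ₑ ^ 2 + C' * periodic.h32Sq z := by gcongr; exact hC' z
      _ ≤ (‖z‖ₑ ^ 2 + periodic.h32Sq z) + C' * (‖z‖ₑ ^ 2 + periodic.h32Sq z) := by
        gcongr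
        · exact le_self_add
        · exact le_add_self
      _ = _ := by push_cast; ring

/-! ### The quintic nonlinearity: difference estimate and measurability of the `L¹²` norm. -/

section Nonlinearity

variable {f : ℝ → ℝ} {C κ K : ℝ}

theorem IsNonlinearity.nonneg (hf : IsNonlinearity f C κ K) : 0 ≤ C := by
  have := hf.deriv_growth 0
  simp only [abs_zero, ne_eq, OfNat.ofNat_ne_zero, not_false_eq_true, zero_pow, add_zero,
    mul_one] at this
  exact (abs_nonneg _).trans this

theorem IsNonlinearity.abs_sub_le (hf : IsNonlinearity f C κ K) (a b : ℝ) :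
    |f a - f b| ≤ C * (1 + |a| ^ 4 + |b| ^ 4) * |a - b| := by
  have hC := hf.nonneg
  have h := Convex.norm_image_sub_le_of_norm_deriv_le (𝕜 := ℝ) (f := f) (s := uIcc b a)
    (C := C * (1 + |a| ^ 4 + |b| ^ 4)) (x := b) (y := a)
    (fun x _ => hf.contDiff.differentiable one_ne_zero x) (fun x hx => ?_) (convex_uIcc b a)
    left_mem_uIcc right_mem_uIcc
  · simpa using h
  · refine (hf.deriv_growth x).trans (mul_le_mul_of_nonneg_left ?_ hC)
    have hx' : |x| ≤ max |a| |b| := by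
      rw [mem_uIcc] at hx
      rcases hx with ⟨h1, h2⟩ | ⟨h1, h2⟩
      · rw [max_comm]; exact abs_le_max_abs_abs h1 h2
      · exact abs_le_max_abs_abs h1 h2
    have h4 : |x| ^ 4 ≤ (max |a| |b|) ^ 4 := by gcongr
    rcases max_choice |a| |b| with h5 | h5 <;> rw [h5] at h4 <;>
      nlinarith [pow_nonneg (abs_nonneg a) 4, pow_nonneg (abs_nonneg b) 4]

end Nonlinearity

namespace Setting

variable (X : Setting)

/-- The fourth power of the norm of `L¹²`. -/
def l12 (q : X.L2) : ℝ≥0∞ := (∫⁻ x in X.cell, ‖q x‖ₑ ^ 12) ^ (1 / 3 : ℝ)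

theorem lipschitzWith_min_abs_pow (n : ℕ) :
    LipschitzWith (6 * n ^ 5 : ℝ≥0) fun s : ℝ => min |s| n ^ 6 := by
  refine LipschitzWith.of_dist_le_mul fun a b => ?_
  rw [Real.dist_eq, Real.dist_eq]
  have h1 := abs_pow_sub_pow_le (min |a| (n : ℝ)) (min |b| (n : ℝ)) 6
  have ha : |min |a| (n : ℝ)| ≤ n := by
    rw [abs_of_nonneg (by positivity)]; exact min_le_right _ _
  have hb : |min |b| (n : ℝ)| ≤ n := by
    rw [abs_of_nonneg (by positivity)]; exact min_le_right _ _
  have h2 : |min |a| (n : ℝ) - min |b| (n : ℝ)| ≤ |a - b| :=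
    (abs_min_sub_min_le_max _ _ _ _).trans (by
      rw [sub_self, abs_zero, max_eq_left (abs_nonneg _)]; exact abs_abs_sub_abs_le _ _)
  refine h1.trans ?_
  push_cast
  calc _ ≤ |a - b| * 6 * (n : ℝ) ^ 5 := by
        have := max_le ha hb
        gcongr
    _ = _ := by ring

/-- The `L¹²` norm is not continuous on `L²`, but `∫ |q|¹²` is the monotone limit of the squared
`L²` norms of `min(|q|, n)⁶`, which are Lipschitz superpositions and so depend continuously on `q`.
-/
theorem aemeasurable_l12 {ν : Measure ℝ} {w : ℝ → X.L2} (hw : AEStronglyMeasurable w ν) :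
    AEMeasurable (fun t => X.l12 (w t)) ν := by
  refine AEMeasurable.pow_const ?_ _
  set T : ℕ → X.L2 → X.L2 := fun n q =>
    (lipschitzWith_min_abs_pow n).compLp (by simp) q with hT
  have hTm : ∀ n, AEMeasurable (fun t => ‖T n (w t)‖ₑ ^ 2) ν := fun n =>
    (((lipschitzWith_min_abs_pow n).continuous_compLp (by simp)).comp_aestronglyMeasurable
      hw).enorm.pow_const 2
  refine aemeasurable_of_tendsto_metrizable_ae' hTm (Eventually.of_forall fun t => ?_)
  generalize w t = q
  have e1 : ∀ n, ‖T n q‖ₑ ^ 2 = ∫⁻ x in X.cell, ENNReal.ofReal (min |q x| n) ^ 12 := by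
    intro n
    rw [← X.lintegral_enorm_sq]
    refine lintegral_congr_ae ?_
    filter_upwards [(lipschitzWith_min_abs_pow n).coeFn_compLp (by simp) q] with x hx
    rw [hT]
    simp only
    rw [hx]
    simp only [Function.comp_apply]
    rw [Real.enorm_of_nonneg (by positivity), ENNReal.ofReal_pow (by positivity), ← pow_mul]
  simp only [e1]
  have hqm : Measurable q := (Lp.stronglyMeasurable q).measurable
  refine lintegral_tendsto_of_tendsto_of_monotone (fun n => ?_) ?_ ?_
  · exact ((((hqm.abs).min measurable_const).ennreal_ofReal).pow_const 12).aemeasurable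
  · refine Eventually.of_forall fun x n m hnm => ?_
    simp only
    gcongr
  · refine Eventually.of_forall fun x => ?_
    refine tendsto_const_nhds.congr' ?_
    obtain ⟨N, hN⟩ := exists_nat_ge |q x|
    filter_upwards [eventually_ge_atTop N] with n hn
    rw [Real.enorm_eq_ofReal_abs, min_eq_left (hN.trans (by exact_mod_cast hn))]

/-- `‖(1 + a⁴ + b⁴)(a - b)‖_{L²} ≤ C (1 + ‖a‖⁴_{L¹²} + ‖b‖⁴_{L¹²}) ‖a - b‖_{H¹}`. -/
theorem exists_lintegral_growth_le : ∃ D : ℝ≥0, ∀ a b : X.H1,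
    ∫⁻ x in X.cell, ((1 + ‖X.incl a x‖ₑ ^ 4 + ‖X.incl b x‖ₑ ^ 4) *
      ‖X.incl a x - X.incl b x‖ₑ) ^ 2 ≤
    (D * ((1 + X.l12 (X.incl a) + X.l12 (X.incl b)) * ‖a - b‖ₑ)) ^ 2 := by
  obtain ⟨C, hC⟩ := X.exists_lintegral_pow_six_le
  set v : ℝ≥0∞ := volume X.cell ^ (1 / 3 : ℝ) with hv
  set D : ℝ≥0∞ := (C : ℝ≥0∞) ^ (1 / 6 : ℝ) * (1 + v) with hD
  have hDt : D ≠ ⊤ := by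
    have := X.volume_cell_ne_top
    rw [hD, hv]; finiteness
  refine ⟨D.toNNReal, fun a b => ?_⟩
  rw [ENNReal.coe_toNNReal hDt]
  have ham : Measurable fun x => ‖X.incl a x‖ₑ := (Lp.stronglyMeasurable (X.incl a)).enorm
  have hbm : Measurable fun x => ‖X.incl b x‖ₑ := (Lp.stronglyMeasurable (X.incl b)).enorm
  have hdm : Measurable fun x => ‖X.incl a x - X.incl b x‖ₑ :=
    ((Lp.stronglyMeasurable (X.incl a)).sub (Lp.stronglyMeasurable (X.incl b))).enorm
  set g : E3 → ℝ≥0∞ := fun x => 1 + ‖X.incl a x‖ₑ ^ 4 + ‖X.incl b x‖ₑ ^ 4 with hg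
  have hgm : Measurable g := (measurable_const.add (ham.pow_const 4)).add (hbm.pow_const 4)
  -- The squared weight is taken in `L^{3/2}`, which is `L¹²` for `u`, and the squared difference in
  -- `L³`, which is `L⁶`, available from `H¹`.
  have hpq : Real.HolderConjugate (3 / 2) 3 := ⟨by norm_num, by norm_num, by norm_num⟩
  have hhol := ENNReal.lintegral_mul_le_Lp_mul_Lq (volume.restrict X.cell) hpq
    (f := fun x => g x ^ 2) (g := fun x => ‖X.incl a x - X.incl b x‖ₑ ^ 2)
    (hgm.pow_const 2).aemeasurable (hdm.pow_const 2).aemeasurable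
  have e1 : ∀ x, (g x ^ 2) ^ (3 / 2 : ℝ) = g x ^ (3 : ℝ) := fun x => by
    rw [← ENNReal.rpow_natCast, ← ENNReal.rpow_mul]; norm_num
  have e2 : ∀ x, (‖X.incl a x - X.incl b x‖ₑ ^ 2) ^ (3 : ℝ) =
      ‖X.incl a x - X.incl b x‖ₑ ^ 6 := fun x => by
    rw [← ENNReal.rpow_natCast, ← ENNReal.rpow_natCast, ← ENNReal.rpow_mul]; norm_num
  simp only [Pi.mul_apply, e1, e2] at hhol
  have h4 : ∀ q : X.L2, (∫⁻ x in X.cell, (‖q x‖ₑ ^ 4) ^ (3 : ℝ)) ^ (1 / 3 : ℝ) = X.l12 q := by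
    intro q
    unfold l12
    congr 1
    refine lintegral_congr fun x => ?_
    rw [← ENNReal.rpow_natCast, ← ENNReal.rpow_mul, ← ENNReal.rpow_natCast]
    norm_num
  have hgb : (∫⁻ x in X.cell, g x ^ (3 : ℝ)) ^ (1 / 3 : ℝ) ≤
      v + X.l12 (X.incl a) + X.l12 (X.incl b) := by
    have h1 := ENNReal.lintegral_Lp_add_le (μ := volume.restrict X.cell) (p := 3)
      (f := fun x => 1 + ‖X.incl a x‖ₑ ^ 4) (g := fun x => ‖X.incl b x‖ₑ ^ 4)
      (measurable_const.add (ham.pow_const 4)).aemeasurable (hbm.pow_const 4).aemeasurable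
      (by norm_num)
    have h2 := ENNReal.lintegral_Lp_add_le (μ := volume.restrict X.cell) (p := 3)
      (f := fun x => 1) (g := fun x => ‖X.incl a x‖ₑ ^ 4)
      aemeasurable_const (ham.pow_const 4).aemeasurable (by norm_num)
    simp only [Pi.add_apply, h4, ENNReal.one_rpow, setLIntegral_const, one_mul] at h1 h2
    exact h1.trans (add_le_add_left h2 _)
  have hsix : ∫⁻ x in X.cell, ‖X.incl a x - X.incl b x‖ₑ ^ 6 ≤ C * ‖a - b‖ₑ ^ 6 := by
    refine le_trans (le_of_eq ?_) (hC (a - b))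
    refine lintegral_congr_ae ?_
    filter_upwards [Lp.coeFn_sub (X.incl a) (X.incl b)] with x hx
    rw [map_sub, hx, Pi.sub_apply]
  calc _ = ∫⁻ x in X.cell, g x ^ 2 * ‖X.incl a x - X.incl b x‖ₑ ^ 2 := by
        simp only [mul_pow, hg]
    _ ≤ (∫⁻ x in X.cell, g x ^ (3 : ℝ)) ^ (1 / (3 / 2) : ℝ) *
        (∫⁻ x in X.cell, ‖X.incl a x - X.incl b x‖ₑ ^ 6) ^ (1 / 3 : ℝ) := hhol
    _ ≤ ((∫⁻ x in X.cell, g x ^ (3 : ℝ)) ^ (1 / 3 : ℝ)) ^ 2 * (C * ‖a - b‖ₑ ^ 6) ^ (1 / 3 : ℝ) := by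
        rw [← ENNReal.rpow_natCast (_ ^ (1 / 3 : ℝ)), ← ENNReal.rpow_mul]
        norm_num
        gcongr
    _ ≤ (v + X.l12 (X.incl a) + X.l12 (X.incl b)) ^ 2 *
        ((C : ℝ≥0∞) ^ (1 / 6 : ℝ) * ‖a - b‖ₑ) ^ 2 := by
        gcongr
        rw [ENNReal.mul_rpow_of_nonneg _ _ (by norm_num), mul_pow, ← ENNReal.rpow_natCast,
          ← ENNReal.rpow_natCast, ← ENNReal.rpow_natCast, ← ENNReal.rpow_mul, ← ENNReal.rpow_mul]
        norm_num
    _ ≤ ((1 + v) * (1 + X.l12 (X.incl a) + X.l12 (X.incl b))) ^ 2 *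
        ((C : ℝ≥0∞) ^ (1 / 6 : ℝ) * ‖a - b‖ₑ) ^ 2 := by
        gcongr
        set p := X.l12 (X.incl a)
        set q := X.l12 (X.incl b)
        calc v + p + q ≤ v + p + q + (1 + v * p + v * q) := le_self_add
          _ = _ := by ring
    _ = _ := by rw [hD]; ring

end Setting

/-! ### Truncated nonlinearities and superposition operators. -/

/-- Truncation of a real number to `[-n, n]`. -/
def clampR (n : ℕ) (s : ℝ) : ℝ := max (-(n : ℝ)) (min s n)

theorem abs_clampR_le (n : ℕ) (s : ℝ) : |clampR n s| ≤ n := by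
  have : (0 : ℝ) ≤ n := n.cast_nonneg
  rw [clampR, abs_le]
  exact ⟨le_max_left _ _, max_le (by linarith) (min_le_right _ _)⟩

theorem abs_clampR_sub_le (n : ℕ) (a b : ℝ) : |clampR n a - clampR n b| ≤ |a - b| := by
  unfold clampR
  refine (abs_max_sub_max_le_max _ _ _ _).trans (max_le (by simp) ?_)
  exact (abs_min_sub_min_le_max _ _ _ _).trans (max_le le_rfl (by simp))

theorem clampR_zero (n : ℕ) : clampR n 0 = 0 := by
  simp [clampR]

theorem abs_clampR_le_abs (n : ℕ) (s : ℝ) : |clampR n s| ≤ |s| := by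
  have := abs_clampR_sub_le n s 0
  rwa [clampR_zero, sub_zero, sub_zero] at this

theorem clampR_of_abs_le {n : ℕ} {s : ℝ} (h : |s| ≤ n) : clampR n s = s := by
  rw [abs_le] at h
  rw [clampR, min_eq_left h.2, max_eq_right h.1]

theorem continuous_clampR (n : ℕ) : Continuous (clampR n) := by
  unfold clampR; fun_prop

/-- The nonlinearity, frozen outside `[-n, n]`. -/
def trunc (f : ℝ → ℝ) (n : ℕ) (s : ℝ) : ℝ := f (clampR n s)

/-- The growth condition `|φ(s) - φ(0)| ≤ A (1 + |s|⁴) |s|`. -/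
def QuinticGrowth (φ : ℝ → ℝ) (A : ℝ) : Prop := ∀ s, |φ s - φ 0| ≤ A * ((1 + |s| ^ 4) * |s|)

section Trunc

variable {f : ℝ → ℝ} {C κ K : ℝ}

theorem IsNonlinearity.quinticGrowth (hf : IsNonlinearity f C κ K) :
    QuinticGrowth f C := fun s => by
  have := hf.abs_sub_le s 0
  simpa [mul_assoc] using this

theorem IsNonlinearity.quinticGrowth_trunc (hf : IsNonlinearity f C κ K) (n : ℕ) :
    QuinticGrowth (trunc f n) C := fun s => by
  have hC := hf.nonneg
  rw [trunc, trunc, clampR_zero]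
  refine (hf.quinticGrowth _).trans ?_
  have := abs_clampR_le_abs n s
  gcongr

theorem IsNonlinearity.continuous_trunc (hf : IsNonlinearity f C κ K) (n : ℕ) :
    Continuous (trunc f n) :=
  hf.contDiff.continuous.comp (continuous_clampR n)

theorem IsNonlinearity.abs_trunc_sub_le (hf : IsNonlinearity f C κ K) (n : ℕ) (a b : ℝ) :
    |trunc f n a - trunc f n b| ≤ C * (1 + n ^ 4 + n ^ 4) * |a - b| := by
  have hC := hf.nonneg
  refine (hf.abs_sub_le _ _).trans ?_
  have h1 := abs_clampR_le n a
  have h2 := abs_clampR_le n b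
  have h3 := abs_clampR_sub_le n a b
  gcongr

theorem IsNonlinearity.abs_trunc_le (hf : IsNonlinearity f C κ K) (n : ℕ) (s : ℝ) :
    |trunc f n s| ≤ |f 0| + C * ((1 + n ^ 4) * n) := by
  have hC := hf.nonneg
  have h1 := hf.quinticGrowth (clampR n s)
  have h2 := abs_clampR_le n s
  have h3 : C * ((1 + |clampR n s| ^ 4) * |clampR n s|) ≤ C * ((1 + (n : ℝ) ^ 4) * n) := by gcongr
  have h4 := abs_add_le (f 0) (f (clampR n s) - f 0)
  rw [add_sub_cancel] at h4
  rw [trunc]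
  linarith

end Trunc

namespace Setting

variable (X : Setting)

open Classical in
/-- The superposition operator `q ↦ φ(q)` in `L²`. -/
def nem (φ : ℝ → ℝ) (q : X.L2) : X.L2 :=
  if h : MemLp (fun x => φ (q x)) 2 (volume.restrict X.cell) then h.toLp else 0

variable {X}

theorem coeFn_nem {φ : ℝ → ℝ} {q : X.L2} (h : MemLp (fun x => φ (q x)) 2 (volume.restrict X.cell)) :
    X.nem φ q =ᵐ[volume.restrict X.cell] fun x => φ (q x) := by
  rw [nem, dif_pos h]
  exact h.coeFn_toLp

theorem measurable_coe (q : X.L2) : Measurable q := (Lp.stronglyMeasurable q).measurable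

theorem memLp_of_bounded {φ : ℝ → ℝ} (hφ : Continuous φ) {M : ℝ} (hM : ∀ s, |φ s| ≤ M) (q : X.L2) :
    MemLp (fun x => φ (q x)) 2 (volume.restrict X.cell) :=
  MemLp.of_bound (hφ.measurable.comp (measurable_coe q)).aestronglyMeasurable M
    (Eventually.of_forall fun _ => hM _)

theorem enorm_nem {φ : ℝ → ℝ} {q : X.L2}
    (h : MemLp (fun x => φ (q x)) 2 (volume.restrict X.cell)) :
    ‖X.nem φ q‖ₑ = eLpNorm (fun x => φ (q x)) 2 (volume.restrict X.cell) := by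
  rw [Lp.enorm_def]
  exact eLpNorm_congr_ae (coeFn_nem h)

theorem norm_nem_sub_le {φ : ℝ → ℝ} (hφ : Continuous φ) {M L : ℝ} (hM : ∀ s, |φ s| ≤ M)
    (hL : ∀ a b, |φ a - φ b| ≤ L * |a - b|) (q r : X.L2) :
    ‖X.nem φ q - X.nem φ r‖ ≤ L * ‖q - r‖ := by
  refine Lp.norm_le_mul_norm_of_ae_le_mul ?_
  filter_upwards [coeFn_nem (memLp_of_bounded hφ hM q), coeFn_nem (memLp_of_bounded hφ hM r),
    Lp.coeFn_sub (X.nem φ q) (X.nem φ r), Lp.coeFn_sub q r] with x h1 h2 h3 h4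
  rw [h3, h4, Pi.sub_apply, Pi.sub_apply, h1, h2]
  exact hL _ _

theorem continuous_nem {φ : ℝ → ℝ} (hφ : Continuous φ) {M L : ℝ} (hM : ∀ s, |φ s| ≤ M)
    (hL : ∀ a b, |φ a - φ b| ≤ L * |a - b|) : Continuous (X.nem φ) := by
  have hL0 : 0 ≤ L := by
    have := (abs_nonneg _).trans (hL 1 0)
    simpa using this
  refine (LipschitzWith.of_dist_le_mul (K := L.toNNReal) fun q r => ?_).continuous
  rw [dist_eq_norm, dist_eq_norm, Real.coe_toNNReal _ hL0]
  exact norm_nem_sub_le hφ hM hL q r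

variable (X)

/-- Stated for a majorized function so that one inequality serves both differences `f(a) - f(b)`
and, with `b = 0`, the size of `f` and of its truncations. -/
theorem exists_eLpNorm_growth_le : ∃ D : ℝ≥0, ∀ (a b : X.H1) (A : ℝ≥0) (Ψ : E3 → ℝ),
    (∀ᵐ x ∂volume.restrict X.cell, ‖Ψ x‖ₑ ≤
      A * ((1 + ‖X.incl a x‖ₑ ^ 4 + ‖X.incl b x‖ₑ ^ 4) * ‖X.incl a x - X.incl b x‖ₑ)) →
    eLpNorm Ψ 2 (volume.restrict X.cell) ≤
      A * (D * ((1 + X.l12 (X.incl a) + X.l12 (X.incl b)) * ‖a - b‖ₑ)) := by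
  obtain ⟨D, hD⟩ := X.exists_lintegral_growth_le
  refine ⟨D, fun a b A Ψ h => ?_⟩
  rw [eLpNorm_eq_lintegral_rpow_enorm_toReal (by norm_num) (by norm_num)]
  simp only [ENNReal.toReal_ofNat, ENNReal.rpow_ofNat]
  have h1 : ∫⁻ x in X.cell, ‖Ψ x‖ₑ ^ 2 ≤
      (A * (D * ((1 + X.l12 (X.incl a) + X.l12 (X.incl b)) * ‖a - b‖ₑ))) ^ 2 := by
    calc _ ≤ ∫⁻ x in X.cell, (A : ℝ≥0∞) ^ 2 * ((1 + ‖X.incl a x‖ₑ ^ 4 + ‖X.incl b x‖ₑ ^ 4) *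
          ‖X.incl a x - X.incl b x‖ₑ) ^ 2 := by
          refine lintegral_mono_ae ?_
          filter_upwards [h] with x hx
          rw [← mul_pow]
          gcongr
      _ ≤ _ := by
          rw [lintegral_const_mul' _ _ (by finiteness), mul_pow]
          gcongr
          exact hD a b
  refine (ENNReal.rpow_le_rpow h1 (by norm_num)).trans_eq ?_
  rw [← ENNReal.rpow_natCast, ← ENNReal.rpow_mul]
  norm_num

theorem l12_zero : X.l12 (X.incl 0) = 0 := by
  have : ∫⁻ x in X.cell, ‖X.incl 0 x‖ₑ ^ 12 = 0 := by
    rw [map_zero]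
    refine (lintegral_congr_ae (g := fun _ => 0) ?_).trans lintegral_zero
    filter_upwards [Lp.coeFn_zero ℝ 2 (volume.restrict X.cell)] with x hx
    rw [hx]; simp
  rw [l12, this, ENNReal.zero_rpow_of_pos (by norm_num)]

/-- The bound `A (1 + (1 + ‖z‖⁴_{L¹²}) ‖z‖_{H¹})` of a quintic superposition operator. -/
theorem exists_eLpNorm_comp_le (A c : ℝ) : ∃ D : ℝ≥0, ∀ (φ : ℝ → ℝ), Continuous φ →
    QuinticGrowth φ A → φ 0 = c → ∀ z : X.H1,
    eLpNorm (fun x => φ (X.incl z x)) 2 (volume.restrict X.cell) ≤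
      D * (1 + (1 + X.l12 (X.incl z)) * ‖z‖ₑ) := by
  obtain ⟨D, hD⟩ := X.exists_eLpNorm_growth_le
  set v : ℝ≥0∞ := ‖c‖ₑ * volume X.cell ^ (1 / 2 : ℝ) with hv
  have hvt : v ≠ ⊤ := by
    have := X.volume_cell_ne_top
    rw [hv]; finiteness
  refine ⟨A.toNNReal * D + v.toNNReal, fun φ hφ hg hφ0 z => ?_⟩
  have h0 := hD z 0 A.toNNReal (fun x => φ (X.incl z x) - φ 0) ?_
  · have h1 : (fun x => φ (X.incl z x)) = (fun x => φ (X.incl z x) - φ 0) + fun _ => c := by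
      ext x; simp [hφ0]
    rw [h1]
    have hm : AEStronglyMeasurable (fun x => φ (X.incl z x) - φ 0) (volume.restrict X.cell) :=
      ((hφ.measurable.comp (measurable_coe _)).sub_const _).aestronglyMeasurable
    refine (eLpNorm_add_le hm aestronglyMeasurable_const (by norm_num)).trans ?_
    have h2 : eLpNorm (fun _ : E3 => c) 2 (volume.restrict X.cell) ≤ v := by
      rcases eq_or_ne (volume.restrict X.cell) 0 with h | h
      · rw [h]; simp
      · rw [eLpNorm_const _ (by norm_num) h, Measure.restrict_apply_univ, hv]
        norm_num
    refine (add_le_add h0 h2).trans ?_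
    rw [l12_zero, sub_zero, add_zero, ENNReal.coe_add, ENNReal.coe_toNNReal hvt, ENNReal.coe_mul]
    set m := (1 + X.l12 (X.incl z)) * ‖z‖ₑ
    calc _ ≤ (A.toNNReal : ℝ≥0∞) * (D * m) + v + (A.toNNReal * D + v * m) := le_self_add
      _ = _ := by ring
  · filter_upwards [Lp.coeFn_zero ℝ 2 (volume.restrict X.cell)] with x hx
    rw [map_zero, hx]
    have e : ∀ s : ℝ, ‖φ s - φ 0‖ₑ ≤ (A.toNNReal : ℝ≥0∞) * ((1 + ‖s‖ₑ ^ 4) * ‖s‖ₑ) := by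
      intro s
      have : (A.toNNReal : ℝ≥0∞) * ((1 + ‖s‖ₑ ^ 4) * ‖s‖ₑ) =
          ENNReal.ofReal A * (ENNReal.ofReal ((1 + |s| ^ 4) * |s|)) := by
        rw [ENNReal.ofReal_mul (by positivity), ENNReal.ofReal_add zero_le_one (by positivity),
          ENNReal.ofReal_pow (abs_nonneg _), Real.enorm_eq_ofReal_abs, ENNReal.ofReal_one]
        rfl
      rw [this, Real.enorm_eq_ofReal_abs]
      by_cases hA : 0 ≤ A
      · rw [← ENNReal.ofReal_mul hA]
        exact ENNReal.ofReal_le_ofReal (hg s)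
      · have h3 := hg s
        have h4 : A * ((1 + |s| ^ 4) * |s|) ≤ 0 :=
          mul_nonpos_of_nonpos_of_nonneg (not_le.1 hA).le (by positivity)
        rw [ENNReal.ofReal_of_nonpos (h3.trans h4)]
        exact zero_le
    simpa using e (X.incl z x)

variable {X} {f : ℝ → ℝ} {C κ K : ℝ}

theorem memLp_nonlinearity (hf : IsNonlinearity f C κ K) {z : X.H1} (hz : X.l12 (X.incl z) ≠ ⊤) :
    MemLp (fun x => f (X.incl z x)) 2 (volume.restrict X.cell) := by
  obtain ⟨D, hD⟩ := X.exists_eLpNorm_comp_le C (f 0)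
  refine ⟨(hf.contDiff.continuous.measurable.comp (measurable_coe _)).aestronglyMeasurable, ?_⟩
  refine (hD f hf.contDiff.continuous hf.quinticGrowth rfl z).trans_lt ?_
  finiteness

theorem exists_enorm_nem_sub_le (hf : IsNonlinearity f C κ K) : ∃ D : ℝ≥0, ∀ a b : X.H1,
    X.l12 (X.incl a) ≠ ⊤ → X.l12 (X.incl b) ≠ ⊤ →
    ‖X.nem f (X.incl a) - X.nem f (X.incl b)‖ₑ ≤
      D * ((1 + X.l12 (X.incl a) + X.l12 (X.incl b)) * ‖a - b‖ₑ) := by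
  obtain ⟨D, hD⟩ := X.exists_eLpNorm_growth_le
  refine ⟨C.toNNReal * D, fun a b ha hb => ?_⟩
  rw [ENNReal.coe_mul, mul_assoc, Lp.enorm_def]
  refine hD a b C.toNNReal _ ?_
  filter_upwards [coeFn_nem (memLp_nonlinearity hf ha), coeFn_nem (memLp_nonlinearity hf hb),
    Lp.coeFn_sub (X.nem f (X.incl a)) (X.nem f (X.incl b))] with x h1 h2 h3
  rw [h3, Pi.sub_apply, h1, h2]
  have e : ∀ s r : ℝ, ‖f s - f r‖ₑ ≤ (C.toNNReal : ℝ≥0∞) *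
      ((1 + ‖s‖ₑ ^ 4 + ‖r‖ₑ ^ 4) * ‖s - r‖ₑ) := by
    intro s r
    have : (C.toNNReal : ℝ≥0∞) * ((1 + ‖s‖ₑ ^ 4 + ‖r‖ₑ ^ 4) * ‖s - r‖ₑ) =
        ENNReal.ofReal (C * ((1 + |s| ^ 4 + |r| ^ 4) * |s - r|)) := by
      rw [ENNReal.ofReal_mul hf.nonneg, ENNReal.ofReal_mul (by positivity),
        ENNReal.ofReal_add (by positivity) (by positivity),
        ENNReal.ofReal_add zero_le_one (by positivity),
        ENNReal.ofReal_pow (abs_nonneg _), ENNReal.ofReal_pow (abs_nonneg _),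
        Real.enorm_eq_ofReal_abs, Real.enorm_eq_ofReal_abs, Real.enorm_eq_ofReal_abs,
        ENNReal.ofReal_one]
      rfl
    rw [this, Real.enorm_eq_ofReal_abs, ← mul_assoc]
    exact ENNReal.ofReal_le_ofReal (hf.abs_sub_le s r)
  exact e _ _

theorem exists_enorm_nem_le (hf : IsNonlinearity f C κ K) : ∃ D : ℝ≥0, ∀ z : X.H1,
    (∀ n, ‖X.nem (trunc f n) (X.incl z)‖ₑ ≤ D * (1 + (1 + X.l12 (X.incl z)) * ‖z‖ₑ)) ∧
    (X.l12 (X.incl z) ≠ ⊤ → ‖X.nem f (X.incl z)‖ₑ ≤ D * (1 + (1 + X.l12 (X.incl z)) * ‖z‖ₑ)) := by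
  obtain ⟨D, hD⟩ := X.exists_eLpNorm_comp_le C (f 0)
  refine ⟨D, fun z => ⟨fun n => ?_, fun hz => ?_⟩⟩
  · rw [enorm_nem (memLp_of_bounded (hf.continuous_trunc n) (hf.abs_trunc_le n) _)]
    exact hD _ (hf.continuous_trunc n) (hf.quinticGrowth_trunc n) (by rw [trunc, clampR_zero]) z
  · rw [enorm_nem (memLp_nonlinearity hf hz)]
    exact hD _ hf.contDiff.continuous hf.quinticGrowth rfl z

theorem trunc_eventually_eq (f : ℝ → ℝ) (s : ℝ) : ∀ᶠ n in atTop, trunc f n s = f s := by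
  obtain ⟨N, hN⟩ := exists_nat_ge |s|
  filter_upwards [eventually_ge_atTop N] with n hn
  rw [trunc, clampR_of_abs_le (hN.trans (by exact_mod_cast hn))]

/-- Pointwise the truncations are eventually equal to `f`. The quintic growth bound holds with the
same constant for all of them and is square integrable when the `L¹²` norm is finite, so dominated
convergence applies. -/
theorem tendsto_nem_trunc (hf : IsNonlinearity f C κ K) {z : X.H1} (hz : X.l12 (X.incl z) ≠ ⊤) :
    Tendsto (fun n => X.nem (trunc f n) (X.incl z)) atTop (𝓝 (X.nem f (X.incl z))) := by
  rw [Lp.tendsto_Lp_iff_tendsto_eLpNorm']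
  have hcongr : ∀ n, eLpNorm (⇑(X.nem (trunc f n) (X.incl z)) - ⇑(X.nem f (X.incl z))) 2
      (volume.restrict X.cell) = (∫⁻ x in X.cell,
        ‖trunc f n (X.incl z x) - f (X.incl z x)‖ₑ ^ 2) ^ (1 / 2 : ℝ) := by
    intro n
    rw [eLpNorm_eq_lintegral_rpow_enorm_toReal (by norm_num) (by norm_num)]
    simp only [ENNReal.toReal_ofNat, ENNReal.rpow_ofNat]
    congr 1
    refine lintegral_congr_ae ?_
    filter_upwards [coeFn_nem (memLp_of_bounded (hf.continuous_trunc n) (hf.abs_trunc_le n)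
      (X.incl z)), coeFn_nem (memLp_nonlinearity hf hz)] with x h1 h2
    rw [Pi.sub_apply, h1, h2]
  simp only [hcongr]
  set B : E3 → ℝ≥0∞ := fun x => (2 * (C.toNNReal *
    ((1 + ‖X.incl z x‖ₑ ^ 4 + ‖X.incl 0 x‖ₑ ^ 4) * ‖X.incl z x - X.incl 0 x‖ₑ))) ^ 2 with hB
  have hfin : ∫⁻ x in X.cell, B x ≠ ⊤ := by
    obtain ⟨D, hD⟩ := X.exists_lintegral_growth_le
    simp only [hB, mul_pow _ _ 2]
    rw [lintegral_const_mul' _ _ (by finiteness), lintegral_const_mul' _ _ (by finiteness)]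
    have h1 := hD z 0
    rw [l12_zero] at h1
    simp only [mul_pow _ _ 2] at h1
    refine ENNReal.mul_ne_top (by finiteness) (ENNReal.mul_ne_top (by finiteness)
      (ne_top_of_le_ne_top ?_ h1))
    finiteness
  have hlim : Tendsto (fun n => ∫⁻ x in X.cell,
      ‖trunc f n (X.incl z x) - f (X.incl z x)‖ₑ ^ 2) atTop (𝓝 (∫⁻ x in X.cell, 0)) := by
    refine tendsto_lintegral_of_dominated_convergence' B (fun n => ?_) (fun n => ?_) hfin ?_
    · exact (((((hf.continuous_trunc n).measurable.comp (measurable_coe _)).sub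
        (hf.contDiff.continuous.measurable.comp (measurable_coe _))).enorm).pow_const 2).aemeasurable
    · filter_upwards [Lp.coeFn_zero ℝ 2 (volume.restrict X.cell)] with x hx
      simp only [hB]
      gcongr
      rw [map_zero, hx]
      have e : ∀ s : ℝ, ‖trunc f n s - f s‖ₑ ≤ 2 * ((C.toNNReal : ℝ≥0∞) *
          ((1 + ‖s‖ₑ ^ 4) * ‖s‖ₑ)) := by
        intro s
        have : 2 * ((C.toNNReal : ℝ≥0∞) * ((1 + ‖s‖ₑ ^ 4) * ‖s‖ₑ)) =
            ENNReal.ofReal (2 * (C * ((1 + |s| ^ 4) * |s|))) := by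
          rw [ENNReal.ofReal_mul (by norm_num), ENNReal.ofReal_mul hf.nonneg,
            ENNReal.ofReal_mul (by positivity),
            ENNReal.ofReal_add zero_le_one (by positivity),
            ENNReal.ofReal_pow (abs_nonneg _), Real.enorm_eq_ofReal_abs, ENNReal.ofReal_one,
            ENNReal.ofReal_ofNat]
          rfl
        rw [this, Real.enorm_eq_ofReal_abs]
        refine ENNReal.ofReal_le_ofReal ?_
        have h1 := hf.quinticGrowth_trunc n s
        have h2 := hf.quinticGrowth s
        have h3 : trunc f n 0 = f 0 := by rw [trunc, clampR_zero]
        rw [h3] at h1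
        rw [abs_sub_comm] at h2
        have h4 := abs_add_le (trunc f n s - f 0) (f 0 - f s)
        rw [sub_add_sub_cancel] at h4
        linarith
      simpa using e (X.incl z x)
    · refine Eventually.of_forall fun x => ?_
      refine tendsto_const_nhds.congr' ?_
      filter_upwards [trunc_eventually_eq f (X.incl z x)] with n hn
      simp [hn]
  have h2 := (ENNReal.continuous_rpow_const (y := 1 / 2)).tendsto _ |>.comp hlim
  simpa [Function.comp_def] using h2

end Setting

/-! ### The potential energy. -/

/-- The primitive of `φ` that vanishes at zero. -/
def prim (φ : ℝ → ℝ) (s : ℝ) : ℝ := ∫ r in (0 : ℝ)..s, φ r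

theorem prim_sub {φ : ℝ → ℝ} (hφ : Continuous φ) (a b : ℝ) :
    prim φ a - prim φ b = ∫ r in b..a, φ r := by
  rw [prim, prim, intervalIntegral.integral_interval_sub_left] <;>
    exact hφ.intervalIntegrable _ _

theorem hasDerivAt_prim {φ : ℝ → ℝ} (hφ : Continuous φ) (s : ℝ) : HasDerivAt (prim φ) (φ s) s :=
  intervalIntegral.integral_hasDerivAt_right (hφ.intervalIntegrable _ _)
    hφ.stronglyMeasurable.stronglyMeasurableAtFilter hφ.continuousAt

theorem continuous_prim {φ : ℝ → ℝ} (hφ : Continuous φ) : Continuous (prim φ) :=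
  continuous_iff_continuousAt.2 fun s => (hasDerivAt_prim hφ s).continuousAt

theorem abs_prim_sub_le {φ : ℝ → ℝ} (hφ : Continuous φ) {M : ℝ} (hM : ∀ s, |φ s| ≤ M) (a b : ℝ) :
    |prim φ a - prim φ b| ≤ M * |a - b| := by
  rw [prim_sub hφ]
  have h : ∀ x ∈ uIoc b a, ‖φ x‖ ≤ M := fun x _ => hM x
  exact intervalIntegral.norm_integral_le_of_norm_le_const h

theorem abs_prim_add_sub_le {φ : ℝ → ℝ} (hφ : Continuous φ) {L : ℝ}
    (hL : ∀ a b, |φ a - φ b| ≤ L * |a - b|) (a h : ℝ) :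
    |prim φ (a + h) - prim φ a - φ a * h| ≤ L * h ^ 2 := by
  have hL0 : 0 ≤ L := by
    have := (abs_nonneg _).trans (hL 1 0)
    simpa using this
  have e : prim φ (a + h) - prim φ a - φ a * h = ∫ r in a..(a + h), (φ r - φ a) := by
    rw [prim_sub hφ, intervalIntegral.integral_sub (hφ.intervalIntegrable _ _)
      intervalIntegrable_const, intervalIntegral.integral_const]
    simp [mul_comm]
  rw [e]
  have h1 := intervalIntegral.norm_integral_le_of_norm_le_const (a := a) (b := a + h)
    (f := fun r => φ r - φ a) (C := L * |h|) fun x hx => ?_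
  · rw [add_sub_cancel_left, mul_assoc, abs_mul_abs_self] at h1
    rw [pow_two]
    exact h1
  · refine (hL x a).trans (mul_le_mul_of_nonneg_left ?_ hL0)
    have := abs_sub_left_of_mem_uIcc (uIoc_subset_uIcc hx)
    rwa [add_sub_cancel_left] at this

theorem QuinticGrowth.abs_prim_le {φ : ℝ → ℝ} {A : ℝ} (hA : 0 ≤ A) (h : QuinticGrowth φ A) (s : ℝ) :
    |prim φ s| ≤ (|φ 0| + A * ((1 + |s| ^ 4) * |s|)) * |s| := by
  have h1 := intervalIntegral.norm_integral_le_of_norm_le_const (a := 0) (b := s)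
    (f := φ) (C := |φ 0| + A * ((1 + |s| ^ 4) * |s|)) fun x hx => ?_
  · simpa [prim] using h1
  · have h2 := abs_sub_left_of_mem_uIcc (uIoc_subset_uIcc hx)
    rw [sub_zero, sub_zero] at h2
    have h3 := h x
    have h4 := abs_add_le (φ 0) (φ x - φ 0)
    rw [add_sub_cancel] at h4
    rw [Real.norm_eq_abs]
    have h5 : A * ((1 + |x| ^ 4) * |x|) ≤ A * ((1 + |s| ^ 4) * |s|) := by gcongr
    linarith

/-- The sextic bound of the primitive of a quintic function. -/
theorem QuinticGrowth.abs_prim_le_sextic {φ : ℝ → ℝ} {A : ℝ} (hA : 0 ≤ A) (h : QuinticGrowth φ A)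
    (s : ℝ) : |prim φ s| ≤ (|φ 0| + 2 * A) * (1 + |s| ^ 6) := by
  refine (h.abs_prim_le hA s).trans ?_
  have hs := abs_nonneg s
  set r := |s|
  have h1 : r ≤ 1 + r ^ 6 := by
    rcases le_total r 1 with h | h
    · have : 0 ≤ r ^ 6 := by positivity
      linarith
    · have := le_self_pow₀ h (n := 6) (by norm_num)
      linarith
  have h2 : r ^ 2 ≤ 1 + r ^ 6 := by
    rcases le_total r 1 with h | h
    · have h3 : r ^ 2 ≤ 1 := pow_le_one₀ hs h
      have : 0 ≤ r ^ 6 := by positivity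
      linarith
    · have := pow_le_pow_right₀ h (show 2 ≤ 6 by norm_num)
      linarith
  have h3 : (1 + r ^ 4) * r * r ≤ 2 * (1 + r ^ 6) := by
    have : (1 + r ^ 4) * r * r = r ^ 2 + r ^ 6 := by ring
    rw [this]
    linarith
  have h0 := abs_nonneg (φ 0)
  calc (|φ 0| + A * ((1 + r ^ 4) * r)) * r = |φ 0| * r + A * ((1 + r ^ 4) * r * r) := by ring
    _ ≤ |φ 0| * (1 + r ^ 6) + A * (2 * (1 + r ^ 6)) := by gcongr
    _ = _ := by ring

/-- The primitive of a dissipative nonlinearity is bounded from below by a quadratic function. -/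
theorem IsNonlinearity.exists_le_prim {f : ℝ → ℝ} {C κ K : ℝ} (hκ : 0 < κ)
    (hf : IsNonlinearity f C κ K) : ∃ B, 0 ≤ B ∧ ∀ s, κ / 4 * s ^ 2 - B ≤ prim f s := by
  have hC := hf.nonneg
  have hfc := hf.contDiff.continuous
  -- One constant for two regimes: `f` is bounded by `|f 0| + 2C` on `[-1, 1]`, and outside
  -- dissipativity is divided by `|r| ≥ 1`.
  set b : ℝ := |f 0| + 2 * C + κ with hb
  have hb0 : 0 ≤ b := by positivity
  have hsmall : ∀ r, |r| ≤ 1 → |f r| ≤ |f 0| + 2 * C := by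
    intro r hr
    have h1 := hf.quinticGrowth r
    have h2 : C * ((1 + |r| ^ 4) * |r|) ≤ C * ((1 + 1 ^ 4) * 1) := by gcongr
    have h4 := abs_add_le (f 0) (f r - f 0)
    rw [add_sub_cancel] at h4
    linarith
  have hpos : ∀ r, 0 ≤ r → κ * r - b ≤ f r := by
    intro r hr
    rcases le_total r 1 with h | h
    · have h1 := hsmall r (by rwa [abs_of_nonneg hr])
      have h2 := neg_abs_le (f r)
      nlinarith
    · have h1 := hf.dissipative r
      rw [sq_abs] at h1
      have h2 : 0 ≤ |f 0| := abs_nonneg _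
      by_contra! hlt
      have h3 : f r * r < (κ * r - b) * r := mul_lt_mul_of_pos_right hlt (by linarith)
      nlinarith
  have hneg : ∀ r, r ≤ 0 → f r ≤ κ * r + b := by
    intro r hr
    rcases le_total (-1) r with h | h
    · have h1 := hsmall r (by rw [abs_of_nonpos hr]; linarith)
      have h2 := le_abs_self (f r)
      nlinarith
    · have h1 := hf.dissipative r
      rw [sq_abs] at h1
      have h2 : 0 ≤ |f 0| := abs_nonneg _
      by_contra! hlt
      have h3 : f r * r < (κ * r + b) * r := mul_lt_mul_of_neg_right hlt (by linarith)
      nlinarith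
  have hquad : ∀ s, κ / 2 * s ^ 2 - b * |s| ≤ prim f s := by
    intro s
    have hi : ∀ c : ℝ, ∫ r in (0 : ℝ)..s, (κ * r + c) = κ / 2 * s ^ 2 + c * s := by
      intro c
      have h1 : IntervalIntegrable (fun r : ℝ => κ * r) volume 0 s :=
        (by fun_prop : Continuous fun r : ℝ => κ * r).intervalIntegrable _ _
      rw [intervalIntegral.integral_add h1 intervalIntegrable_const, intervalIntegral.integral_const_mul, integral_id,
        intervalIntegral.integral_const]
      simp only [smul_eq_mul]
      ring
    rcases le_total 0 s with hs | hs
    · have h1 := intervalIntegral.integral_mono_on (μ := volume) hs (f := fun r => κ * r + -b) (g := f)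
        (Continuous.intervalIntegrable (by fun_prop) _ _) (hfc.intervalIntegrable _ _)
        fun r hr => by linarith [hpos r hr.1]
      rw [hi] at h1
      rw [abs_of_nonneg hs, prim]
      linarith
    · have h1 := intervalIntegral.integral_mono_on (μ := volume) hs (f := f) (g := fun r => κ * r + b)
        (hfc.intervalIntegrable _ _) (Continuous.intervalIntegrable (by fun_prop) _ _)
        fun r hr => by linarith [hneg r hr.2]
      rw [intervalIntegral.integral_symm, intervalIntegral.integral_symm 0 s, hi] at h1
      rw [abs_of_nonpos hs, prim]
      linarith
  refine ⟨b ^ 2 / κ, by positivity, fun s => le_trans ?_ (hquad s)⟩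
  -- Completing the square spends half of `κ/2 s²` on the linear term.
  have h1 : 0 ≤ (κ / 2 * |s| - b) ^ 2 / κ := by positivity
  have h2 : (κ / 2 * |s| - b) ^ 2 / κ = κ / 4 * |s| ^ 2 - b * |s| + b ^ 2 / κ := by
    field_simp; ring
  rw [h2, sq_abs] at h1
  linarith

namespace Setting

variable (X : Setting)

/-- The potential energy `∫ F(q)`, with `F` the primitive of `φ`. -/
def potential (φ : ℝ → ℝ) (q : X.L2) : ℝ := ∫ x in X.cell, prim φ (q x)

variable {X}

theorem integrable_prim_of_bounded {φ : ℝ → ℝ} (hφ : Continuous φ) {M : ℝ} (hM : ∀ s, |φ s| ≤ M)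
    (q : X.L2) : Integrable (fun x => prim φ (q x)) (volume.restrict X.cell) := by
  have hq : Integrable q (volume.restrict X.cell) := (Lp.memLp q).integrable (by norm_num)
  refine (hq.norm.const_mul M).mono'
    ((continuous_prim hφ).measurable.comp (measurable_coe q)).aestronglyMeasurable ?_
  refine Eventually.of_forall fun x => ?_
  have := abs_prim_sub_le hφ hM (q x) 0
  simpa [prim] using this

theorem integral_sq_eq (q : X.L2) : ∫ x in X.cell, q x ^ 2 = ‖q‖ ^ 2 := by
  rw [← real_inner_self_eq_norm_sq, L2.inner_def]
  refine integral_congr_ae (Eventually.of_forall fun x => ?_)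
  simp [pow_two]

theorem integral_abs_le (q : X.L2) : ∫ x in X.cell, |q x| ≤ √(volume.real X.cell) * ‖q‖ := by
  have h := X.lintegral_enorm_le q
  have e : ∫ x in X.cell, |q x| = (∫⁻ x in X.cell, ‖q x‖ₑ).toReal :=
    integral_norm_eq_lintegral_enorm (Lp.aestronglyMeasurable q)
  rw [e]
  have h2 := ENNReal.toReal_mono (b := ‖q‖ₑ * volume X.cell ^ (1 / 2 : ℝ)) (by
    have := X.volume_cell_ne_top
    finiteness) h
  refine h2.trans_eq ?_
  rw [ENNReal.toReal_mul, toReal_enorm, ← ENNReal.toReal_rpow, Real.sqrt_eq_rpow, mul_comm]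
  rfl

theorem abs_potential_sub_le {φ : ℝ → ℝ} (hφ : Continuous φ) {M : ℝ} (hM : ∀ s, |φ s| ≤ M)
    (q r : X.L2) :
    |X.potential φ q - X.potential φ r| ≤ M * √(volume.real X.cell) * ‖q - r‖ := by
  have hM0 : 0 ≤ M := (abs_nonneg _).trans (hM 0)
  have hd : Integrable (q - r : X.L2) (volume.restrict X.cell) :=
    (Lp.memLp (q - r)).integrable (by norm_num)
  rw [potential, potential, ← integral_sub (integrable_prim_of_bounded hφ hM q)
    (integrable_prim_of_bounded hφ hM r)]
  calc |∫ x in X.cell, (prim φ (q x) - prim φ (r x))|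
      ≤ ∫ x in X.cell, M * |(q - r : X.L2) x| := by
        rw [← Real.norm_eq_abs]
        refine norm_integral_le_of_norm_le (hd.norm.const_mul M) ?_
        filter_upwards [Lp.coeFn_sub q r] with x hx
        rw [hx]
        exact abs_prim_sub_le hφ hM _ _
    _ = M * ∫ x in X.cell, |(q - r : X.L2) x| := integral_const_mul _ _
    _ ≤ _ := by
        rw [mul_assoc]
        gcongr
        exact integral_abs_le _

/-- For Lipschitz `φ` the pointwise Taylor remainder is at most `L h²`, which integrates to `L
‖h‖²`. Such an argument is not available for the quintic `f` on `L²`, hence the truncations. -/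
theorem hasFDerivAt_potential {φ : ℝ → ℝ} (hφ : Continuous φ) {M L : ℝ} (hM : ∀ s, |φ s| ≤ M)
    (hL : ∀ a b, |φ a - φ b| ≤ L * |a - b|) (q : X.L2) :
    HasFDerivAt (X.potential φ) (innerSL ℝ (X.nem φ q)) q := by
  rw [hasFDerivAt_iff_isLittleO_nhds_zero]
  refine Asymptotics.IsBigO.trans_isLittleO (g := fun h : X.L2 => ‖h‖ ^ 2) ?_
    (Asymptotics.isLittleO_norm_pow_id (by norm_num))
  refine Asymptotics.IsBigO.of_bound L (Eventually.of_forall fun h => ?_)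
  have hmem := memLp_of_bounded hφ hM q
  have hsq : Integrable (fun x => h x ^ 2) (volume.restrict X.cell) := (Lp.memLp h).integrable_sq
  have hin : Integrable (fun x => φ (q x) * h x) (volume.restrict X.cell) :=
    hmem.integrable_mul (Lp.memLp h)
  have e1 : innerSL ℝ (X.nem φ q) h = ∫ x in X.cell, φ (q x) * h x := by
    change inner ℝ (X.nem φ q) h = _
    rw [L2.inner_def]
    refine integral_congr_ae ?_
    filter_upwards [coeFn_nem hmem] with x hx
    rw [hx, RCLike.inner_apply]
    simp [mul_comm]
  have e2 : X.potential φ (q + h) = ∫ x in X.cell, prim φ (q x + h x) := by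
    refine integral_congr_ae ?_
    filter_upwards [Lp.coeFn_add q h] with x hx
    rw [hx, Pi.add_apply]
  have hi2 : Integrable (fun x => prim φ (q x + h x)) (volume.restrict X.cell) := by
    refine (integrable_prim_of_bounded hφ hM (q + h)).congr ?_
    filter_upwards [Lp.coeFn_add q h] with x hx
    rw [hx, Pi.add_apply]
  rw [e1, e2, potential, ← integral_sub hi2 (integrable_prim_of_bounded hφ hM q),
    ← integral_sub (f := fun x => prim φ (q x + h x) - prim φ (q x))
      (hi2.sub (integrable_prim_of_bounded hφ hM q)) hin]
  rw [norm_pow, norm_norm, ← integral_sq_eq h, ← integral_const_mul]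
  refine norm_integral_le_of_norm_le (hsq.const_mul L) (Eventually.of_forall fun x => ?_)
  exact abs_prim_add_sub_le hφ hL _ _

theorem exists_integral_sextic_le (X : Setting) : ∃ D : ℝ, 0 ≤ D ∧ ∀ z : X.H1,
    Integrable (fun x => 1 + |X.incl z x| ^ 6) (volume.restrict X.cell) ∧
    ∫ x in X.cell, (1 + |X.incl z x| ^ 6) ≤ D * (1 + ‖z‖ ^ 6) := by
  obtain ⟨C, hC⟩ := X.exists_lintegral_pow_six_le
  refine ⟨volume.real X.cell + C, by positivity, fun z => ?_⟩
  have e : ∀ x, ‖|X.incl z x| ^ 6‖ₑ = ‖X.incl z x‖ₑ ^ 6 := fun x => by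
    rw [Real.enorm_of_nonneg (by positivity), ENNReal.ofReal_pow (abs_nonneg _),
      Real.enorm_eq_ofReal_abs]
  have hfin : ∫⁻ x in X.cell, ‖X.incl z x‖ₑ ^ 6 ≠ ⊤ :=
    ne_top_of_le_ne_top (by finiteness) (hC z)
  have hsm : AEStronglyMeasurable (fun x => |X.incl z x| ^ 6) (volume.restrict X.cell) :=
    ((measurable_coe (X.incl z)).abs.pow_const 6).aestronglyMeasurable
  have hi : Integrable (fun x => |X.incl z x| ^ 6) (volume.restrict X.cell) := by
    refine ⟨hsm, ?_⟩
    rw [HasFiniteIntegral]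
    simp only [e]
    exact hfin.lt_top
  refine ⟨(integrable_const 1).add hi, ?_⟩
  rw [integral_add (integrable_const 1) hi, integral_const, smul_eq_mul, mul_one,
    measureReal_restrict_apply_univ]
  have h2 : ∫ x in X.cell, |X.incl z x| ^ 6 ≤ C * ‖z‖ ^ 6 := by
    have h3 : ∫ x in X.cell, |X.incl z x| ^ 6 = (∫⁻ x in X.cell, ‖X.incl z x‖ₑ ^ 6).toReal := by
      rw [integral_eq_lintegral_of_nonneg_ae (Eventually.of_forall fun x => by positivity) hsm]
      congr 1
      refine lintegral_congr fun x => ?_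
      rw [ENNReal.ofReal_pow (abs_nonneg _), Real.enorm_eq_ofReal_abs]
    rw [h3]
    have := ENNReal.toReal_mono (by finiteness) (hC z)
    rwa [ENNReal.toReal_mul, ENNReal.toReal_pow, toReal_enorm, ENNReal.coe_toReal] at this
  have h3 : 0 ≤ volume.real X.cell := measureReal_nonneg
  have h4 : (0 : ℝ) ≤ C := C.2
  have h5 : 0 ≤ ‖z‖ ^ 6 := by positivity
  nlinarith [mul_nonneg h3 h5]

/-- Dominated convergence with the sextic majorant, uniform in the truncation; here `H¹ ⊂ L⁶` is
enough. -/
theorem tendsto_potential_trunc {f : ℝ → ℝ} {C κ K : ℝ} (hf : IsNonlinearity f C κ K) (z : X.H1) :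
    Tendsto (fun n => X.potential (trunc f n) (X.incl z)) atTop
      (𝓝 (X.potential f (X.incl z))) := by
  obtain ⟨D, -, hD⟩ := X.exists_integral_sextic_le
  have hfc := hf.contDiff.continuous
  refine tendsto_integral_of_dominated_convergence
    (fun x => (|f 0| + 2 * C) * (1 + |X.incl z x| ^ 6)) (fun n => ?_) ((hD z).1.const_mul _)
    (fun n => ?_) ?_
  · exact ((continuous_prim (hf.continuous_trunc n)).measurable.comp
      (measurable_coe _)).aestronglyMeasurable
  · refine Eventually.of_forall fun x => ?_
    have := (hf.quinticGrowth_trunc n).abs_prim_le_sextic hf.nonneg (X.incl z x)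
    rwa [trunc, clampR_zero] at this
  · refine Eventually.of_forall fun x => tendsto_const_nhds.congr' ?_
    obtain ⟨N, hN⟩ := exists_nat_ge |X.incl z x|
    filter_upwards [eventually_ge_atTop N] with n hn
    rw [prim, prim]
    refine intervalIntegral.integral_congr fun r hr => ?_
    rw [trunc, clampR_of_abs_le]
    have h2 := abs_sub_left_of_mem_uIcc hr
    rw [sub_zero, sub_zero] at h2
    exact h2.trans (hN.trans (by exact_mod_cast hn))

theorem exists_potential_bounds (X : Setting) {f : ℝ → ℝ} {C κ K : ℝ} (hκ : 0 < κ)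
    (hf : IsNonlinearity f C κ K) : ∃ B, 0 ≤ B ∧ ∀ z : X.H1,
    κ / 4 * ‖X.incl z‖ ^ 2 - B ≤ X.potential f (X.incl z) ∧
    X.potential f (X.incl z) ≤ B * (1 + ‖z‖ ^ 6) := by
  obtain ⟨D, hD0, hD⟩ := X.exists_integral_sextic_le
  obtain ⟨B, hB0, hB⟩ := hf.exists_le_prim hκ
  have hC := hf.nonneg
  have hfc := hf.contDiff.continuous
  set B₁ : ℝ := B * volume.real X.cell with hB₁
  set B₂ : ℝ := (|f 0| + 2 * C) * D with hB₂
  have h1 : 0 ≤ B₁ := by positivity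
  have h2 : 0 ≤ B₂ := by positivity
  refine ⟨B₁ + B₂, by positivity, fun z => ?_⟩
  have hi : Integrable (fun x => prim f (X.incl z x)) (volume.restrict X.cell) :=
    ((hD z).1.const_mul (|f 0| + 2 * C)).mono'
      ((continuous_prim hfc).measurable.comp (measurable_coe _)).aestronglyMeasurable
      (Eventually.of_forall fun x => hf.quinticGrowth.abs_prim_le_sextic hC _)
  have hsq : Integrable (fun x => X.incl z x ^ 2) (volume.restrict X.cell) :=
    (Lp.memLp (X.incl z)).integrable_sq
  constructor
  · have h3 := integral_mono ((hsq.const_mul (κ / 4)).sub (integrable_const B)) hi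
      fun x => hB (X.incl z x)
    simp only [Pi.sub_apply] at h3
    rw [integral_sub (hsq.const_mul (κ / 4)) (integrable_const B), integral_const_mul,
      integral_sq_eq, integral_const, measureReal_restrict_apply_univ, smul_eq_mul] at h3
    have h4 : X.potential f (X.incl z) = ∫ x in X.cell, prim f (X.incl z x) := rfl
    rw [h4]
    linarith [mul_comm B (volume.real X.cell)]
  · have h3 : X.potential f (X.incl z) ≤
        ∫ x in X.cell, (|f 0| + 2 * C) * (1 + |X.incl z x| ^ 6) :=
      integral_mono hi ((hD z).1.const_mul _) fun x =>
        (le_abs_self _).trans (hf.quinticGrowth.abs_prim_le_sextic hC _)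
    rw [integral_const_mul] at h3
    have h4 := mul_le_mul_of_nonneg_left (hD z).2 (show 0 ≤ |f 0| + 2 * C by positivity)
    have h5 : 0 ≤ B₁ * (1 + ‖z‖ ^ 6) := by positivity
    calc _ ≤ B₂ * (1 + ‖z‖ ^ 6) := by rw [hB₂, mul_assoc]; exact h3.trans h4
      _ ≤ _ := by rw [add_mul]; linarith

end Setting

/-! ### The nonlinear term along a path in `H¹` and the chain rule for the potential energy. -/

namespace Setting

variable {X : Setting} {f : ℝ → ℝ} {C κ K : ℝ}

theorem aestronglyMeasurable_nem (hf : IsNonlinearity f C κ K) {ν : Measure ℝ} {u : ℝ → X.H1}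
    (hum : AEStronglyMeasurable u ν) (hl : ∀ᵐ s ∂ν, X.l12 (X.incl (u s)) ≠ ⊤) :
    AEStronglyMeasurable (fun s => X.nem f (X.incl (u s))) ν := by
  refine aestronglyMeasurable_of_tendsto_ae atTop
    (f := fun (n : ℕ) s => X.nem (trunc f n) (X.incl (u s))) (fun n => ?_) ?_
  · exact (continuous_nem (hf.continuous_trunc n) (hf.abs_trunc_le n)
      (hf.abs_trunc_sub_le n)).comp_aestronglyMeasurable
        (X.incl.continuous.comp_aestronglyMeasurable hum)
  · filter_upwards [hl] with s hs
    exact tendsto_nem_trunc hf hs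

theorem ae_l12_ne_top {ν : Measure ℝ} {u : ℝ → X.H1} (hum : AEStronglyMeasurable u ν)
    (hl : ∫⁻ s, X.l12 (X.incl (u s)) ∂ν ≠ ⊤) : ∀ᵐ s ∂ν, X.l12 (X.incl (u s)) ≠ ⊤ := by
  filter_upwards [ae_lt_top' (X.aemeasurable_l12
    (X.incl.continuous.comp_aestronglyMeasurable hum)) hl] with s hs
  exact hs.ne

/-- An integrable bound of the nonlinear term and of its truncations along a path. -/
theorem exists_bound_nem (hf : IsNonlinearity f C κ K) {ν : Measure ℝ} [IsFiniteMeasure ν]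
    {u : ℝ → X.H1} (hum : AEStronglyMeasurable u ν) {R : ℝ} (hR : ∀ᵐ s ∂ν, ‖u s‖ ≤ R)
    (hl : ∫⁻ s, X.l12 (X.incl (u s)) ∂ν ≠ ⊤) : ∃ b : ℝ → ℝ, Integrable b ν ∧ ∀ᵐ s ∂ν,
      (∀ n, ‖X.nem (trunc f n) (X.incl (u s))‖ ≤ b s) ∧ ‖X.nem f (X.incl (u s))‖ ≤ b s := by
  obtain ⟨D, hD⟩ := exists_enorm_nem_le (X := X) hf
  have hlm := X.aemeasurable_l12 (X.incl.continuous.comp_aestronglyMeasurable hum)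
  set B : ℝ → ℝ≥0∞ := fun s => D * (1 + (1 + X.l12 (X.incl (u s))) * ENNReal.ofReal R) with hB
  have hBm : AEMeasurable B ν :=
    ((((hlm.const_add 1).mul_const _).const_add 1).const_mul _)
  have hBi : ∫⁻ s, B s ∂ν ≠ ⊤ := by
    simp only [hB]
    rw [lintegral_const_mul' _ _ (by finiteness), lintegral_add_left measurable_const,
      lintegral_mul_const' _ _ (by finiteness), lintegral_add_left measurable_const,
      lintegral_const]
    finiteness
  refine ⟨fun s => (B s).toReal, integrable_toReal_of_lintegral_ne_top hBm hBi, ?_⟩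
  filter_upwards [hR, ae_l12_ne_top hum hl] with s hs hls
  have hBs : B s ≠ ⊤ := by simp only [hB]; finiteness
  have hle : D * (1 + (1 + X.l12 (X.incl (u s))) * ‖u s‖ₑ) ≤ B s := by
    simp only [hB]
    gcongr
    rw [← ofReal_norm]
    exact ENNReal.ofReal_le_ofReal hs
  refine ⟨fun n => ?_, ?_⟩
  · rw [← toReal_enorm]
    exact ENNReal.toReal_mono hBs (((hD (u s)).1 n).trans hle)
  · rw [← toReal_enorm]
    exact ENNReal.toReal_mono hBs (((hD (u s)).2 hls).trans hle)

theorem integrable_nem (hf : IsNonlinearity f C κ K) {ν : Measure ℝ} [IsFiniteMeasure ν]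
    {u : ℝ → X.H1} (hum : AEStronglyMeasurable u ν) {R : ℝ} (hR : ∀ᵐ s ∂ν, ‖u s‖ ≤ R)
    (hl : ∫⁻ s, X.l12 (X.incl (u s)) ∂ν ≠ ⊤) :
    Integrable (fun s => X.nem f (X.incl (u s))) ν := by
  obtain ⟨b, hb, hle⟩ := exists_bound_nem hf hum hR hl
  exact hb.mono' (aestronglyMeasurable_nem hf hum (ae_l12_ne_top hum hl))
    (hle.mono fun s hs => hs.2)

/-- The chain rule for the potential energy along a path with extra integrability. -/
theorem integral_inner_nem_eq_sub (hf : IsNonlinearity f C κ K) {u : ℝ → X.H1} {p : ℝ → X.L2}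
    {t R M : ℝ} (ht : 0 ≤ t)
    (hum : AEStronglyMeasurable u (volume.restrict (Ioc 0 t)))
    (hR : ∀ᵐ s ∂volume.restrict (Ioc 0 t), ‖u s‖ ≤ R)
    (hl : ∫⁻ s in Ioc 0 t, X.l12 (X.incl (u s)) ≠ ⊤)
    (hpm : AEStronglyMeasurable p (volume.restrict (Ioc 0 t)))
    (hpM : ∀ᵐ s ∂volume.restrict (Ioc 0 t), ‖p s‖ ≤ M)
    (hu : ∀ s ∈ Icc 0 t, X.incl (u s) = X.incl (u 0) + ∫ r in (0 : ℝ)..s, p r) :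
    ∫ s in (0 : ℝ)..t, inner ℝ (X.nem f (X.incl (u s))) (p s) =
      X.potential f (X.incl (u t)) - X.potential f (X.incl (u 0)) := by
  have hpi : IntervalIntegrable p volume 0 t := intervalIntegrable_of_ae_bound ht hpm hpM
  -- The truncated potentials are differentiable and Lipschitz on `L²`, so the chain rule applies to
  -- the absolutely continuous path; the truncation is then removed under an integrable majorant in
  -- time.
  have hn : ∀ n : ℕ, ∫ s in (0 : ℝ)..t, inner ℝ (X.nem (trunc f n) (X.incl (u s))) (p s) =
      X.potential (trunc f n) (X.incl (u t)) - X.potential (trunc f n) (X.incl (u 0)) := fun n =>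
    integral_chain_rule (P := fun s => X.incl (u s)) ht hpi hu
      (fun q => hasFDerivAt_potential (hf.continuous_trunc n) (hf.abs_trunc_le n)
        (hf.abs_trunc_sub_le n) q)
      fun _ => ⟨_, mul_nonneg ((abs_nonneg _).trans (hf.abs_trunc_le n 0)) (Real.sqrt_nonneg _),
        fun x y _ _ => abs_potential_sub_le (hf.continuous_trunc n) (hf.abs_trunc_le n) x y⟩
  obtain ⟨b, hb, hle⟩ := exists_bound_nem hf hum hR hl
  have hlim : Tendsto (fun n : ℕ => ∫ s in (0 : ℝ)..t,
      inner ℝ (X.nem (trunc f n) (X.incl (u s))) (p s)) atTop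
      (𝓝 (∫ s in (0 : ℝ)..t, inner ℝ (X.nem f (X.incl (u s))) (p s))) := by
    simp only [intervalIntegral.integral_of_le ht]
    refine tendsto_integral_of_dominated_convergence (fun s => b s * M) (fun n => ?_)
      (hb.mul_const M) (fun n => ?_) ?_
    · exact AEStronglyMeasurable.inner ((continuous_nem (hf.continuous_trunc n) (hf.abs_trunc_le n)
        (hf.abs_trunc_sub_le n)).comp_aestronglyMeasurable
        (X.incl.continuous.comp_aestronglyMeasurable hum)) hpm
    · filter_upwards [hle, hpM] with s h1 h2
      refine (norm_inner_le_norm _ _).trans ?_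
      have h3 := h1.1 n
      have h4 := norm_nonneg (X.nem (trunc f n) (X.incl (u s)))
      gcongr
      linarith
    · filter_upwards [ae_l12_ne_top hum hl] with s hs
      exact (tendsto_nem_trunc hf hs).inner tendsto_const_nhds
  simp only [hn] at hlim
  exact tendsto_nhds_unique hlim
    ((tendsto_potential_trunc hf (u t)).sub (tendsto_potential_trunc hf (u 0)))

/-- Products `θ(t) ψ(x)` suffice: for each `ψ` the weak formulation becomes a scalar statement in
time, to which the lemma of du Bois-Reymond applies. -/
theorem spaceTimeSupport_mul {ψ : E3 → ℝ} (hψ : X.IsTest ψ) {θ : ℝ → ℝ} {T l r : ℝ} (hl : 0 < l)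
    (hr : r < T) (hθ : ∀ t ∉ Icc l r, θ t = 0) :
    X.SpaceTimeSupport T fun q : ℝ × E3 => θ q.1 * ψ q.2 := by
  cases X with
  | dirichlet Ω hΩ =>
    have hsub : Function.support (fun q : ℝ × E3 => θ q.1 * ψ q.2) ⊆ Icc l r ×ˢ tsupport ψ := by
      rintro ⟨t, x⟩ h
      constructor
      · by_contra hn
        exact h (by simp [hθ t hn])
      · by_contra hn
        exact h (by simp [image_eq_zero_of_notMem_tsupport hn])
    have hcl : IsClosed (Icc l r ×ˢ tsupport ψ) := isClosed_Icc.prod (isClosed_tsupport ψ)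
    have hcpt : IsCompact (Icc l r ×ˢ tsupport ψ) := isCompact_Icc.prod hψ.2.1
    refine ⟨HasCompactSupport.of_support_subset_isCompact hcpt hsub, ?_⟩
    refine (closure_minimal hsub hcl).trans (prod_mono ?_ hψ.2.2)
    exact fun t ht => ⟨hl.trans_le ht.1, ht.2.trans_lt hr⟩
  | periodic =>
    refine ⟨fun t i x => ?_, l, r, hl, hr, fun t x ht => by simp [hθ t ht]⟩
    simp only [hψ.2 i x]

theorem contDiff_mul_space_time {ψ : E3 → ℝ} (hψ : X.IsTest ψ) {θ : ℝ → ℝ} (hθ : ContDiff ℝ ∞ θ) :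
    ContDiff ℝ ∞ fun q : ℝ × E3 => θ q.1 * ψ q.2 :=
  (hθ.comp contDiff_fst).mul (hψ.contDiff.comp contDiff_snd)

theorem integral_mul_lift {ψ : E3 → ℝ} {w : X.H1} (hw : X.IsLift ψ w) (q : X.L2) (c : ℝ) :
    ∫ x in X.cell, q x * (c * ψ x) = inner ℝ q (X.incl w) * c := by
  rw [inner_toLp_eq_integral q hw.1, ← integral_mul_const]
  refine integral_congr_ae (Eventually.of_forall fun x => ?_)
  ring

end Setting

/-! ### From the distributional formulation to identities integrated in time. -/

section WeakForm

variable {X : Setting} {f : ℝ → ℝ} {α γ : ℝ} {g : X.L2} {ξ₀ : X.Energy} {ξ : ℝ → X.Energy}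

theorem norm_fst_le (e : X.Energy) : ‖e.fst‖ ≤ ‖e‖ := by
  have := WithLp.prod_norm_sq_eq_of_L2 e
  exact (sq_le_sq₀ (norm_nonneg _) (norm_nonneg _)).1 (by nlinarith [sq_nonneg ‖e.snd‖])

theorem norm_snd_le (e : X.Energy) : ‖e.snd‖ ≤ ‖e‖ := by
  have := WithLp.prod_norm_sq_eq_of_L2 e
  exact (sq_le_sq₀ (norm_nonneg _) (norm_nonneg _)).1 (by nlinarith [sq_nonneg ‖e.fst‖])

namespace IsEnergySolution

theorem aestronglyMeasurable (h : IsEnergySolution X f α γ g ξ₀ ξ) (t : ℝ) :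
    AEStronglyMeasurable ξ (volume.restrict (Ioc 0 t)) := by
  rw [← restrict_Ioo_eq_restrict_Ioc]
  -- The bounds are assumed on intervals of positive length; `max t 1` covers every real `t`.
  refine (h.bounded (max t 1) (by positivity)).aestronglyMeasurable.mono_measure ?_
  exact Measure.restrict_mono (Ioo_subset_Ioo_right (le_max_left _ _)) le_rfl

theorem aestronglyMeasurable_fst (h : IsEnergySolution X f α γ g ξ₀ ξ) (t : ℝ) :
    AEStronglyMeasurable (fun s => (ξ s).fst) (volume.restrict (Ioc 0 t)) :=
  (WithLp.fstL 2 ℝ X.H1 X.L2).continuous.comp_aestronglyMeasurable (h.aestronglyMeasurable t)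

theorem aestronglyMeasurable_snd (h : IsEnergySolution X f α γ g ξ₀ ξ) (t : ℝ) :
    AEStronglyMeasurable (fun s => (ξ s).snd) (volume.restrict (Ioc 0 t)) :=
  (WithLp.sndL 2 ℝ X.H1 X.L2).continuous.comp_aestronglyMeasurable (h.aestronglyMeasurable t)

theorem exists_ae_bound (h : IsEnergySolution X f α γ g ξ₀ ξ) (t : ℝ) :
    ∃ M : ℝ, ∀ᵐ s ∂volume.restrict (Ioc 0 t), ‖ξ s‖ ≤ M := by
  have hb := (h.bounded (max t 1) (by positivity)).mono_measure
    (Measure.restrict_mono (Ioo_subset_Ioo_right (le_max_left t 1)) le_rfl)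
  rw [restrict_Ioo_eq_restrict_Ioc] at hb
  refine ⟨(eLpNorm ξ ⊤ (volume.restrict (Ioc 0 t))).toReal, ?_⟩
  have h1 := ae_le_eLpNormEssSup (f := ξ) (μ := volume.restrict (Ioc 0 t))
  filter_upwards [h1] with s hs
  rw [← toReal_enorm]
  rw [eLpNorm_exponent_top]
  refine ENNReal.toReal_mono ?_ hs
  rw [← eLpNorm_exponent_top]
  exact hb.2.ne

theorem intervalIntegrable_snd (h : IsEnergySolution X f α γ g ξ₀ ξ) {t : ℝ} (ht : 0 ≤ t) :
    IntervalIntegrable (fun s => (ξ s).snd) volume 0 t := by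
  obtain ⟨M, hM⟩ := h.exists_ae_bound t
  exact intervalIntegrable_of_ae_bound ht (h.aestronglyMeasurable_snd t)
    (hM.mono fun s hs => (norm_snd_le _).trans hs)

theorem intervalIntegrable_fst (h : IsEnergySolution X f α γ g ξ₀ ξ) {t : ℝ} (ht : 0 ≤ t) :
    IntervalIntegrable (fun s => (ξ s).fst) volume 0 t := by
  obtain ⟨M, hM⟩ := h.exists_ae_bound t
  exact intervalIntegrable_of_ae_bound ht (h.aestronglyMeasurable_fst t)
    (hM.mono fun s hs => (norm_fst_le _).trans hs)

/-- `u(t) = u(0) + ∫₀ᵗ ∂_t u`. -/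
theorem incl_fst_eq (h : IsEnergySolution X f α γ g ξ₀ ξ) {t : ℝ} (ht : 0 ≤ t) :
    X.incl (ξ t).fst = X.incl (ξ 0).fst + ∫ r in (0 : ℝ)..t, (ξ r).snd := by
  -- The horizon `t + 1` is positive also for `t = 0`.
  have hT : (0 : ℝ) < t + 1 := by linarith
  have hpi := h.intervalIntegrable_snd hT.le
  have key : ∀ w : X.H1, inner ℝ (X.incl (ξ t).fst) (X.incl w) =
      inner ℝ (X.incl (ξ 0).fst + ∫ r in (0 : ℝ)..t, (ξ r).snd) (X.incl w) := by
    intro w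
    have hcl : IsClosed {w : X.H1 | inner ℝ (X.incl (ξ t).fst) (X.incl w) =
      inner ℝ (X.incl (ξ 0).fst + ∫ r in (0 : ℝ)..t, (ξ r).snd) (X.incl w)} :=
      isClosed_eq (by fun_prop) (by fun_prop)
    refine hcl.closure_subset_iff.2 ?_ (X.dense_lift w)
    rintro w ⟨ψ, hψ, hw⟩
    have hweak := eq_integral_of_weak_deriv (T := t + 1)
      (a := fun s => inner ℝ (X.incl (ξ s).fst) (X.incl w))
      (b := fun s => inner ℝ (ξ s).snd (X.incl w)) hT ?_ ?_ ?_ t ⟨ht, by linarith⟩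
    · rw [mem_ofPred_eq, hweak, inner_add_left]
      congr 1
      have hpi' : IntervalIntegrable (fun s => (ξ s).snd) volume 0 t :=
        h.intervalIntegrable_snd ht
      rw [intervalIntegral.integral_of_le ht, intervalIntegral.integral_of_le ht,
        real_inner_comm, ← integral_inner hpi'.1]
      simp only [real_inner_comm]
    · refine ContinuousOn.inner ?_ continuousOn_const
      exact h.continuous_fst.mono Icc_subset_Ici_self
    · exact ⟨hpi.1.inner_const _, hpi.2.inner_const _⟩
    · rintro θ hθ ⟨l, r, hl, hr, hlr⟩
      have h1 := h.time_deriv (t + 1) hT _ (Setting.contDiff_mul_space_time hψ hθ)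
        (Setting.spaceTimeSupport_mul hψ hl hr hlr)
      have e1 : ∀ s, ∫ x in X.cell, X.incl (ξ s).fst x * deriv (fun s => θ s * ψ x) s =
          inner ℝ (X.incl (ξ s).fst) (X.incl w) * deriv θ s := fun s => by
        rw [← Setting.integral_mul_lift hw]
        refine integral_congr_ae (Eventually.of_forall fun x => ?_)
        simp only
        rw [deriv_mul_const (hθ.differentiable (by simp) s)]
      simp only [e1, Setting.integral_mul_lift hw] at h1
      exact h1
  have hd := X.denseRange_incl
  refine ext_inner_right ℝ fun q => ?_
  refine hd.induction_on (p := fun q => inner ℝ (X.incl (ξ t).fst) q =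
    inner ℝ (X.incl (ξ 0).fst + ∫ r in (0 : ℝ)..t, (ξ r).snd) q) q ?_ key
  exact isClosed_eq (by fun_prop) (by fun_prop)

end IsEnergySolution
end WeakForm

theorem integral_inner_right_const {F : Type*} [NormedAddCommGroup F] [InnerProductSpace ℝ F]
    [CompleteSpace F] {k : ℝ → F} {a b : ℝ} (hk : IntervalIntegrable k volume a b) (c : F) :
    ∫ r in a..b, inner ℝ (k r) c = inner ℝ (∫ r in a..b, k r) c := by
  have h := (innerSL ℝ c).intervalIntegral_comp_comm hk
  simp only [innerSL_apply_apply] at h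
  simp only [real_inner_comm] at h ⊢
  exact h

namespace Setting

variable {X : Setting}

theorem IsLift.ofContinuous_const_mul {ψ : E3 → ℝ} {w : X.H1} (hw : X.IsLift ψ w) (c : ℝ)
    (hc : Continuous fun x => c * ψ x) :
    X.ofContinuous (fun x => c * ψ x) hc = X.incl (c • w) := by
  refine Lp.ext ?_
  rw [map_smul]
  filter_upwards [(X.memLp_of_continuous hc).coeFn_toLp, Lp.coeFn_smul c (X.incl w), hw.1]
    with x h1 h2 h3
  rw [h2, Pi.smul_apply, smul_eq_mul]
  refine h1.trans ?_
  rw [← h3]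

theorem integral_inner_gradient_lift {ψ : E3 → ℝ} (hψ : X.IsTest ψ) {w : X.H1}
    (hw : X.IsLift ψ w) (q : X.L2V) (c : ℝ) :
    ∫ x in X.cell, inner ℝ (q x) (gradient (fun y => c * ψ y) x) =
      inner ℝ q (X.grad w) * c := by
  rw [L2.inner_def, ← integral_mul_const]
  refine integral_congr_ae ?_
  filter_upwards [hw.2] with x hx
  have d1 : DifferentiableAt ℝ ψ x := (hψ.contDiff.differentiable (by simp)) x
  have : gradient (fun y => c * ψ y) x = c • gradient ψ x := by
    simp [gradient, fderiv_const_mul d1]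
  rw [this, inner_smul_right]
  change c * inner ℝ (q x) (gradient ψ x) = inner ℝ (q x) (X.grad w x) * c
  rw [mul_comm]
  congr 2
  exact hx.symm

end Setting

namespace IsEnergySolution

variable {X : Setting} {f : ℝ → ℝ} {C κ K α γ : ℝ} {g : X.L2} {ξ₀ : X.Energy} {ξ : ℝ → X.Energy}

theorem intervalIntegrable_nem (h : IsEnergySolution X f α γ g ξ₀ ξ) (hf : IsNonlinearity f C κ K)
    {t : ℝ} (ht : 0 ≤ t) (hl : ∫⁻ s in Ioc 0 t, X.l12 (X.incl (ξ s).fst) ≠ ⊤) :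
    IntervalIntegrable (fun s => X.nem f (X.incl (ξ s).fst)) volume 0 t := by
  obtain ⟨M, hM⟩ := h.exists_ae_bound t
  rw [intervalIntegrable_iff_integrableOn_Ioc_of_le ht]
  exact Setting.integrable_nem hf (h.aestronglyMeasurable_fst t)
    (hM.mono fun s hs => (norm_fst_le _).trans hs) hl

/-- The momentum balance integrated in time and tested with a function of `H^1`. -/
theorem inner_snd_eq (h : IsEnergySolution X f α γ g ξ₀ ξ) (hf : IsNonlinearity f C κ K)
    (hl : ∀ t, ∫⁻ s in Ioc 0 t, X.l12 (X.incl (ξ s).fst) ≠ ⊤) {D : X.H1 →L[ℝ] X.L2}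
    (hD : ∀ z, D z = ∑' μ : ℝ, μ ^ (1 / 2 : ℝ) • formProj X.incl X.grad μ (X.incl z))
    {t : ℝ} (ht : 0 ≤ t) (w : X.H1) :
    inner ℝ (ξ t).snd (X.incl w) = inner ℝ (ξ 0).snd (X.incl w) + ∫ r in (0 : ℝ)..t,
      (inner ℝ (g - X.nem f (X.incl (ξ r).fst)) (X.incl w)
        - inner ℝ (X.grad (ξ r).fst) (X.grad w) - α * inner ℝ (ξ r).snd (X.incl w)
        - γ * inner ℝ (ξ r).snd (D w)) := by
  have hT : (0 : ℝ) < t + 1 := by linarith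
  have hin : ∀ {T : ℝ}, 0 ≤ T → IntervalIntegrable
      (fun r => g - X.nem f (X.incl (ξ r).fst)) volume 0 T := fun hT =>
    intervalIntegrable_const.sub (h.intervalIntegrable_nem hf hT (hl _))
  have hgr : ∀ {T : ℝ}, 0 ≤ T → IntervalIntegrable
      (fun r => X.grad (ξ r).fst) volume 0 T := fun hT =>
    ⟨X.grad.integrable_comp (h.intervalIntegrable_fst hT).1,
      X.grad.integrable_comp (h.intervalIntegrable_fst hT).2⟩
  have hpi : ∀ {T : ℝ}, 0 ≤ T → IntervalIntegrable
      (fun r => (ξ r).snd) volume 0 T := fun hT => h.intervalIntegrable_snd hT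
  have hinner : ∀ {F : Type} [NormedAddCommGroup F] [InnerProductSpace ℝ F] {k : ℝ → F} {T : ℝ},
      IntervalIntegrable k volume 0 T → ∀ c : F,
      IntervalIntegrable (fun r => inner ℝ (k r) c) volume 0 T := fun hk c =>
    ⟨hk.1.inner_const c, hk.2.inner_const c⟩
  have hInt : ∀ w, ∫ r in (0 : ℝ)..t,
      (inner ℝ (g - X.nem f (X.incl (ξ r).fst)) (X.incl w)
        - inner ℝ (X.grad (ξ r).fst) (X.grad w) - α * inner ℝ (ξ r).snd (X.incl w)
        - γ * inner ℝ (ξ r).snd (D w)) =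
      inner ℝ (∫ r in (0 : ℝ)..t, (g - X.nem f (X.incl (ξ r).fst))) (X.incl w)
        - inner ℝ (∫ r in (0 : ℝ)..t, X.grad (ξ r).fst) (X.grad w)
        - α * inner ℝ (∫ r in (0 : ℝ)..t, (ξ r).snd) (X.incl w)
        - γ * inner ℝ (∫ r in (0 : ℝ)..t, (ξ r).snd) (D w) := by
    intro w
    have i1 := hinner (hin ht) (X.incl w)
    have i2 := hinner (hgr ht) (X.grad w)
    have i3 := (hinner (hpi ht) (X.incl w)).const_mul α
    have i4 := (hinner (hpi ht) (D w)).const_mul γ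
    rw [intervalIntegral.integral_sub ((i1.sub i2).sub i3) i4,
      intervalIntegral.integral_sub (i1.sub i2) i3, intervalIntegral.integral_sub i1 i2,
      intervalIntegral.integral_const_mul, intervalIntegral.integral_const_mul,
      integral_inner_right_const (hin ht), integral_inner_right_const (hgr ht),
      integral_inner_right_const (hpi ht), integral_inner_right_const (hpi ht)]
  rw [hInt]
  -- With the time integrals carried out in the Hilbert spaces, both sides are continuous in `w`,
  -- and the identity extends from test functions to `H¹` by density.
  have hcl : IsClosed {w : X.H1 | inner ℝ (ξ t).snd (X.incl w) =
      inner ℝ (ξ 0).snd (X.incl w) +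
        (inner ℝ (∫ r in (0 : ℝ)..t, (g - X.nem f (X.incl (ξ r).fst))) (X.incl w)
        - inner ℝ (∫ r in (0 : ℝ)..t, X.grad (ξ r).fst) (X.grad w)
        - α * inner ℝ (∫ r in (0 : ℝ)..t, (ξ r).snd) (X.incl w)
        - γ * inner ℝ (∫ r in (0 : ℝ)..t, (ξ r).snd) (D w))} :=
    isClosed_eq (by fun_prop) (by fun_prop)
  refine hcl.closure_subset_iff.2 ?_ (X.dense_lift w)
  rintro w ⟨ψ, hψ, hw⟩
  rw [mem_ofPred_eq, ← hInt]
  have i1 := hinner (hpi hT.le) (X.incl w)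
  have i2 := hinner (hgr hT.le) (X.grad w)
  have i4 := hinner (hpi hT.le) (D w)
  have i5 := hinner (h.intervalIntegrable_nem hf hT.le (hl _)) (X.incl w)
  have i6 := hinner (intervalIntegrable_const (c := g) (a := 0) (b := t + 1)) (X.incl w)
  refine eq_integral_of_weak_deriv (T := t + 1)
    (a := fun s => inner ℝ (ξ s).snd (X.incl w)) hT ?_ ?_ ?_ t ⟨ht, by linarith⟩
  · have := (ContinuousLinearMap.apply ℝ ℝ w).continuous.comp_continuousOn
      (h.continuous_snd.mono (t := Icc 0 (t + 1)) fun s hs => hs.1)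
    exact this
  · exact (((hinner (hin hT.le) (X.incl w)).sub i2).sub (i1.const_mul α)).sub (i4.const_mul γ)
  · rintro θ hθ ⟨l, r, hl0, hr, hlr⟩
    have h1 := h.equation (t + 1) hT _ (Setting.contDiff_mul_space_time hψ hθ)
      (Setting.spaceTimeSupport_mul hψ hl0 hr hlr)
    have e1 : ∀ s, ∫ x in X.cell, (ξ s).snd x * deriv (fun s => θ s * ψ x) s =
        inner ℝ (ξ s).snd (X.incl w) * deriv θ s := fun s => by
      rw [← Setting.integral_mul_lift hw]
      refine integral_congr_ae (Eventually.of_forall fun x => ?_)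
      simp only
      rw [deriv_mul_const (hθ.differentiable (by simp) s)]
    -- On the class of a test function `(-Δ)^{1/2}` is the bounded operator `D`, which is linear;
    -- this extracts the scalar factor `θ s`.
    have e2 : ∀ s, inner ℝ (ξ s).snd (X.fracLap (1 / 2) (X.ofContinuous (fun x => θ s * ψ x)
        ((Setting.contDiff_mul_space_time hψ hθ).continuous.comp
          (Continuous.prodMk_right s)))) = inner ℝ (ξ s).snd (D w) * θ s := fun s => by
      rw [Setting.IsLift.ofContinuous_const_mul hw]
      have : X.fracLap (1 / 2) (X.incl (θ s • w)) = D (θ s • w) := (hD _).symm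
      rw [this, map_smul, inner_smul_right, mul_comm]
    have e3 : ∫ s in Ioo 0 (t + 1), ∫ x in X.cell, f (X.incl (ξ s).fst x) * (θ s * ψ x) =
        ∫ s in Ioo 0 (t + 1), inner ℝ (X.nem f (X.incl (ξ s).fst)) (X.incl w) * θ s := by
      refine integral_congr_ae ?_
      have := Setting.ae_l12_ne_top (h.aestronglyMeasurable_fst (t + 1)) (hl (t + 1))
      rw [restrict_Ioo_eq_restrict_Ioc]
      filter_upwards [this] with s hs
      rw [← Setting.integral_mul_lift hw]
      refine integral_congr_ae ?_
      filter_upwards [Setting.coeFn_nem (Setting.memLp_nonlinearity hf hs)] with x hx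
      rw [hx]
    simp only [e1, e2, e3, Setting.integral_mul_lift hw,
      Setting.integral_inner_gradient_lift hψ hw] at h1
    have hmul : ∀ {k : ℝ → ℝ}, IntervalIntegrable k volume 0 (t + 1) →
        Integrable (fun s => k s * θ s) (volume.restrict (Ioo 0 (t + 1))) := fun hk => by
      have := hk.mul_continuousOn hθ.continuous.continuousOn
      rw [intervalIntegrable_iff_integrableOn_Ioc_of_le hT.le] at this
      exact this.mono_set Ioo_subset_Ioc_self
    have e4 : ∀ s, (inner ℝ (g - X.nem f (X.incl (ξ s).fst)) (X.incl w)
        - inner ℝ (X.grad (ξ s).fst) (X.grad w) - α * inner ℝ (ξ s).snd (X.incl w)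
        - γ * inner ℝ (ξ s).snd (D w)) * θ s =
        inner ℝ g (X.incl w) * θ s - inner ℝ (X.nem f (X.incl (ξ s).fst)) (X.incl w) * θ s
        - inner ℝ (X.grad (ξ s).fst) (X.grad w) * θ s
        - α * (inner ℝ (ξ s).snd (X.incl w) * θ s)
        - γ * (inner ℝ (ξ s).snd (D w) * θ s) := fun s => by
      rw [inner_sub_left]; ring
    simp only [e4]
    have hsub : ∀ {k m : ℝ → ℝ}, Integrable k (volume.restrict (Ioo 0 (t + 1))) →
        Integrable m (volume.restrict (Ioo 0 (t + 1))) →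
        Integrable (fun s => k s - m s) (volume.restrict (Ioo 0 (t + 1))) :=
      fun hk hm => hk.sub hm
    have j1 := hsub (hmul i6) (hmul i5)
    have j2 := hsub j1 (hmul i2)
    have j3 := hsub j2 ((hmul i1).const_mul α)
    rw [integral_sub j3 ((hmul i4).const_mul γ), integral_sub j2 ((hmul i1).const_mul α),
      integral_sub j1 (hmul i2), integral_sub (hmul i6) (hmul i5)]
    simp only [integral_const_mul] at h1 ⊢
    linarith

end IsEnergySolution

/-! ### A priori bounds: energy, dissipation and the `L⁴(L¹²)` norm. -/

theorem lintegral_Ioc_le_sum (F : ℝ → ℝ≥0∞) (n : ℕ) : ∫⁻ s in Ioc (0 : ℝ) n, F s ≤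
    ∑ k ∈ Finset.range n, ∫⁻ s in Icc (k : ℝ) (k + 1), F s := by
  induction n with
  | zero => simp
  | succ n ih =>
    rw [Finset.sum_range_succ]
    have hsub : Ioc (0 : ℝ) (n + 1 : ℕ) ⊆ Ioc (0 : ℝ) n ∪ Icc (n : ℝ) (n + 1) := by
      intro s hs
      push_cast at hs
      rcases le_total s n with h | h
      · exact Or.inl ⟨hs.1, h⟩
      · exact Or.inr ⟨h, hs.2⟩
    calc ∫⁻ s in Ioc (0 : ℝ) (n + 1 : ℕ), F s
        ≤ ∫⁻ s in Ioc (0 : ℝ) n ∪ Icc (n : ℝ) (n + 1), F s := lintegral_mono_set hsub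
      _ ≤ _ := (lintegral_union_le _ _ _).trans (by gcongr)

theorem lintegral_Icc_le_lintegral_Ioc (F : ℝ → ℝ≥0∞) {τ : ℝ} (hτ : 0 ≤ τ) :
    ∫⁻ s in Icc τ (τ + 1), F s ≤ ∫⁻ s in Ioc 0 (τ + 1), F s := by
  rw [restrict_Ioc_eq_restrict_Icc]
  exact lintegral_mono_set (Icc_subset_Icc_left hτ)

namespace Setting

variable (X : Setting)

theorem tsum_enorm_eigenProj_sq_le (p : X.L2) : ∑' μ : ℝ, ‖X.eigenProj μ p‖ₑ ^ 2 ≤ ‖p‖ₑ ^ 2 := by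
  rw [ENNReal.tsum_eq_iSup_sum]
  refine iSup_le fun s => ?_
  have h := sum_norm_sq_formProj_le X.inner_H1 p s
  have h2 := ENNReal.ofReal_le_ofReal h
  rw [ENNReal.ofReal_sum_of_nonneg fun _ _ => sq_nonneg _] at h2
  simpa only [ENNReal.ofReal_pow (norm_nonneg _), ofReal_norm, eigenProj_eq] using h2

/-- The homogeneous part of the square of the norm of `H^{1/2}_Δ`. -/
def hHalfSq (p : X.L2) : ℝ≥0∞ :=
  ∑' μ : ℝ, ENNReal.ofReal (μ ^ (1 / 2 : ℝ)) * ‖formProj X.incl X.grad μ p‖ₑ ^ 2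

/-- Subadditivity of the square root, `(1 + μ)^{1/2} ≤ 1 + μ^{1/2}`, and Bessel for the first part.
The energy inequality controls the homogeneous part only. -/
theorem hDeltaSq_half_le (p : X.L2) : X.hDeltaSq (1 / 2) p ≤ ‖p‖ₑ ^ 2 + X.hHalfSq p := by
  calc X.hDeltaSq (1 / 2) p
      ≤ ∑' μ : ℝ, (‖X.eigenProj μ p‖ₑ ^ 2 +
          ENNReal.ofReal (μ ^ (1 / 2 : ℝ)) * ‖X.eigenProj μ p‖ₑ ^ 2) := by
        refine ENNReal.tsum_le_tsum fun μ => ?_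
        rcases lt_or_ge μ 0 with hμ | hμ
        · simp [eigenProj_eq, formProj_eq_zero hμ]
        · rw [← one_add_mul]
          gcongr
          rw [← ENNReal.ofReal_one, ← ENNReal.ofReal_add zero_le_one (by positivity)]
          refine ENNReal.ofReal_le_ofReal ?_
          simpa using Real.rpow_add_le_add_rpow zero_le_one hμ (p := 1 / 2) (by norm_num)
            (by norm_num)
    _ = ∑' μ : ℝ, ‖X.eigenProj μ p‖ₑ ^ 2 + X.hHalfSq p := ENNReal.tsum_add
    _ ≤ _ := by gcongr; exact X.tsum_enorm_eigenProj_sq_le p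

theorem exists_lintegral_l12_le : ∃ C : ℝ≥0, ∀ (ν : Measure ℝ) (u : ℝ → X.H1) (R : ℝ≥0),
    (∀ᵐ s ∂ν, ‖u s‖ₑ ^ 2 ≤ R) → ∫⁻ s, X.l12 (X.incl (u s)) ∂ν ≤
      C * (R * (R * ν univ + ∫⁻ s, X.h32Sq (u s) ∂ν)) := by
  obtain ⟨C, hC⟩ := X.exists_lintegral_pow_twelve_le_h32Sq
  refine ⟨C, fun ν u R hR => ?_⟩
  calc ∫⁻ s, X.l12 (X.incl (u s)) ∂ν ≤ ∫⁻ s, C * (R * (R + X.h32Sq (u s))) ∂ν := by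
        refine lintegral_mono_ae ?_
        filter_upwards [hR] with s hs
        refine (hC (u s)).trans ?_
        gcongr
    _ = _ := by
        rw [lintegral_const_mul' _ _ (by finiteness), lintegral_const_mul' _ _ (by finiteness),
          lintegral_add_left measurable_const, lintegral_const]

end Setting

variable {X : Setting} {f : ℝ → ℝ} {C κ K α γ : ℝ} {g : X.L2} {ξ₀ : X.Energy} {ξ : ℝ → X.Energy}
  {Q : ℝ → ℝ}

theorem ExtraRegularity.lintegral_h32Sq_le (hE : ExtraRegularity X Q g ξ) {τ : ℝ} (hτ : 0 ≤ τ) :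
    ∫⁻ t in Icc τ (τ + 1), X.h32Sq (ξ t).fst ≤
      ENNReal.ofReal (Q ((eLpNorm ξ ⊤ (volume.restrict (Icc τ (τ + 1)))).toReal
        + ((∫⁻ t in Icc τ (τ + 1), X.hDeltaSq (1 / 2) (ξ t).snd) ^ (1 / 2 : ℝ)).toReal
        + ‖g‖)) ^ 2 := by
  have h := pow_le_pow_left' (hE τ hτ) 2
  rwa [← ENNReal.rpow_natCast, ← ENNReal.rpow_mul, show (1 / 2 : ℝ) * ((2 : ℕ) : ℝ) = 1 by norm_num,
    ENNReal.rpow_one] at h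

namespace IsEnergySolution

/-- A qualitative statement, needed first: it places the nonlinear term in `L¹(L²)` so that the
energy inequality may be used at all. The quantitative bound comes afterwards, from the energy. -/
theorem lintegral_l12_ne_top (h : IsEnergySolution X f α γ g ξ₀ ξ) (hE : ExtraRegularity X Q g ξ)
    (t : ℝ) : ∫⁻ s in Ioc 0 t, X.l12 (X.incl (ξ s).fst) ≠ ⊤ := by
  obtain ⟨C, hC⟩ := X.exists_lintegral_l12_le
  have hunit : ∀ k : ℕ, ∫⁻ s in Icc (k : ℝ) (k + 1), X.l12 (X.incl (ξ s).fst) ≠ ⊤ := by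
    intro k
    have hk : (0 : ℝ) ≤ k := Nat.cast_nonneg k
    obtain ⟨M, hM⟩ := h.exists_ae_bound (k + 1)
    rw [restrict_Ioc_eq_restrict_Icc] at hM
    have hM' := ae_mono (Measure.restrict_mono (Icc_subset_Icc_left hk) le_rfl) hM
    have hle := hC (volume.restrict (Icc (k : ℝ) (k + 1))) (fun s => (ξ s).fst)
      ((M ^ 2).toNNReal) (by
        filter_upwards [hM'] with s hs
        rw [← ofReal_norm, ← ENNReal.ofReal_pow (norm_nonneg _)]
        refine ENNReal.ofReal_le_ofReal ?_
        have := (norm_fst_le (ξ s)).trans hs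
        gcongr)
    refine ne_top_of_le_ne_top ?_ hle
    have h3 : ∫⁻ s in Icc (k : ℝ) (k + 1), X.h32Sq (ξ s).fst ≠ ⊤ :=
      ne_top_of_le_ne_top (by finiteness) (hE.lintegral_h32Sq_le hk)
    have h4 : (volume.restrict (Icc (k : ℝ) (k + 1))) univ ≠ ⊤ := by simp
    finiteness
  obtain ⟨n, hn⟩ := exists_nat_ge t
  refine ne_top_of_le_ne_top ?_ ((lintegral_mono_set (Ioc_subset_Ioc_right hn)).trans
    (lintegral_Ioc_le_sum _ n))
  exact ENNReal.sum_ne_top.2 fun k _ => hunit k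

/-- The dissipative estimate in integrated form. -/
theorem energy_le (h : IsEnergySolution X f α γ g ξ₀ ξ) (hα : 0 < α) (hγ : 0 < γ)
    (hf : IsNonlinearity f C κ K) (hE : ExtraRegularity X Q g ξ) {t : ℝ} (ht : 0 ≤ t) :
    ‖(ξ t).snd‖ ^ 2 + ‖X.grad (ξ t).fst‖ ^ 2 ≤ ‖(ξ 0).snd‖ ^ 2 + ‖X.grad (ξ 0).fst‖ ^ 2
      + 2 * (inner ℝ g (X.incl (ξ t).fst - X.incl (ξ 0).fst)
        - (X.potential f (X.incl (ξ t).fst) - X.potential f (X.incl (ξ 0).fst))) ∧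
    ∫⁻ s in Ioc 0 t, X.hHalfSq (ξ s).snd ≤ ENNReal.ofReal ((2 * γ)⁻¹ *
      (‖(ξ 0).snd‖ ^ 2 + ‖X.grad (ξ 0).fst‖ ^ 2
      + 2 * (inner ℝ g (X.incl (ξ t).fst - X.incl (ξ 0).fst)
        - (X.potential f (X.incl (ξ t).fst) - X.potential f (X.incl (ξ 0).fst))))) := by
  obtain ⟨D, hD⟩ := exists_sqrtOp X.inner_H1
  obtain ⟨M, hM⟩ := h.exists_ae_bound t
  have hl := h.lintegral_l12_ne_top hE
  have hp := h.intervalIntegrable_snd ht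
  have hpM : ∀ᵐ s ∂volume.restrict (Ioc 0 t), ‖(ξ s).snd‖ ≤ M :=
    hM.mono fun s hs => (norm_snd_le _).trans hs
  have hnem := h.intervalIntegrable_nem hf ht (hl t)
  have hu : ∀ s ∈ Icc 0 t, X.incl (ξ s).fst = X.incl (ξ 0).fst + ∫ r in (0 : ℝ)..s, (ξ r).snd :=
    fun s hs => h.incl_fst_eq hs.1
  have hen := energy_inequality (q := X.hHalfSq) X.inner_H1 X.incl_injective X.denseRange_incl
    (fun ε hε p q => sqrtOp_resolvent_symm X.inner_H1 hD hε p q)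
    (fun ε hε p => inner_resolvent_sqrtOp_nonneg X.inner_H1 hD hε p)
    (fun p => tsum_sqrt_le_liminf X.inner_H1 hD p) (α := α) (γ := γ) (u := fun s => (ξ s).fst)
    (p := fun s => (ξ s).snd) (h := fun s => g - X.nem f (X.incl (ξ s).fst)) ht hγ
    (h.aestronglyMeasurable_snd t) hpM (intervalIntegrable_const.sub hnem) hu
    (fun ψ s hs => h.inner_snd_eq hf hl hD hs.1 ψ)
  -- The nonlinear and the constant forcing are both exact derivatives in time, so the right-hand
  -- side depends on the endpoints only and does not grow with `t`.
  have hchain := Setting.integral_inner_nem_eq_sub hf ht (h.aestronglyMeasurable_fst t)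
    (hM.mono fun s hs => (norm_fst_le _).trans hs) (hl t) (h.aestronglyMeasurable_snd t) hpM hu
  have hg : ∫ s in (0 : ℝ)..t, inner ℝ g (ξ s).snd =
      inner ℝ g (X.incl (ξ t).fst - X.incl (ξ 0).fst) := by
    have h1 := integral_inner_right_const hp g
    simp only [real_inner_comm] at h1 ⊢
    rw [h1, hu t ⟨ht, le_rfl⟩, add_sub_cancel_left]
  have hbound : ∀ {k : ℝ → X.L2}, IntervalIntegrable k volume 0 t →
      IntervalIntegrable (fun s => inner ℝ (k s) (ξ s).snd) volume 0 t := by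
    intro k hk
    rw [intervalIntegrable_iff_integrableOn_Ioc_of_le ht] at hk ⊢
    refine (hk.norm.mul_const M).mono' (hk.1.inner (h.aestronglyMeasurable_snd t)) ?_
    filter_upwards [hpM] with s hs
    refine (norm_inner_le_norm _ _).trans ?_
    gcongr
  have hsplit : ∫ s in (0 : ℝ)..t, inner ℝ (g - X.nem f (X.incl (ξ s).fst)) (ξ s).snd =
      inner ℝ g (X.incl (ξ t).fst - X.incl (ξ 0).fst)
        - (X.potential f (X.incl (ξ t).fst) - X.potential f (X.incl (ξ 0).fst)) := by
    simp only [inner_sub_left]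
    rw [intervalIntegral.integral_sub (hbound intervalIntegrable_const) (hbound hnem), hg, hchain]
  simp only [hsplit] at hen
  have hdiss : 0 ≤ 2 * α * ∫ s in (0 : ℝ)..t, ‖(ξ s).snd‖ ^ 2 :=
    mul_nonneg (by positivity) (intervalIntegral.integral_nonneg ht fun s _ => sq_nonneg _)
  refine ⟨by linarith [hen.1], hen.2.trans (ENNReal.ofReal_le_ofReal ?_)⟩
  gcongr
  have h1 := sq_nonneg ‖(ξ t).snd‖
  have h2 := sq_nonneg ‖X.grad (ξ t).fst‖
  linarith

end IsEnergySolution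

/-- A bound of the energy norm and of the dissipation integral, uniform in time. -/
theorem exists_energy_bound (X : Setting) (hκ : 0 < κ) (hα : 0 < α) (hγ : 0 < γ)
    (hf : IsNonlinearity f C κ K) (Q : ℝ → ℝ) : ∃ W : ℝ → ℝ → ℝ≥0,
    ∀ (g : X.L2) (ξ₀ : X.Energy) (ξ : ℝ → X.Energy), IsEnergySolution X f α γ g ξ₀ ξ →
      ExtraRegularity X Q g ξ → ∀ t, 0 ≤ t → ‖ξ t‖ ^ 2 ≤ W ‖ξ₀‖ ‖g‖ ∧
        ∫⁻ s in Ioc 0 t, X.hHalfSq (ξ s).snd ≤ W ‖ξ₀‖ ‖g‖ := by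
  obtain ⟨B, hB0, hB⟩ := Setting.exists_potential_bounds X hκ hf
  set W₀ : ℝ → ℝ → ℝ := fun a c => a ^ 2 + 4 / κ * c ^ 2 + 2 * (c * a) + 2 * B
    + 2 * (B * (1 + a ^ 6)) with hW₀
  -- The three factors bound, in turn, velocity and gradient, the `L²` norm of `u`, and the
  -- dissipation integral.
  refine ⟨fun a c => ((1 + 4 / κ + (2 * γ)⁻¹) * W₀ a c).toNNReal, fun g ξ₀ ξ h hE t ht => ?_⟩
  obtain ⟨h1, h2⟩ := h.energy_le hα hγ hf hE ht
  have h0 : ‖(ξ 0).snd‖ ^ 2 + ‖X.grad (ξ 0).fst‖ ^ 2 ≤ ‖ξ₀‖ ^ 2 := by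
    rw [h.initial, WithLp.prod_norm_sq_eq_of_L2 ξ₀]
    have := X.norm_sq_H1 ξ₀.fst
    nlinarith [sq_nonneg ‖X.incl ξ₀.fst‖]
  have hi0 : ‖X.incl (ξ 0).fst‖ ≤ ‖ξ₀‖ := by
    rw [h.initial]
    exact (X.norm_incl_le _).trans (norm_fst_le _)
  have hP0 : X.potential f (X.incl (ξ 0).fst) ≤ B * (1 + ‖ξ₀‖ ^ 6) := by
    refine (hB _).2.trans ?_
    have := norm_fst_le ξ₀
    rw [h.initial]
    gcongr
  have hPt := (hB (ξ t).fst).1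
  have hg1 : inner ℝ g (X.incl (ξ t).fst - X.incl (ξ 0).fst) ≤
      ‖g‖ * ‖X.incl (ξ t).fst‖ + ‖g‖ * ‖ξ₀‖ := by
    refine (real_inner_le_norm _ _).trans ?_
    rw [← mul_add]
    gcongr
    exact (norm_sub_le _ _).trans (by gcongr)
  -- Twice the potential supplies `κ/2 ‖u‖²`. Young's inequality uses half of it, and the remaining
  -- `κ/4 ‖u‖²` controls the `L²` norm.
  have hyoung : 2 * (‖g‖ * ‖X.incl (ξ t).fst‖) ≤
      4 / κ * ‖g‖ ^ 2 + κ / 4 * ‖X.incl (ξ t).fst‖ ^ 2 := by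
    have := sq_nonneg (2 / √κ * ‖g‖ - √κ / 2 * ‖X.incl (ξ t).fst‖)
    have e1 : √κ ^ 2 = κ := Real.sq_sqrt hκ.le
    have e2 : √κ ≠ 0 := (Real.sqrt_pos.2 hκ).ne'
    have e3 : (2 / √κ * ‖g‖ - √κ / 2 * ‖X.incl (ξ t).fst‖) ^ 2 =
        4 / √κ ^ 2 * ‖g‖ ^ 2 + √κ ^ 2 / 4 * ‖X.incl (ξ t).fst‖ ^ 2
          - 2 * (‖g‖ * ‖X.incl (ξ t).fst‖) := by field_simp; ring
    rw [e3, e1] at this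
    linarith
  have hR : ‖(ξ 0).snd‖ ^ 2 + ‖X.grad (ξ 0).fst‖ ^ 2
      + 2 * (inner ℝ g (X.incl (ξ t).fst - X.incl (ξ 0).fst)
        - (X.potential f (X.incl (ξ t).fst) - X.potential f (X.incl (ξ 0).fst)))
      ≤ W₀ ‖ξ₀‖ ‖g‖ - κ / 4 * ‖X.incl (ξ t).fst‖ ^ 2 := by
    simp only [hW₀]
    linarith
  have hi := sq_nonneg ‖X.incl (ξ t).fst‖
  have hgr := sq_nonneg ‖X.grad (ξ t).fst‖
  have hs := sq_nonneg ‖(ξ t).snd‖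
  have hW : 0 ≤ W₀ ‖ξ₀‖ ‖g‖ := by simp only [hW₀]; positivity
  have h4 : 0 ≤ 4 / κ := by positivity
  have hγ' : 0 ≤ (2 * γ)⁻¹ := by positivity
  constructor
  · rw [Real.coe_toNNReal _ (by positivity)]
    have e : ‖ξ t‖ ^ 2 = ‖X.incl (ξ t).fst‖ ^ 2 + ‖X.grad (ξ t).fst‖ ^ 2 + ‖(ξ t).snd‖ ^ 2 := by
      rw [WithLp.prod_norm_sq_eq_of_L2, X.norm_sq_H1]
    have h5 : ‖X.incl (ξ t).fst‖ ^ 2 ≤ 4 / κ * W₀ ‖ξ₀‖ ‖g‖ := by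
      rw [div_mul_eq_mul_div, le_div_iff₀ hκ]
      linarith
    have h6 : 0 ≤ (2 * γ)⁻¹ * W₀ ‖ξ₀‖ ‖g‖ := by positivity
    have h7 : 0 ≤ κ / 4 * ‖X.incl (ξ t).fst‖ ^ 2 := by positivity
    rw [e]
    linarith
  · refine h2.trans (ENNReal.ofReal_le_ofReal ?_)
    have h7 : 0 ≤ κ / 4 * ‖X.incl (ξ t).fst‖ ^ 2 := by positivity
    have h8 : (2 * γ)⁻¹ * (‖(ξ 0).snd‖ ^ 2 + ‖X.grad (ξ 0).fst‖ ^ 2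
      + 2 * (inner ℝ g (X.incl (ξ t).fst - X.incl (ξ 0).fst)
        - (X.potential f (X.incl (ξ t).fst) - X.potential f (X.incl (ξ 0).fst))))
        ≤ (2 * γ)⁻¹ * W₀ ‖ξ₀‖ ‖g‖ := by
      gcongr
      linarith
    refine h8.trans ?_
    gcongr
    linarith

/-- A bound of `u` in `L⁴([τ, τ + 1]; L^{12})`, uniform in `τ`. -/
theorem exists_l12_bound (X : Setting) (hκ : 0 < κ) (hα : 0 < α) (hγ : 0 < γ)
    (hf : IsNonlinearity f C κ K) {Q : ℝ → ℝ} (hQ : Monotone Q) : ∃ B : ℝ → ℝ → ℝ≥0,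
    ∀ (g : X.L2) (ξ₀ : X.Energy) (ξ : ℝ → X.Energy), IsEnergySolution X f α γ g ξ₀ ξ →
      ExtraRegularity X Q g ξ → ∀ τ, 0 ≤ τ →
        ∫⁻ s in Icc τ (τ + 1), X.l12 (X.incl (ξ s).fst) ≤ B ‖ξ₀‖ ‖g‖ := by
  obtain ⟨W, hW⟩ := exists_energy_bound X hκ hα hγ hf Q
  obtain ⟨C, hC⟩ := X.exists_lintegral_l12_le
  -- The energy is at most `W`, and the full `H^{1/2}` dissipation over a unit interval at most `2
  -- W`: one `W` for its `L²` part, one for the homogeneous part. Monotonicity of `Q` does the rest.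
  refine ⟨fun a c => C * (W a c * (W a c +
    (Q (√(W a c) + √(2 * W a c) + c)).toNNReal ^ 2)), fun g ξ₀ ξ h hE τ hτ => ?_⟩
  set w := W ‖ξ₀‖ ‖g‖ with hw
  have hWt : ∀ t, 0 ≤ t → ‖ξ t‖ ^ 2 ≤ w := fun t ht => (hW g ξ₀ ξ h hE t ht).1
  have hmem : ∀ᵐ s ∂volume.restrict (Icc τ (τ + 1)), 0 ≤ s :=
    (ae_restrict_iff' measurableSet_Icc).2 (Eventually.of_forall fun s hs => hτ.trans hs.1)
  have hsq : ∀ {x : ℝ}, 0 ≤ x → x ^ 2 ≤ w → ENNReal.ofReal x ^ 2 ≤ w := fun hx hxw => by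
    rw [← ENNReal.ofReal_pow hx]
    exact ENNReal.ofReal_le_of_le_toReal (by simpa using hxw)
  have hle := hC (volume.restrict (Icc τ (τ + 1))) (fun s => (ξ s).fst) w (by
    filter_upwards [hmem] with s hs
    rw [← ofReal_norm]
    refine hsq (norm_nonneg _) ((hWt s hs).trans' ?_)
    have := norm_fst_le (ξ s)
    gcongr)
  have hvol : (volume.restrict (Icc τ (τ + 1))) univ = 1 := by simp
  rw [hvol, mul_one] at hle
  have hnorm : (eLpNorm ξ ⊤ (volume.restrict (Icc τ (τ + 1)))).toReal ≤ √w := by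
    rw [eLpNorm_exponent_top]
    refine ENNReal.toReal_le_of_le_ofReal (Real.sqrt_nonneg _) (eLpNormEssSup_le_of_ae_bound ?_)
    filter_upwards [hmem] with s hs
    exact Real.le_sqrt_of_sq_le (hWt s hs)
  have hdiss : ∫⁻ t in Icc τ (τ + 1), X.hDeltaSq (1 / 2) (ξ t).snd ≤ ENNReal.ofReal (2 * w) := by
    calc ∫⁻ t in Icc τ (τ + 1), X.hDeltaSq (1 / 2) (ξ t).snd
        ≤ ∫⁻ t in Icc τ (τ + 1), (w + X.hHalfSq (ξ t).snd) := by
          refine lintegral_mono_ae ?_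
          filter_upwards [hmem] with s hs
          refine (X.hDeltaSq_half_le _).trans ?_
          gcongr
          rw [← ofReal_norm]
          refine hsq (norm_nonneg _) ((hWt s hs).trans' ?_)
          have := norm_snd_le (ξ s)
          gcongr
      _ = w + ∫⁻ t in Icc τ (τ + 1), X.hHalfSq (ξ t).snd := by
          rw [lintegral_add_left measurable_const, lintegral_const, hvol, mul_one]
      _ ≤ w + w := by
          gcongr
          exact (lintegral_Icc_le_lintegral_Ioc _ hτ).trans
            (hW g ξ₀ ξ h hE (τ + 1) (by linarith)).2
      _ = ENNReal.ofReal (2 * w) := by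
          rw [two_mul, ENNReal.ofReal_add w.coe_nonneg w.coe_nonneg, ENNReal.ofReal_coe_nnreal]
  have hdiss' : ((∫⁻ t in Icc τ (τ + 1), X.hDeltaSq (1 / 2) (ξ t).snd) ^ (1 / 2 : ℝ)).toReal ≤
      √(2 * w) := by
    refine ENNReal.toReal_le_of_le_ofReal (Real.sqrt_nonneg _) ?_
    rw [Real.sqrt_eq_rpow, ← ENNReal.ofReal_rpow_of_nonneg (by positivity) (by norm_num)]
    exact ENNReal.rpow_le_rpow hdiss (by norm_num)
  refine hle.trans ?_
  push_cast
  gcongr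
  refine (hE.lintegral_h32Sq_le hτ).trans ?_
  gcongr
  exact ENNReal.ofReal_le_ofReal (hQ (by gcongr))

/-! ### The difference of two solutions and the conclusion. -/

variable {X : Setting} {f : ℝ → ℝ} {C κ K α γ : ℝ} {g : X.L2} {ξ₀ η₀ : X.Energy}
  {ξ η : ℝ → X.Energy} {Q : ℝ → ℝ}

theorem lintegral_Ioc_le_mul {F : ℝ → ℝ≥0∞} {B : ℝ≥0∞}
    (hF : ∀ τ, 0 ≤ τ → ∫⁻ s in Icc τ (τ + 1), F s ≤ B) {t : ℝ} (ht : 0 ≤ t) :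
    ∫⁻ s in Ioc 0 t, F s ≤ ENNReal.ofReal (t + 1) * B := by
  calc ∫⁻ s in Ioc 0 t, F s ≤ ∫⁻ s in Ioc (0 : ℝ) ⌈t⌉₊, F s :=
        lintegral_mono_set (Ioc_subset_Ioc_right (Nat.le_ceil t))
    _ ≤ ∑ k ∈ Finset.range ⌈t⌉₊, ∫⁻ s in Icc (k : ℝ) (k + 1), F s := lintegral_Ioc_le_sum _ _
    _ ≤ ∑ _k ∈ Finset.range ⌈t⌉₊, B := Finset.sum_le_sum fun k _ => hF k (Nat.cast_nonneg k)
    _ = (⌈t⌉₊ : ℝ≥0∞) * B := by simp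
    _ ≤ ENNReal.ofReal (t + 1) * B := by
        gcongr
        rw [← ENNReal.ofReal_natCast]
        exact ENNReal.ofReal_le_ofReal (Nat.ceil_lt_add_one ht).le

namespace IsEnergySolution

theorem intervalIntegrable_momentum (h : IsEnergySolution X f α γ g ξ₀ ξ)
    (hf : IsNonlinearity f C κ K) {t : ℝ} (ht : 0 ≤ t)
    (hl : ∫⁻ s in Ioc 0 t, X.l12 (X.incl (ξ s).fst) ≠ ⊤) (D : X.H1 →L[ℝ] X.L2) (w : X.H1) :
    IntervalIntegrable (fun r => inner ℝ (g - X.nem f (X.incl (ξ r).fst)) (X.incl w)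
        - inner ℝ (X.grad (ξ r).fst) (X.grad w) - α * inner ℝ (ξ r).snd (X.incl w)
        - γ * inner ℝ (ξ r).snd (D w)) volume 0 t := by
  have hinner : ∀ {F : Type} [NormedAddCommGroup F] [InnerProductSpace ℝ F] {k : ℝ → F},
      IntervalIntegrable k volume 0 t → ∀ c : F,
      IntervalIntegrable (fun r => inner ℝ (k r) c) volume 0 t := fun hk c =>
    ⟨hk.1.inner_const c, hk.2.inner_const c⟩
  have hgr : IntervalIntegrable (fun r => X.grad (ξ r).fst) volume 0 t :=
    ⟨X.grad.integrable_comp (h.intervalIntegrable_fst ht).1,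
      X.grad.integrable_comp (h.intervalIntegrable_fst ht).2⟩
  have hp := h.intervalIntegrable_snd ht
  exact (((hinner (intervalIntegrable_const.sub (h.intervalIntegrable_nem hf ht hl))
    (X.incl w)).sub (hinner hgr (X.grad w))).sub ((hinner hp (X.incl w)).const_mul α)).sub
      ((hinner hp (D w)).const_mul γ)

/-- The energy inequality for the difference of two energy solutions. -/
theorem energy_sub_le (h : IsEnergySolution X f α γ g ξ₀ ξ)
    (h' : IsEnergySolution X f α γ g η₀ η) (hα : 0 < α) (hγ : 0 < γ)
    (hf : IsNonlinearity f C κ K) (hE : ExtraRegularity X Q g ξ) (hE' : ExtraRegularity X Q g η)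
    {t : ℝ} (ht : 0 ≤ t) :
    ‖(ξ t).snd - (η t).snd‖ ^ 2 + ‖X.grad ((ξ t).fst - (η t).fst)‖ ^ 2 ≤
      ‖(ξ 0).snd - (η 0).snd‖ ^ 2 + ‖X.grad ((ξ 0).fst - (η 0).fst)‖ ^ 2
        + 2 * ∫ s in (0 : ℝ)..t, inner ℝ (X.nem f (X.incl (η s).fst) - X.nem f (X.incl (ξ s).fst))
          ((ξ s).snd - (η s).snd) := by
  obtain ⟨D, hD⟩ := exists_sqrtOp X.inner_H1
  obtain ⟨M, hM⟩ := h.exists_ae_bound t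
  obtain ⟨M', hM'⟩ := h'.exists_ae_bound t
  have hl := h.lintegral_l12_ne_top hE
  have hl' := h'.lintegral_l12_ne_top hE'
  have hpM : ∀ᵐ s ∂volume.restrict (Ioc 0 t), ‖(ξ s).snd - (η s).snd‖ ≤ M + M' := by
    filter_upwards [hM, hM'] with s h1 h2
    exact (norm_sub_le _ _).trans
      (add_le_add ((norm_snd_le _).trans h1) ((norm_snd_le _).trans h2))
  have hen := energy_inequality (q := X.hHalfSq) X.inner_H1 X.incl_injective X.denseRange_incl
    (fun ε hε p q => sqrtOp_resolvent_symm X.inner_H1 hD hε p q)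
    (fun ε hε p => inner_resolvent_sqrtOp_nonneg X.inner_H1 hD hε p)
    (fun p => tsum_sqrt_le_liminf X.inner_H1 hD p) (α := α) (γ := γ)
    (u := fun s => (ξ s).fst - (η s).fst) (p := fun s => (ξ s).snd - (η s).snd)
    (h := fun s => X.nem f (X.incl (η s).fst) - X.nem f (X.incl (ξ s).fst)) ht hγ
    ((h.aestronglyMeasurable_snd t).sub (h'.aestronglyMeasurable_snd t)) hpM
    ((h'.intervalIntegrable_nem hf ht (hl' t)).sub (h.intervalIntegrable_nem hf ht (hl t)))
    (fun s hs => ?_) (fun ψ s hs => ?_)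
  -- Both damping terms have a good sign and are dropped; `g` cancels in the difference.
  · have hdiss : 0 ≤ 2 * α * ∫ s in (0 : ℝ)..t, ‖(ξ s).snd - (η s).snd‖ ^ 2 :=
      mul_nonneg (by positivity) (intervalIntegral.integral_nonneg ht fun s _ => sq_nonneg _)
    linarith [hen.1]
  · rw [intervalIntegral.integral_sub (h.intervalIntegrable_snd hs.1)
      (h'.intervalIntegrable_snd hs.1), map_sub, map_sub, h.incl_fst_eq hs.1, h'.incl_fst_eq hs.1]
    abel
  · have e : ∀ r, inner ℝ (X.nem f (X.incl (η r).fst) - X.nem f (X.incl (ξ r).fst)) (X.incl ψ)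
        - inner ℝ (X.grad ((ξ r).fst - (η r).fst)) (X.grad ψ)
        - α * inner ℝ ((ξ r).snd - (η r).snd) (X.incl ψ)
        - γ * inner ℝ ((ξ r).snd - (η r).snd) (D ψ) =
      (inner ℝ (g - X.nem f (X.incl (ξ r).fst)) (X.incl ψ)
        - inner ℝ (X.grad (ξ r).fst) (X.grad ψ) - α * inner ℝ (ξ r).snd (X.incl ψ)
        - γ * inner ℝ (ξ r).snd (D ψ)) -
      (inner ℝ (g - X.nem f (X.incl (η r).fst)) (X.incl ψ)
        - inner ℝ (X.grad (η r).fst) (X.grad ψ) - α * inner ℝ (η r).snd (X.incl ψ)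
        - γ * inner ℝ (η r).snd (D ψ)) := fun r => by
      simp only [map_sub, inner_sub_left]
      ring
    simp only [e]
    rw [intervalIntegral.integral_sub (h.intervalIntegrable_momentum hf hs.1 (hl s) D ψ)
      (h'.intervalIntegrable_momentum hf hs.1 (hl' s) D ψ), inner_sub_left, inner_sub_left,
      h.inner_snd_eq hf hl hD hs.1 ψ, h'.inner_snd_eq hf hl' hD hs.1 ψ]
    ring

/-- The `L²` norm of the difference of two energy solutions. -/
theorem norm_incl_sub_sq_eq (h : IsEnergySolution X f α γ g ξ₀ ξ)
    (h' : IsEnergySolution X f α γ g η₀ η) {t : ℝ} (ht : 0 ≤ t) :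
    ‖X.incl ((ξ t).fst - (η t).fst)‖ ^ 2 = ‖X.incl ((ξ 0).fst - (η 0).fst)‖ ^ 2 +
      ∫ s in (0 : ℝ)..t, 2 * inner ℝ (X.incl ((ξ s).fst - (η s).fst))
        ((ξ s).snd - (η s).snd) := by
  have := integral_inner_eq_sub (P := fun s => X.incl ((ξ s).fst - (η s).fst))
    (a := fun s => (ξ s).snd - (η s).snd) ht
    ((h.intervalIntegrable_snd ht).sub (h'.intervalIntegrable_snd ht)) (fun s hs => by
      rw [intervalIntegral.integral_sub (h.intervalIntegrable_snd hs.1)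
        (h'.intervalIntegrable_snd hs.1), map_sub, map_sub, h.incl_fst_eq hs.1,
        h'.incl_fst_eq hs.1]
      abel)
  linarith

end IsEnergySolution

set_option maxHeartbeats 1000000 in
/-- Lipschitz dependence of energy solutions on the initial data. -/
theorem exists_sub_le (X : Setting) (hα : 0 < α) (hγ : 0 < γ) (hf : IsNonlinearity f C κ K) :
    ∃ D : ℝ≥0, ∀ (g : X.L2) (ξ₀ η₀ : X.Energy) (ξ η : ℝ → X.Energy) (Q : ℝ → ℝ) (B B' : ℝ≥0),
      IsEnergySolution X f α γ g ξ₀ ξ → IsEnergySolution X f α γ g η₀ η →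
      ExtraRegularity X Q g ξ → ExtraRegularity X Q g η →
      (∀ τ, 0 ≤ τ → ∫⁻ s in Icc τ (τ + 1), X.l12 (X.incl (ξ s).fst) ≤ B) →
      (∀ τ, 0 ≤ τ → ∫⁻ s in Icc τ (τ + 1), X.l12 (X.incl (η s).fst) ≤ B') →
      ∀ t, 0 ≤ t → ‖(ξ t).fst - (η t).fst‖ ^ 2 + ‖(ξ t).snd - (η t).snd‖ ^ 2 ≤
        (‖(ξ 0).fst - (η 0).fst‖ ^ 2 + ‖(ξ 0).snd - (η 0).snd‖ ^ 2) *
          Real.exp ((D * (1 + B + B') + 1) * (t + 1)) := by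
  obtain ⟨D, hD⟩ := Setting.exists_enorm_nem_sub_le (X := X) hf
  refine ⟨D, fun g ξ₀ η₀ ξ η Q B B' h h' hE hE' hB hB' t ht => ?_⟩
  have hl := h.lintegral_l12_ne_top hE
  have hl' := h'.lintegral_l12_ne_top hE'
  obtain ⟨M, hM⟩ := h.exists_ae_bound t
  obtain ⟨M', hM'⟩ := h'.exists_ae_bound t
  set v : ℝ → X.H1 := fun s => (ξ s).fst - (η s).fst with hv
  set p : ℝ → X.L2 := fun s => (ξ s).snd - (η s).snd with hp
  set N : ℝ → X.L2 := fun s => X.nem f (X.incl (η s).fst) - X.nem f (X.incl (ξ s).fst) with hN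
  set y : ℝ → ℝ := fun s => ‖v s‖ ^ 2 + ‖p s‖ ^ 2 with hy
  set L : ℝ → ℝ := fun s => (X.l12 (X.incl (ξ s).fst)).toReal with hL
  set L' : ℝ → ℝ := fun s => (X.l12 (X.incl (η s).fst)).toReal with hL'
  -- The Grönwall kernel. The final 1 comes from `2 (v, ∂_t v)`, which restores the `L²` part of the
  -- `H¹` norm.
  set k : ℝ → ℝ := fun s => D * (1 + L s + L' s) + 1 with hk
  have hpm : AEStronglyMeasurable p (volume.restrict (Ioc 0 t)) :=
    (h.aestronglyMeasurable_snd t).sub (h'.aestronglyMeasurable_snd t)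
  have hvm : AEStronglyMeasurable v (volume.restrict (Ioc 0 t)) :=
    (h.aestronglyMeasurable_fst t).sub (h'.aestronglyMeasurable_fst t)
  have hvb : ∀ᵐ s ∂volume.restrict (Ioc 0 t), ‖v s‖ ≤ M + M' := by
    filter_upwards [hM, hM'] with s h1 h2
    exact (norm_sub_le _ _).trans
      (add_le_add ((norm_fst_le _).trans h1) ((norm_fst_le _).trans h2))
  have hpb : ∀ᵐ s ∂volume.restrict (Ioc 0 t), ‖p s‖ ≤ M + M' := by
    filter_upwards [hM, hM'] with s h1 h2
    exact (norm_sub_le _ _).trans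
      (add_le_add ((norm_snd_le _).trans h1) ((norm_snd_le _).trans h2))
  have hl12m := X.aemeasurable_l12
    (X.incl.continuous.comp_aestronglyMeasurable (h.aestronglyMeasurable_fst t))
  have hl12m' := X.aemeasurable_l12
    (X.incl.continuous.comp_aestronglyMeasurable (h'.aestronglyMeasurable_fst t))
  have hLi : Integrable L (volume.restrict (Ioc 0 t)) :=
    integrable_toReal_of_lintegral_ne_top hl12m (hl t)
  have hLi' : Integrable L' (volume.restrict (Ioc 0 t)) :=
    integrable_toReal_of_lintegral_ne_top hl12m' (hl' t)
  have hki : Integrable k (volume.restrict (Ioc 0 t)) :=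
    ((((integrable_const 1).add hLi).add hLi').const_mul _).add (integrable_const 1)
  have hkyi : Integrable (fun s => k s * y s) (volume.restrict (Ioc 0 t)) := by
    refine hki.mul_bdd (c := (M + M') ^ 2 + (M + M') ^ 2)
      ((hvm.norm.pow 2).add (hpm.norm.pow 2)) ?_
    filter_upwards [hvb, hpb] with s h1 h2
    rw [Real.norm_of_nonneg (by positivity)]
    simp only [hy]
    gcongr
  have hNi : IntervalIntegrable N volume 0 t :=
    (h'.intervalIntegrable_nem hf ht (hl' t)).sub (h.intervalIntegrable_nem hf ht (hl t))
  rw [intervalIntegrable_iff_integrableOn_Ioc_of_le ht] at hNi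
  have hbound : ∀ {q : ℝ → X.L2}, Integrable q (volume.restrict (Ioc 0 t)) →
      Integrable (fun s => inner ℝ (q s) (p s)) (volume.restrict (Ioc 0 t)) := by
    intro q hq
    refine (hq.norm.mul_const (M + M')).mono' (hq.1.inner hpm) ?_
    filter_upwards [hpb] with s hs
    refine (norm_inner_le_norm _ _).trans ?_
    gcongr
  have hvi : Integrable (fun s => X.incl (v s)) (volume.restrict (Ioc 0 t)) :=
    X.incl.integrable_comp ((integrable_const (M + M')).mono' hvm hvb)
  have hpt : ∀ᵐ s ∂volume.restrict (Ioc 0 t),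
      2 * inner ℝ (N s) (p s) + 2 * inner ℝ (X.incl (v s)) (p s) ≤ k s * y s := by
    filter_upwards [Setting.ae_l12_ne_top (h.aestronglyMeasurable_fst t) (hl t),
      Setting.ae_l12_ne_top (h'.aestronglyMeasurable_fst t) (hl' t)] with s hs hs'
    have h1 : ‖N s‖ ≤ D * ((1 + L s + L' s) * ‖v s‖) := by
      have := ENNReal.toReal_mono (by finiteness) (hD _ _ hs hs')
      rw [toReal_enorm, norm_sub_rev] at this
      refine this.trans_eq ?_
      rw [ENNReal.toReal_mul, ENNReal.toReal_mul, ENNReal.toReal_add (by finiteness) hs',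
        ENNReal.toReal_add (by finiteness) hs, toReal_enorm]
      simp [hL, hL', hv]
    have h2 := real_inner_le_norm (N s) (p s)
    have h3 := real_inner_le_norm (X.incl (v s)) (p s)
    have h4 := X.norm_incl_le (v s)
    have h5 := two_mul_le_add_sq ‖v s‖ ‖p s‖
    have h6 : 0 ≤ D * (1 + L s + L' s) := by
      simp only [hL, hL']
      positivity
    have h7 : ‖N s‖ * ‖p s‖ ≤ D * ((1 + L s + L' s) * ‖v s‖) * ‖p s‖ := by gcongr
    have h8 : ‖X.incl (v s)‖ * ‖p s‖ ≤ ‖v s‖ * ‖p s‖ := by gcongr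
    have h9 := mul_le_mul_of_nonneg_left h5 h6
    simp only [hk, hy]
    nlinarith
  have hyle : ∀ s ∈ Icc 0 t, y s ≤ y 0 + ∫ r in (0 : ℝ)..s, k r * y r := by
    intro s hs
    have h1 := h.energy_sub_le h' hα hγ hf hE hE' hs.1
    have h2 := h.norm_incl_sub_sq_eq h' hs.1
    have hsub : Ioc 0 s ⊆ Ioc 0 t := Ioc_subset_Ioc_right hs.2
    have i1 : Integrable (fun r => 2 * inner ℝ (N r) (p r)) (volume.restrict (Ioc 0 s)) :=
      ((hbound hNi).const_mul 2).mono_measure (Measure.restrict_mono hsub le_rfl)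
    have i2 : Integrable (fun r => 2 * inner ℝ (X.incl (v r)) (p r)) (volume.restrict (Ioc 0 s)) :=
      ((hbound hvi).const_mul 2).mono_measure (Measure.restrict_mono hsub le_rfl)
    have h3 : ∫ r in Ioc 0 s, (2 * inner ℝ (N r) (p r) + 2 * inner ℝ (X.incl (v r)) (p r)) ≤
        ∫ r in Ioc 0 s, k r * y r :=
      integral_mono_ae (i1.add i2) (hkyi.mono_measure (Measure.restrict_mono hsub le_rfl))
        (ae_mono (Measure.restrict_mono hsub le_rfl) hpt)
    rw [integral_add i1 i2, integral_const_mul] at h3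
    rw [intervalIntegral.integral_of_le hs.1] at h1 h2 ⊢
    simp only [hy, X.norm_sq_H1 (v s), X.norm_sq_H1 (v 0)]
    linarith
  have hgron := le_mul_exp_of_le_add_integral ht
    ((intervalIntegrable_iff_integrableOn_Ioc_of_le ht).2 hki)
    (fun s _ => by simp only [hk, hL, hL']; positivity)
    ((intervalIntegrable_iff_integrableOn_Ioc_of_le ht).2 hkyi) hyle
  refine hgron.trans ?_
  have hI : ∀ {u : ℝ → X.H1} {A : ℝ≥0}, AEMeasurable (fun s => X.l12 (X.incl (u s)))
      (volume.restrict (Ioc 0 t)) → ∫⁻ s in Ioc 0 t, X.l12 (X.incl (u s)) ≠ ⊤ →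
      (∀ τ, 0 ≤ τ → ∫⁻ s in Icc τ (τ + 1), X.l12 (X.incl (u s)) ≤ A) →
      ∫ s in Ioc 0 t, (X.l12 (X.incl (u s))).toReal ≤ (t + 1) * A := by
    intro u A hm hfin hA
    rw [integral_toReal hm (ae_lt_top' hm hfin)]
    refine ENNReal.toReal_le_of_le_ofReal (by positivity) ((lintegral_Ioc_le_mul hA ht).trans_eq ?_)
    rw [ENNReal.ofReal_mul (by positivity), ENNReal.ofReal_coe_nnreal]
  -- Unit-interval bounds are summed over the integer cover of `[0, t]`, which has at most `t + 1`
  -- pieces.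
  have hkint : ∫ r in (0 : ℝ)..t, k r ≤ (D * (1 + B + B') + 1) * (t + 1) := by
    rw [intervalIntegral.integral_of_le ht]
    have e : ∫ r in Ioc 0 t, k r =
        D * (t + (∫ r in Ioc 0 t, L r) + ∫ r in Ioc 0 t, L' r) + t := by
      have j1 : Integrable (fun r => 1 + L r) (volume.restrict (Ioc 0 t)) :=
        (integrable_const 1).add hLi
      have j2 : Integrable (fun r => 1 + L r + L' r) (volume.restrict (Ioc 0 t)) := j1.add hLi'
      simp only [hk]
      rw [integral_add (j2.const_mul _) (integrable_const 1), integral_const_mul,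
        integral_add j1 hLi', integral_add (integrable_const 1) hLi]
      simp [ht]
    have h1 : ∫ r in Ioc 0 t, L r ≤ (t + 1) * B := hI hl12m (hl t) hB
    have h2 : ∫ r in Ioc 0 t, L' r ≤ (t + 1) * B' := hI hl12m' (hl' t) hB'
    rw [e]
    have h3 : (D : ℝ) * (t + (∫ r in Ioc 0 t, L r) + ∫ r in Ioc 0 t, L' r) ≤
        D * ((t + 1) + (t + 1) * B + (t + 1) * B') := by
      gcongr
      linarith
    calc _ ≤ D * ((t + 1) + (t + 1) * B + (t + 1) * B') + (t + 1) := by linarith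
      _ = _ := by ring
  gcongr

end DampedWave

end

theorem theorem3p1 (X : DampedWave.Setting) (f : ℝ → ℝ) (C κ K α γ : ℝ)
    (hC : 0 < C) (hκ : 0 < κ) (hK : 0 < K) (hα : 0 < α) (hγ : 0 < γ)
    (hf : DampedWave.IsNonlinearity f C κ K) (Q : ℝ → ℝ) (hQ : Monotone Q) :
    ∃ Khat : ℝ → ℝ → ℝ → ℝ, (∀ a b c, 0 < Khat a b c) ∧
      ∀ g : X.L2,
        (∀ (ξ₀ : X.Energy) (ξ : ℝ → X.Energy),
          DampedWave.IsEnergySolution X f α γ g ξ₀ ξ → DampedWave.ExtraRegularity X Q g ξ) →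
        (∀ (ξ₀ : X.Energy) (ξ η : ℝ → X.Energy),
          DampedWave.IsEnergySolution X f α γ g ξ₀ ξ →
          DampedWave.IsEnergySolution X f α γ g ξ₀ η → ∀ t : ℝ, 0 ≤ t → ξ t = η t) ∧
        (∀ (ξ₀ η₀ : X.Energy) (ξ η : ℝ → X.Energy),
          DampedWave.IsEnergySolution X f α γ g ξ₀ ξ →
          DampedWave.IsEnergySolution X f α γ g η₀ η → ∀ t : ℝ, 0 ≤ t →
            ‖(ξ t).fst - (η t).fst‖ ^ 2 + ‖(ξ t).snd - (η t).snd‖ ^ 2 ≤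
              Real.exp (Khat ‖ξ₀‖ ‖η₀‖ ‖g‖ * (t + 1)) *
                (‖ξ₀.fst - η₀.fst‖ ^ 2 + ‖ξ₀.snd - η₀.snd‖ ^ 2)) := by
  obtain ⟨B, hB⟩ := DampedWave.exists_l12_bound X hκ hα hγ hf hQ
  obtain ⟨D, hD⟩ := DampedWave.exists_sub_le X hα hγ hf
  have key : ∀ g : X.L2, (∀ (ξ₀ : X.Energy) (ξ : ℝ → X.Energy),
      DampedWave.IsEnergySolution X f α γ g ξ₀ ξ → DampedWave.ExtraRegularity X Q g ξ) →
      ∀ (ξ₀ η₀ : X.Energy) (ξ η : ℝ → X.Energy),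
        DampedWave.IsEnergySolution X f α γ g ξ₀ ξ →
        DampedWave.IsEnergySolution X f α γ g η₀ η → ∀ t : ℝ, 0 ≤ t →
          ‖(ξ t).fst - (η t).fst‖ ^ 2 + ‖(ξ t).snd - (η t).snd‖ ^ 2 ≤
            Real.exp ((D * (1 + B ‖ξ₀‖ ‖g‖ + B ‖η₀‖ ‖g‖) + 1) * (t + 1)) *
              (‖ξ₀.fst - η₀.fst‖ ^ 2 + ‖ξ₀.snd - η₀.snd‖ ^ 2) := by
    intro g hE ξ₀ η₀ ξ η h h' t ht
    have hle := hD g ξ₀ η₀ ξ η Q _ _ h h' (hE _ _ h) (hE _ _ h') (hB g ξ₀ ξ h (hE _ _ h))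
      (hB g η₀ η h' (hE _ _ h')) t ht
    rwa [h.initial, h'.initial, mul_comm] at hle
  -- `B` and `D` were obtained before `g` and the solutions are fixed, so the constant depends on
  -- the three norms only.
  refine ⟨fun a b c => D * (1 + B a c + B b c) + 1, fun a b c => by positivity,
    fun g hE => ⟨fun ξ₀ ξ η h h' t ht => ?_, key g hE⟩⟩
  have hle := key g hE ξ₀ ξ₀ ξ η h h' t ht
  simp only [sub_self, norm_zero, ne_eq, OfNat.ofNat_ne_zero, not_false_eq_true, zero_pow,
    add_zero, mul_zero] at hle
  have p1 := sq_nonneg (‖(ξ t).fst - (η t).fst‖)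
  have p2 := sq_nonneg (‖(ξ t).snd - (η t).snd‖)
  have h1 : ‖(ξ t).fst - (η t).fst‖ ^ 2 = 0 := by linarith
  have h2 : ‖(ξ t).snd - (η t).snd‖ ^ 2 = 0 := by linarith
  have e1 : (ξ t).fst = (η t).fst := by simpa [sub_eq_zero] using h1
  have e2 : (ξ t).snd = (η t).snd := by simpa [sub_eq_zero] using h2
  exact WithLp.ofLp_injective 2 (Prod.ext e1 e2)
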